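/- A \emph{cluster vertex deletion} of a finite simple graph $G=(V,E)$ is a set $X\subseteq V$ such that every connected component of $G[V\setminus X]$ is a clique; the \emph{cvd number} $k(G)$ is the minimum size of such a set. The \emph{clusters} of $G[V\setminus X]$ are its (nonempty) maximal cliques. For a cluster $C$ and $S\subseteq X$ put $C_S=\{v\in C : N_G(v)\cap X=S\}$. The auxiliary graph $H=H(G,X)$ has as vertices the elements of $V$, a \emph{cluster label} $l_C$ for each cluster $C$ of $G[V\setminus X]$, and a \emph{class label} $p_{C,S}$ for each nonempty class $C_S$. Its edges are: $\{x,y\}$ for $x,y\in X$ with $\{x,y\}\in E$; $\{x,l_C\}$ for $x\in X$ with a neighbour in $C$; $\{l_C,p_{C,S}\}$; and $\{p_{C,S},v\}$ for $v\in C_S$. There is a fully dynamic data structure (on a word RAM with words of $O(\log n)$ bits) that is initialized for the edgeless graph on $n$ vertices in $O(n+1)$ time, and then supports any sequence of insertions of a non-existing edge, deletions of an existing edge, and queries, such that for the current graph $G$ at every moment: (1) the memory holds, for some minimum cluster vertex deletion $X$ of $G$, the graph $H(G,X)$: each vertex of $H$ has a record with its type (element of $X$, cluster label, class label, element of $V\setminus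 X$) and its adjacency list as a linked list, the record of $p_{C,S}$ also has a list of the elements of $S$, and the address of the record of a vertex of $G$ is a fixed affine function of its number; (2) a query takes $O(1)$ time and returns $|X|$ and the address of an array that lists the elements of this $X$; (3) an edge insertion or deletion that changes $G$ into $G'$ takes $O(8^k k^6)$ time, where $k=\max\{k(G),k(G')\}$ (and $O(1)$ time if $k=0$). The constants in all bounds, including the word length, are absolute. -/

import Mathlib

namespace DynCVD

/-! ## Cluster vertex deletion -/

section Graphs

variable {V : Type*}

/-- A cluster graph: every connected component is a clique. -/
def IsClusterGraph {W : Type*} (G : SimpleGraph W) : Prop :=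
  ∀ a b, G.Reachable a b → a ≠ b → G.Adj a b

/-- `X` is a cluster vertex deletion of `G`: the induced subgraph `G[V ∖ X]` is a cluster graph. -/
def IsCVD (G : SimpleGraph V) (X : Finset V) : Prop :=
  IsClusterGraph (G.induce {v | v ∉ X})

/-- `X` is a cluster vertex deletion of minimum size. -/
def IsMinCVD (G : SimpleGraph V) (X : Finset V) : Prop :=
  IsCVD G X ∧ ∀ Y : Finset V, IsCVD G Y → X.card ≤ Y.card

/-- The cvd number of `G` (for finite `V` the set is nonempty: it contains `|V|`). -/
noncomputable def cvdNumber (G : SimpleGraph V) : ℕ :=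
  sInf {m | ∃ X : Finset V, IsCVD G X ∧ X.card = m}

/-! ## The auxiliary graph `H` determined by `G` and `X` -/

/-- `C` is a cluster of `G[V ∖ X]`: a nonempty maximal clique. -/
def IsCluster (G : SimpleGraph V) (X : Finset V) (C : Set V) : Prop :=
  C.Nonempty ∧ Maximal (fun D : Set V => (∀ v ∈ D, v ∉ X) ∧ G.IsClique D) C

/-- The equivalence class `C_S = {v ∈ C | N(v) ∩ X = S}`. -/
def equivClass (G : SimpleGraph V) (X : Finset V) (C S : Set V) : Set V :=
  {v | v ∈ C ∧ G.neighborSet v ∩ X = S}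

/-- Names for the vertices of `H`: vertices of `G`, cluster labels (one for each cluster `C`), and
class labels (one for each nonempty class `C_S`). -/
inductive Node (V : Type*) where
  | vertex (v : V) : Node V
  | clusterLabel (C : Set V) : Node V
  | classLabel (C S : Set V) : Node V

/-- The nodes that do occur in `H`, i.e. the set `X ∪ L ∪ P ∪ (V ∖ X)`. -/
def IsNode (G : SimpleGraph V) (X : Finset V) : Node V → Prop
  | .vertex _ => True
  | .clusterLabel C => IsCluster G X C
  | .classLabel C S => IsCluster G X C ∧ (equivClass G X C S).Nonempty

/-- The four kinds of edges of `H`, each in one orientation. -/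
inductive AuxEdge (G : SimpleGraph V) (X : Finset V) : Node V → Node V → Prop
  | inSolution (x y : V) (hx : x ∈ X) (hy : y ∈ X) (h : G.Adj x y) :
      AuxEdge G X (.vertex x) (.vertex y)
  | incident (x : V) (C : Set V) (hx : x ∈ X) (h : ∃ v ∈ C, G.Adj x v) :
      AuxEdge G X (.vertex x) (.clusterLabel C)
  | hasClass (C S : Set V) : AuxEdge G X (.clusterLabel C) (.classLabel C S)
  | member (C S : Set V) (v : V) (h : v ∈ equivClass G X C S) :
      AuxEdge G X (.classLabel C S) (.vertex v)

/-- The auxiliary graph `H`. -/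
def auxGraph (G : SimpleGraph V) (X : Finset V) : SimpleGraph {a : Node V // IsNode G X a} :=
  SimpleGraph.fromRel fun a b => AuxEdge G X a.1 b.1

open Classical in
/-- The type of a node of `H`: `0` for `X`, `1` for `L`, `2` for `P`, `3` for `V ∖ X`. -/
noncomputable def nodeKind (X : Finset V) : Node V → ℕ
  | .vertex v => if v ∈ X then 0 else 3
  | .clusterLabel _ => 1
  | .classLabel _ _ => 2

end Graphs

/-! ## A word RAM with step counts -/

/-- A machine state: registers and random access memory. -/
structure State where
  reg : ℕ → ℕ
  mem : ℕ → ℕ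

/-- Write `a` into register `x`. -/
def State.setReg (s : State) (x a : ℕ) : State := ⟨Function.update s.reg x a, s.mem⟩

/-- Write `a` into memory cell `p`. -/
def State.setMem (s : State) (p a : ℕ) : State := ⟨s.reg, Function.update s.mem p a⟩

/-- The arithmetic instructions (subtraction is truncated, division rounds down). -/
inductive Arith where
  | add | sub | mul | div

def Arith.eval : Arith → ℕ → ℕ → ℕ
  | .add, a, b => a + b
  | .sub, a, b => a - b
  | .mul, a, b => a * b
  | .div, a, b => a / b

/-- Comparisons of two registers. -/
inductive Test where
  | lt (x y : ℕ)
  | eq (x y : ℕ)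

def Test.Holds (s : State) : Test → Prop
  | .lt x y => s.reg x < s.reg y
  | .eq x y => s.reg x = s.reg y

/-- Programs; `x y z` are register numbers. A program is a finite object, so it uses finitely many
registers. -/
inductive Cmd where
  | skip
  | const (x a : ℕ)
  | move (x y : ℕ)
  | arith (o : Arith) (x y z : ℕ)
  | load (x y : ℕ)
  | store (x y : ℕ)
  | seq (p q : Cmd)
  | ite (b : Test) (p q : Cmd)
  | while (b : Test) (p : Cmd)

/-- `Exec W p s s' t`: on a machine whose words hold the numbers below `W`, the program `p` started
in state `s` halts in state `s'` after exactly `t` steps. Every instruction and every test is one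
step; a run in which a number `≥ W` would arise does not count as an execution. -/
inductive Exec (W : ℕ) : Cmd → State → State → ℕ → Prop
  | skip (s : State) : Exec W .skip s s 1
  | const (s : State) (x a : ℕ) (ha : a < W) : Exec W (.const x a) s (s.setReg x a) 1
  | move (s : State) (x y : ℕ) (h : s.reg y < W) : Exec W (.move x y) s (s.setReg x (s.reg y)) 1
  | arith (s : State) (o : Arith) (x y z : ℕ) (h : o.eval (s.reg y) (s.reg z) < W) :
      Exec W (.arith o x y z) s (s.setReg x (o.eval (s.reg y) (s.reg z))) 1
  | load (s : State) (x y : ℕ) (hy : s.reg y < W) (h : s.mem (s.reg y) < W) :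
      Exec W (.load x y) s (s.setReg x (s.mem (s.reg y))) 1
  | store (s : State) (x y : ℕ) (hx : s.reg x < W) (hy : s.reg y < W) :
      Exec W (.store x y) s (s.setMem (s.reg x) (s.reg y)) 1
  | seq {p q : Cmd} {s s' s'' : State} {t t' : ℕ} (hp : Exec W p s s' t)
      (hq : Exec W q s' s'' t') : Exec W (.seq p q) s s'' (t + t')
  | iteTrue {b : Test} {p q : Cmd} {s s' : State} {t : ℕ} (hb : b.Holds s)
      (hp : Exec W p s s' t) : Exec W (.ite b p q) s s' (t + 1)
  | iteFalse {b : Test} {p q : Cmd} {s s' : State} {t : ℕ} (hb : ¬ b.Holds s)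
      (hq : Exec W q s s' t) : Exec W (.ite b p q) s s' (t + 1)
  | whileTrue {b : Test} {p : Cmd} {s s' s'' : State} {t t' : ℕ} (hb : b.Holds s)
      (hp : Exec W p s s' t) (hr : Exec W (.while b p) s' s'' t') :
      Exec W (.while b p) s s'' (t + t' + 1)
  | whileFalse {b : Test} {p : Cmd} {s : State} (hb : ¬ b.Holds s) :
      Exec W (.while b p) s s 1

/-! ## Dynamic data structures -/

/-- The four programs of a dynamic graph data structure; they do not depend on the input. -/
structure Programs where
  init : Cmd
  insert : Cmd
  delete : Cmd
  query : Cmd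

/-- Words of `c * log₂ (n + 2)` bits. -/
def wordBound (c n : ℕ) : ℕ := (n + 2) ^ c

/-- The start state: register `0` holds `n`, everything else is `0`. -/
def startState (n : ℕ) : State := State.setReg ⟨fun _ => 0, fun _ => 0⟩ 0 n

/-- Pass the end points of an edge to an update, in registers `0` and `1`. -/
def State.withEdge {n : ℕ} (s : State) (u v : Fin n) : State := (s.setReg 0 u).setReg 1 v

/-- `Reaches D c n G s`: initialization for the edgeless graph on `n` vertices followed by some
finite sequence of edge insertions, edge deletions and queries can lead to the current graph `G`
and the machine state `s`. -/
inductive Reaches (D : Programs) (c n : ℕ) : SimpleGraph (Fin n) → State → Prop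
  | init {s : State} {t : ℕ} (h : Exec (wordBound c n) D.init (startState n) s t) :
      Reaches D c n ⊥ s
  | insert {G : SimpleGraph (Fin n)} {s s' : State} {t : ℕ} (u v : Fin n)
      (hr : Reaches D c n G s) (huv : u ≠ v) (hG : ¬ G.Adj u v)
      (h : Exec (wordBound c n) D.insert (s.withEdge u v) s' t) :
      Reaches D c n (G ⊔ SimpleGraph.edge u v) s'
  | delete {G : SimpleGraph (Fin n)} {s s' : State} {t : ℕ} (u v : Fin n)
      (hr : Reaches D c n G s) (hG : G.Adj u v)
      (h : Exec (wordBound c n) D.delete (s.withEdge u v) s' t) :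
      Reaches D c n (G.deleteEdges {s(u, v)}) s'
  | query {G : SimpleGraph (Fin n)} {s s' : State} {t : ℕ} (hr : Reaches D c n G s)
      (h : Exec (wordBound c n) D.query s s' t) : Reaches D c n G s'

/-- The linked list with head pointer `p` holds `l`: a list cell at address `p ≠ 0` has its entry in
cell `p` and the pointer to the next list cell in cell `p + 1`; the pointer `0` ends the list. -/
def ListAt (mem : ℕ → ℕ) : ℕ → List ℕ → Prop
  | p, [] => p = 0
  | p, a :: l => p ≠ 0 ∧ mem p = a ∧ ListAt mem (mem (p + 1)) l

/-- The memory holds the auxiliary graph `H` of `G` and `X`. Every node `a` of `H` has a record at an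
address `addr a`, which for the vertex number `v` of `G` is `base + stride * v`. The record consists
of the type of the node, a pointer to its adjacency list, and, for the label of a class `C_S`, a
pointer to a list of the elements of `S`. Nodes are referred to by the addresses of their records;
further fields of records and list cells are unrestricted. -/
def StoresAuxGraph {n : ℕ} (mem : ℕ → ℕ) (base stride : ℕ) (G : SimpleGraph (Fin n))
    (X : Finset (Fin n)) : Prop :=
  ∃ addr : {a : Node (Fin n) // IsNode G X a} → ℕ,
    Function.Injective addr ∧
    (∀ v : Fin n, addr ⟨.vertex v, trivial⟩ = base + stride * v) ∧
    (∀ a, mem (addr a) = nodeKind X a.1) ∧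
    (∀ a, ∃ l : List {a : Node (Fin n) // IsNode G X a},
      l.Nodup ∧ (∀ b, b ∈ l ↔ (auxGraph G X).Adj a b) ∧
      ListAt mem (mem (addr a + 1)) (l.map addr)) ∧
    (∀ (C S : Set (Fin n)) (h : IsNode G X (.classLabel C S)), ∃ l : List (Fin n),
      l.Nodup ∧ (∀ x, x ∈ l ↔ x ∈ S) ∧
      ListAt mem (mem (addr ⟨.classLabel C S, h⟩ + 2))
        (l.map fun x => addr ⟨.vertex x, trivial⟩))

/-- The answer to a query: register `0` holds `|X|`, and register `1` holds the address of an array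
of length `|X|` that lists the elements of `X`. -/
def Outputs {n : ℕ} (s : State) (X : Finset (Fin n)) : Prop :=
  ∃ l : List (Fin n), l.Nodup ∧ (∀ x, x ∈ l ↔ x ∈ X) ∧ s.reg 0 = l.length ∧
    ∀ (i : ℕ) (hi : i < l.length), s.mem (s.reg 1 + i) = (l[i] : ℕ)

/-- `8 ^ k * k ^ 6`, with the factor `k ^ 6` read as `1` for `k = 0`. -/
def updateBound (k : ℕ) : ℕ := 8 ^ k * (max 1 k) ^ 6

end DynCVD

namespace DynCVD

/-! ## A structured language over the word RAM

Programs are written with named registers, named arrays and nested expressions. Only loop iterations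
count as time; `compile_spec` turns this into a bound on the number of machine steps. -/

/-! A graph is a cluster graph exactly when it has no induced path on three vertices
(`isCVD_iff_p3Free`), so a cluster vertex deletion is a set that meets all these paths. An update of
the edge `uv` puts `u` and `v` into the stored solution. The enlarged set remains a deletion set
whatever happens to `uv`, and the changed edge lies inside it, so only one adjacency of `H` has to
be rewritten (`Conf.OK.setG`, `Conf.spec_setG`). With this solution of size at most `k + 2` at hand,
a minimum one is computed (`solve_spec`), and the stored solution is exchanged for it vertex by
vertex (`exchange_spec`).

Moving one vertex is cheap because no class is split or merged by it. A vertex outside the solution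
sees its whole cluster and no other cluster, so it separates no two members of a class when it
enters. Dually, if `X ∖ {x}` is still a deletion set, then `x` sees all of one cluster or no cluster
at all, so its departure merges nothing. Apart from the links of the moved vertex and its labels,
only relations of solution vertices with one cluster and one vertex can change (`Conf.OK.spec_add`,
`Conf.OK.spec_remove`), and they are simply recomputed (`refresh_spec`). A cluster has at most `2 ^
|X|` classes, one for each possible neighbourhood. The exchange passes through the union of both
solutions, so all intermediate sets are deletion sets of size at most `2k + 2`, and it costs about
`4 ^ k` up to a polynomial.

The minimum solution comes from a search tree with three branches per induced path, for the depths
`0, 1, 2, …`. Paths cannot be sought in the whole graph. For depth `d` it is enough to look at a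
kernel: the solution, `d + 2` clusters of each solution vertex, all classes of these clusters, and
`d + 1` members of each class. A set of at most `d` vertices that meets all paths inside the kernel
meets all paths (`Conf.Kernel.p3Free`). The kernel has `O(k ^ 3 * 2 ^ k)` vertices. One search in it
compares, for each solution vertex, only its solution neighbours and a single outside neighbour
(`Conf.OK.free_of_checked`), which costs `O(k ^ 2)` passes through the kernel. With `O(3 ^ k)` tree
nodes and `k + 1` depths the total is `O(6 ^ k * k ^ 6)`.

The programs are written in a small structured language in which only loop iterations cost time;
`compile_spec` converts this into machine steps. The predicate `Ready` is the invariant of the data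
structure, `Holds` its version for the machine, and `Reaches.holds` shows that it survives every
sequence of operations. -/

/-- The three families of lists: adjacency lists, the lists of the elements of `S` for a class `C_S`,
and the lists of children in the hierarchy solution vertex, cluster, class, member. -/
inductive Kd where
  | adj | nbr | sub
  deriving DecidableEq

/-- Arrays with one index. -/
inductive F1 where
  | ty | rhead (κ : Kd) | cnt (κ : Kd) | cls | clu | freeL | freeP | mark | larr | parr | karr
  | dl | len | xarr
  deriving DecidableEq

/-- Arrays with two indices. -/
inductive F2 where
  | val (κ : Kd) | rnext (κ : Kd) | arr (κ : Kd) | pos (κ : Kd) | gm | slot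
  deriving DecidableEq

inductive Reg where
  | n | xc | nfl | nfp | eu | ev
  | ia | ib | ic | id
  | fx | fl | fi | fp | fb | fv | ri
  | ap | ai | aq | ar | ab | aj | ay
  | d | found | lc | pc | kc | xi | xj | xa | xb
  | hit | pa | pb | pd | yi | y | g | t | w | jv | vv
  | sp | ln | j | dlen | ui | uz
  deriving DecidableEq

def Kd.code : Kd → ℕ
  | adj => 0 | nbr => 1 | sub => 2

def F1.code : F1 → ℕ
  | ty => 0 | rhead κ => 1 + κ.code | cnt κ => 4 + κ.code | cls => 7 | clu => 8 | freeL => 9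
  | freeP => 10 | mark => 11 | larr => 12 | parr => 13 | karr => 14 | dl => 15 | len => 16
  | xarr => 17

def F2.code : F2 → ℕ
  | val κ => 32 + 8 * κ.code | rnext κ => 33 + 8 * κ.code | arr κ => 34 + 8 * κ.code
  | pos κ => 35 + 8 * κ.code | gm => 56 | slot => 57

theorem F1.code_lt (f : F1) : f.code < 32 := by
  cases f <;> simp [F1.code] <;> rename_i κ <;> cases κ <;> simp [Kd.code]

theorem F2.code_lt (f : F2) : f.code < 64 := by
  cases f <;> simp [F2.code] <;> rename_i κ <;> cases κ <;> simp [Kd.code]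

theorem F2.le_code (f : F2) : 32 ≤ f.code := by
  cases f <;> simp [F2.code] <;> omega

theorem F1.code_inj {f g : F1} (h : f.code = g.code) : f = g := by
  cases f <;> cases g <;> (try (rename_i κ; cases κ)) <;> (try (rename_i κ; cases κ)) <;>
    simp [F1.code, Kd.code] at h ⊢

theorem F2.code_inj {f g : F2} (h : f.code = g.code) : f = g := by
  cases f <;> cases g <;> (try (rename_i κ; cases κ)) <;> (try (rename_i κ; cases κ)) <;>
    simp [F2.code, Kd.code] at h ⊢

/-- A state of the structured language. -/
structure HS where
  reg : Reg → ℕ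
  m1 : F1 → ℕ → ℕ
  m2 : F2 → ℕ → ℕ → ℕ

def HS.set (s : HS) (x : Reg) (a : ℕ) : HS := ⟨fun r => if r = x then a else s.reg r, s.m1, s.m2⟩

def HS.st1 (s : HS) (f : F1) (j a : ℕ) : HS :=
  ⟨s.reg, fun f' j' => if f' = f ∧ j' = j then a else s.m1 f' j', s.m2⟩

def HS.st2 (s : HS) (f : F2) (i j a : ℕ) : HS :=
  ⟨s.reg, s.m1, fun f' i' j' => if f' = f ∧ i' = i ∧ j' = j then a else s.m2 f' i' j'⟩

inductive Expr where
  | num (a : ℕ)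
  | var (x : Reg)
  | bin (o : Arith) (a b : Expr)
  | ld1 (f : F1) (j : Expr)
  | ld2 (f : F2) (i j : Expr)

instance (a : ℕ) : OfNat Expr a := ⟨.num a⟩
instance : Add Expr := ⟨.bin .add⟩
instance : Sub Expr := ⟨.bin .sub⟩
instance : Mul Expr := ⟨.bin .mul⟩
instance : Coe Reg Expr := ⟨.var⟩

def Expr.eval (s : HS) : Expr → ℕ
  | num a => a
  | var x => s.reg x
  | bin o a b => o.eval (a.eval s) (b.eval s)
  | ld1 f j => s.m1 f (j.eval s)
  | ld2 f i j => s.m2 f (i.eval s) (j.eval s)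

inductive Cond where
  | lt (a b : Expr)
  | eq (a b : Expr)
  | and (b c : Cond)
  | not (b : Cond)

def Cond.holds (s : HS) : Cond → Prop
  | lt a b => a.eval s < b.eval s
  | eq a b => a.eval s = b.eval s
  | and b c => b.holds s ∧ c.holds s
  | not b => ¬ b.holds s

inductive Stmt where
  | skip
  | asg (x : Reg) (e : Expr)
  | st1 (f : F1) (j e : Expr)
  | st2 (f : F2) (i j e : Expr)
  | seq (p q : Stmt)
  | ite (b : Cond) (p q : Stmt)
  | loop (b : Cond) (p : Stmt)

infixr:60 " ;; " => Stmt.seq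

/-- Big-step semantics: all assigned and stored values have to be below `B`, and the time is the
number of loop iterations. -/
inductive HExec (B : ℕ) : Stmt → HS → HS → ℕ → Prop
  | skip (s : HS) : HExec B .skip s s 0
  | asg (s : HS) (x : Reg) (e : Expr) (h : e.eval s < B) :
      HExec B (.asg x e) s (s.set x (e.eval s)) 0
  | st1 (s : HS) (f : F1) (j e : Expr) (h : e.eval s < B) :
      HExec B (.st1 f j e) s (s.st1 f (j.eval s) (e.eval s)) 0
  | st2 (s : HS) (f : F2) (i j e : Expr) (h : e.eval s < B) :
      HExec B (.st2 f i j e) s (s.st2 f (i.eval s) (j.eval s) (e.eval s)) 0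
  | seq {p q : Stmt} {s s' s'' : HS} {t t' : ℕ} (hp : HExec B p s s' t) (hq : HExec B q s' s'' t') :
      HExec B (.seq p q) s s'' (t + t')
  | iteTrue {b : Cond} {p q : Stmt} {s s' : HS} {t : ℕ} (hb : b.holds s) (hp : HExec B p s s' t) :
      HExec B (.ite b p q) s s' t
  | iteFalse {b : Cond} {p q : Stmt} {s s' : HS} {t : ℕ} (hb : ¬ b.holds s)
      (hq : HExec B q s s' t) : HExec B (.ite b p q) s s' t
  | loopTrue {b : Cond} {p : Stmt} {s s' s'' : HS} {t t' : ℕ} (hb : b.holds s)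
      (hp : HExec B p s s' t) (hr : HExec B (.loop b p) s' s'' t') :
      HExec B (.loop b p) s s'' (t + t' + 1)
  | loopFalse {b : Cond} {p : Stmt} {s : HS} (hb : ¬ b.holds s) : HExec B (.loop b p) s s 0

/-- All numbers in the state are below `B`. -/
structure Bd (B : ℕ) (s : HS) : Prop where
  reg : ∀ x, s.reg x < B
  m1 : ∀ f j, s.m1 f j < B
  m2 : ∀ f i j, s.m2 f i j < B

theorem HExec.bd {B : ℕ} {p : Stmt} {s s' : HS} {t : ℕ} (h : HExec B p s s' t) (hB : Bd B s) :
    Bd B s' := by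
  induction h with
  | skip => exact hB
  | asg s x e h =>
    refine ⟨fun r => ?_, hB.m1, hB.m2⟩
    simp only [HS.set]; split_ifs; exacts [h, hB.reg r]
  | st1 s f j e h =>
    refine ⟨hB.reg, fun f' j' => ?_, hB.m2⟩
    simp only [HS.st1]; split_ifs; exacts [h, hB.m1 _ _]
  | st2 s f i j e h =>
    refine ⟨hB.reg, hB.m1, fun f' i' j' => ?_⟩
    simp only [HS.st2]; split_ifs; exacts [h, hB.m2 _ _ _]
  | seq _ _ ih1 ih2 => exact ih2 (ih1 hB)
  | iteTrue _ _ ih => exact ih hB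
  | iteFalse _ _ ih => exact ih hB
  | loopTrue _ _ _ ih1 ih2 => exact ih2 (ih1 hB)
  | loopFalse => exact hB

/-! ### Syntactic well-formedness -/

/-- An exponent `w` such that the value of the expression is below `B ^ w`. -/
def Expr.wt : Expr → ℕ
  | num _ => 1
  | var _ => 1
  | bin .add a b => max a.wt b.wt + 1
  | bin .sub a _ => a.wt
  | bin .mul a b => a.wt + b.wt
  | bin .div a _ => a.wt
  | ld1 _ _ => 1
  | ld2 _ _ _ => 1

/-- With stored numbers below `B`, weight at most 10 keeps every intermediate value below `B ^ 10`,
far inside a word of size `B ^ 20`. Indices of weight at most 3 keep the addresses of all arrays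
other than `xarr` below `B ^ 11`. Literals below 1024 are below `B`, as `1024 ≤ B` is assumed
throughout. -/
def Expr.ok : Expr → Bool
  | num a => a < 1024
  | var _ => true
  | bin o a b => a.ok && b.ok && (bin o a b).wt ≤ 10
  | ld1 _ j => j.ok && j.wt ≤ 3
  | ld2 _ i j => i.ok && j.ok && i.wt ≤ 3 && j.wt ≤ 3

def Cond.ok : Cond → Bool
  | lt a b => a.ok && b.ok
  | eq a b => a.ok && b.ok
  | and b c => b.ok && c.ok
  | not b => b.ok

def Stmt.ok : Stmt → Bool
  | skip => true
  | asg _ e => e.ok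
  | st1 _ j e => j.ok && e.ok && j.wt ≤ 3
  | st2 _ i j e => i.ok && j.ok && e.ok && i.wt ≤ 3 && j.wt ≤ 3
  | seq p q => p.ok && q.ok
  | ite b p q => b.ok && p.ok && q.ok
  | loop b p => b.ok && p.ok

theorem pow_mono_base {B a b : ℕ} (hB : 1024 ≤ B) (h : a ≤ b) : B ^ a ≤ B ^ b :=
  Nat.pow_le_pow_right (by omega) h

theorem add_lt_pow {B a b x y : ℕ} (hB : 1024 ≤ B) (hx : x < B ^ a) (hy : y < B ^ b) :
    x + y < B ^ (max a b + 1) := by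
  have h1 := pow_mono_base hB (le_max_left a b)
  have h2 := pow_mono_base hB (le_max_right a b)
  rw [pow_succ]; nlinarith

theorem mul_lt_pow {B a b x y : ℕ} (hx : x < B ^ a) (hy : y < B ^ b) :
    x * y < B ^ (a + b) := by
  rw [pow_add]; exact Nat.mul_lt_mul'' hx hy

theorem Expr.eval_lt {B : ℕ} {s : HS} (hB : 1024 ≤ B) (hs : Bd B s) (e : Expr) (he : e.ok) :
    e.eval s < B ^ e.wt := by
  induction e with
  | num a => simp [ok] at he; simp [eval, wt]; omega
  | var x => simpa [eval, wt] using hs.reg x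
  | bin o a b iha ihb =>
    simp only [ok, Bool.and_eq_true, decide_eq_true_eq] at he
    have ha := iha he.1.1
    have hb := ihb he.1.2
    cases o
    · exact add_lt_pow hB ha hb
    · exact lt_of_le_of_lt (Nat.sub_le _ _) ha
    · exact mul_lt_pow ha hb
    · exact lt_of_le_of_lt (Nat.div_le_self _ _) ha
  | ld1 f j => simpa [eval, wt] using hs.m1 _ _
  | ld2 f i j => simpa [eval, wt] using hs.m2 _ _ _

/-! ### Addresses and compilation -/

def Reg.code (r : Reg) : ℕ := r.ctorIdx

theorem Reg.code_inj {r q : Reg} (h : r.code = q.code) : r = q := by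
  have : ∀ r : Reg, Reg.ofNat r.code = r := fun r => by cases r <;> rfl
  rw [← this r, h, this q]

theorem Reg.code_lt (r : Reg) : r.code < 100 := by
  cases r <;> (simp only [Reg.code]; decide)

/-- Memory consists of blocks of 64 cells. One-index arrays use the residues below 32, so that block
`a` is the record of the node with identifier `a`; two-index arrays use the residues from 32 on.
Only `xarr` is contiguous, since a query has to return a genuine array; it starts at `Off`, beyond
everything else. -/
def addr1 (Off : ℕ) (f : F1) (j : ℕ) : ℕ := if f = .xarr then Off + j else j * 64 + f.code

/-- The map `(i, j) ↦ (i + j) ^ 2 + j` is injective, because `j` is smaller than the gap between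
consecutive squares. The codes of `val κ` and `rnext κ` are consecutive, which puts the entry and
the pointer of a list cell into adjacent words, as `ListAt` requires. -/
def addr2 (f : F2) (i j : ℕ) : ℕ := ((i + j) * (i + j) + j) * 64 + f.code

/-- From an index in register `d` to an address in register `d`. -/
def compileA1 (f : F1) (d : ℕ) : Cmd :=
  if f = .xarr then .arith .add d 2 d else
    .seq (.const (d + 1) 64) (.seq (.arith .mul d d (d + 1)) (.seq (.const (d + 1) f.code)
      (.arith .add d d (d + 1))))

/-- From indices in the registers `d` and `d + 1` to an address in register `d`. -/
def compileA2 (f : F2) (d : ℕ) : Cmd :=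
  .seq (.arith .add d d (d + 1)) (.seq (.arith .mul d d d) (.seq (.arith .add d d (d + 1))
    (.seq (.const (d + 1) 64) (.seq (.arith .mul d d (d + 1)) (.seq (.const (d + 1) f.code)
      (.arith .add d d (d + 1)))))))

/-- Registers `0` and `1` pass arguments, register `2` holds the offset of `xarr`, and the named
registers occupy `3` to `102`. From `103` on the registers form an evaluation stack: the result goes
to `d`, and nothing below `d` is modified. -/
def compileE : Expr → ℕ → Cmd
  | .num a, d => .const d a
  | .var r, d => .move d (r.code + 3)
  | .bin o a b, d => .seq (compileE a d) (.seq (compileE b (d + 1)) (.arith o d d (d + 1)))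
  | .ld1 f j, d => .seq (compileE j d) (.seq (compileA1 f d) (.load d d))
  | .ld2 f i j, d => .seq (compileE i d) (.seq (compileE j (d + 1)) (.seq (compileA2 f d)
      (.load d d)))

def compileC : Cond → ℕ → Cmd
  | .lt a b, d => .seq (compileE a d) (.seq (compileE b (d + 1))
      (.ite (.lt d (d + 1)) (.const d 1) (.const d 0)))
  | .eq a b, d => .seq (compileE a d) (.seq (compileE b (d + 1))
      (.ite (.eq d (d + 1)) (.const d 1) (.const d 0)))
  | .and b c, d => .seq (compileC b d) (.seq (compileC c (d + 1)) (.arith .mul d d (d + 1)))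
  | .not b, d => .seq (compileC b d) (.seq (.const (d + 1) 1) (.arith .sub d (d + 1) d))

/-- A condition leaves `0` or `1` in register `103`, which is compared with a `0` in register `104`.
Equality means that the condition fails, whence the exchanged branches of `ite`. -/
def compile : Stmt → Cmd
  | .skip => .skip
  | .asg x e => .seq (compileE e 103) (.move (x.code + 3) 103)
  | .st1 f j e => .seq (compileE j 103) (.seq (compileA1 f 103) (.seq (compileE e 104)
      (.store 103 104)))
  | .st2 f i j e => .seq (compileE i 103) (.seq (compileE j 104) (.seq (compileA2 f 103)
      (.seq (compileE e 104) (.store 103 104))))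
  | .seq p q => .seq (compile p) (compile q)
  | .ite b p q => .seq (compileC b 103) (.seq (.const 104 0) (.ite (.eq 103 104) (compile q)
      (compile p)))
  | .loop b p => .seq (.seq (compileC b 103) (.const 104 0)) (.while (.lt 104 103)
      (.seq (compile p) (.seq (compileC b 103) (.const 104 0))))

/-- The machine state `s` represents `σ`. -/
structure Sim (B : ℕ) (σ : HS) (s : State) : Prop where
  off : s.reg 2 = B ^ 16
  reg : ∀ x : Reg, s.reg (x.code + 3) = σ.reg x
  m1 : ∀ f j, j < B ^ 3 → s.mem (addr1 (B ^ 16) f j) = σ.m1 f j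
  m2 : ∀ f i j, i < B ^ 3 → j < B ^ 3 → s.mem (addr2 f i j) = σ.m2 f i j

theorem Sim.congr {B : ℕ} {σ : HS} {s s' : State} (h : Sim B σ s) (hm : s'.mem = s.mem)
    (hr : ∀ r < 103, s'.reg r = s.reg r) : Sim B σ s' := by
  refine ⟨by rw [hr 2 (by omega), h.off], fun x => ?_, fun f j hj => ?_, fun f i j hi hj => ?_⟩
  · rw [hr _ (by have := x.code_lt; omega), h.reg]
  · rw [hm, h.m1 f j hj]
  · rw [hm, h.m2 f i j hi hj]

theorem addr2_inj {f g : F2} {i j i' j' : ℕ} (h : addr2 f i j = addr2 g i' j') :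
    f = g ∧ i = i' ∧ j = j' := by
  unfold addr2 at h
  have hf := f.code_lt
  have hg := g.code_lt
  have h1 : f.code = g.code := by omega
  have h2 : (i + j) * (i + j) + j = (i' + j') * (i' + j') + j' := by omega
  have h3 : i + j = i' + j' := by
    rcases lt_trichotomy (i + j) (i' + j') with h | h | h
    · nlinarith
    · exact h
    · nlinarith
  rw [h3] at h2
  exact ⟨F2.code_inj h1, by omega, by omega⟩

theorem addr2_lt {B i j : ℕ} (hB : 1024 ≤ B) (f : F2) (hi : i < B ^ 3) (hj : j < B ^ 3) :
    addr2 f i j < B ^ 11 := by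
  have h1 := add_lt_pow hB hi hj
  have h2 := mul_lt_pow h1 h1
  have h3 := add_lt_pow hB h2 hj
  have h4 : ((i + j) * (i + j) + j) * 64 < B ^ (9 + 1) :=
    mul_lt_pow h3 (by simp; omega)
  have h5 : f.code < B ^ 1 := by have := f.code_lt; simp; omega
  exact add_lt_pow hB h4 h5

theorem addr1_lt {B j : ℕ} (hB : 1024 ≤ B) (f : F1) (hf : f ≠ .xarr) (hj : j < B ^ 3) :
    addr1 (B ^ 16) f j < B ^ 11 := by
  have h4 : j * 64 < B ^ (3 + 1) := mul_lt_pow hj (by simp; omega)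
  have h5 : f.code < B ^ 1 := by have := f.code_lt; simp; omega
  have := add_lt_pow hB h4 h5
  simp only [addr1, hf, if_false]
  exact lt_of_lt_of_le this (pow_mono_base hB (by norm_num))

theorem addr1_inj {B : ℕ} (hB : 1024 ≤ B) {f g : F1} {j j' : ℕ} (hj : j < B ^ 3)
    (hj' : j' < B ^ 3) (h : addr1 (B ^ 16) f j = addr1 (B ^ 16) g j') : f = g ∧ j = j' := by
  have hp : B ^ 11 ≤ B ^ 16 := pow_mono_base hB (by norm_num)
  by_cases hf : f = .xarr <;> by_cases hg : g = .xarr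
  · simp [addr1, hf, hg] at h; simp [hf, hg, h]
  · have := addr1_lt hB g hg hj'
    rw [← h] at this; simp only [addr1, hf, if_true] at this; omega
  · have := addr1_lt hB f hf hj
    rw [h] at this; simp only [addr1, hg, if_true] at this; omega
  · simp only [addr1, hf, hg, if_false] at h
    have h1 := f.code_lt
    have h2 := g.code_lt
    exact ⟨F1.code_inj (by omega), by omega⟩

theorem addr1_ne_addr2 {B : ℕ} (hB : 1024 ≤ B) {f : F1} {g : F2} {j i' j' : ℕ}
    (hi' : i' < B ^ 3) (hj' : j' < B ^ 3) : addr1 (B ^ 16) f j ≠ addr2 g i' j' := by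
  intro h
  have h2 := addr2_lt hB g hi' hj'
  have hp : B ^ 11 ≤ B ^ 16 := pow_mono_base hB (by norm_num)
  by_cases hf : f = .xarr
  · simp only [addr1, hf, if_true] at h; omega
  · simp only [addr1, hf, if_false, addr2] at h
    have h1 := f.code_lt
    have h2 := g.code_lt
    have h3 := g.le_code
    omega

/-! ### Total runs of machine code -/

def Ex (W : ℕ) (p : Cmd) (s : State) (Q : State → Prop) (T : ℕ) : Prop :=
  ∃ s' t, Exec W p s s' t ∧ t ≤ T ∧ Q s'

theorem Ex.const {W x a : ℕ} {s : State} (h : a < W) :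
    Ex W (.const x a) s (fun s' => s' = s.setReg x a) 1 := ⟨_, _, .const _ _ _ h, le_rfl, rfl⟩

theorem Ex.move {W x y : ℕ} {s : State} (h : s.reg y < W) :
    Ex W (.move x y) s (fun s' => s' = s.setReg x (s.reg y)) 1 :=
  ⟨_, _, .move _ _ _ h, le_rfl, rfl⟩

theorem Ex.arith {W x y z : ℕ} {o : Arith} {s : State} (h : o.eval (s.reg y) (s.reg z) < W) :
    Ex W (.arith o x y z) s (fun s' => s' = s.setReg x (o.eval (s.reg y) (s.reg z))) 1 :=
  ⟨_, _, .arith _ _ _ _ _ h, le_rfl, rfl⟩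

theorem Ex.load {W x y : ℕ} {s : State} (hy : s.reg y < W) (h : s.mem (s.reg y) < W) :
    Ex W (.load x y) s (fun s' => s' = s.setReg x (s.mem (s.reg y))) 1 :=
  ⟨_, _, .load _ _ _ hy h, le_rfl, rfl⟩

theorem Ex.store {W x y : ℕ} {s : State} (hx : s.reg x < W) (hy : s.reg y < W) :
    Ex W (.store x y) s (fun s' => s' = s.setMem (s.reg x) (s.reg y)) 1 :=
  ⟨_, _, .store _ _ _ hx hy, le_rfl, rfl⟩

theorem Ex.seq {W : ℕ} {p q : Cmd} {s : State} {Q1 Q : State → Prop} {T1 T2 : ℕ}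
    (hp : Ex W p s Q1 T1) (hq : ∀ s1, Q1 s1 → Ex W q s1 Q T2) : Ex W (.seq p q) s Q (T1 + T2) := by
  obtain ⟨s1, t1, h1, h1', hQ1⟩ := hp
  obtain ⟨s2, t2, h2, h2', hQ2⟩ := hq s1 hQ1
  exact ⟨s2, _, .seq h1 h2, by omega, hQ2⟩

theorem Ex.mono {W : ℕ} {p : Cmd} {s : State} {Q1 Q : State → Prop} {T1 T2 : ℕ}
    (hp : Ex W p s Q1 T1) (hT : T1 ≤ T2) (hq : ∀ s1, Q1 s1 → Q s1) : Ex W p s Q T2 := by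
  obtain ⟨s1, t1, h1, h1', hQ1⟩ := hp
  exact ⟨s1, _, h1, by omega, hq _ hQ1⟩

theorem Ex.ite {W : ℕ} {b : Test} {p q : Cmd} {s : State} {Q : State → Prop} {T1 T2 : ℕ}
    (hp : b.Holds s → Ex W p s Q T1) (hq : ¬ b.Holds s → Ex W q s Q T2) :
    Ex W (.ite b p q) s Q (T1 + T2 + 1) := by
  by_cases hb : b.Holds s
  · obtain ⟨s1, t1, h1, h1', hQ1⟩ := hp hb
    exact ⟨s1, _, .iteTrue hb h1, by omega, hQ1⟩
  · obtain ⟨s1, t1, h1, h1', hQ1⟩ := hq hb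
    exact ⟨s1, _, .iteFalse hb h1, by omega, hQ1⟩

/-! ### Correctness of compiled expressions and conditions -/

/-- The effect of evaluating something into register `d`. -/
def Puts (s : State) (d v : ℕ) (s' : State) : Prop :=
  s'.mem = s.mem ∧ s'.reg d = v ∧ ∀ r < d, s'.reg r = s.reg r

theorem compileA1_spec {B : ℕ} (hB : 1024 ≤ B) (f : F1) (d j : ℕ) (s : State)
    (h2 : s.reg 2 = B ^ 16) (hj : s.reg d = j) (hj3 : j < B ^ 3) :
    Ex (B ^ 20) (compileA1 f d) s (Puts s d (addr1 (B ^ 16) f j)) 4 := by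
  by_cases hf : f = .xarr
  · simp only [compileA1, hf, if_true]
    refine (Ex.arith ?_).mono (by omega) ?_
    · simp only [Arith.eval, h2, hj]
      exact lt_of_lt_of_le (add_lt_pow hB (a := 17) (b := 3)
        (Nat.pow_lt_pow_right (by omega) (by omega)) hj3) (pow_mono_base hB (by norm_num))
    · rintro _ rfl
      refine ⟨rfl, by simp [State.setReg, addr1, Arith.eval, h2, hj], fun r hr => ?_⟩
      simp [State.setReg, hr.ne]
  · have hlt := addr1_lt hB f hf hj3
    have hpow := pow_mono_base (B := B) hB (show 11 ≤ 20 by norm_num)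
    simp only [addr1, hf, if_false] at hlt
    simp only [compileA1, hf, if_false]
    have hc := f.code_lt
    have h1 : B ^ 1 ≤ B ^ 20 := pow_mono_base hB (by norm_num)
    rw [pow_one] at h1
    refine (Ex.seq (Ex.const (by omega)) ?_).mono (T1 := 1 + (1 + (1 + 1))) (by omega) (fun _ h => h)
    rintro _ rfl
    refine Ex.seq (Ex.arith ?_) ?_
    · simp [State.setReg, Arith.eval, hj]; omega
    rintro _ rfl
    refine Ex.seq (Ex.const (by omega)) ?_
    rintro _ rfl
    refine (Ex.arith ?_).mono (by omega) ?_
    · simp [State.setReg, Arith.eval, hj]; omega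
    rintro _ rfl
    refine ⟨rfl, by simp [State.setReg, addr1, Arith.eval, hj, hf], fun r hr => ?_⟩
    simp [State.setReg, hr.ne, show r ≠ d + 1 by omega]

theorem compileA2_spec {B : ℕ} (hB : 1024 ≤ B) (f : F2) (d i j : ℕ) (s : State)
    (hi : s.reg d = i) (hj : s.reg (d + 1) = j) (hi3 : i < B ^ 3) (hj3 : j < B ^ 3) :
    Ex (B ^ 20) (compileA2 f d) s (Puts s d (addr2 f i j)) 7 := by
  have hlt := addr2_lt hB f hi3 hj3
  have hpow := pow_mono_base (B := B) hB (show 11 ≤ 20 by norm_num)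
  have hc := f.code_lt
  have h1 : B ^ 1 ≤ B ^ 20 := pow_mono_base hB (by norm_num)
  rw [pow_one] at h1
  simp only [addr2] at hlt
  have hsq : i + j ≤ (i + j) * (i + j) := Nat.le_mul_self _
  unfold compileA2
  refine (Ex.seq (Ex.arith ?_) ?_).mono (T1 := 1 + (1 + (1 + (1 + (1 + (1 + 1)))))) (by omega)
    (fun _ h => h)
  · simp only [Arith.eval, hi, hj]; omega
  rintro _ rfl
  refine Ex.seq (Ex.arith ?_) ?_
  · simp [State.setReg, Arith.eval, hi, hj]; omega
  rintro _ rfl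
  refine Ex.seq (Ex.arith ?_) ?_
  · simp [State.setReg, Arith.eval, hi, hj]; omega
  rintro _ rfl
  refine Ex.seq (Ex.const (by omega)) ?_
  rintro _ rfl
  refine Ex.seq (Ex.arith ?_) ?_
  · simp [State.setReg, Arith.eval, hi, hj]; omega
  rintro _ rfl
  refine Ex.seq (Ex.const (by omega)) ?_
  rintro _ rfl
  refine (Ex.arith ?_).mono (by omega) ?_
  · simp [State.setReg, Arith.eval, hi, hj]; omega
  rintro _ rfl
  refine ⟨rfl, by simp [State.setReg, addr2, Arith.eval, hi, hj], fun r hr => ?_⟩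
  simp [State.setReg, hr.ne, show r ≠ d + 1 by omega]

theorem Sim.of_puts {B : ℕ} {σ : HS} {s s' : State} {d v : ℕ} (h : Sim B σ s) (hd : 103 ≤ d)
    (hp : Puts s d v s') : Sim B σ s' :=
  h.congr hp.1 fun r hr => hp.2.2 r (by omega)

theorem Puts.trans {s s' s'' : State} {d d' v v' : ℕ} (h : Puts s d v s') (h' : Puts s' d' v' s'')
    (hd : d < d') : Puts s d v s'' :=
  ⟨h'.1.trans h.1, (h'.2.2 d hd).trans h.2.1, fun r hr => (h'.2.2 r (by omega)).trans (h.2.2 r hr)⟩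

theorem Puts.over {s s' s'' : State} {d d' v v' : ℕ} (h : Puts s d v s') (h' : Puts s' d' v' s'')
    (hd : d' ≤ d) : Puts s d' v' s'' :=
  ⟨h'.1.trans h.1, h'.2.1, fun r hr => (h'.2.2 r hr).trans (h.2.2 r (by omega))⟩

theorem Puts.setReg (s : State) (d v : ℕ) : Puts s d v (s.setReg d v) :=
  ⟨rfl, by simp [State.setReg], fun r hr => by simp [State.setReg, hr.ne]⟩

/-- `K` is chosen before `B` and the states: it depends on the syntax alone, which makes the final
constants absolute. -/
theorem compileE_spec (e : Expr) (he : e.ok) : ∃ K, ∀ (B : ℕ) (σ : HS) (s : State) (d : ℕ),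
    1024 ≤ B → Bd B σ → Sim B σ s → 103 ≤ d →
    Ex (B ^ 20) (compileE e d) s (Puts s d (e.eval σ)) K := by
  have hev : ∀ (B : ℕ) (σ : HS) (e : Expr), 1024 ≤ B → Bd B σ → e.ok → e.wt ≤ 10 →
      e.eval σ < B ^ 20 := fun B σ e hB hb h1 h2 =>
    lt_of_lt_of_le (e.eval_lt hB hb h1) (pow_mono_base hB (by omega))
  induction e with
  | num a =>
    refine ⟨1, fun B σ s d hB hb hs hd => (Ex.const ?_).mono le_rfl ?_⟩
    · exact hev B σ (.num a) hB hb he (by simp [Expr.wt])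
    · rintro _ rfl; exact Puts.setReg _ _ _
  | var r =>
    refine ⟨1, fun B σ s d hB hb hs hd => (Ex.move ?_).mono le_rfl ?_⟩
    · rw [hs.reg]; exact hev B σ (.var r) hB hb he (by simp [Expr.wt])
    · rintro _ rfl; rw [hs.reg]; exact Puts.setReg _ _ _
  | bin o a b iha ihb =>
    have hok := he
    simp only [Expr.ok, Bool.and_eq_true, decide_eq_true_eq] at he
    obtain ⟨Ka, ha⟩ := iha he.1.1
    obtain ⟨Kb, hb⟩ := ihb he.1.2
    refine ⟨Ka + (Kb + 1), fun B σ s d hB hbd hs hd => ?_⟩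
    refine Ex.seq (ha B σ s d hB hbd hs hd) fun s1 h1 => ?_
    refine Ex.seq (hb B σ s1 (d + 1) hB hbd (hs.of_puts hd h1) (by omega)) fun s2 h2 => ?_
    have h3 := h1.trans h2 (by omega)
    refine (Ex.arith ?_).mono le_rfl ?_
    · rw [h3.2.1, h2.2.1]; exact hev B σ (.bin o a b) hB hbd hok he.2
    · rintro _ rfl; rw [h3.2.1, h2.2.1]
      exact h3.over (Puts.setReg _ _ _) le_rfl
  | ld1 f j ihj =>
    simp only [Expr.ok, Bool.and_eq_true, decide_eq_true_eq] at he
    obtain ⟨Kj, hj⟩ := ihj he.1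
    refine ⟨Kj + (4 + 1), fun B σ s d hB hbd hs hd => ?_⟩
    have hj3 : j.eval σ < B ^ 3 :=
      lt_of_lt_of_le (j.eval_lt hB hbd he.1) (pow_mono_base hB he.2)
    refine Ex.seq (hj B σ s d hB hbd hs hd) fun s1 h1 => ?_
    have hs1 := hs.of_puts hd h1
    refine Ex.seq (compileA1_spec hB f d _ s1 hs1.off h1.2.1 hj3) fun s2 h2 => ?_
    have hs2 := hs1.of_puts hd h2
    refine (Ex.load ?_ ?_).mono le_rfl ?_
    · rw [h2.2.1]
      by_cases hf : f = .xarr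
      · simp only [addr1, hf, if_true]
        exact lt_of_lt_of_le (add_lt_pow hB (a := 17) (b := 3)
          (Nat.pow_lt_pow_right (by omega) (by omega)) hj3) (pow_mono_base hB (by norm_num))
      · exact lt_of_lt_of_le (addr1_lt hB f hf hj3) (pow_mono_base hB (by norm_num))
    · rw [h2.2.1, hs2.m1 f _ hj3]
      exact lt_of_lt_of_le (hbd.m1 _ _) (by simpa using pow_mono_base hB (show 1 ≤ 20 by norm_num))
    · rintro _ rfl
      rw [h2.2.1, hs2.m1 f _ hj3]
      exact (h1.over h2 le_rfl).over (Puts.setReg _ _ _) le_rfl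
  | ld2 f i j ihi ihj =>
    simp only [Expr.ok, Bool.and_eq_true, decide_eq_true_eq] at he
    obtain ⟨Ki, hi⟩ := ihi he.1.1.1
    obtain ⟨Kj, hj⟩ := ihj he.1.1.2
    refine ⟨Ki + (Kj + (7 + 1)), fun B σ s d hB hbd hs hd => ?_⟩
    have hi3 : i.eval σ < B ^ 3 :=
      lt_of_lt_of_le (i.eval_lt hB hbd he.1.1.1) (pow_mono_base hB he.1.2)
    have hj3 : j.eval σ < B ^ 3 :=
      lt_of_lt_of_le (j.eval_lt hB hbd he.1.1.2) (pow_mono_base hB he.2)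
    refine Ex.seq (hi B σ s d hB hbd hs hd) fun s1 h1 => ?_
    have hs1 := hs.of_puts hd h1
    refine Ex.seq (hj B σ s1 (d + 1) hB hbd hs1 (by omega)) fun s2 h2 => ?_
    have h12 := h1.trans h2 (by omega)
    refine Ex.seq (compileA2_spec hB f d _ _ s2 h12.2.1 h2.2.1 hi3 hj3) fun s3 h3 => ?_
    have hs3 := (hs.of_puts hd h12).of_puts hd h3
    refine (Ex.load ?_ ?_).mono le_rfl ?_
    · rw [h3.2.1]
      exact lt_of_lt_of_le (addr2_lt hB f hi3 hj3) (pow_mono_base hB (by norm_num))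
    · rw [h3.2.1, hs3.m2 f _ _ hi3 hj3]
      exact lt_of_lt_of_le (hbd.m2 _ _ _)
        (by simpa using pow_mono_base hB (show 1 ≤ 20 by norm_num))
    · rintro _ rfl
      rw [h3.2.1, hs3.m2 f _ _ hi3 hj3]
      exact (h12.over h3 le_rfl).over (Puts.setReg _ _ _) le_rfl

open Classical in
theorem compileC_spec (b : Cond) (hb : b.ok) : ∃ K, ∀ (B : ℕ) (σ : HS) (s : State) (d : ℕ),
    1024 ≤ B → Bd B σ → Sim B σ s → 103 ≤ d →
    Ex (B ^ 20) (compileC b d) s (Puts s d (if b.holds σ then 1 else 0)) K := by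
  have hlt : ∀ {B : ℕ}, 1024 ≤ B → 1024 ≤ B ^ 20 := fun {B} hB =>
    hB.trans (by simpa using pow_mono_base hB (show 1 ≤ 20 by norm_num))
  induction b with
  | lt e1 e2 =>
    simp only [Cond.ok, Bool.and_eq_true] at hb
    obtain ⟨Ka, ha⟩ := compileE_spec e1 hb.1
    obtain ⟨Kb, hb⟩ := compileE_spec e2 hb.2
    refine ⟨Ka + (Kb + (1 + 1 + 1)), fun B σ s d hB hbd hs hd => ?_⟩
    have := hlt hB
    refine Ex.seq (ha B σ s d hB hbd hs hd) fun s1 h1 => ?_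
    refine Ex.seq (hb B σ s1 (d + 1) hB hbd (hs.of_puts hd h1) (by omega)) fun s2 h2 => ?_
    have h3 := h1.trans h2 (by omega)
    refine Ex.ite (fun h => ?_) (fun h => ?_) <;> simp only [Test.Holds, h3.2.1, h2.2.1] at h
    · refine (Ex.const (by omega)).mono le_rfl ?_
      rintro _ rfl
      simpa [Cond.holds, h] using h3.over (Puts.setReg _ _ _) le_rfl
    · refine (Ex.const (by omega)).mono le_rfl ?_
      rintro _ rfl
      simpa [Cond.holds, h] using h3.over (Puts.setReg _ _ _) le_rfl
  | eq e1 e2 =>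
    simp only [Cond.ok, Bool.and_eq_true] at hb
    obtain ⟨Ka, ha⟩ := compileE_spec e1 hb.1
    obtain ⟨Kb, hb⟩ := compileE_spec e2 hb.2
    refine ⟨Ka + (Kb + (1 + 1 + 1)), fun B σ s d hB hbd hs hd => ?_⟩
    have := hlt hB
    refine Ex.seq (ha B σ s d hB hbd hs hd) fun s1 h1 => ?_
    refine Ex.seq (hb B σ s1 (d + 1) hB hbd (hs.of_puts hd h1) (by omega)) fun s2 h2 => ?_
    have h3 := h1.trans h2 (by omega)
    refine Ex.ite (fun h => ?_) (fun h => ?_) <;> simp only [Test.Holds, h3.2.1, h2.2.1] at h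
    · refine (Ex.const (by omega)).mono le_rfl ?_
      rintro _ rfl
      simpa [Cond.holds, h] using h3.over (Puts.setReg _ _ _) le_rfl
    · refine (Ex.const (by omega)).mono le_rfl ?_
      rintro _ rfl
      simpa [Cond.holds, h] using h3.over (Puts.setReg _ _ _) le_rfl
  | and b c ihb ihc =>
    simp only [Cond.ok, Bool.and_eq_true] at hb
    obtain ⟨Ka, ha⟩ := ihb hb.1
    obtain ⟨Kb, hb⟩ := ihc hb.2
    refine ⟨Ka + (Kb + 1), fun B σ s d hB hbd hs hd => ?_⟩
    have := hlt hB
    refine Ex.seq (ha B σ s d hB hbd hs hd) fun s1 h1 => ?_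
    refine Ex.seq (hb B σ s1 (d + 1) hB hbd (hs.of_puts hd h1) (by omega)) fun s2 h2 => ?_
    have h3 := h1.trans h2 (by omega)
    refine (Ex.arith ?_).mono le_rfl ?_
    · rw [h3.2.1, h2.2.1]; simp only [Arith.eval]; split_ifs <;> omega
    · rintro _ rfl; rw [h3.2.1, h2.2.1]
      have := h3.over (Puts.setReg s2 d (Arith.mul.eval (if b.holds σ then 1 else 0)
        (if c.holds σ then 1 else 0))) le_rfl
      have h4 : (if (b.and c).holds σ then 1 else 0) = Arith.mul.eval (if b.holds σ then 1 else 0)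
          (if c.holds σ then 1 else 0) := by
        by_cases h : b.holds σ <;> by_cases h' : c.holds σ <;> simp [Cond.holds, Arith.eval, h, h']
      rw [h4]; exact this
  | not b ihb =>
    simp only [Cond.ok] at hb
    obtain ⟨Ka, ha⟩ := ihb hb
    refine ⟨Ka + (1 + 1), fun B σ s d hB hbd hs hd => ?_⟩
    have := hlt hB
    refine Ex.seq (ha B σ s d hB hbd hs hd) fun s1 h1 => ?_
    refine Ex.seq (Ex.const (by omega)) fun s2 h2 => ?_
    subst h2
    have h3 := h1.trans (Puts.setReg s1 (d + 1) 1) (by omega)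
    refine (Ex.arith ?_).mono le_rfl ?_
    · rw [h3.2.1]; simp only [Arith.eval, State.setReg, Function.update_self]; omega
    · rintro _ rfl; rw [h3.2.1]
      have h4 : (if (Cond.not b).holds σ then 1 else 0) =
          Arith.sub.eval ((s1.setReg (d + 1) 1).reg (d + 1)) (if b.holds σ then 1 else 0) := by
        simp only [Cond.holds, Arith.eval, State.setReg, Function.update_self]
        split_ifs <;> simp_all
      rw [h4]
      exact h3.over (Puts.setReg _ _ _) le_rfl

/-! ### Correctness and determinism of compiled statements -/

theorem Sim.set {B : ℕ} {σ : HS} {s : State} (h : Sim B σ s) (x : Reg) (a : ℕ) :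
    Sim B (σ.set x a) (s.setReg (x.code + 3) a) := by
  refine ⟨by simp [State.setReg, h.off], fun z => ?_, h.m1, h.m2⟩
  by_cases hy : z = x
  · simp [hy, HS.set, State.setReg]
  · have : z.code ≠ x.code := fun h => hy (Reg.code_inj h)
    simp [hy, HS.set, State.setReg, h.reg, this]

theorem Sim.st1 {B : ℕ} {σ : HS} {s : State} (hB : 1024 ≤ B) (h : Sim B σ s) (f : F1) (j a : ℕ)
    (hj : j < B ^ 3) : Sim B (σ.st1 f j a) (s.setMem (addr1 (B ^ 16) f j) a) := by
  refine ⟨h.off, h.reg, fun f' j' hj' => ?_, fun f' i' j' hi' hj' => ?_⟩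
  · by_cases he : f' = f ∧ j' = j
    · simp [he, HS.st1, State.setMem]
    · have : addr1 (B ^ 16) f' j' ≠ addr1 (B ^ 16) f j := fun h => he (addr1_inj hB hj' hj h)
      simp [he, HS.st1, State.setMem, this, h.m1 f' j' hj']
  · have := addr1_ne_addr2 hB (f := f) (g := f') (j := j) hi' hj'
    simp [HS.st1, State.setMem, this.symm, h.m2 f' i' j' hi' hj']

theorem Sim.st2 {B : ℕ} {σ : HS} {s : State} (hB : 1024 ≤ B) (h : Sim B σ s) (f : F2) (i j a : ℕ)
    (hi : i < B ^ 3) (hj : j < B ^ 3) : Sim B (σ.st2 f i j a) (s.setMem (addr2 f i j) a) := by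
  refine ⟨h.off, h.reg, fun f' j' hj' => ?_, fun f' i' j' hi' hj' => ?_⟩
  · have := addr1_ne_addr2 hB (f := f') (g := f) (j := j') hi hj
    simp [HS.st2, State.setMem, this, h.m1 f' j' hj']
  · by_cases he : f' = f ∧ i' = i ∧ j' = j
    · simp [he, HS.st2, State.setMem]
    · have : addr2 f' i' j' ≠ addr2 f i j := fun h => he (addr2_inj h)
      simp [he, HS.st2, State.setMem, this, h.m2 f' i' j' hi' hj']

theorem addr1_lt' {B j : ℕ} (hB : 1024 ≤ B) (f : F1) (hj : j < B ^ 3) :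
    addr1 (B ^ 16) f j < B ^ 20 := by
  by_cases hf : f = .xarr
  · simp only [addr1, hf, if_true]
    exact lt_of_lt_of_le (add_lt_pow hB (a := 17) (b := 3)
      (Nat.pow_lt_pow_right (by omega) (by omega)) hj) (pow_mono_base hB (by norm_num))
  · exact lt_of_lt_of_le (addr1_lt hB f hf hj) (pow_mono_base hB (by norm_num))

/-- Code without loops takes a number of steps that depends only on its text, so each iteration can
be charged a constant. The summand 1 in `t + 1` pays for code that performs no iteration at all. -/
theorem compile_spec (p : Stmt) (hp : p.ok) : ∃ K, ∀ (B : ℕ) (σ σ' : HS) (t : ℕ) (s : State),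
    1024 ≤ B → HExec B p σ σ' t → Bd B σ → Sim B σ s →
    Ex (B ^ 20) (compile p) s (Sim B σ') (K * (t + 1)) := by
  have hlt : ∀ {B : ℕ}, 1024 ≤ B → B ≤ B ^ 20 := fun {B} hB =>
    by simpa using pow_mono_base hB (show 1 ≤ 20 by norm_num)
  induction p with
  | skip =>
    refine ⟨1, fun B σ σ' t s hB h hbd hs => ?_⟩
    cases h
    exact ⟨s, 1, .skip s, by omega, hs⟩
  | asg x e =>
    obtain ⟨K, hK⟩ := compileE_spec e hp
    refine ⟨K + 1, fun B σ σ' t s hB h hbd hs => ?_⟩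
    cases h with | asg _ _ _ h => ?_
    have := hlt hB
    refine (Ex.seq (hK B σ s 103 hB hbd hs le_rfl) fun s1 h1 => (Ex.move ?_).mono le_rfl ?_).mono
      (by omega) (fun _ h => h)
    · rw [h1.2.1]; omega
    · rintro _ rfl; rw [h1.2.1]
      exact (hs.of_puts le_rfl h1).set _ _
  | st1 f j e =>
    simp only [Stmt.ok, Bool.and_eq_true, decide_eq_true_eq] at hp
    obtain ⟨Kj, hj⟩ := compileE_spec j hp.1.1
    obtain ⟨Ke, he⟩ := compileE_spec e hp.1.2
    refine ⟨Kj + (4 + (Ke + 1)), fun B σ σ' t s hB h hbd hs => ?_⟩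
    cases h with | st1 _ _ _ _ h => ?_
    have := hlt hB
    have hj3 : j.eval σ < B ^ 3 :=
      lt_of_lt_of_le (j.eval_lt hB hbd hp.1.1) (pow_mono_base hB hp.2)
    refine (Ex.seq (T2 := 4 + (Ke + 1)) (hj B σ s 103 hB hbd hs le_rfl) fun s1 h1 => ?_).mono
      (by omega) (fun _ h => h)
    have hs1 := hs.of_puts le_rfl h1
    refine Ex.seq (compileA1_spec hB f 103 _ s1 hs1.off h1.2.1 hj3) fun s2 h2 => ?_
    have hs2 := hs1.of_puts le_rfl h2
    refine Ex.seq (he B σ s2 104 hB hbd hs2 (by omega)) fun s3 h3 => ?_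
    have hs3 := hs2.of_puts (by omega) h3
    have h23 := h2.trans h3 (by omega)
    refine (Ex.store ?_ ?_).mono le_rfl ?_
    · rw [h23.2.1]; exact addr1_lt' hB f hj3
    · rw [h3.2.1]; omega
    · rintro _ rfl; rw [h23.2.1, h3.2.1]; exact hs3.st1 hB _ _ _ hj3
  | st2 f i j e =>
    simp only [Stmt.ok, Bool.and_eq_true, decide_eq_true_eq] at hp
    obtain ⟨Ki, hi⟩ := compileE_spec i hp.1.1.1.1
    obtain ⟨Kj, hj⟩ := compileE_spec j hp.1.1.1.2
    obtain ⟨Ke, he⟩ := compileE_spec e hp.1.1.2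
    refine ⟨Ki + (Kj + (7 + (Ke + 1))), fun B σ σ' t s hB h hbd hs => ?_⟩
    cases h with | st2 _ _ _ _ _ h => ?_
    have := hlt hB
    have hi3 : i.eval σ < B ^ 3 :=
      lt_of_lt_of_le (i.eval_lt hB hbd hp.1.1.1.1) (pow_mono_base hB hp.1.2)
    have hj3 : j.eval σ < B ^ 3 :=
      lt_of_lt_of_le (j.eval_lt hB hbd hp.1.1.1.2) (pow_mono_base hB hp.2)
    refine (Ex.seq (T2 := Kj + (7 + (Ke + 1))) (hi B σ s 103 hB hbd hs le_rfl) fun s1 h1 => ?_).mono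
      (by omega) (fun _ h => h)
    have hs1 := hs.of_puts le_rfl h1
    refine Ex.seq (hj B σ s1 104 hB hbd hs1 (by omega)) fun s1' h1' => ?_
    have h11 := h1.trans h1' (by omega)
    refine Ex.seq (compileA2_spec hB f 103 _ _ s1' h11.2.1 h1'.2.1 hi3 hj3) fun s2 h2 => ?_
    have hs2 := (hs.of_puts le_rfl h11).of_puts le_rfl h2
    refine Ex.seq (he B σ s2 104 hB hbd hs2 (by omega)) fun s3 h3 => ?_
    have hs3 := hs2.of_puts (by omega) h3
    have h23 := h2.trans h3 (by omega)
    refine (Ex.store ?_ ?_).mono le_rfl ?_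
    · rw [h23.2.1]
      exact lt_of_lt_of_le (addr2_lt hB f hi3 hj3) (pow_mono_base hB (by norm_num))
    · rw [h3.2.1]; omega
    · rintro _ rfl; rw [h23.2.1, h3.2.1]; exact hs3.st2 hB _ _ _ _ hi3 hj3
  | seq p q ihp ihq =>
    simp only [Stmt.ok, Bool.and_eq_true] at hp
    obtain ⟨Kp, hKp⟩ := ihp hp.1
    obtain ⟨Kq, hKq⟩ := ihq hp.2
    refine ⟨Kp + Kq, fun B σ σ' t s hB h hbd hs => ?_⟩
    cases h with | @seq _ _ _ σ1 _ t1 t2 h1 h2 => ?_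
    refine (Ex.seq (hKp B σ σ1 t1 s hB h1 hbd hs) fun s1 hs1 =>
      hKq B σ1 σ' t2 s1 hB h2 (h1.bd hbd) hs1).mono ?_ (fun _ h => h)
    nlinarith [Nat.zero_le (Kp * t2), Nat.zero_le (Kq * t1)]
  | ite b p q ihp ihq =>
    simp only [Stmt.ok, Bool.and_eq_true] at hp
    obtain ⟨Kb, hKb⟩ := compileC_spec b hp.1.1
    obtain ⟨Kp, hKp⟩ := ihp hp.1.2
    obtain ⟨Kq, hKq⟩ := ihq hp.2
    refine ⟨Kb + 2 + Kp + Kq, fun B σ σ' t s hB h hbd hs => ?_⟩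
    have := hlt hB
    refine (Ex.seq (hKb B σ s 103 hB hbd hs le_rfl) fun s1 h1 =>
      Ex.seq (Ex.const (by omega)) fun s2 h2 => ?_).mono
      (T1 := Kb + (1 + (Kq * (t + 1) + Kp * (t + 1) + 1))) (by nlinarith) (fun _ h => h)
    subst h2
    have h2 := h1.trans (Puts.setReg s1 104 0) (by omega)
    have hs2 := hs.of_puts le_rfl h2
    have h104 : (s1.setReg 104 0).reg 104 = 0 := by simp [State.setReg]
    refine Ex.ite (fun hc => ?_) (fun hc => ?_) <;>
      simp only [Test.Holds, h2.2.1, h104, ite_eq_right_iff, one_ne_zero, imp_false,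
        not_not] at hc
    · cases h with
      | iteTrue hb _ => exact absurd hb hc
      | iteFalse hb h => exact hKq B σ σ' t _ hB h hbd hs2
    · cases h with
      | iteTrue hb h => exact hKp B σ σ' t _ hB h hbd hs2
      | iteFalse hb _ => exact absurd hc hb
  | loop b p ihp =>
    simp only [Stmt.ok, Bool.and_eq_true] at hp
    obtain ⟨Kb, hKb⟩ := compileC_spec b hp.1
    obtain ⟨Kp, hKp⟩ := ihp hp.2
    refine ⟨(Kb + 1) + 1 + (Kp + (Kb + 1) + 1), fun B σ σ' t s hB h hbd hs => ?_⟩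
    have := hlt hB
    have key : ∀ (σ : HS) (s : State), Bd B σ → Sim B σ s →
        Ex (B ^ 20) (.seq (compileC b 103) (.const 104 0)) s
          (fun s' => Sim B σ s' ∧ ((Test.lt 104 103).Holds s' ↔ b.holds σ)) (Kb + 1) := by
      intro σ s hbd hs
      refine Ex.seq (hKb B σ s 103 hB hbd hs le_rfl) fun s1 h1 => (Ex.const (by omega)).mono le_rfl ?_
      rintro _ rfl
      have h2 := h1.trans (Puts.setReg s1 104 0) (by omega)
      have h104 : (s1.setReg 104 0).reg 104 = 0 := by simp [State.setReg]
      refine ⟨hs.of_puts le_rfl h2, ?_⟩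
      simp only [Test.Holds, h2.2.1, h104]
      split_ifs with h <;> simp [h]
    -- Induction on the execution needs a variable program, hence `P` together with an equation. The
    -- invariant says that the test registers already hold the value of the condition.
    have main : ∀ (P : Stmt) (σ σ' : HS) (t : ℕ), HExec B P σ σ' t → P = .loop b p →
        ∀ s, Bd B σ → Sim B σ s → ((Test.lt 104 103).Holds s ↔ b.holds σ) →
        Ex (B ^ 20) (.while (.lt 104 103) (.seq (compile p) (.seq (compileC b 103) (.const 104 0))))
          s (Sim B σ') ((Kp + (Kb + 1) + 1) * t + 1) := by
      intro P σ σ' t h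
      induction h with
      | @loopTrue b' p' σ0 σ1 σ2 t1 t2 hb h1 h2 _ ih2 =>
        intro hP s hbd hs hc
        cases hP
        have hbd1 := h1.bd hbd
        obtain ⟨s1, u1, e1, hu1, hs1, hc1⟩ : Ex (B ^ 20)
            (.seq (compile p) (.seq (compileC b 103) (.const 104 0))) s
            (fun s' => Sim B σ1 s' ∧ ((Test.lt 104 103).Holds s' ↔ b.holds σ1))
            (Kp * (t1 + 1) + (Kb + 1)) :=
          Ex.seq (hKp B σ0 σ1 t1 s hB h1 hbd hs) fun s1 hs1 => key σ1 s1 hbd1 hs1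
        obtain ⟨s2, u2, e2, hu2, hs2⟩ := ih2 rfl s1 hbd1 hs1 hc1
        refine ⟨s2, _, .whileTrue (hc.2 hb) e1 e2, ?_, hs2⟩
        nlinarith [Nat.zero_le (Kb * t1)]
      | loopFalse hb =>
        intro hP s hbd hs hc
        cases hP
        exact ⟨s, 1, .whileFalse (fun h => hb (hc.1 h)), by omega, hs⟩
      | _ => intro hP; cases hP
    refine (Ex.seq (key σ s hbd hs) fun s1 hs1 => main _ σ σ' t h rfl s1 hbd hs1.1 hs1.2).mono ?_
      (fun _ h => h)
    nlinarith [Nat.zero_le (Kb * t)]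

/-- `Reaches` speaks of arbitrary executions, whereas the specifications provide one; determinism
identifies their final states. -/
theorem Exec.det {W : ℕ} {p : Cmd} {s s1 s2 : State} {t1 t2 : ℕ} (h1 : Exec W p s s1 t1)
    (h2 : Exec W p s s2 t2) : s1 = s2 := by
  induction h1 generalizing s2 t2 with
  | seq _ _ ih1 ih2 => cases h2 with | seq h3 h4 => cases ih1 h3; exact ih2 h4
  | iteTrue hb _ ih => cases h2 with
    | iteTrue _ h => exact ih h
    | iteFalse h _ => exact absurd hb h
  | iteFalse hb _ ih => cases h2 with
    | iteTrue h _ => exact absurd h hb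
    | iteFalse _ h => exact ih h
  | whileTrue hb _ _ ih1 ih2 => cases h2 with
    | whileTrue _ h3 h4 => cases ih1 h3; exact ih2 h4
    | whileFalse h => exact absurd hb h
  | whileFalse hb => cases h2 with
    | whileTrue h _ _ => exact absurd h hb
    | whileFalse _ => rfl
  | _ => cases h2; rfl

end DynCVD

namespace DynCVD

theorem Expr.eval_add (s : HS) (a b : Expr) : (a + b).eval s = a.eval s + b.eval s := rfl
theorem Expr.eval_sub (s : HS) (a b : Expr) : (a - b).eval s = a.eval s - b.eval s := rfl

/-! ### Frames -/

/-- A syntactic overestimate. It is computable, so frame conditions for concrete programs are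
settled by `rfl` or `decide`. -/
def Stmt.writes : Stmt → Reg → Bool
  | skip, _ => false
  | asg x _, r => decide (r = x)
  | st1 _ _ _, _ => false
  | st2 _ _ _ _, _ => false
  | seq p q, r => p.writes r || q.writes r
  | ite _ p q, r => p.writes r || q.writes r
  | loop _ p, r => p.writes r

def Stmt.stores1 : Stmt → F1 → Bool
  | skip, _ => false
  | asg _ _, _ => false
  | st1 f _ _, g => decide (g = f)
  | st2 _ _ _ _, _ => false
  | seq p q, r => p.stores1 r || q.stores1 r
  | ite _ p q, r => p.stores1 r || q.stores1 r
  | loop _ p, r => p.stores1 r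

def Stmt.stores2 : Stmt → F2 → Bool
  | skip, _ => false
  | asg _ _, _ => false
  | st1 _ _ _, _ => false
  | st2 f _ _ _, g => decide (g = f)
  | seq p q, r => p.stores2 r || q.stores2 r
  | ite _ p q, r => p.stores2 r || q.stores2 r
  | loop _ p, r => p.stores2 r

/-- What `p` cannot modify is the same in `s` and `s'`. -/
structure Frame (p : Stmt) (s s' : HS) : Prop where
  reg : ∀ r, p.writes r = false → s'.reg r = s.reg r
  m1 : ∀ f, p.stores1 f = false → s'.m1 f = s.m1 f
  m2 : ∀ f, p.stores2 f = false → s'.m2 f = s.m2 f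

theorem Frame.refl (p : Stmt) (s : HS) : Frame p s s := ⟨fun _ _ => rfl, fun _ _ => rfl, fun _ _ => rfl⟩

theorem Frame.trans {p : Stmt} {s s' s'' : HS} (h : Frame p s s') (h' : Frame p s' s'') :
    Frame p s s'' :=
  ⟨fun r hr => (h'.reg r hr).trans (h.reg r hr), fun r hr => (h'.m1 r hr).trans (h.m1 r hr),
    fun r hr => (h'.m2 r hr).trans (h.m2 r hr)⟩

theorem Frame.seq_left {p q : Stmt} {s s' : HS} (h : Frame p s s') : Frame (p ;; q) s s' := by
  refine ⟨fun r hr => h.reg r ?_, fun r hr => h.m1 r ?_, fun r hr => h.m2 r ?_⟩ <;>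
    simp_all [Stmt.writes, Stmt.stores1, Stmt.stores2]

theorem Frame.seq_right {p q : Stmt} {s s' : HS} (h : Frame q s s') : Frame (p ;; q) s s' := by
  refine ⟨fun r hr => h.reg r ?_, fun r hr => h.m1 r ?_, fun r hr => h.m2 r ?_⟩ <;>
    simp_all [Stmt.writes, Stmt.stores1, Stmt.stores2]

theorem Frame.of_loop {b : Cond} {p : Stmt} {s s' : HS} (h : Frame p s s') :
    Frame (.loop b p) s s' := ⟨h.reg, h.m1, h.m2⟩

theorem HExec.frame {B : ℕ} {p : Stmt} {s s' : HS} {t : ℕ} (h : HExec B p s s' t) :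
    Frame p s s' := by
  induction h with
  | skip => exact .refl _ _
  | asg s x e h =>
    refine ⟨fun r hr => ?_, fun _ _ => rfl, fun _ _ => rfl⟩
    simp [Stmt.writes] at hr; simp [HS.set, hr]
  | st1 s f j e h =>
    refine ⟨fun _ _ => rfl, fun r hr => ?_, fun _ _ => rfl⟩
    simp [Stmt.stores1] at hr; simp [HS.st1, hr]
  | st2 s f i j e h =>
    refine ⟨fun _ _ => rfl, fun _ _ => rfl, fun r hr => ?_⟩
    simp [Stmt.stores2] at hr; simp [HS.st2, hr]
  | seq _ _ ih1 ih2 => exact ih1.seq_left.trans ih2.seq_right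
  | iteTrue _ _ ih =>
    refine ⟨fun r hr => ih.reg r ?_, fun r hr => ih.m1 r ?_, fun r hr => ih.m2 r ?_⟩ <;>
      simp_all [Stmt.writes, Stmt.stores1, Stmt.stores2]
  | iteFalse _ _ ih =>
    refine ⟨fun r hr => ih.reg r ?_, fun r hr => ih.m1 r ?_, fun r hr => ih.m2 r ?_⟩ <;>
      simp_all [Stmt.writes, Stmt.stores1, Stmt.stores2]
  | loopTrue _ _ _ ih1 ih2 => exact ih1.of_loop.trans ih2
  | loopFalse => exact .refl _ _

/-! ### Total correctness with time bounds -/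

def Run (B : ℕ) (p : Stmt) (s : HS) (Q : HS → Prop) (T : ℕ) : Prop :=
  ∃ s' t, HExec B p s s' t ∧ t ≤ T ∧ Q s'

variable {B : ℕ} {p q : Stmt} {s : HS} {Q Q1 : HS → Prop} {T T1 T2 : ℕ}

theorem Run.mono (h : Run B p s Q1 T1) (hT : T1 ≤ T) (hQ : ∀ s', Q1 s' → Q s') :
    Run B p s Q T := by
  obtain ⟨s', t, h1, h2, h3⟩ := h
  exact ⟨s', t, h1, h2.trans hT, hQ _ h3⟩

theorem Run.full (h : Run B p s Q T) (hB : Bd B s) :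
    Run B p s (fun s' => Bd B s' ∧ Frame p s s' ∧ Q s') T := by
  obtain ⟨s', t, h1, h2, h3⟩ := h
  exact ⟨s', t, h1, h2, h1.bd hB, h1.frame, h3⟩

theorem Run.bind (hB : Bd B s) (hp : Run B p s Q1 T1)
    (hq : ∀ s1, Bd B s1 → Frame p s s1 → Q1 s1 → Run B q s1 Q T2) :
    Run B (p ;; q) s Q (T1 + T2) := by
  obtain ⟨s', t, h1, h2, h3⟩ := hp
  obtain ⟨s'', t', h1', h2', h3'⟩ := hq s' (h1.bd hB) h1.frame h3
  exact ⟨s'', _, .seq h1 h1', by omega, h3'⟩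

theorem Run.skip (h : Q s) : Run B .skip s Q T := ⟨s, 0, .skip s, by omega, h⟩

theorem Run.asg {x : Reg} {e : Expr} (v : ℕ) (he : e.eval s = v) (hv : v < B) (h : Q (s.set x v)) :
    Run B (.asg x e) s Q T := by
  subst he; exact ⟨_, 0, .asg s x e hv, by omega, h⟩

theorem Run.st1 {f : F1} {j e : Expr} (i v : ℕ) (hj : j.eval s = i) (he : e.eval s = v)
    (hv : v < B) (h : Q (s.st1 f i v)) : Run B (.st1 f j e) s Q T := by
  subst he hj; exact ⟨_, 0, .st1 s f j e hv, by omega, h⟩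

theorem Run.st2 {f : F2} {k j e : Expr} (a i v : ℕ) (hk : k.eval s = a) (hj : j.eval s = i)
    (he : e.eval s = v) (hv : v < B) (h : Q (s.st2 f a i v)) : Run B (.st2 f k j e) s Q T := by
  subst he hj hk; exact ⟨_, 0, .st2 s f k j e hv, by omega, h⟩

theorem Run.asg' {x : Reg} {e : Expr} (v : ℕ) (he : e.eval s = v) (hv : v < B)
    (h : Run B q (s.set x v) Q T) : Run B (.asg x e ;; q) s Q T := by
  subst he
  obtain ⟨s', t, h1, h2, h3⟩ := h
  exact ⟨s', _, .seq (.asg s x e hv) h1, by omega, h3⟩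

theorem Run.st1' {f : F1} {j e : Expr} (i v : ℕ) (hj : j.eval s = i) (he : e.eval s = v)
    (hv : v < B) (h : Run B q (s.st1 f i v) Q T) : Run B (.st1 f j e ;; q) s Q T := by
  subst he hj
  obtain ⟨s', t, h1, h2, h3⟩ := h
  exact ⟨s', _, .seq (.st1 s f j e hv) h1, by omega, h3⟩

theorem Run.st2' {f : F2} {k j e : Expr} (a i v : ℕ) (hk : k.eval s = a) (hj : j.eval s = i)
    (he : e.eval s = v) (hv : v < B) (h : Run B q (s.st2 f a i v) Q T) :
    Run B (.st2 f k j e ;; q) s Q T := by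
  subst he hj hk
  obtain ⟨s', t, h1, h2, h3⟩ := h
  exact ⟨s', _, .seq (.st2 s f k j e hv) h1, by omega, h3⟩

theorem Run.ite {b : Cond} (hp : b.holds s → Run B p s Q T) (hq : ¬ b.holds s → Run B q s Q T) :
    Run B (.ite b p q) s Q T := by
  by_cases hb : b.holds s
  · obtain ⟨s', t, h1, h2, h3⟩ := hp hb
    exact ⟨s', t, .iteTrue hb h1, h2, h3⟩
  · obtain ⟨s', t, h1, h2, h3⟩ := hq hb
    exact ⟨s', t, .iteFalse hb h1, h2, h3⟩

/-- Each round lowers `μ`, so there are at most `μ s` rounds, each of which costs `T` for the body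
and 1 for itself. -/
theorem Run.loop {b : Cond} {I : HS → Prop} {μ : HS → ℕ} (hB : Bd B s) (h0 : I s)
    (hstep : ∀ s', Bd B s' → Frame (.loop b p) s s' → I s' → b.holds s' →
      Run B p s' (fun s'' => I s'' ∧ μ s'' < μ s') T) :
    Run B (.loop b p) s (fun s' => I s' ∧ ¬ b.holds s') (μ s * (T + 1)) := by
  have main : ∀ m s', μ s' = m → Bd B s' → Frame (.loop b p) s s' → I s' →
      Run B (.loop b p) s' (fun s' => I s' ∧ ¬ b.holds s') (m * (T + 1)) := by
    intro m
    induction m using Nat.strong_induction_on with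
    | _ m ih =>
      intro s' hm hB' hF hI
      by_cases hb : b.holds s'
      · obtain ⟨s1, t1, h1, h2, h3, h4⟩ := hstep s' hB' hF hI hb
        obtain ⟨s2, t2, h5, h6, h7⟩ := ih (μ s1) (by omega) s1 rfl (h1.bd hB')
          (hF.trans h1.frame.of_loop) h3
        refine ⟨s2, _, .loopTrue hb h1 h5, ?_, h7⟩
        have : (μ s1 + 1) * (T + 1) ≤ m * (T + 1) := Nat.mul_le_mul_right _ (by omega)
        nlinarith
      · exact ⟨s', 0, .loopFalse hb, by omega, hI, hb⟩
  exact main _ s rfl hB (.refl _ _) h0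

def forLt (i : Reg) (e : Expr) (p : Stmt) : Stmt :=
  .asg i 0 ;; .loop (.lt i e) (p ;; .asg i (i + 1 : Expr))

/-- The loop bound is evaluated anew in every round, hence the hypothesis `he`. The body ends before
the counter moves on, so its postcondition is the next invariant in the state with the counter
already advanced. -/
theorem Run.forLt {i : Reg} {e : Expr} {I : ℕ → HS → Prop} {N : ℕ} (hB : Bd B s) (hN : N < B)
    (hp : p.writes i = false) (h0 : I 0 (s.set i 0))
    (he : ∀ j s', Frame (forLt i e p) s s' → I j s' → e.eval s' = N)
    (hstep : ∀ j s', j < N → Bd B s' → s'.reg i = j → Frame (DynCVD.forLt i e p) s s' → I j s' →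
      Run B p s' (fun s'' => I (j + 1) (s''.set i (j + 1))) T) :
    Run B (forLt i e p) s (I N) (N * (T + 1)) := by
  have hF0 : Frame (DynCVD.forLt i e p) s (s.set i 0) := by
    refine ⟨fun r hr => ?_, fun _ _ => rfl, fun _ _ => rfl⟩
    simp [DynCVD.forLt, Stmt.writes] at hr; simp [HS.set, hr]
  refine Run.asg' 0 rfl (by omega) ?_
  have hB1 : Bd B (s.set i 0) := (HExec.asg s i 0 (by simp only [Expr.eval]; omega)).bd hB
  have := Run.loop (b := .lt i e) (p := p ;; .asg i (i + 1 : Expr)) (T := T)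
    (I := fun s' => Frame (DynCVD.forLt i e p) s s' ∧ s'.reg i ≤ N ∧ I (s'.reg i) s')
    (μ := fun s' => N - s'.reg i) hB1
    ⟨hF0, by simp [HS.set], by simpa [HS.set] using h0⟩ ?_
  · refine this.mono (by simp [HS.set]) ?_
    rintro s' ⟨⟨hF, h1, h2⟩, h3⟩
    by_cases h4 : s'.reg i = N
    · rwa [h4] at h2
    · refine absurd ?_ h3
      simp only [Cond.holds, he _ s' hF h2]
      simp only [Expr.eval]; omega
  · rintro s' hB' - ⟨hF, h1, h2⟩ hb
    simp only [Cond.holds, he _ s' hF h2] at hb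
    simp only [Expr.eval] at hb
    refine (Run.bind hB' (hstep _ s' hb hB' rfl hF h2) (T2 := 0) fun s1 hB1 hF1 h3 => ?_).mono
      (by omega) (fun _ h => h)
    have hi := hF1.reg i hp
    have hFs : Frame (DynCVD.forLt i e p) s s1 := hF.trans hF1.seq_left.of_loop.seq_right
    refine Run.asg (s'.reg i + 1) (by rw [← hi]; rfl) (by omega) ⟨⟨⟨?_, hFs.m1, hFs.m2⟩, ?_, ?_⟩, ?_⟩
    · intro r hr
      have hr' := hr
      simp [DynCVD.forLt, Stmt.writes] at hr'
      simp only [HS.set, hr'.1, if_false]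
      exact hFs.reg r hr
    · simp only [HS.set, if_true]; omega
    · simp only [HS.set, if_true]; exact h3
    · simp only [HS.set, if_true]; omega

/-! ### Lists with constant time membership, insertion and deletion

The list `κ` of `a` is kept in an array, with a table of positions. The cells of the array also form
a linked list, from the last one to the first one. -/

/-- `b` is in the list `κ` of `a`. -/
def HS.Lst (s : HS) (κ : Kd) (a b : ℕ) : Prop := s.m2 (.pos κ) a b ≠ 0

/-- Positions are shifted by one, so that `0` means absence and cleared memory represents empty
lists. The field `val` repeats `arr` in the form of record addresses. The links `rnext` depend on
the position of a cell only, never on its entry, so replacing an entry in the middle does not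
disturb the linked list. -/
structure LOK (N : ℕ) (s : HS) (κ : Kd) (a : ℕ) : Prop where
  arr_pos : ∀ i < s.m1 (.cnt κ) a, s.m2 (.pos κ) a (s.m2 (.arr κ) a i) = i + 1
  arr_lt : ∀ i < s.m1 (.cnt κ) a, s.m2 (.arr κ) a i < N
  pos_arr : ∀ b, s.m2 (.pos κ) a b ≠ 0 → s.m2 (.pos κ) a b ≤ s.m1 (.cnt κ) a ∧
    s.m2 (.arr κ) a (s.m2 (.pos κ) a b - 1) = b
  rhead : s.m1 (.rhead κ) a =
    if s.m1 (.cnt κ) a = 0 then 0 else addr2 (.val κ) a (s.m1 (.cnt κ) a - 1)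
  val : ∀ i < s.m1 (.cnt κ) a, s.m2 (.val κ) a i = s.m2 (.arr κ) a i * 64
  rnext : ∀ i < s.m1 (.cnt κ) a, s.m2 (.rnext κ) a i =
    if i = 0 then 0 else addr2 (.val κ) a (i - 1)

/-- All lists are well-formed. -/
def LW (N : ℕ) (s : HS) : Prop := ∀ κ a, LOK N s κ a

theorem LOK.congr {N : ℕ} {s s' : HS} {κ : Kd} {a : ℕ} (h : LOK N s κ a)
    (h1 : s'.m1 (.cnt κ) a = s.m1 (.cnt κ) a) (h2 : s'.m1 (.rhead κ) a = s.m1 (.rhead κ) a)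
    (h3 : s'.m2 (.val κ) a = s.m2 (.val κ) a) (h4 : s'.m2 (.rnext κ) a = s.m2 (.rnext κ) a)
    (h5 : s'.m2 (.arr κ) a = s.m2 (.arr κ) a) (h6 : s'.m2 (.pos κ) a = s.m2 (.pos κ) a) :
    LOK N s' κ a := by
  obtain ⟨a1, a2, a3, a4, a5, a6⟩ := h
  constructor <;> simpa only [h1, h2, h3, h4, h5, h6]

theorem LOK.cnt_le {N : ℕ} {s : HS} {κ : Kd} {a : ℕ} (h : LOK N s κ a) : s.m1 (.cnt κ) a ≤ N := by
  have := Finset.card_le_card_of_injOn (s := Finset.range (s.m1 (.cnt κ) a)) (t := Finset.range N)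
    (s.m2 (.arr κ) a) (fun i hi => by simpa using h.arr_lt i (by simpa using hi)) ?_
  · simpa using this
  · intro i hi j hj hij
    simp only [Finset.coe_range, Set.mem_Iio] at hi hj
    have h1 := h.arr_pos i hi
    rw [hij, h.arr_pos j hj] at h1
    omega

theorem LOK.arr_mem {N : ℕ} {s : HS} {κ : Kd} {a : ℕ} (h : LOK N s κ a) {i : ℕ}
    (hi : i < s.m1 (.cnt κ) a) : s.Lst κ a (s.m2 (.arr κ) a i) := by
  rw [HS.Lst, h.arr_pos i hi]; omega

theorem LOK.exists_arr {N : ℕ} {s : HS} {κ : Kd} {a b : ℕ} (h : LOK N s κ a) (hb : s.Lst κ a b) :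
    ∃ i < s.m1 (.cnt κ) a, s.m2 (.arr κ) a i = b := by
  have := h.pos_arr b hb
  exact ⟨_, by unfold HS.Lst at hb; omega, this.2⟩

theorem LOK.arr_inj {N : ℕ} {s : HS} {κ : Kd} {a i j : ℕ} (h : LOK N s κ a)
    (hi : i < s.m1 (.cnt κ) a) (hj : j < s.m1 (.cnt κ) a)
    (hij : s.m2 (.arr κ) a i = s.m2 (.arr κ) a j) : i = j := by
  have h1 := h.arr_pos i hi
  rw [hij, h.arr_pos j hj] at h1
  omega

theorem LOK.cnt_lt {N : ℕ} {s : HS} {κ : Kd} {a b : ℕ} (h : LOK N s κ a) (hb : b < N)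
    (hn : ¬ s.Lst κ a b) : s.m1 (.cnt κ) a < N := by
  have := Finset.card_le_card_of_injOn (s := Finset.range (s.m1 (.cnt κ) a))
    (t := (Finset.range N).erase b) (s.m2 (.arr κ) a) (fun i hi => ?_) ?_
  · rw [Finset.card_range, Finset.card_erase_of_mem (by simpa using hb), Finset.card_range] at this
    omega
  · simp only [Finset.coe_range, Set.mem_Iio] at hi
    have h1 := h.arr_lt i hi
    have h2 := h.arr_mem hi
    simp only [Finset.coe_erase, Finset.coe_range, Set.mem_sdiff, Set.mem_Iio, h1, true_and,
      Set.mem_singleton_iff]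
    rintro h3; rw [h3] at h2; exact hn h2
  · intro i hi j hj hij
    simp only [Finset.coe_range, Set.mem_Iio] at hi hj
    exact h.arr_inj hi hj hij

/-- Evaluates to `addr2 (.val κ) a i`: the structured program has to store true machine addresses as
list pointers. -/
def ptrE (κ : Kd) (a i : Expr) : Expr :=
  ((a + i) * (a + i) + i) * 64 + .num (F2.val κ).code

/-- Insert `b` into the list `κ` of `a`, unless it is there. -/
def ins (κ : Kd) (a b : Expr) : Stmt :=
  .asg .ia a ;; .asg .ib b ;;
  .ite (.eq (.ld2 (.pos κ) Reg.ia Reg.ib) 0)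
    (.asg .ic (.ld1 (.cnt κ) Reg.ia) ;;
      .st2 (.arr κ) Reg.ia Reg.ic Reg.ib ;;
      .st2 (.val κ) Reg.ia Reg.ic (Reg.ib * 64 : Expr) ;;
      .st2 (.rnext κ) Reg.ia Reg.ic (.ld1 (.rhead κ) Reg.ia) ;;
      .st2 (.pos κ) Reg.ia Reg.ib (Reg.ic + 1 : Expr) ;;
      .st1 (.rhead κ) Reg.ia (ptrE κ Reg.ia Reg.ic) ;;
      .st1 (.cnt κ) Reg.ia (Reg.ic + 1 : Expr))
    .skip

/-- Delete `b` from the list `κ` of `a`, if it is there. -/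
def del (κ : Kd) (a b : Expr) : Stmt :=
  .asg .ia a ;; .asg .ib b ;; .asg .ic (.ld2 (.pos κ) Reg.ia Reg.ib) ;;
  .ite (.eq Reg.ic 0) .skip
    (.asg .id (.ld2 (.arr κ) Reg.ia (.ld1 (.cnt κ) Reg.ia - 1 : Expr)) ;;
      .st1 (.rhead κ) Reg.ia (.ld2 (.rnext κ) Reg.ia (.ld1 (.cnt κ) Reg.ia - 1 : Expr)) ;;
      .st2 (.arr κ) Reg.ia (Reg.ic - 1 : Expr) Reg.id ;;
      .st2 (.val κ) Reg.ia (Reg.ic - 1 : Expr) (Reg.id * 64 : Expr) ;;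
      .st2 (.pos κ) Reg.ia Reg.id Reg.ic ;;
      .st2 (.pos κ) Reg.ia Reg.ib 0 ;;
      .st1 (.cnt κ) Reg.ia (.ld1 (.cnt κ) Reg.ia - 1 : Expr))

/-- The lists other than the list `κ` of `a` are the same. -/
def SameBut (κ : Kd) (a : ℕ) (s s' : HS) : Prop :=
  ∀ κ' a', ¬ (κ' = κ ∧ a' = a) → s'.m1 (.cnt κ') a' = s.m1 (.cnt κ') a' ∧
    s'.m2 (.arr κ') a' = s.m2 (.arr κ') a'

/-- Pointers are stored numbers and have to be below `B`. This is the origin of the assumption `64 *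
(4 * N * N + N + 1) ≤ B` in the specifications below, where `N` is `3 * n` in the end. -/
theorem addr2_le {N a i : ℕ} (f : F2) (ha : a < N) (hi : i ≤ N) :
    addr2 f a i < 64 * (4 * N * N + N + 1) := by
  unfold addr2
  have := f.code_lt
  have : (a + i) * (a + i) ≤ (2 * N) * (2 * N) := Nat.mul_le_mul (by omega) (by omega)
  nlinarith

/-- The new cell goes to the end of the array and becomes the head of the linked list, pointing to
the old head. The expression `eb` is evaluated after `ia` has been overwritten, whence the state in
`hb`. -/
theorem ins_spec {N : ℕ} (hB : Bd B s) (hN : 64 * (4 * N * N + N + 1) ≤ B) (hL : LW N s) {κ : Kd}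
    {ea eb : Expr} {a b : ℕ} (ha : ea.eval s = a) (hb : eb.eval (s.set .ia a) = b) (haN : a < N)
    (hbN : b < N) :
    Run B (ins κ ea eb) s (fun s' => LW N s' ∧
      (∀ κ' a' b', s'.Lst κ' a' b' ↔ s.Lst κ' a' b' ∨ (κ' = κ ∧ a' = a ∧ b' = b)) ∧
      SameBut κ a s s') 0 := by
  have hNB : N < B := by nlinarith
  refine Run.asg' a ha (by omega) (Run.asg' b hb (by omega) (Run.ite (fun h => ?_) fun h => ?_))
  · have hl := hL κ a
    have hcN := hl.cnt_le
    simp [Cond.holds, Expr.eval, HS.set] at h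
    have hcN' : s.m1 (.cnt κ) a < N := hl.cnt_lt hbN (by simpa [HS.Lst] using h)
    refine Run.asg' (s.m1 (.cnt κ) a) (by simp [Expr.eval, HS.set]) (hB.m1 _ _) ?_
    refine Run.st2' a (s.m1 (.cnt κ) a) b rfl rfl rfl (by omega) ?_
    refine Run.st2' a (s.m1 (.cnt κ) a) (b * 64) rfl rfl rfl (by nlinarith) ?_
    refine Run.st2' a (s.m1 (.cnt κ) a) (s.m1 (.rhead κ) a) rfl rfl rfl (hB.m1 _ _) ?_
    refine Run.st2' a b (s.m1 (.cnt κ) a + 1) rfl rfl rfl (by omega) ?_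
    refine Run.st1' a (addr2 (.val κ) a (s.m1 (.cnt κ) a)) rfl rfl
      (lt_of_lt_of_le (addr2_le _ haN hcN) hN) ?_
    refine Run.st1 a (s.m1 (.cnt κ) a + 1) rfl rfl (by omega) ?_
    refine ⟨fun κ' a' => ?_, fun κ' a' b' => ?_, fun κ' a' h' => ?_⟩
    · by_cases h' : κ' = κ ∧ a' = a
      · obtain ⟨rfl, rfl⟩ := h'
        obtain ⟨a1, a2, a3, a4, a5, a6⟩ := hl
        constructor <;> simp [HS.st1, HS.st2, HS.set]
        all_goals grind
      · refine (hL κ' a').congr ?_ ?_ ?_ ?_ ?_ ?_ <;> simp [HS.st1, HS.st2, HS.set] <;> grind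
    · simp [HS.Lst, HS.st1, HS.st2, HS.set]; grind
    · simp [HS.st1, HS.st2, HS.set]; grind
  · simp [Cond.holds, Expr.eval, HS.set] at h
    refine Run.skip ⟨fun κ a => (hL κ a).congr rfl rfl rfl rfl rfl rfl, fun κ' a' b' => ⟨Or.inl, ?_⟩, fun _ _ _ => ⟨rfl, rfl⟩⟩
    rintro (h' | ⟨rfl, rfl, rfl⟩)
    exacts [h', h]


/-- The last entry moves into the gap and the last cell, which is the head of the linked list, is
dropped. All other links stay as they are. -/
theorem del_spec {N : ℕ} (hB : Bd B s) (hN : 64 * (4 * N * N + N + 1) ≤ B) (hL : LW N s) {κ : Kd}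
    {ea eb : Expr} {a b : ℕ} (ha : ea.eval s = a) (hb : eb.eval (s.set .ia a) = b) (haN : a < N)
    (hbN : b < N) :
    Run B (del κ ea eb) s (fun s' => LW N s' ∧
      (∀ κ' a' b', s'.Lst κ' a' b' ↔ s.Lst κ' a' b' ∧ ¬ (κ' = κ ∧ a' = a ∧ b' = b)) ∧
      SameBut κ a s s') 0 := by
  have hN64 : N * 64 < B := by nlinarith
  refine Run.asg' a ha (by omega) (Run.asg' b hb (by omega) ?_)
  refine Run.asg' (s.m2 (.pos κ) a b) (by simp [Expr.eval, HS.set]) (hB.m2 _ _ _) ?_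
  refine Run.ite (fun h => ?_) fun h => ?_
  · simp [Cond.holds, Expr.eval, HS.set] at h
    refine Run.skip ⟨fun κ a => (hL κ a).congr rfl rfl rfl rfl rfl rfl,
      fun κ' a' b' => ⟨fun h' => ⟨h', ?_⟩, fun h => h.1⟩, fun _ _ _ => ⟨rfl, rfl⟩⟩
    rintro ⟨rfl, rfl, rfl⟩
    exact h' h
  · have hl := hL κ a
    have hcN := hl.cnt_le
    simp [Cond.holds, Expr.eval, HS.set] at h
    obtain ⟨hp1, hp2⟩ := hl.pos_arr b h
    have hc : s.m2 (.arr κ) a (s.m1 (.cnt κ) a - 1) < N := hl.arr_lt _ (by omega)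
    refine Run.asg' (s.m2 (.arr κ) a (s.m1 (.cnt κ) a - 1)) (by simp [Expr.eval, Expr.eval_sub, HS.set])
      (hB.m2 _ _ _) ?_
    refine Run.st1' a (s.m2 (.rnext κ) a (s.m1 (.cnt κ) a - 1)) rfl rfl (hB.m2 _ _ _) ?_
    refine Run.st2' a (s.m2 (.pos κ) a b - 1) (s.m2 (.arr κ) a (s.m1 (.cnt κ) a - 1))
      rfl rfl rfl (hB.m2 _ _ _) ?_
    refine Run.st2' a (s.m2 (.pos κ) a b - 1) (s.m2 (.arr κ) a (s.m1 (.cnt κ) a - 1) * 64)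
      rfl rfl rfl (by omega) ?_
    refine Run.st2' a (s.m2 (.arr κ) a (s.m1 (.cnt κ) a - 1)) (s.m2 (.pos κ) a b)
      rfl rfl rfl (hB.m2 _ _ _) ?_
    -- The order of the two writes matters: if `b` is itself the last entry, the previous write has
    -- just restored its position, and this one clears it.
    refine Run.st2' a b 0 rfl rfl rfl (by omega) ?_
    refine Run.st1 a (s.m1 (.cnt κ) a - 1) rfl (by simp [Expr.eval, Expr.eval_sub, HS.set, HS.st1, HS.st2])
      (by omega) ?_
    refine ⟨fun κ' a' => ?_, fun κ' a' b' => ?_, fun κ' a' h' => ?_⟩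
    · by_cases h' : κ' = κ ∧ a' = a
      · obtain ⟨rfl, rfl⟩ := h'
        obtain ⟨a1, a2, a3, a4, a5, a6⟩ := hl
        constructor <;> simp [HS.st1, HS.st2, HS.set]
        · intro i hi
          have e1 := a1 i (by omega)
          have e2 := a1 (s.m1 (.cnt κ') a' - 1) (by omega)
          have e3 := a1 (s.m2 (.pos κ') a' b - 1) (by omega)
          clear a1 a2 a3 a4 a5 a6 hL
          by_cases hib : i = s.m2 (.pos κ') a' b - 1
          · have : s.m2 (.arr κ') a' (s.m1 (.cnt κ') a' - 1) ≠ b := by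
              intro h'; rw [h'] at e2; omega
            simp only [hib, if_true, this, if_false, not_true_eq_false, false_imp_iff]
            omega
          · have h1 : s.m2 (.arr κ') a' i ≠ b := by
              intro h'; rw [h'] at e1; omega
            have h2 : s.m2 (.arr κ') a' i ≠ s.m2 (.arr κ') a' (s.m1 (.cnt κ') a' - 1) := by
              intro h'; rw [h'] at e1; omega
            simp [hib, h1, h2, e1]
        · intro i hi
          have := a2 i (by omega)
          split_ifs <;> omega
        · intro x hx
          have e2 := a1 (s.m1 (.cnt κ') a' - 1) (by omega)
          have e4 := a3 x
          clear a1 a2 a3 a4 a5 a6 hL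
          by_cases hxc : x = s.m2 (.arr κ') a' (s.m1 (.cnt κ') a' - 1)
          · subst hxc
            simp only [hx, if_false, if_true]
            refine fun _ => ⟨?_, trivial⟩
            by_contra hlt
            have : s.m2 (.pos κ') a' b = s.m1 (.cnt κ') a' := by omega
            rw [this] at hp2; exact hx hp2
          · simp only [hx, hxc, if_false]
            intro h0
            obtain ⟨h1, h2⟩ := e4 h0
            have h3 : s.m2 (.pos κ') a' x ≠ s.m1 (.cnt κ') a' := by
              intro h'; rw [h'] at h2; exact hxc h2.symm
            have h4 : s.m2 (.pos κ') a' x - 1 ≠ s.m2 (.pos κ') a' b - 1 := by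
              intro h'; rw [h', hp2] at h2; exact hx h2.symm
            simp only [h4, if_false]; exact ⟨by omega, h2⟩
        · have := a6 (s.m1 (.cnt κ') a' - 1) (by omega)
          clear hL
          grind
        · intro i hi
          have := a5 i (by omega)
          split_ifs <;> simp_all
        · intro i hi
          exact a6 i (by omega)
      · refine (hL κ' a').congr ?_ ?_ ?_ ?_ ?_ ?_ <;> simp [HS.st1, HS.st2, HS.set] <;> grind
    · simp [HS.Lst, HS.st1, HS.st2, HS.set]
      have := hl.arr_pos (s.m1 (.cnt κ) a - 1) (by omega)
      grind
    · simp [HS.st1, HS.st2, HS.set]; grind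

end DynCVD

namespace DynCVD

variable {B : ℕ} {p q : Stmt} {s : HS} {Q Q1 : HS → Prop} {T T1 T2 : ℕ}

/-! ### Relations between a solution vertex and a cluster -/

/-- Recompute all relations of the vertex `fx` with the cluster `fl`. -/
def fixL : Stmt :=
  .asg .fb 0 ;;
  forLt .fi (.ld1 (.cnt .sub) Reg.fl)
    (.asg .fp (.ld2 (.arr .sub) Reg.fl Reg.fi) ;;
      .ite (.and (.eq (.ld1 .ty Reg.fx) 0) (.eq (.ld2 .gm Reg.fx (.ld2 (.arr .sub) Reg.fp 0)) 1))
        (ins .nbr Reg.fp Reg.fx ;; .asg .fb 1)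
        (del .nbr Reg.fp Reg.fx)) ;;
  .ite (.eq Reg.fb 1)
    (ins .adj Reg.fx Reg.fl ;; ins .adj Reg.fl Reg.fx ;; ins .sub Reg.fx Reg.fl)
    (del .adj Reg.fx Reg.fl ;; del .adj Reg.fl Reg.fx ;; del .sub Reg.fx Reg.fl)

/-- Recompute the adjacency of the vertices `fx` and `fv`. -/
def fixX : Stmt :=
  .ite (.and (.eq (.ld1 .ty Reg.fx) 0) (.and (.eq (.ld1 .ty Reg.fv) 0)
      (.eq (.ld2 .gm Reg.fx Reg.fv) 1)))
    (ins .adj Reg.fx Reg.fv ;; ins .adj Reg.fv Reg.fx)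
    (del .adj Reg.fx Reg.fv ;; del .adj Reg.fv Reg.fx)

/-- The lists of children are the same, except possibly for the list of `x`. -/
def SameSub (x : ℕ) (s s' : HS) : Prop :=
  ∀ a, a ≠ x → s'.m1 (.cnt .sub) a = s.m1 (.cnt .sub) a ∧ s'.m2 (.arr .sub) a = s.m2 (.arr .sub) a

theorem fixX_spec {N : ℕ} (hB : Bd B s) (hN : 64 * (4 * N * N + N + 1) ≤ B) (hL : LW N s)
    (hx : s.reg .fx < N) (hv : s.reg .fv < N) :
    Run B fixX s (fun s' => LW N s' ∧ SameSub (s.reg .fx) s s' ∧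
      ∀ κ a b, s'.Lst κ a b ↔
        if κ = .adj ∧ (a = s.reg .fx ∧ b = s.reg .fv ∨ a = s.reg .fv ∧ b = s.reg .fx) then
          s.m1 .ty (s.reg .fx) = 0 ∧ s.m1 .ty (s.reg .fv) = 0 ∧ s.m2 .gm (s.reg .fx) (s.reg .fv) = 1
        else s.Lst κ a b) 0 := by
  have hF : ∀ {κ e e' s1}, Frame (ins κ e e') s s1 → s1.reg .fx = s.reg .fx ∧
      s1.reg .fv = s.reg .fv := fun h => ⟨h.reg _ rfl, h.reg _ rfl⟩
  have hF' : ∀ {κ e e' s1}, Frame (del κ e e') s s1 → s1.reg .fx = s.reg .fx ∧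
      s1.reg .fv = s.reg .fv := fun h => ⟨h.reg _ rfl, h.reg _ rfl⟩
  refine Run.ite (fun h => ?_) fun h => ?_ <;>
    simp only [Cond.holds, Expr.eval] at h
  · refine Run.bind hB (ins_spec hB hN hL rfl rfl hx hv) (T2 := 0) fun s1 hB1 hF1 ⟨hL1, hR1, hS1⟩ => ?_
    obtain ⟨e1, e2⟩ := hF hF1
    refine (ins_spec hB1 hN hL1 rfl rfl (by simpa [Expr.eval, e2] using hv)
      (by simpa [Expr.eval, e1, HS.set] using hx)).mono le_rfl ?_
    rintro s2 ⟨hL2, hR2, hS2⟩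
    refine ⟨hL2, fun a ha => ?_, fun κ a b => ?_⟩
    · obtain ⟨h1, h2⟩ := hS1 .sub a (by simp)
      obtain ⟨h3, h4⟩ := hS2 .sub a (by simp)
      exact ⟨h3.trans h1, h4.trans h2⟩
    · rw [hR2, hR1]
      simp only [Expr.eval, HS.set, e1, e2, reduceCtorEq, if_false]
      split_ifs <;> grind
  · refine Run.bind hB (del_spec hB hN hL rfl rfl hx hv) (T2 := 0) fun s1 hB1 hF1 ⟨hL1, hR1, hS1⟩ => ?_
    obtain ⟨e1, e2⟩ := hF' hF1
    refine (del_spec hB1 hN hL1 rfl rfl (by simpa [Expr.eval, e2] using hv)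
      (by simpa [Expr.eval, e1, HS.set] using hx)).mono le_rfl ?_
    rintro s2 ⟨hL2, hR2, hS2⟩
    refine ⟨hL2, fun a ha => ?_, fun κ a b => ?_⟩
    · obtain ⟨h1, h2⟩ := hS1 .sub a (by simp)
      obtain ⟨h3, h4⟩ := hS2 .sub a (by simp)
      exact ⟨h3.trans h1, h4.trans h2⟩
    · rw [hR2, hR1]
      simp only [Expr.eval, HS.set, e1, e2, reduceCtorEq, if_false]
      split_ifs <;> grind

/-- The vertex `x` is a solution vertex and adjacent to the representative of the class `p`. -/
def HS.Hits (s : HS) (x p : ℕ) : Prop := s.m1 .ty x = 0 ∧ s.m2 .gm x (s.m2 (.arr .sub) p 0) = 1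

-- The new relations are computed from the type of `x`, the adjacency matrix, the classes of `l` and
-- their first members. Nothing is assumed about the old relations of `x` with `l`, so they may be
-- arbitrarily wrong before the call; this is what makes a repair by recomputation possible.
open Classical in
theorem fixL_spec {N x l : ℕ} (hB : Bd B s) (hN : 64 * (4 * N * N + N + 1) ≤ B) (hL : LW N s)
    (hx : s.reg .fx = x) (hl : s.reg .fl = l) (hxN : x < N) (hlN : l < N) (hxl : x ≠ l) :
    Run B fixL s (fun s' => LW N s' ∧ SameSub x s s' ∧
      ∀ κ a b, s'.Lst κ a b ↔
        if κ = .nbr ∧ b = x ∧ s.Lst .sub l a then s.Hits x a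
        else if (κ = .adj ∧ (a = x ∧ b = l ∨ a = l ∧ b = x)) ∨ (κ = .sub ∧ a = x ∧ b = l) then
          ∃ p, s.Lst .sub l p ∧ s.Hits x p
        else s.Lst κ a b) (s.m1 (.cnt .sub) l) := by
  have hNB : N < B := by nlinarith
  have hll := hL .sub l
  -- `E j` describes the classes treated in the first `j` rounds, and `F j` says that one of them is
  -- hit. Both are kept opaque for the case distinctions that follow.
  obtain ⟨E, hE⟩ : ∃ E : ℕ → ℕ → Prop, ∀ j a, E j a ↔ ∃ i < j, s.m2 (.arr .sub) l i = a :=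
    ⟨_, fun _ _ => Iff.rfl⟩
  obtain ⟨F, hF⟩ : ∃ F : ℕ → Prop, ∀ j, F j ↔ ∃ i < j, s.Hits x (s.m2 (.arr .sub) l i) :=
    ⟨_, fun _ => Iff.rfl⟩
  have hE0 : ∀ a, ¬ E 0 a := fun a => by simp [hE]
  have hF0 : ¬ F 0 := by simp [hF]
  refine Run.asg' 0 rfl (by omega) ?_
  have hB0 : Bd B (s.set .fb 0) := (HExec.asg s .fb 0 (by simp only [Expr.eval]; omega)).bd hB
  refine (Run.bind (T1 := s.m1 (.cnt .sub) l * (0 + 1)) (T2 := 0) hB0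
    (Run.forLt (N := s.m1 (.cnt .sub) l) (I := fun j s' => LW N s' ∧
      (∀ a, s'.m1 (.cnt .sub) a = s.m1 (.cnt .sub) a ∧ s'.m2 (.arr .sub) a = s.m2 (.arr .sub) a) ∧
      (s'.reg .fb = if F j then 1 else 0) ∧
      ∀ κ a b, s'.Lst κ a b ↔ if κ = .nbr ∧ b = x ∧ E j a then
        s.Hits x a else s.Lst κ a b) hB0 (by have := hll.cnt_le; omega) rfl ?_ ?_ ?_) ?_).mono
          (by omega) (fun _ h => h)
  · refine ⟨fun κ a => (hL κ a).congr rfl rfl rfl rfl rfl rfl, fun a => ⟨rfl, rfl⟩,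
      by simp [HS.set, hF0], fun κ a b => ?_⟩
    simp [HS.Lst, HS.set, hE0]
  · rintro j s' hF ⟨h1, h2, h3, h4⟩
    have e1 : s'.reg .fl = l := (hF.reg .fl rfl).trans hl
    simp [Expr.eval, e1, (h2 l).1]
  · rintro j s' hj hB' hfi hFr ⟨hL', hS', hfb, hR'⟩
    have e1 : s'.reg .fl = l := (hFr.reg .fl rfl).trans hl
    have e2 : s'.reg .fx = x := (hFr.reg .fx rfl).trans hx
    have e3 : s'.m1 .ty = s.m1 .ty := hFr.m1 .ty rfl
    have e4 : s'.m2 .gm = s.m2 .gm := hFr.m2 .gm rfl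
    have hpN := hll.arr_lt j hj
    refine Run.asg' (s.m2 (.arr .sub) l j) (by simp [Expr.eval, e1, hfi, (hS' l).2])
      (by omega) ?_
    set pj := s.m2 (.arr .sub) l j with hpj
    have hB'' : Bd B (s'.set .fp pj) := by
      refine ⟨fun r => ?_, hB'.m1, hB'.m2⟩
      simp only [HS.set]; split_ifs; exacts [by omega, hB'.reg r]
    have hL'' : LW N (s'.set .fp pj) := fun κ a => (hL' κ a).congr rfl rfl rfl rfl rfl rfl
    have hiff : F (j + 1) ↔ F j ∨ s.Hits x pj := by
      rw [hpj, hF, hF]; constructor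
      · rintro ⟨i, hi, h⟩
        rcases Nat.lt_succ_iff_lt_or_eq.1 hi with h' | rfl
        exacts [Or.inl ⟨i, h', h⟩, Or.inr h]
      · rintro (⟨i, hi, h⟩ | h)
        exacts [⟨i, by omega, h⟩, ⟨j, by omega, h⟩]
    have hiff' : ∀ a, E (j + 1) a ↔ E j a ∨ pj = a := by
      intro a; rw [hpj, hE, hE]; constructor
      · rintro ⟨i, hi, h⟩
        rcases Nat.lt_succ_iff_lt_or_eq.1 hi with h' | rfl
        exacts [Or.inl ⟨i, h', h⟩, Or.inr h]
      · rintro (⟨i, hi, h⟩ | h)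
        exacts [⟨i, by omega, h⟩, ⟨j, by omega, h⟩]
    refine Run.ite (fun h => ?_) fun h => ?_ <;>
      simp only [Cond.holds, Expr.eval, HS.set, reduceCtorEq, if_false, if_true, e2, e3, e4, (hS' pj).2] at h
    · refine Run.bind hB'' (T1 := 0) (T2 := 0) (ins_spec (a := pj) (b := x) hB'' hN hL''
        (by simp [Expr.eval, HS.set]) (by simp [Expr.eval, HS.set, e2]) (by omega) hxN) ?_
      rintro s2 hB2 hF2 ⟨hL2, hR2, hS2⟩
      refine Run.asg 1 rfl (by omega) ⟨fun κ a => (hL2 κ a).congr rfl rfl rfl rfl rfl rfl, ?_, ?_, ?_⟩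
      · intro a
        obtain ⟨h1, h2⟩ := hS2 .sub a (by simp)
        exact ⟨h1.trans (hS' a).1, h2.trans (hS' a).2⟩
      · have : s.Hits x pj := h
        simp [HS.set, hiff, this]
      · intro κ a b
        have h2 := hR2 κ a b
        have h3 := hR' κ a b
        change s2.Lst κ a b ↔ _
        change s2.Lst κ a b ↔ s'.Lst κ a b ∨ _ at h2
        have : s.Hits x pj := h
        rw [h2, h3, hiff' a]
        split_ifs <;> grind
    · refine (del_spec (a := pj) (b := x) hB'' hN hL'' (by simp [Expr.eval, HS.set])
        (by simp [Expr.eval, HS.set, e2]) (by omega) hxN).full hB'' |>.mono le_rfl ?_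
      rintro s2 ⟨hB2, hF2, hL2, hR2, hS2⟩
      have hnot : ¬ s.Hits x pj := h
      refine ⟨fun κ a => (hL2 κ a).congr rfl rfl rfl rfl rfl rfl, ?_, ?_, ?_⟩
      · intro a
        obtain ⟨h1, h2⟩ := hS2 .sub a (by simp)
        exact ⟨h1.trans (hS' a).1, h2.trans (hS' a).2⟩
      · have e5 : s2.reg .fb = s'.reg .fb := (hF2.reg .fb rfl).trans (by simp [HS.set])
        simp [HS.set, hiff, hnot, e5, hfb]
      · intro κ a b
        have h2 := hR2 κ a b
        have h3 := hR' κ a b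
        change s2.Lst κ a b ↔ _
        change s2.Lst κ a b ↔ s'.Lst κ a b ∧ _ at h2
        rw [h2, h3, hiff' a]
        split_ifs <;> grind
  · rintro s1 hB1 hF1 ⟨hL1, hS1, hfb, hR1⟩
    have e1 : s1.reg .fl = l := (hF1.reg .fl rfl).trans hl
    have e2 : s1.reg .fx = x := (hF1.reg .fx rfl).trans hx
    have hch : ∀ a, E (s.m1 (.cnt .sub) l) a ↔ s.Lst .sub l a := by
      intro a; rw [hE]
      exact ⟨fun ⟨i, hi, h⟩ => h ▸ hll.arr_mem hi, fun h => hll.exists_arr h⟩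
    have hex : F (s.m1 (.cnt .sub) l) ↔ ∃ p, s.Lst .sub l p ∧ s.Hits x p := by
      rw [hF]; constructor
      · rintro ⟨i, hi, h⟩; exact ⟨_, hll.arr_mem hi, h⟩
      · rintro ⟨p, hp, h⟩
        obtain ⟨i, hi, rfl⟩ := hll.exists_arr hp
        exact ⟨i, hi, h⟩
    simp only [hch] at hR1
    simp only [hex] at hfb
    refine Run.ite (fun h => ?_) fun h => ?_ <;>
      simp only [Cond.holds, Expr.eval, hfb] at h
    · have hP : ∃ p, s.Lst .sub l p ∧ s.Hits x p := by
        by_contra hP; simp [hP] at h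
      refine Run.bind (T1 := 0) (T2 := 0) hB1 (ins_spec (a := x) (b := l) hB1 hN hL1
        (by simp [Expr.eval, e2]) (by simp [Expr.eval, HS.set, e1]) hxN hlN) ?_
      rintro s2 hB2 hF2 ⟨hL2, hR2, hS2⟩
      have f1 : s2.reg .fl = l := (hF2.reg .fl rfl).trans e1
      have f2 : s2.reg .fx = x := (hF2.reg .fx rfl).trans e2
      refine Run.bind (T1 := 0) (T2 := 0) hB2 (ins_spec (a := l) (b := x) hB2 hN hL2
        (by simp [Expr.eval, f1]) (by simp [Expr.eval, HS.set, f2]) hlN hxN) ?_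
      rintro s3 hB3 hF3 ⟨hL3, hR3, hS3⟩
      have g1 : s3.reg .fl = l := (hF3.reg .fl rfl).trans f1
      have g2 : s3.reg .fx = x := (hF3.reg .fx rfl).trans f2
      refine (ins_spec (a := x) (b := l) hB3 hN hL3
        (by simp [Expr.eval, g2]) (by simp [Expr.eval, HS.set, g1]) hxN hlN).mono le_rfl ?_
      rintro s4 ⟨hL4, hR4, hS4⟩
      refine ⟨hL4, fun a ha => ?_, fun κ a b => ?_⟩
      · obtain ⟨h1, h2⟩ := hS2 .sub a (by simp)
        obtain ⟨h3, h4⟩ := hS3 .sub a (by simp)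
        obtain ⟨h5, h6⟩ := hS4 .sub a (by simp [ha])
        exact ⟨h5.trans (h3.trans (h1.trans (hS1 a).1)), h6.trans (h4.trans (h2.trans (hS1 a).2))⟩
      · rw [hR4, hR3, hR2, hR1]
        generalize (∃ p, s.Lst .sub l p ∧ s.Hits x p) = P at hP
        cases κ <;> simp [hP] <;> grind
    · have hP : ¬ ∃ p, s.Lst .sub l p ∧ s.Hits x p := by
        intro hP; simp [hP] at h
      refine Run.bind (T1 := 0) (T2 := 0) hB1 (del_spec (a := x) (b := l) hB1 hN hL1
        (by simp [Expr.eval, e2]) (by simp [Expr.eval, HS.set, e1]) hxN hlN) ?_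
      rintro s2 hB2 hF2 ⟨hL2, hR2, hS2⟩
      have f1 : s2.reg .fl = l := (hF2.reg .fl rfl).trans e1
      have f2 : s2.reg .fx = x := (hF2.reg .fx rfl).trans e2
      refine Run.bind (T1 := 0) (T2 := 0) hB2 (del_spec (a := l) (b := x) hB2 hN hL2
        (by simp [Expr.eval, f1]) (by simp [Expr.eval, HS.set, f2]) hlN hxN) ?_
      rintro s3 hB3 hF3 ⟨hL3, hR3, hS3⟩
      have g1 : s3.reg .fl = l := (hF3.reg .fl rfl).trans f1
      have g2 : s3.reg .fx = x := (hF3.reg .fx rfl).trans f2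
      refine (del_spec (a := x) (b := l) hB3 hN hL3
        (by simp [Expr.eval, g2]) (by simp [Expr.eval, HS.set, g1]) hxN hlN).mono le_rfl ?_
      rintro s4 ⟨hL4, hR4, hS4⟩
      refine ⟨hL4, fun a ha => ?_, fun κ a b => ?_⟩
      · obtain ⟨h1, h2⟩ := hS2 .sub a (by simp)
        obtain ⟨h3, h4⟩ := hS3 .sub a (by simp)
        obtain ⟨h5, h6⟩ := hS4 .sub a (by simp [ha])
        exact ⟨h5.trans (h3.trans (h1.trans (hS1 a).1)), h6.trans (h4.trans (h2.trans (hS1 a).2))⟩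
      · rw [hR4, hR3, hR2, hR1]
        generalize (∃ p, s.Lst .sub l p ∧ s.Hits x p) = P at hP
        cases κ <;> simp [hP] <;> grind

end DynCVD

namespace DynCVD

/-! ### The auxiliary graph in terms of identifiers

Vertices are the numbers below `n`, cluster labels the numbers from `n` to `2 * n` and class labels
the numbers from `2 * n` to `3 * n`. -/

/-- No induced path on three vertices avoids `X`. -/
def P3Free {V : Type*} (G : SimpleGraph V) (X : Finset V) : Prop :=
  ∀ a b c, a ∉ X → b ∉ X → c ∉ X → G.Adj a b → G.Adj b c → a ≠ c → G.Adj a c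

/-- Labels are recorded only through the functions `cls` and `clu`; a label is in use when some
vertex outside the solution is sent to it. Since there are at most `n` such vertices, `n` labels of
each sort suffice. -/
structure Conf where
  n : ℕ
  G : SimpleGraph ℕ
  X : Finset ℕ
  /-- the class of a vertex outside the solution -/
  cls : ℕ → ℕ
  /-- the cluster of a class -/
  clu : ℕ → ℕ

namespace Conf

variable (C : Conf)

def Out (v : ℕ) : Prop := v < C.n ∧ v ∉ C.X

/-- Two vertices outside `X` share a cluster label exactly if they are equal or adjacent. Equality
of labels is transitive, so `clu_iff` already forces `X` to be a deletion set. By `cls_iff` the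
class labels separate exactly the pairs (cluster, neighbourhood in `X`). -/
structure OK : Prop where
  X_lt : ∀ x ∈ C.X, x < C.n
  adj_lt : ∀ u v, C.G.Adj u v → u < C.n
  cls_rng : ∀ v, C.Out v → 2 * C.n ≤ C.cls v ∧ C.cls v < 3 * C.n
  clu_rng : ∀ v, C.Out v → C.n ≤ C.clu (C.cls v) ∧ C.clu (C.cls v) < 2 * C.n
  clu_iff : ∀ v w, C.Out v → C.Out w → (C.clu (C.cls v) = C.clu (C.cls w) ↔ v = w ∨ C.G.Adj v w)
  cls_iff : ∀ v w, C.Out v → C.Out w → (C.cls v = C.cls w ↔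
    C.clu (C.cls v) = C.clu (C.cls w) ∧ ∀ x ∈ C.X, C.G.Adj x v ↔ C.G.Adj x w)

/-- `b` is a child of `a`: a cluster adjacent to a solution vertex, a class of a cluster, or a member
of a class. -/
def Ch (a b : ℕ) : Prop :=
  (a ∈ C.X ∧ ∃ v, C.Out v ∧ C.clu (C.cls v) = b ∧ C.G.Adj a v) ∨
    (∃ v, C.Out v ∧ C.cls v = b ∧ C.clu b = a) ∨ (C.Out b ∧ C.cls b = a)

/-- The relations that have to be stored. -/
def Spec : Kd → ℕ → ℕ → Prop
  | .adj, a, b => (a ∈ C.X ∧ b ∈ C.X ∧ C.G.Adj a b) ∨ C.Ch a b ∨ C.Ch b a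
  | .nbr, p, x => x ∈ C.X ∧ ∃ v, C.Out v ∧ C.cls v = p ∧ C.G.Adj x v
  | .sub, a, b => C.Ch a b

/-- The relations of `x` with the cluster `l` and the vertex `v`. -/
def Touched (l v x : ℕ) : Kd → ℕ → ℕ → Prop
  | .adj, a, b => (a = x ∧ b = l) ∨ (a = l ∧ b = x) ∨ (a = x ∧ b = v) ∨ (a = v ∧ b = x)
  | .nbr, p, b => b = x ∧ C.Ch l p
  | .sub, a, b => a = x ∧ b = l

variable {C}

theorem OK.ch_vertex (h : C.OK) {x b : ℕ} (hx : x < C.n) :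
    C.Ch x b ↔ x ∈ C.X ∧ ∃ v, C.Out v ∧ C.clu (C.cls v) = b ∧ C.G.Adj x v := by
  constructor
  · rintro (h' | ⟨v, hv, rfl, h'⟩ | ⟨hb, h'⟩)
    · exact h'
    · have := h.clu_rng v hv; omega
    · have := h.cls_rng b hb; omega
  · exact Or.inl

theorem OK.ch_cluster (h : C.OK) {l b : ℕ} (hl : C.n ≤ l) (hl' : l < 2 * C.n) :
    C.Ch l b ↔ ∃ v, C.Out v ∧ C.cls v = b ∧ C.clu b = l := by
  constructor
  · rintro (h' | h' | ⟨hb, h'⟩)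
    · have := h.X_lt _ h'.1; omega
    · exact h'
    · have := h.cls_rng b hb; omega
  · exact fun h => Or.inr (Or.inl h)

theorem OK.ch_class (h : C.OK) {p b : ℕ} (hp : 2 * C.n ≤ p) :
    C.Ch p b ↔ C.Out b ∧ C.cls b = p := by
  constructor
  · rintro (h' | ⟨v, hv, rfl, h'⟩ | h')
    · have := h.X_lt _ h'.1; omega
    · have := h.clu_rng v hv; omega
    · exact h'
  · exact fun h => Or.inr (Or.inr h)

theorem OK.ch_rng (h : C.OK) {a b : ℕ} (hab : C.Ch a b) :
    (a < C.n ∧ C.n ≤ b ∧ b < 2 * C.n) ∨ (C.n ≤ a ∧ a < 2 * C.n ∧ 2 * C.n ≤ b ∧ b < 3 * C.n) ∨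
      (2 * C.n ≤ a ∧ a < 3 * C.n ∧ b < C.n) := by
  rcases hab with ⟨h1, v, hv, rfl, h2⟩ | ⟨v, hv, rfl, rfl⟩ | ⟨hb, rfl⟩
  · exact Or.inl ⟨h.X_lt _ h1, h.clu_rng v hv⟩
  · exact Or.inr (Or.inl ⟨(h.clu_rng v hv).1, (h.clu_rng v hv).2, h.cls_rng v hv⟩)
  · exact Or.inr (Or.inr ⟨(h.cls_rng b hb).1, (h.cls_rng b hb).2, hb.1⟩)

theorem OK.p3Free (h : C.OK) : P3Free C.G C.X := by
  intro a b c ha hb hc hab hbc hac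
  have h1 : C.Out a := ⟨h.adj_lt _ _ hab, ha⟩
  have h2 : C.Out b := ⟨h.adj_lt _ _ hbc, hb⟩
  have h3 : C.Out c := ⟨h.adj_lt _ _ hbc.symm, hc⟩
  have e1 := (h.clu_iff a b h1 h2).2 (Or.inr hab)
  have e2 := (h.clu_iff b c h2 h3).2 (Or.inr hbc)
  exact ((h.clu_iff a c h1 h3).1 (e1.trans e2)).resolve_left hac

/-- A cluster has at most `2 ^ |X|` classes. -/
theorem OK.card_classes (h : C.OK) {l : ℕ} (hl : C.n ≤ l) (hl' : l < 2 * C.n) (P : Finset ℕ)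
    (hP : ∀ p ∈ P, C.Ch l p) : P.card ≤ 2 ^ C.X.card := by
  classical
  rw [← Finset.card_powerset]
  -- A class is sent to the set `S` of its neighbours in the solution, which determines it within
  -- its cluster.
  refine Finset.card_le_card_of_injOn
    (fun p => C.X.filter fun x => ∃ v, C.Out v ∧ C.cls v = p ∧ C.G.Adj x v)
    (fun p _ => Finset.mem_coe.2 (Finset.mem_powerset.2 (Finset.filter_subset _ _))) ?_
  intro p hp q hq hpq
  obtain ⟨v, hv, rfl, hvl⟩ := (h.ch_cluster hl hl').1 (hP p hp)
  obtain ⟨w, hw, rfl, hwl⟩ := (h.ch_cluster hl hl').1 (hP q hq)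
  have key : ∀ u, C.Out u → ∀ x ∈ C.X, (∃ u', C.Out u' ∧ C.cls u' = C.cls u ∧ C.G.Adj x u') ↔
      C.G.Adj x u := by
    intro u hu x hx
    constructor
    · rintro ⟨u', hu', e, ha⟩
      exact (((h.cls_iff u' u hu' hu).1 e).2 x hx).1 ha
    · exact fun ha => ⟨u, hu, rfl, ha⟩
  refine (h.cls_iff v w hv hw).2 ⟨hvl.trans hwl.symm, fun x hx => ?_⟩
  have := congrArg (fun S => x ∈ S) hpq
  simpa [hx, key v hv x hx, key w hw x hx] using this

/-! ### A vertex enters the solution -/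

/-- The vertex `v` enters the solution. -/
def add (C : Conf) (v : ℕ) : Conf := { C with X := insert v C.X }

theorem out_add {v w : ℕ} : (C.add v).Out w ↔ C.Out w ∧ w ≠ v := by
  simp [Out, add]; tauto

/-- As a new solution vertex, `v` is adjacent to all remaining vertices of its cluster and to no
vertex of another cluster. It therefore distinguishes no two vertices with the same cluster label,
and all labels can stay. -/
theorem OK.add (h : C.OK) {v : ℕ} (hv : C.Out v) : (C.add v).OK := by
  have ho : ∀ w, (C.add v).Out w → C.Out w := fun w hw => (out_add.1 hw).1
  refine ⟨fun x hx => ?_, h.adj_lt, fun w hw => h.cls_rng w (ho w hw),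
    fun w hw => h.clu_rng w (ho w hw), fun w u hw hu => h.clu_iff w u (ho w hw) (ho u hu),
    fun w u hw hu => ?_⟩
  · rcases Finset.mem_insert.1 hx with rfl | hx
    exacts [hv.1, h.X_lt x hx]
  · change C.cls w = C.cls u ↔ C.clu (C.cls w) = C.clu (C.cls u) ∧
      ∀ x ∈ insert v C.X, C.G.Adj x w ↔ C.G.Adj x u
    rw [h.cls_iff w u (ho w hw) (ho u hu), Finset.forall_mem_insert]
    have h1 := h.clu_iff v w hv (ho w hw)
    have h2 := h.clu_iff v u hv (ho u hu)
    have h3 := (out_add.1 hw).2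
    have h4 := (out_add.1 hu).2
    constructor
    · rintro ⟨e, hx⟩
      refine ⟨e, ?_, hx⟩
      rw [e] at h1
      rw [h1] at h2
      constructor
      · intro ha; exact (h2.1 (Or.inr ha)).resolve_left (Ne.symm h4)
      · intro ha; exact (h2.2 (Or.inr ha)).resolve_left (Ne.symm h3)
    · rintro ⟨e, -, hx⟩
      exact ⟨e, hx⟩

/-- Apart from links between solution vertices and the cluster of `v`, the hierarchy only loses `v`
as a member of its class, and that class as a child of its cluster if `v` was its last member. -/
theorem OK.ch_add (h : C.OK) {v : ℕ} (hv : C.Out v) {a b : ℕ}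
    (ht : ¬ (a ∈ (C.add v).X ∧ b = C.clu (C.cls v))) :
    (C.add v).Ch a b ↔ C.Ch a b ∧ ¬ (a = C.cls v ∧ b = v) ∧
      ((¬ ∃ w, (C.add v).Out w ∧ C.cls w = C.cls v) → ¬ (a = C.clu (C.cls v) ∧ b = C.cls v)) := by
  have hcv := h.cls_rng v hv
  have hlv := h.clu_rng v hv
  have hX : ∀ x, x ∈ (C.add v).X ↔ x = v ∨ x ∈ C.X := fun x => by simp [Conf.add]
  constructor
  · rintro (⟨ha, w, hw, rfl, hw'⟩ | ⟨w, hw, rfl, rfl⟩ | ⟨hb, rfl⟩)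
    · have hw0 := (out_add.1 hw).1
      have hne : C.clu (C.cls w) ≠ C.clu (C.cls v) := fun e => ht ⟨ha, e⟩
      have hav : a ≠ v := by
        rintro rfl
        exact hne ((h.clu_iff w a hw0 hv).2 (Or.inr hw'.symm))
      have haX := ((hX a).1 ha).resolve_left hav
      have := h.X_lt a haX
      exact ⟨Or.inl ⟨haX, w, hw0, rfl, hw'⟩, by omega, fun _ => by omega⟩
    · have hw0 := (out_add.1 hw).1
      have := h.cls_rng w hw0
      refine ⟨Or.inr (Or.inl ⟨w, hw0, rfl, rfl⟩), fun h' => ?_, fun hn h' => hn ⟨w, hw, h'.2⟩⟩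
      have := hv.1
      have h1 : C.cls w = v := h'.2
      omega
    · have hb0 := out_add.1 hb
      refine ⟨Or.inr (Or.inr ⟨hb0.1, rfl⟩), fun h' => hb0.2 h'.2, fun _ h' => ?_⟩
      have := hb0.1.1
      have h1 : b = C.cls v := h'.2
      omega
  · rintro ⟨(⟨ha, w, hw, rfl, hw'⟩ | ⟨w, hw, rfl, rfl⟩ | ⟨hb, rfl⟩), h1, h2⟩
    · refine Or.inl ⟨(hX a).2 (Or.inr ha), w, out_add.2 ⟨hw, ?_⟩, rfl, hw'⟩
      rintro rfl
      exact ht ⟨(hX a).2 (Or.inr ha), rfl⟩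
    · by_cases hwv : C.cls w = C.cls v
      · by_cases hex : ∃ w, (C.add v).Out w ∧ C.cls w = C.cls v
        · obtain ⟨u, hu, e⟩ := hex
          exact Or.inr (Or.inl ⟨u, hu, by rw [hwv]; exact e, rfl⟩)
        · exact absurd ⟨by rw [hwv], hwv⟩ (h2 hex)
      · exact Or.inr (Or.inl ⟨w, out_add.2 ⟨hw, fun e => hwv (by rw [e])⟩, rfl, rfl⟩)
    · refine Or.inr (Or.inr ⟨out_add.2 ⟨hb, ?_⟩, rfl⟩)
      rintro rfl
      exact h1 ⟨rfl, rfl⟩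

/-- The relations that vanish with the vertex `v` and, if `q` holds, with the class `p` of the
cluster `l`. -/
def Gone (l p v : ℕ) (q : Prop) : Kd → ℕ → ℕ → Prop
  | .adj, a, b => (a = v ∧ b = p) ∨ (a = p ∧ b = v) ∨ (q ∧ ((a = p ∧ b = l) ∨ (a = l ∧ b = p)))
  | .nbr, a, _ => q ∧ a = p
  | .sub, a, b => (a = p ∧ b = v) ∨ (q ∧ a = l ∧ b = p)

/-- The change is split into deletions known in advance (`Gone`) and relations touched by some
vertex of `A`. The latter are not analysed, since they will be recomputed. -/
theorem OK.spec_add (h : C.OK) {v : ℕ} (hv : C.Out v) {A : Finset ℕ} (hA : (C.add v).X ⊆ A)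
    {κ : Kd} {a b : ℕ}
    (ht : ¬ ∃ x ∈ A, (C.add v).Touched (C.clu (C.cls v)) v x κ a b) :
    (C.add v).Spec κ a b ↔ C.Spec κ a b ∧ ¬ Gone (C.clu (C.cls v)) (C.cls v) v
      (¬ ∃ w, (C.add v).Out w ∧ C.cls w = C.cls v) κ a b := by
  have hcv := h.cls_rng v hv
  have hlv := h.clu_rng v hv
  have hX : ∀ x, x ∈ (C.add v).X ↔ x = v ∨ x ∈ C.X := fun x => by simp [Conf.add]
  have hvn := hv.1
  cases κ with
  | sub =>
    change (C.add v).Ch a b ↔ C.Ch a b ∧ _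
    rw [h.ch_add hv (fun h' => ht ⟨a, hA h'.1, rfl, h'.2⟩)]
    simp only [Gone]; tauto
  | adj =>
    have h1 := h.ch_add hv (a := a) (b := b) (fun h' => ht ⟨a, hA h'.1, Or.inl ⟨rfl, h'.2⟩⟩)
    have h2 := h.ch_add hv (a := b) (b := a)
      (fun h' => ht ⟨b, hA h'.1, Or.inr (Or.inl ⟨h'.2, rfl⟩)⟩)
    have h3 : (a ∈ (C.add v).X ∧ b ∈ (C.add v).X ∧ C.G.Adj a b) ↔
        (a ∈ C.X ∧ b ∈ C.X ∧ C.G.Adj a b) := by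
      constructor
      · rintro ⟨ha, hb, hab⟩
        refine ⟨((hX a).1 ha).resolve_left fun e => ?_, ((hX b).1 hb).resolve_left fun e => ?_, hab⟩
        · exact ht ⟨b, hA hb, Or.inr (Or.inr (Or.inr ⟨e, rfl⟩))⟩
        · exact ht ⟨a, hA ha, Or.inr (Or.inr (Or.inl ⟨rfl, e⟩))⟩
      · rintro ⟨ha, hb, hab⟩
        exact ⟨(hX a).2 (Or.inr ha), (hX b).2 (Or.inr hb), hab⟩
    have h4 : ∀ {a b}, C.Ch a b → (a < C.n ∧ C.n ≤ b ∧ b < 2 * C.n) ∨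
      (C.n ≤ a ∧ a < 2 * C.n ∧ 2 * C.n ≤ b ∧ b < 3 * C.n) ∨
      (2 * C.n ≤ a ∧ a < 3 * C.n ∧ b < C.n) := fun h' => h.ch_rng h'
    change (a ∈ (C.add v).X ∧ b ∈ (C.add v).X ∧ C.G.Adj a b) ∨ _ ∨ _ ↔ (_ ∨ _ ∨ _) ∧ _
    rw [h1, h2, h3]
    simp only [Gone]
    have h5 : a ∈ C.X → a < C.n := h.X_lt a
    have h6 : b ∈ C.X → b < C.n := h.X_lt b
    have h7 := @h4 a b
    have h8 := @h4 b a
    constructor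
    · rintro (⟨ha, hb, hab⟩ | ⟨hc, h9, h10⟩ | ⟨hc, h9, h10⟩)
      · refine ⟨Or.inl ⟨ha, hb, hab⟩, ?_⟩
        have := h5 ha; have := h6 hb; omega
      · refine ⟨Or.inr (Or.inl hc), ?_⟩
        have := h7 hc
        rintro (h' | h' | ⟨hq, h' | h'⟩)
        · omega
        · exact h9 h'
        · omega
        · exact h10 hq h'
      · refine ⟨Or.inr (Or.inr hc), ?_⟩
        have := h8 hc
        rintro (h' | h' | ⟨hq, h' | h'⟩)
        · exact h9 h'.symm
        · omega
        · exact h10 hq h'.symm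
        · omega
    · rintro ⟨(hx | hc | hc), hg⟩
      · exact Or.inl hx
      · exact Or.inr (Or.inl ⟨hc, fun h' => hg (Or.inr (Or.inl h')),
          fun hq h' => hg (Or.inr (Or.inr ⟨hq, Or.inr h'⟩))⟩)
      · exact Or.inr (Or.inr ⟨hc, fun h' => hg (Or.inl h'.symm),
          fun hq h' => hg (Or.inr (Or.inr ⟨hq, Or.inl h'.symm⟩))⟩)
  | nbr =>
    change (b ∈ (C.add v).X ∧ ∃ w, (C.add v).Out w ∧ C.cls w = a ∧ C.G.Adj b w) ↔
      (b ∈ C.X ∧ ∃ w, C.Out w ∧ C.cls w = a ∧ C.G.Adj b w) ∧ ¬ (_ ∧ a = C.cls v)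
    have hcl : ∀ w, (C.add v).Out w → C.cls w = a → b ∈ (C.add v).X →
        C.clu a ≠ C.clu (C.cls v) := by
      intro w hw e hb e'
      refine ht ⟨b, hA hb, rfl, ?_⟩
      exact ((h.add hv).ch_cluster hlv.1 hlv.2).2 ⟨w, hw, e, e'⟩
    constructor
    · rintro ⟨hb, w, hw, e, hbw⟩
      have hne := hcl w hw e hb
      have hbv : b ≠ v := by
        rintro rfl
        rw [← e] at hne
        exact hne ((h.clu_iff w b (out_add.1 hw).1 hv).2 (Or.inr hbw.symm))
      exact ⟨⟨((hX b).1 hb).resolve_left hbv, w, (out_add.1 hw).1, e, hbw⟩,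
        fun h' => hne (by rw [h'.2])⟩
    · rintro ⟨⟨hb, w, hw, e, hbw⟩, hg⟩
      refine ⟨(hX b).2 (Or.inr hb), ?_⟩
      by_cases hwv : w = v
      · subst hwv
        by_cases hex : ∃ u, (C.add w).Out u ∧ C.cls u = C.cls w
        · obtain ⟨u, hu, e'⟩ := hex
          exact absurd (by rw [← e]) (hcl u hu (e'.trans e) ((hX b).2 (Or.inr hb)))
        · exact absurd ⟨hex, e.symm⟩ hg
      · exact ⟨w, out_add.2 ⟨hw, hwv⟩, e, hbw⟩

/-! ### A vertex leaves the solution -/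

/-- The vertex `x` leaves the solution and joins the class `p` of the cluster `l`. -/
def remove (C : Conf) (x p l : ℕ) : Conf :=
  { C with X := C.X.erase x, cls := Function.update C.cls x p, clu := Function.update C.clu p l }

/-- The right cluster and class for a vertex `x` that leaves the solution. -/
structure Fit (C : Conf) (x p l : ℕ) : Prop where
  mem : x ∈ C.X
  free : P3Free C.G (C.X.erase x)
  cluster : C.Ch x l ∨ (C.n ≤ l ∧ l < 2 * C.n ∧ (∀ w, C.Out w → C.clu (C.cls w) ≠ l) ∧
    ∀ w, C.Out w → ¬ C.G.Adj x w)
  cls : (C.Ch l p ∧ ∀ w, C.Out w → C.cls w = p → ∀ y ∈ C.X.erase x, C.G.Adj y x ↔ C.G.Adj y w) ∨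
    (2 * C.n ≤ p ∧ p < 3 * C.n ∧ (∀ w, C.Out w → C.cls w ≠ p) ∧
      ∀ w, C.Out w → C.clu (C.cls w) = l → ¬ ∀ y ∈ C.X.erase x, C.G.Adj y x ↔ C.G.Adj y w)

variable {x p l : ℕ}

theorem OK.out_remove (h : C.OK) (hx : x ∈ C.X) {w : ℕ} :
    (C.remove x p l).Out w ↔ C.Out w ∨ w = x := by
  have := h.X_lt x hx
  simp only [Out, remove, Finset.mem_erase]
  by_cases hwx : w = x
  · subst hwx; simp [this]
  · simp [hwx]

theorem Fit.ne (h : Fit C x p l) {w : ℕ} (hw : C.Out w) : w ≠ x := by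
  rintro rfl; exact hw.2 h.mem

theorem Fit.l_rng (h : Fit C x p l) (hC : C.OK) : C.n ≤ l ∧ l < 2 * C.n := by
  rcases h.cluster with h' | h'
  · have := hC.ch_rng h'; have := hC.X_lt x h.mem; omega
  · exact ⟨h'.1, h'.2.1⟩

theorem Fit.p_rng (h : Fit C x p l) (hC : C.OK) : 2 * C.n ≤ p ∧ p < 3 * C.n := by
  rcases h.cls with h' | h'
  · have := hC.ch_rng h'.1; have := h.l_rng hC; omega
  · exact ⟨h'.1, h'.2.1⟩

/-- As `X ∖ {x}` is a deletion set, the neighbours of `x` outside `X` form a whole cluster or the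
empty set: otherwise two neighbours in different clusters, or a neighbour and a non-neighbour in one
cluster, would give an induced path through `x`. The label `l` is that cluster, or unused. -/
theorem Fit.clu_iff (h : Fit C x p l) (hC : C.OK) {w : ℕ} (hw : C.Out w) :
    C.clu (C.cls w) = l ↔ C.G.Adj x w := by
  have hxn := hC.X_lt x h.mem
  rcases h.cluster with h' | h'
  · obtain ⟨-, u, hu, rfl, hxu⟩ := (hC.ch_vertex hxn).1 h'
    have hm : ∀ {u}, C.Out u → u ∉ C.X.erase x := fun hu h => hu.2 (Finset.mem_of_mem_erase h)
    have hxx : x ∉ C.X.erase x := Finset.notMem_erase _ _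
    rw [hC.clu_iff w u hw hu]
    constructor
    · rintro (rfl | hwu)
      · exact hxu
      · exact h.free x u w hxx (hm hu) (hm hw) hxu hwu.symm (h.ne hw).symm
    · intro hxw
      by_cases e : w = u
      · exact Or.inl e
      · exact Or.inr (h.free w x u (hm hw) hxx (hm hu) hxw.symm hxu e)
  · exact ⟨fun e => absurd e (h'.2.2.1 w hw), fun e => absurd e (h'.2.2.2 w hw)⟩

theorem Fit.cls_remove (h : Fit C x p l) {w : ℕ} (hw : C.Out w) :
    (C.remove x p l).cls w = C.cls w := Function.update_of_ne (h.ne hw) _ _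

theorem Fit.clu_remove (h : Fit C x p l) (hC : C.OK) {w : ℕ} (hw : C.Out w) :
    (C.remove x p l).clu (C.cls w) = C.clu (C.cls w) := by
  by_cases e : C.cls w = p
  · rcases h.cls with h' | h'
    · obtain ⟨u, hu, -, e'⟩ := (hC.ch_cluster (h.l_rng hC).1 (h.l_rng hC).2).1 h'.1
      rw [e, e']; exact Function.update_self _ _ _
    · exact absurd e (h'.2.2.1 w hw)
  · exact Function.update_of_ne e _ _

theorem cls_remove_self : (C.remove x p l).cls x = p := Function.update_self _ _ _

theorem clu_remove_self : (C.remove x p l).clu p = l := Function.update_self _ _ _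

/-- By `Fit.clu_iff`, adjacency to `x` is decided by the cluster label. Two classes of one cluster
thus never differ in `x` alone, and no classes merge when `x` ceases to be a solution vertex. -/
theorem OK.remove (hC : C.OK) (h : Fit C x p l) : (C.remove x p l).OK := by
  have ho : ∀ w, (C.remove x p l).Out w → C.Out w ∨ w = x := fun w => (hC.out_remove h.mem).1
  have hcc : ∀ {w}, C.Out w → (C.remove x p l).clu ((C.remove x p l).cls w) = C.clu (C.cls w) :=
    fun hw => by rw [h.cls_remove hw, h.clu_remove hC hw]
  have hX : ∀ y, y ∈ (C.remove x p l).X ↔ y ∈ C.X.erase x := fun _ => Iff.rfl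
  -- Either `p` is the class of the cluster `l` with the neighbourhood of `x`, or `p` is unused and
  -- no vertex of `l` has this neighbourhood.
  have hxw : ∀ w, C.Out w → (p = C.cls w ↔
      l = C.clu (C.cls w) ∧ ∀ y ∈ C.X.erase x, C.G.Adj y x ↔ C.G.Adj y w) := by
    intro w hw
    rcases h.cls with h' | h'
    · obtain ⟨u, hu, e1, e2⟩ := (hC.ch_cluster (h.l_rng hC).1 (h.l_rng hC).2).1 h'.1
      constructor
      · intro e; exact ⟨by rw [← e, e2], h'.2 w hw e.symm⟩
      · rintro ⟨e3, e4⟩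
        rw [← e1, hC.cls_iff u w hu hw]
        refine ⟨by rw [e1, e2, e3], fun y hy => ?_⟩
        by_cases hyx : y = x
        · subst hyx
          rw [← h.clu_iff hC hu, ← h.clu_iff hC hw, e1, e2, e3]
        · rw [← e4 y (Finset.mem_erase.2 ⟨hyx, hy⟩),
            h'.2 u hu e1 y (Finset.mem_erase.2 ⟨hyx, hy⟩)]
    · constructor
      · intro e; exact absurd e.symm (h'.2.2.1 w hw)
      · rintro ⟨e3, e4⟩; exact absurd e4 (h'.2.2.2 w hw e3.symm)
  refine ⟨fun y hy => hC.X_lt y (Finset.mem_of_mem_erase hy), hC.adj_lt, fun w hw => ?_,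
    fun w hw => ?_, fun w u hw hu => ?_, fun w u hw hu => ?_⟩
  · rcases ho w hw with hw | rfl
    · rw [h.cls_remove hw]; exact hC.cls_rng w hw
    · rw [cls_remove_self]; exact h.p_rng hC
  · rcases ho w hw with hw | rfl
    · rw [hcc hw]; exact hC.clu_rng w hw
    · rw [cls_remove_self, clu_remove_self]; exact h.l_rng hC
  · change _ ↔ w = u ∨ C.G.Adj w u
    rcases ho w hw with hw' | rfl <;> rcases ho u hu with hu' | rfl
    · rw [hcc hw', hcc hu']; exact hC.clu_iff w u hw' hu'
    · rw [hcc hw', cls_remove_self, clu_remove_self, h.clu_iff hC hw', C.G.adj_comm]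
      simp [h.ne hw']
    · rw [hcc hu', cls_remove_self, clu_remove_self, eq_comm, h.clu_iff hC hu']
      simp [(h.ne hu').symm]
    · simp
  · change _ ↔ _ ∧ ∀ y ∈ C.X.erase x, C.G.Adj y w ↔ C.G.Adj y u
    rcases ho w hw with hw' | rfl <;> rcases ho u hu with hu' | rfl
    · rw [hcc hw', hcc hu', h.cls_remove hw', h.cls_remove hu', hC.cls_iff w u hw' hu']
      constructor
      · rintro ⟨e, h1⟩; exact ⟨e, fun y hy => h1 y (Finset.mem_of_mem_erase hy)⟩
      · rintro ⟨e, h1⟩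
        refine ⟨e, fun y hy => ?_⟩
        by_cases hyx : y = x
        · subst hyx; rw [← h.clu_iff hC hw', ← h.clu_iff hC hu', e]
        · exact h1 y (Finset.mem_erase.2 ⟨hyx, hy⟩)
    · rw [hcc hw', cls_remove_self, clu_remove_self, h.cls_remove hw', eq_comm, hxw w hw']
      simp only [eq_comm (a := l), iff_comm]
    · rw [hcc hu', cls_remove_self, clu_remove_self, h.cls_remove hu', hxw u hu']
    · simp

/-- The relations that come with the class `p` of the cluster `l` and its member `x`. -/
def New (l p x : ℕ) : Kd → ℕ → ℕ → Prop
  | .adj, a, b => (a = x ∧ b = p) ∨ (a = p ∧ b = x) ∨ (a = p ∧ b = l) ∨ (a = l ∧ b = p)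
  | .nbr, _, _ => False
  | .sub, a, b => (a = p ∧ b = x) ∨ (a = l ∧ b = p)

theorem OK.ch_remove (hC : C.OK) (h : Fit C x p l) {a b : ℕ} (ht : ¬ (a ∈ C.X ∧ b = l)) :
    (C.remove x p l).Ch a b ↔ C.Ch a b ∨ (a = p ∧ b = x) ∨ (a = l ∧ b = p) := by
  have ho : ∀ {w}, (C.remove x p l).Out w ↔ C.Out w ∨ w = x := fun {w} => hC.out_remove h.mem
  have hcc : ∀ {w}, C.Out w → (C.remove x p l).clu ((C.remove x p l).cls w) = C.clu (C.cls w) :=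
    fun hw => by rw [h.cls_remove hw, h.clu_remove hC hw]
  constructor
  · rintro (⟨ha, w, hw, rfl, hw'⟩ | ⟨w, hw, rfl, rfl⟩ | ⟨hb, rfl⟩)
    · have haX : a ∈ C.X := Finset.mem_of_mem_erase ha
      rcases ho.1 hw with hw | rfl
      · rw [hcc hw]; exact Or.inl (Or.inl ⟨haX, w, hw, rfl, hw'⟩)
      · exact absurd ⟨haX, by rw [cls_remove_self, clu_remove_self]⟩ ht
    · rcases ho.1 hw with hw | rfl
      · rw [hcc hw, h.cls_remove hw]; exact Or.inl (Or.inr (Or.inl ⟨w, hw, rfl, rfl⟩))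
      · rw [cls_remove_self, clu_remove_self]; exact Or.inr (Or.inr ⟨rfl, rfl⟩)
    · rcases ho.1 hb with hb | rfl
      · rw [h.cls_remove hb]; exact Or.inl (Or.inr (Or.inr ⟨hb, rfl⟩))
      · rw [cls_remove_self]; exact Or.inr (Or.inl ⟨rfl, rfl⟩)
  · rintro ((⟨ha, w, hw, rfl, hw'⟩ | ⟨w, hw, rfl, rfl⟩ | ⟨hb, rfl⟩) | ⟨rfl, rfl⟩ | ⟨rfl, rfl⟩)
    · have hax : a ≠ x := by
        rintro rfl
        exact ht ⟨ha, (h.clu_iff hC hw).2 hw'⟩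
      exact Or.inl ⟨Finset.mem_erase.2 ⟨hax, ha⟩, w, ho.2 (Or.inl hw), hcc hw, hw'⟩
    · exact Or.inr (Or.inl ⟨w, ho.2 (Or.inl hw), h.cls_remove hw, h.clu_remove hC hw⟩)
    · exact Or.inr (Or.inr ⟨ho.2 (Or.inl hb), h.cls_remove hb⟩)
    · exact Or.inr (Or.inr ⟨ho.2 (Or.inr rfl), cls_remove_self⟩)
    · exact Or.inr (Or.inl ⟨x, ho.2 (Or.inr rfl), cls_remove_self, clu_remove_self⟩)

/-- The counterpart of `OK.spec_add`: apart from the relations that are going to be recomputed,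
relations are only gained. Here `A` contains the old solution, so the obsolete relations of `x`
itself are among the touched ones. -/
theorem OK.spec_remove (hC : C.OK) (h : Fit C x p l) {A : Finset ℕ} (hA : C.X ⊆ A) {κ : Kd}
    {a b : ℕ} (ht : ¬ ∃ y ∈ A, (C.remove x p l).Touched l x y κ a b) :
    (C.remove x p l).Spec κ a b ↔ C.Spec κ a b ∨ New l p x κ a b := by
  have ho : ∀ {w}, (C.remove x p l).Out w ↔ C.Out w ∨ w = x := fun {w} => hC.out_remove h.mem
  have hC' := hC.remove h
  have hl := h.l_rng hC
  cases κ with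
  | sub => exact hC.ch_remove h fun h' => ht ⟨a, hA h'.1, rfl, h'.2⟩
  | adj =>
    have h1 := hC.ch_remove h (a := a) (b := b) (fun h' => ht ⟨a, hA h'.1, Or.inl ⟨rfl, h'.2⟩⟩)
    have h2 := hC.ch_remove h (a := b) (b := a)
      (fun h' => ht ⟨b, hA h'.1, Or.inr (Or.inl ⟨h'.2, rfl⟩)⟩)
    have h3 : (a ∈ (C.remove x p l).X ∧ b ∈ (C.remove x p l).X ∧ C.G.Adj a b) ↔
        (a ∈ C.X ∧ b ∈ C.X ∧ C.G.Adj a b) := by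
      constructor
      · rintro ⟨ha, hb, hab⟩
        exact ⟨Finset.mem_of_mem_erase ha, Finset.mem_of_mem_erase hb, hab⟩
      · rintro ⟨ha, hb, hab⟩
        refine ⟨Finset.mem_erase.2 ⟨fun e => ?_, ha⟩, Finset.mem_erase.2 ⟨fun e => ?_, hb⟩, hab⟩
        · exact ht ⟨b, hA hb, Or.inr (Or.inr (Or.inr ⟨e, rfl⟩))⟩
        · exact ht ⟨a, hA ha, Or.inr (Or.inr (Or.inl ⟨rfl, e⟩))⟩
    change (a ∈ (C.remove x p l).X ∧ b ∈ (C.remove x p l).X ∧ C.G.Adj a b) ∨ _ ∨ _ ↔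
      (_ ∨ _ ∨ _) ∨ _
    rw [h1, h2, h3]
    constructor
    · rintro (h' | (h' | ⟨e, e'⟩ | ⟨e, e'⟩) | (h' | ⟨e, e'⟩ | ⟨e, e'⟩))
      exacts [Or.inl (Or.inl h'), Or.inl (Or.inr (Or.inl h')), Or.inr (Or.inr (Or.inl ⟨e, e'⟩)),
        Or.inr (Or.inr (Or.inr (Or.inr ⟨e, e'⟩))), Or.inl (Or.inr (Or.inr h')),
        Or.inr (Or.inl ⟨e', e⟩), Or.inr (Or.inr (Or.inr (Or.inl ⟨e', e⟩)))]
    · rintro ((h' | h' | h') | (⟨e, e'⟩ | ⟨e, e'⟩ | ⟨e, e'⟩ | ⟨e, e'⟩))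
      exacts [Or.inl h', Or.inr (Or.inl (Or.inl h')), Or.inr (Or.inr (Or.inl h')),
        Or.inr (Or.inr (Or.inr (Or.inl ⟨e', e⟩))), Or.inr (Or.inl (Or.inr (Or.inl ⟨e, e'⟩))),
        Or.inr (Or.inr (Or.inr (Or.inr ⟨e', e⟩))), Or.inr (Or.inl (Or.inr (Or.inr ⟨e, e'⟩)))]
  | nbr =>
    change (b ∈ C.X.erase x ∧ ∃ w, (C.remove x p l).Out w ∧ (C.remove x p l).cls w = a ∧
      C.G.Adj b w) ↔ (b ∈ C.X ∧ ∃ w, C.Out w ∧ C.cls w = a ∧ C.G.Adj b w) ∨ False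
    have hcl : b ∈ C.X → ∀ w, (C.remove x p l).Out w → (C.remove x p l).cls w = a →
        (C.remove x p l).clu a ≠ l := fun hb w hw e e' =>
      ht ⟨b, hA hb, rfl, (hC'.ch_cluster hl.1 hl.2).2 ⟨w, hw, e, e'⟩⟩
    rw [or_false]
    constructor
    · rintro ⟨hb, w, hw, e, hbw⟩
      have hbX := Finset.mem_of_mem_erase hb
      rcases ho.1 hw with hw' | rfl
      · exact ⟨hbX, w, hw', by rw [← e, h.cls_remove hw'], hbw⟩
      · exact absurd (by rw [← e, cls_remove_self, clu_remove_self]) (hcl hbX w hw e)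
    · rintro ⟨hb, w, hw, e, hbw⟩
      have hw' := ho.2 (Or.inl hw)
      have e' : (C.remove x p l).cls w = a := (h.cls_remove hw).trans e
      refine ⟨Finset.mem_erase.2 ⟨?_, hb⟩, w, hw', e', hbw⟩
      rintro rfl
      refine hcl hb w hw' e' ?_
      rw [← e, h.clu_remove hC hw, h.clu_iff hC hw]
      exact hbw

/-- The cluster label `l` is in use. -/
def UsedL (C : Conf) (l : ℕ) : Prop := ∃ w, C.Out w ∧ C.clu (C.cls w) = l

/-- The class label `p` is in use. -/
def UsedP (C : Conf) (p : ℕ) : Prop := ∃ w, C.Out w ∧ C.cls w = p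

theorem OK.usedL_remove (hC : C.OK) (h : Fit C x p l) (i : ℕ) :
    (C.remove x p l).UsedL i ↔ C.UsedL i ∨ i = l := by
  constructor
  · rintro ⟨w, hw, rfl⟩
    rcases (hC.out_remove h.mem).1 hw with hw | rfl
    · rw [h.cls_remove hw, h.clu_remove hC hw]; exact Or.inl ⟨w, hw, rfl⟩
    · rw [cls_remove_self, clu_remove_self]; exact Or.inr rfl
  · rintro (⟨w, hw, rfl⟩ | rfl)
    · exact ⟨w, (hC.out_remove h.mem).2 (Or.inl hw), by rw [h.cls_remove hw, h.clu_remove hC hw]⟩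
    · exact ⟨x, (hC.out_remove h.mem).2 (Or.inr rfl), by rw [cls_remove_self, clu_remove_self]⟩

theorem OK.usedP_remove (hC : C.OK) (h : Fit C x p l) (i : ℕ) :
    (C.remove x p l).UsedP i ↔ C.UsedP i ∨ i = p := by
  constructor
  · rintro ⟨w, hw, rfl⟩
    rcases (hC.out_remove h.mem).1 hw with hw | rfl
    · rw [h.cls_remove hw]; exact Or.inl ⟨w, hw, rfl⟩
    · rw [cls_remove_self]; exact Or.inr rfl
  · rintro (⟨w, hw, rfl⟩ | rfl)
    · exact ⟨w, (hC.out_remove h.mem).2 (Or.inl hw), h.cls_remove hw⟩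
    · exact ⟨x, (hC.out_remove h.mem).2 (Or.inr rfl), cls_remove_self⟩

end Conf

/-! ### Stacks of free labels -/

/-- `f 0, …, f (m - 1)` are the labels from `lo` to `lo + n` that are not in use. -/
structure Stack (f : ℕ → ℕ) (m lo n : ℕ) (used : ℕ → Prop) : Prop where
  inj : ∀ i < m, ∀ j < m, f i = f j → i = j
  rng : ∀ i < m, lo ≤ f i ∧ f i < lo + n
  free : ∀ i < m, ¬ used (f i)
  all : ∀ a, lo ≤ a → a < lo + n → ¬ used a → ∃ i < m, f i = a

namespace Stack

variable {f : ℕ → ℕ} {m lo n : ℕ} {used used' : ℕ → Prop}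

/-- A label in use is missing from the stack, which leaves room for pushing it; the counter never
exceeds `n`. -/
theorem lt (h : Stack f m lo n used) {a : ℕ} (h1 : lo ≤ a) (h2 : a < lo + n) (ha : used a) :
    m < n := by
  have := Finset.card_le_card_of_injOn (s := Finset.range m)
    (t := (Finset.Ico lo (lo + n)).erase a) f
    (fun i hi => by
      have hi : i < m := by simpa using hi
      have h3 := h.rng i hi
      have h4 : f i ≠ a := fun e => h.free i hi (e ▸ ha)
      simpa [h4] using h3)
    (fun i hi j hj => h.inj i (by simpa using hi) j (by simpa using hj))
  rw [Finset.card_erase_of_mem (by simp [h1, h2])] at this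
  simp at this; omega

theorem congr (h : Stack f m lo n used) (hu : ∀ a, used' a ↔ used a) : Stack f m lo n used' :=
  ⟨h.inj, h.rng, fun i hi => by rw [hu]; exact h.free i hi, fun a h1 h2 h3 =>
    h.all a h1 h2 (by rwa [← hu])⟩

theorem push (h : Stack f m lo n used) {a : ℕ} (h1 : lo ≤ a) (h2 : a < lo + n) (ha : used a)
    (hu : ∀ i, used' i ↔ used i ∧ i ≠ a) :
    Stack (fun i => if i = m then a else f i) (m + 1) lo n used' := by
  have key : ∀ i < m, f i ≠ a := fun i hi e => h.free i hi (e ▸ ha)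
  refine ⟨fun i hi j hj => ?_, fun i hi => ?_, fun i hi => ?_, fun b h3 h4 h5 => ?_⟩
  · by_cases e : i = m <;> by_cases e' : j = m <;> simp only [e, e', if_true, if_false]
    · simp
    · exact fun e'' => absurd e''.symm (key j (by omega))
    · exact fun e'' => absurd e'' (key i (by omega))
    · exact h.inj i (by omega) j (by omega)
  · by_cases e : i = m <;> simp only [e, if_true, if_false]
    exacts [⟨h1, h2⟩, h.rng i (by omega)]
  · by_cases e : i = m <;> simp only [e, if_true, if_false, hu]
    · simp
    · exact fun h' => h.free i (by omega) h'.1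
  · by_cases e : b = a
    · exact ⟨m, by omega, by simp [e]⟩
    · obtain ⟨i, hi, e'⟩ := h.all b h3 h4 fun h' => h5 ((hu b).2 ⟨h', e⟩)
      exact ⟨i, by omega, by simp [e', (show i ≠ m by omega)]⟩

theorem pop (h : Stack f (m + 1) lo n used) (hu : ∀ i, used' i ↔ used i ∨ i = f m) :
    Stack f m lo n used' := by
  refine ⟨fun i hi j hj => h.inj i (by omega) j (by omega), fun i hi => h.rng i (by omega),
    fun i hi => ?_, fun b h3 h4 h5 => ?_⟩
  · rw [hu]
    rintro (h' | h')
    · exact h.free i (by omega) h'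
    · have := h.inj i (by omega) m (by omega) h'; omega
  · rw [hu, not_or] at h5
    obtain ⟨i, hi, e⟩ := h.all b h3 h4 h5.1
    refine ⟨i, ?_, e⟩
    have : i ≠ m := by rintro rfl; exact h5.2 e.symm
    omega

/-- If the used labels come from fewer than `n` objects, there is a free one. -/
theorem pos (h : Stack f m lo n used) (g : ℕ → ℕ) (O : Finset ℕ) (hO : O.card < n)
    (hg : ∀ a, used a → ∃ w ∈ O, g w = a) : 0 < m := by
  by_contra hm
  have hm : m = 0 := by omega
  subst hm
  have : (Finset.Ico lo (lo + n)).card ≤ (O.image g).card := by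
    refine Finset.card_le_card fun a ha => ?_
    have ha : lo ≤ a ∧ a < lo + n := by simpa using ha
    by_cases hu : used a
    · obtain ⟨w, hw, e⟩ := hg a hu
      exact Finset.mem_image.2 ⟨w, hw, e⟩
    · obtain ⟨i, hi, -⟩ := h.all a ha.1 ha.2 hu
      omega
  have h2 := Finset.card_image_le (s := O) (f := g)
  simp at this; omega

end Stack

end DynCVD

namespace DynCVD

section Refresh

variable {B : ℕ} {p q : Stmt} {s : HS} {Q Q1 : HS → Prop} {T T1 T2 : ℕ} {C : Conf} {A : Finset ℕ}

/-! ### The data structure in memory -/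

/-- The array of `s` lists the set `A`. -/
structure Listing (s : HS) (A : Finset ℕ) : Prop where
  card : s.reg .xc = A.card
  mem : ∀ i < s.reg .xc, s.m1 .xarr i ∈ A
  all : ∀ x ∈ A, ∃ i < s.reg .xc, s.m1 .xarr i = x

open Classical in
/-- All parts of the data structure apart from the lists. -/
structure Base (C : Conf) (A : Finset ℕ) (s : HS) : Prop where
  ok : C.OK
  n : s.reg .n = C.n
  ty : ∀ v < C.n, s.m1 .ty v = if v ∈ C.X then 0 else 3
  ty_cluster : ∀ l, C.n ≤ l → l < 2 * C.n → s.m1 .ty l = 1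
  ty_class : ∀ p, 2 * C.n ≤ p → p < 3 * C.n → s.m1 .ty p = 2
  gm : ∀ u v, s.m2 .gm u v = if C.G.Adj u v then 1 else 0
  cls : s.m1 .cls = C.cls
  clu : s.m1 .clu = C.clu
  listing : Listing s A
  sub : C.X ⊆ A
  lt : ∀ x ∈ A, x < C.n
  freeL : Stack (s.m1 .freeL) (s.reg .nfl) C.n C.n C.UsedL
  freeP : Stack (s.m1 .freeP) (s.reg .nfp) (2 * C.n) C.n C.UsedP

/-- The listed set `A` may be larger than the solution: while vertices leave, the array keeps their
entries and the type field alone decides membership. Between updates, `A` is the solution. -/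
structure Inv (C : Conf) (A : Finset ℕ) (s : HS) : Prop where
  base : Base C A s
  lw : LW (3 * C.n) s
  rel : ∀ κ a b, s.Lst κ a b ↔ C.Spec κ a b

/-- `p` modifies nothing that matters for `Base`. -/
def Stmt.keeps (p : Stmt) : Bool :=
  !p.writes .n && !p.writes .xc && !p.writes .nfl && !p.writes .nfp && !p.stores1 .ty &&
  !p.stores1 .cls && !p.stores1 .clu && !p.stores1 .freeL && !p.stores1 .freeP &&
  !p.stores1 .xarr && !p.stores2 .gm

theorem Base.frame {s' : HS} (h : Base C A s) (hF : Frame p s s') (hp : p.keeps = true) :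
    Base C A s' := by
  simp only [Stmt.keeps, Bool.and_eq_true, Bool.not_eq_true'] at hp
  obtain ⟨⟨⟨⟨⟨⟨⟨⟨⟨⟨h1, h2⟩, h3⟩, h4⟩, h5⟩, h6⟩, h7⟩, h8⟩, h9⟩, h10⟩, h11⟩ := hp
  have e1 := hF.reg _ h1
  have e2 := hF.reg _ h2
  have e3 := hF.reg _ h3
  have e4 := hF.reg _ h4
  have e5 := hF.m1 _ h5
  have e6 := hF.m1 _ h6
  have e7 := hF.m1 _ h7
  have e8 := hF.m1 _ h8
  have e9 := hF.m1 _ h9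
  have e10 := hF.m1 _ h10
  have e11 := hF.m2 _ h11
  obtain ⟨a1, a2, a3, a4, a5, a6, a7, a8, ⟨a9, a10, a11⟩, a12, a13, a14, a15⟩ := h
  refine ⟨a1, ?_, ?_, ?_, ?_, ?_, ?_, ?_, ⟨?_, ?_, ?_⟩, a12, a13, ?_, ?_⟩
  all_goals simp only [e1, e2, e3, e4, e5, e6, e7, e8, e9, e10, e11]; assumption

theorem Base.ty_eq_zero (h : Base C A s) {v : ℕ} (hv : v < C.n) : s.m1 .ty v = 0 ↔ v ∈ C.X := by
  rw [h.ty v hv]; split_ifs with h' <;> simp [h']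

theorem Base.gm_eq_one (h : Base C A s) {u v : ℕ} : s.m2 .gm u v = 1 ↔ C.G.Adj u v := by
  rw [h.gm u v]; split_ifs with h' <;> simp [h']

theorem Base.xarr_lt (h : Base C A s) {i : ℕ} (hi : i < s.reg .xc) : s.m1 .xarr i < C.n :=
  h.lt _ (h.listing.mem i hi)

theorem Base.xc_le (h : Base C A s) : s.reg .xc ≤ C.n := by
  rw [h.listing.card]
  simpa using Finset.card_le_card (t := Finset.range C.n) fun x hx => Finset.mem_range.2 (h.lt x hx)

/-- The first entry in the list of a class is a member. -/
theorem Inv.rep_aux {l p : ℕ} (hok : C.OK) (hL : LW (3 * C.n) s) (hl : C.n ≤ l) (hl' : l < 2 * C.n)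
    (hp : C.Ch l p) (hR : ∀ b, s.Lst .sub p b ↔ C.Ch p b) :
    C.Out (s.m2 (.arr .sub) p 0) ∧ C.cls (s.m2 (.arr .sub) p 0) = p := by
  obtain ⟨w, hw, rfl, -⟩ := (hok.ch_cluster hl hl').1 hp
  have h2n := (hok.cls_rng w hw).1
  obtain ⟨i, hi, -⟩ := (hL .sub _).exists_arr ((hR w).2 ((hok.ch_class h2n).2 ⟨hw, rfl⟩))
  exact (hok.ch_class h2n).1 ((hR _).1 ((hL .sub _).arr_mem (by omega : 0 < s.m1 (.cnt .sub) _)))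

theorem cnt_sub_le {l : ℕ} (hok : C.OK) (hL : LW (3 * C.n) s) (hl : C.n ≤ l) (hl' : l < 2 * C.n)
    (hR : ∀ b, s.Lst .sub l b → C.Ch l b) : s.m1 (.cnt .sub) l ≤ 2 ^ C.X.card := by
  classical
  have := hok.card_classes hl hl'
    ((Finset.range (s.m1 (.cnt .sub) l)).image (s.m2 (.arr .sub) l)) (fun p hp => by
      obtain ⟨i, hi, rfl⟩ := Finset.mem_image.1 hp
      exact hR _ ((hL .sub l).arr_mem (by simpa using hi)))
  rwa [Finset.card_image_of_injOn, Finset.card_range] at this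
  intro i hi j hj e
  exact (hL .sub l).arr_inj (by simpa using hi) (by simpa using hj) e

-- The first member of a class decides for the whole class, because its members have the same
-- neighbours in the solution. For this, only the lists of children of clusters and classes have to
-- be correct beforehand. The cluster has at most `2 ^ |X|` classes, which is the cost.
open Classical in
theorem fix_spec {l v x : ℕ} (hB : Bd B s) (hN : 64 * (4 * (3 * C.n) * (3 * C.n) + 3 * C.n + 1) ≤ B)
    (hb : Base C A s) (hL : LW (3 * C.n) s) (hx : s.reg .fx = x) (hl : s.reg .fl = l)
    (hv : s.reg .fv = v) (hxn : x < C.n) (hvn : v < C.n) (hln : C.n ≤ l) (hln' : l < 2 * C.n)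
    (hR : ∀ a, C.n ≤ a → ∀ b, s.Lst .sub a b ↔ C.Ch a b) :
    Run B (fixL ;; fixX) s (fun s' => LW (3 * C.n) s' ∧ SameSub x s s' ∧
      ∀ κ a b, s'.Lst κ a b ↔ if C.Touched l v x κ a b then C.Spec κ a b else s.Lst κ a b)
      (2 ^ C.X.card) := by
  have hcnt := cnt_sub_le hb.ok hL hln hln' fun b => (hR l hln b).1
  have hhit : ∀ p, s.Lst .sub l p → (s.Hits x p ↔ C.Spec .nbr p x) := by
    intro p hp
    rw [hR l hln] at hp
    obtain ⟨hr1, hr2⟩ := Inv.rep_aux hb.ok hL hln hln' hp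
      (hR p (by have := hb.ok.ch_rng hp; omega))
    unfold HS.Hits Conf.Spec
    rw [hb.ty_eq_zero hxn, hb.gm_eq_one]
    constructor
    · exact fun ⟨h1, h2⟩ => ⟨h1, _, hr1, hr2, h2⟩
    · rintro ⟨h1, w, hw, e, h2⟩
      exact ⟨h1, ((((hb.ok.cls_iff _ w hr1 hw).1 (hr2.trans e.symm)).2 x h1)).2 h2⟩
  have hch : (∃ p, s.Lst .sub l p ∧ s.Hits x p) ↔ C.Ch x l := by
    rw [hb.ok.ch_vertex hxn]
    constructor
    · rintro ⟨p, hp, h⟩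
      obtain ⟨h1, w, hw, rfl, h2⟩ := (hhit p hp).1 h
      obtain ⟨w', hw', e, h3⟩ := (hb.ok.ch_cluster hln hln').1 ((hR l hln _).1 hp)
      exact ⟨h1, w, hw, h3, h2⟩
    · rintro ⟨h1, w, hw, h3, h2⟩
      have := (hR l hln _).2 ((hb.ok.ch_cluster hln hln').2 ⟨w, hw, rfl, h3⟩)
      exact ⟨_, this, (hhit _ this).2 ⟨h1, w, hw, rfl, h2⟩⟩
  refine (Run.bind (T1 := s.m1 (.cnt .sub) l) (T2 := 0) hB
    (fixL_spec hB hN hL hx hl (by omega) (by omega) (by omega)) ?_).mono (by omega) (fun _ h => h)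
  rintro s1 hB1 hF1 ⟨hL1, hS1, hR1⟩
  have e1 : s1.reg .fx = x := (hF1.reg .fx rfl).trans hx
  have e2 : s1.reg .fv = v := (hF1.reg .fv rfl).trans hv
  have hb1 := hb.frame hF1 (by decide)
  refine (fixX_spec hB1 hN hL1 (by omega) (by omega)).mono le_rfl ?_
  rw [e1, e2, hb1.ty_eq_zero hxn, hb1.ty_eq_zero hvn, hb1.gm_eq_one]
  rintro s2 ⟨hL2, hS2, hR2⟩
  refine ⟨hL2, fun a ha => ⟨(hS2 a ha).1.trans (hS1 a ha).1, (hS2 a ha).2.trans (hS1 a ha).2⟩, ?_⟩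
  intro κ a b
  rw [hR2, hR1, hch]
  have hnl : l ∉ C.X := fun h => by have := hb.ok.X_lt _ h; omega
  have hnlx : ¬ C.Ch l x := fun h => by have := hb.ok.ch_rng h; omega
  have hnxv : ¬ C.Ch x v := fun h => by have := hb.ok.ch_rng h; omega
  have hnvx : ¬ C.Ch v x := fun h => by have := hb.ok.ch_rng h; omega
  cases κ with
  | nbr =>
    simp only [reduceCtorEq, false_and, if_false, true_and, or_self]
    simp only [show C.Touched l v x .nbr a b ↔ b = x ∧ C.Ch l a from Iff.rfl, ← hR l hln a]
    by_cases h : b = x ∧ s.Lst .sub l a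
    · rw [if_pos h, if_pos h, h.1]; exact hhit a h.2
    · rw [if_neg h, if_neg h]
  | sub =>
    simp only [reduceCtorEq, false_and, if_false, true_and, false_or]
    simp only [show C.Touched l v x .sub a b ↔ a = x ∧ b = l from Iff.rfl,
      show C.Spec .sub a b ↔ C.Ch a b from Iff.rfl]
    by_cases h : a = x ∧ b = l
    · rw [if_pos h, if_pos h, h.1, h.2]
    · rw [if_neg h, if_neg h]
  | adj =>
    simp only [reduceCtorEq, false_and, if_false, true_and, or_false]
    simp only [show C.Touched l v x .adj a b ↔ (a = x ∧ b = l) ∨ (a = l ∧ b = x) ∨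
        (a = x ∧ b = v) ∨ (a = v ∧ b = x) from Iff.rfl,
      show C.Spec .adj a b ↔ (a ∈ C.X ∧ b ∈ C.X ∧ C.G.Adj a b) ∨ C.Ch a b ∨ C.Ch b a from Iff.rfl]
    by_cases h : a = x ∧ b = v ∨ a = v ∧ b = x
    · rw [if_pos h, if_pos (by tauto)]
      rcases h with ⟨rfl, rfl⟩ | ⟨rfl, rfl⟩
      · simp [hnxv, hnvx]
      · simp [hnxv, hnvx, C.G.adj_comm]; tauto
    · rw [if_neg h]
      by_cases h' : a = x ∧ b = l ∨ a = l ∧ b = x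
      · rw [if_pos h', if_pos (by tauto)]
        rcases h' with ⟨rfl, rfl⟩ | ⟨rfl, rfl⟩ <;> simp [hnl, hnlx]
      · rw [if_neg h', if_neg (by tauto)]

/-- Recompute all relations of the listed vertices with the cluster `fl` and the vertex `fv`. -/
def refresh : Stmt :=
  forLt .ri Reg.xc (.asg .fx (.ld1 .xarr Reg.ri) ;; fixL ;; fixX)

/-- The invariant leaves open the relations touched by vertices that are still to come. The children
of clusters and classes are never touched, because `Touched` changes the children of listed vertices
only; so the hypothesis of `fix_spec` holds in every round. -/
theorem refresh_spec {l v : ℕ} (hB : Bd B s)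
    (hN : 64 * (4 * (3 * C.n) * (3 * C.n) + 3 * C.n + 1) ≤ B)
    (hb : Base C A s) (hL : LW (3 * C.n) s) (hl : s.reg .fl = l)
    (hv : s.reg .fv = v) (hvn : v < C.n) (hln : C.n ≤ l) (hln' : l < 2 * C.n)
    (hR : ∀ κ a b, (¬ ∃ x ∈ A, C.Touched l v x κ a b) → (s.Lst κ a b ↔ C.Spec κ a b)) :
    Run B refresh s (Inv C A) (A.card * (2 ^ C.X.card + 1)) := by
  rw [← hb.listing.card]
  have hxl : ∀ i < s.reg .xc, s.m1 .xarr i < C.n := fun i hi => hb.xarr_lt hi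
  refine (Run.forLt (N := s.reg .xc) (I := fun j s' => LW (3 * C.n) s' ∧
    ∀ κ a b, (¬ ∃ i < s.reg .xc, j ≤ i ∧ C.Touched l v (s.m1 .xarr i) κ a b) →
      (s'.Lst κ a b ↔ C.Spec κ a b)) hB (hB.reg _) rfl ?_ ?_ ?_).full hB |>.mono le_rfl ?_
  · refine ⟨fun κ a => (hL κ a).congr rfl rfl rfl rfl rfl rfl, fun κ a b h => hR κ a b ?_⟩
    rintro ⟨x, hx, h'⟩
    obtain ⟨i, hi, rfl⟩ := hb.listing.all x hx
    exact h ⟨i, hi, by omega, h'⟩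
  · intro j s' hF _
    exact hF.reg .xc rfl
  · rintro j s' hj hB' hri hF ⟨hL', hR'⟩
    have hb' := hb.frame hF (by decide)
    refine Run.asg' (s.m1 .xarr j) (by simp [Expr.eval, hri, hF.m1 .xarr rfl]) (hB.m1 _ _) ?_
    set s1 := s'.set .fx (s.m1 .xarr j) with hs1
    have hB1 : Bd B s1 := by
      refine ⟨fun r => ?_, hB'.m1, hB'.m2⟩
      simp only [hs1, HS.set]; split_ifs; exacts [hB.m1 _ _, hB'.reg r]
    have hF1 : Frame (.asg .fx 0) s' s1 := by
      refine ⟨fun r hr => ?_, fun _ _ => rfl, fun _ _ => rfl⟩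
      simp [Stmt.writes] at hr; simp [hs1, HS.set, hr]
    refine (fix_spec (x := s.m1 .xarr j) hB1 hN (hb'.frame hF1 (by decide))
      (fun κ a => (hL' κ a).congr rfl rfl rfl rfl rfl rfl) (by simp [hs1, HS.set])
      ((hF1.reg .fl rfl).trans ((hF.reg .fl rfl).trans hl))
      ((hF1.reg .fv rfl).trans ((hF.reg .fv rfl).trans hv)) (hxl j hj) hvn hln hln' ?_).mono le_rfl ?_
    · intro a ha b
      refine hR' .sub a b ?_
      rintro ⟨i, hi, -, h1, -⟩
      have := hxl i hi; omega
    · rintro s2 ⟨hL2, hS2, hR2⟩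
      refine ⟨fun κ a => (hL2 κ a).congr rfl rfl rfl rfl rfl rfl, fun κ a b h => ?_⟩
      change s2.Lst κ a b ↔ _
      rw [hR2]
      split_ifs with h'
      · rfl
      · refine hR' κ a b ?_
        rintro ⟨i, hi, hji, h1⟩
        rcases Nat.eq_or_lt_of_le hji with rfl | hlt
        · exact h' h1
        · exact h ⟨i, hi, hlt, h1⟩
  · rintro s' ⟨-, hF, hL', hR'⟩
    refine ⟨hb.frame hF (by decide), hL', fun κ a b => hR' κ a b ?_⟩
    rintro ⟨i, hi, h, -⟩
    omega

end Refresh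

end DynCVD

namespace DynCVD

/-! ### The program that puts a vertex into the solution -/

section AddVertex

variable {B : ℕ} {p q : Stmt} {s : HS} {Q Q1 : HS → Prop} {T T1 T2 : ℕ} {C : Conf} {A : Finset ℕ}

theorem LOK.cnt_eq_zero {N : ℕ} {κ : Kd} {a : ℕ} (h : LOK N s κ a) :
    s.m1 (.cnt κ) a = 0 ↔ ∀ b, ¬ s.Lst κ a b := by
  constructor
  · intro h0 b hb
    obtain ⟨i, hi, -⟩ := h.exists_arr hb
    omega
  · intro h0
    by_contra hne
    exact h0 _ (h.arr_mem (i := 0) (by omega))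

/-- Delete the relations that vanish when `fv` leaves the class `ap` of the cluster `fl`. -/
def unlink : Stmt :=
  del .adj Reg.fv Reg.ap ;; del .adj Reg.ap Reg.fv ;; del .sub Reg.ap Reg.fv ;;
  .ite (.eq (.ld1 (.cnt .sub) Reg.ap) 0)
    (del .adj Reg.ap Reg.fl ;; del .adj Reg.fl Reg.ap ;; del .sub Reg.fl Reg.ap ;;
      forLt .ai Reg.xc (del .nbr Reg.ap (.ld1 .xarr Reg.ai)))
    .skip

/-- The vertices in the neighbour list of an emptied class belong to the solution, hence to the
listed set. The list is cleared by deleting every listed vertex from it, which costs `|A|`. -/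
theorem unlink_spec {l c v : ℕ} (hB : Bd B s)
    (hN : 64 * (4 * (3 * C.n) * (3 * C.n) + 3 * C.n + 1) ≤ B)
    (h : Inv C A s) (hv : C.Out v) (hc : C.cls v = c) (hl : C.clu c = l)
    (hfl : s.reg .fl = l) (hfv : s.reg .fv = v) (hap : s.reg .ap = c) :
    Run B unlink s (fun s' => LW (3 * C.n) s' ∧ ∀ κ a b, s'.Lst κ a b ↔
      C.Spec κ a b ∧ ¬ Conf.Gone l c v (¬ ∃ w, (C.add v).Out w ∧ C.cls w = c) κ a b) A.card := by
  have hok := h.base.ok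
  have hcr := hok.cls_rng v hv
  have hlr := hok.clu_rng v hv
  rw [hc] at hcr hlr
  rw [hl] at hlr
  have hvn := hv.1
  have hF : ∀ {κ e e' s1 s2}, Frame (del κ e e') s1 s2 → s1.reg .fl = l ∧ s1.reg .fv = v ∧
      s1.reg .ap = c → s2.reg .fl = l ∧ s2.reg .fv = v ∧ s2.reg .ap = c :=
    fun h ⟨h1, h2, h3⟩ => ⟨(h.reg _ rfl).trans h1, (h.reg _ rfl).trans h2, (h.reg _ rfl).trans h3⟩
  rw [← h.base.listing.card]
  refine (Run.bind (T1 := 0) hB (del_spec (a := v) (b := c) hB hN h.lw (by simp [Expr.eval, hfv])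
    (by simp [Expr.eval, HS.set, hap]) (by omega) (by omega)) (T2 := s.reg .xc) ?_).mono (by omega) fun _ h => h
  rintro s1 hB1 hF1 ⟨hL1, hR1, -⟩
  have r1 := hF hF1 ⟨hfl, hfv, hap⟩
  refine (Run.bind (T1 := 0) hB1 (del_spec (a := c) (b := v) hB1 hN hL1 (by simp [Expr.eval, r1])
    (by simp [Expr.eval, HS.set, r1]) (by omega) (by omega)) (T2 := s.reg .xc) ?_).mono (by omega) fun _ h => h
  rintro s2 hB2 hF2 ⟨hL2, hR2, -⟩
  have r2 := hF hF2 r1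
  refine (Run.bind (T1 := 0) hB2 (del_spec (a := c) (b := v) hB2 hN hL2 (by simp [Expr.eval, r2])
    (by simp [Expr.eval, HS.set, r2]) (by omega) (by omega)) (T2 := s.reg .xc) ?_).mono (by omega) fun _ h => h
  rintro s3 hB3 hF3 ⟨hL3, hR3, -⟩
  have r3 := hF hF3 r2
  -- These deletions are all that is due if the class survives; its list of members now shows
  -- whether it does.
  have hR3' : ∀ κ a b, s3.Lst κ a b ↔ C.Spec κ a b ∧ ¬ Conf.Gone l c v False κ a b := by
    intro κ a b
    rw [hR3, hR2, hR1, h.rel]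
    cases κ <;> simp [Conf.Gone] <;> tauto
  have hq : s3.m1 (.cnt .sub) c = 0 ↔ ¬ ∃ w, (C.add v).Out w ∧ C.cls w = c := by
    rw [(hL3 _ _).cnt_eq_zero, not_exists]
    refine forall_congr' fun w => not_congr ?_
    rw [hR3', Conf.out_add]
    change C.Ch c w ∧ ¬ ((c = c ∧ w = v) ∨ (False ∧ c = l ∧ w = c)) ↔ _
    rw [hok.ch_class hcr.1]
    tauto
  have hx0 : s3.reg .xc = s.reg .xc :=
    (hF3.reg .xc rfl).trans ((hF2.reg .xc rfl).trans (hF1.reg .xc rfl))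
  have hxa : s3.m1 .xarr = s.m1 .xarr :=
    (hF3.m1 .xarr rfl).trans ((hF2.m1 .xarr rfl).trans (hF1.m1 .xarr rfl))
  refine Run.ite (fun hc0 => ?_) fun hc0 => ?_ <;>
    simp only [Cond.holds, Expr.eval, r3] at hc0 <;> erw [hq] at hc0
  · refine (Run.bind (T1 := 0) hB3 (del_spec (a := c) (b := l) hB3 hN hL3 (by simp [Expr.eval, r3])
      (by simp [Expr.eval, HS.set, r3]) (by omega) (by omega)) (T2 := s.reg .xc) ?_).mono (by omega)
        fun _ h => h
    rintro s4 hB4 hF4 ⟨hL4, hR4, -⟩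
    have r4 := hF hF4 r3
    refine (Run.bind (T1 := 0) hB4 (del_spec (a := l) (b := c) hB4 hN hL4 (by simp [Expr.eval, r4])
      (by simp [Expr.eval, HS.set, r4]) (by omega) (by omega)) (T2 := s.reg .xc) ?_).mono (by omega)
        fun _ h => h
    rintro s5 hB5 hF5 ⟨hL5, hR5, -⟩
    have r5 := hF hF5 r4
    refine (Run.bind (T1 := 0) hB5 (del_spec (a := l) (b := c) hB5 hN hL5 (by simp [Expr.eval, r5])
      (by simp [Expr.eval, HS.set, r5]) (by omega) (by omega)) (T2 := s.reg .xc) ?_).mono (by omega)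
        fun _ h => h
    rintro s6 hB6 hF6 ⟨hL6, hR6, -⟩
    have r6 := hF hF6 r5
    have hx6 : s6.reg .xc = s.reg .xc := (hF6.reg .xc rfl).trans
      ((hF5.reg .xc rfl).trans ((hF4.reg .xc rfl).trans hx0))
    have hxa6 : s6.m1 .xarr = s.m1 .xarr := (hF6.m1 .xarr rfl).trans
      ((hF5.m1 .xarr rfl).trans ((hF4.m1 .xarr rfl).trans hxa))
    refine (Run.forLt (N := s.reg .xc) (T := 0) (I := fun j s' => LW (3 * C.n) s' ∧
      ∀ κ a b, s'.Lst κ a b ↔ s6.Lst κ a b ∧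
        ¬ (κ = .nbr ∧ a = c ∧ ∃ i < j, s.m1 .xarr i = b)) hB6 (hB.reg _) rfl ?_ ?_ ?_).mono
          (by omega) ?_
    · exact ⟨fun κ a => (hL6 κ a).congr rfl rfl rfl rfl rfl rfl, fun κ a b => by simp [HS.Lst, HS.set]⟩
    · intro j s' hF' _
      exact (hF'.reg .xc rfl).trans hx6
    · rintro j s' hj hB' hai hF' ⟨hL', hR'⟩
      have hlt := h.base.xarr_lt hj
      refine (del_spec (a := c) (b := s.m1 .xarr j) hB' hN hL'
        (by simp [Expr.eval, (hF'.reg .ap rfl).trans r6.2.2])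
        (by simp [Expr.eval, HS.set, hF'.m1 .xarr rfl, hxa6, hai]) (by omega) (by omega)).mono le_rfl ?_
      rintro s'' ⟨hL'', hR'', -⟩
      refine ⟨fun κ a => (hL'' κ a).congr rfl rfl rfl rfl rfl rfl, fun κ a b => ?_⟩
      change s''.Lst κ a b ↔ _
      rw [hR'', hR', and_assoc]
      refine and_congr_right' ?_
      simp only [Nat.lt_succ_iff_lt_or_eq, or_and_right, exists_or, exists_eq_left]
      rw [eq_comm (a := b), ← not_or, ← and_or_left, ← and_or_left]
    · rintro s' ⟨hL', hR'⟩
      refine ⟨hL', fun κ a b => ?_⟩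
      rw [hR', hR6, hR5, hR4, hR3']
      have hcl : c ≠ l := by omega
      cases κ with
      | adj => simp [Conf.Gone, hc0]; tauto
      | sub => simp [Conf.Gone, hc0]; tauto
      | nbr =>
        simp only [reduceCtorEq, false_and, not_false_eq_true, and_true, true_and, Conf.Gone, hc0]
        refine and_congr_right fun hs => not_congr (and_iff_left_of_imp fun _ => ?_)
        obtain ⟨i, hi, e⟩ := h.base.listing.all b (h.base.sub hs.1)
        exact ⟨i, hi, e⟩
  · rw [not_not] at hc0
    refine Run.skip ⟨hL3, fun κ a b => ?_⟩
    rw [hR3']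
    have : (¬ ∃ w, (C.add v).Out w ∧ C.cls w = c) = False := by simpa using hc0
    rw [this]

/-- The vertex `fv` joins the listed set. -/
def enlist : Stmt :=
  .st1 .xarr Reg.xc Reg.fv ;; .asg .xc (Reg.xc + 1 : Expr) ;; .st1 .ty Reg.fv 0 ;;
  .ite (.eq (.ld1 (.cnt .sub) Reg.ap) 0)
    (.st1 .freeP Reg.nfp Reg.ap ;; .asg .nfp (Reg.nfp + 1 : Expr)) .skip ;;
  .ite (.eq (.ld1 (.cnt .sub) Reg.fl) 0)
    (.st1 .freeL Reg.nfl Reg.fl ;; .asg .nfl (Reg.nfl + 1 : Expr)) .skip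

/-- The lists of children have been updated already, so an empty one signals that the label has come
out of use; it is then pushed onto its stack. -/
theorem enlist_spec {l c v : ℕ} (hB : Bd B s)
    (hN : 64 * (4 * (3 * C.n) * (3 * C.n) + 3 * C.n + 1) ≤ B) (hb : Base C A s) (hv : C.Out v)
    (hvA : v ∉ A) (hc : C.cls v = c) (hl : C.clu c = l)
    (hfl : s.reg .fl = l) (hfv : s.reg .fv = v) (hap : s.reg .ap = c)
    (hcc : s.m1 (.cnt .sub) c = 0 ↔ ¬ (C.add v).UsedP c)
    (hcl : s.m1 (.cnt .sub) l = 0 ↔ ¬ (C.add v).UsedL l) :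
    Run B enlist s (Base (C.add v) (insert v A)) 0 := by
  have hvn := hv.1
  have hcr := hb.ok.cls_rng v hv
  have hlr := hb.ok.clu_rng v hv
  rw [hc] at hcr hlr
  rw [hl] at hlr
  have hxc := hb.xc_le
  have hP : C.UsedP c := ⟨v, hv, hc⟩
  have hLu : C.UsedL l := ⟨v, hv, by rw [hc, hl]⟩
  have hpn := hb.freeP.lt (by omega) (by omega) hP
  have hln := hb.freeL.lt (by omega) (by omega) hLu
  have hPi : ∀ i, i ≠ c → ((C.add v).UsedP i ↔ C.UsedP i) := by
    intro i hi
    constructor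
    · rintro ⟨w, hw, e⟩; exact ⟨w, (Conf.out_add.1 hw).1, e⟩
    · rintro ⟨w, hw, e⟩
      refine ⟨w, Conf.out_add.2 ⟨hw, ?_⟩, e⟩
      rintro rfl; exact hi (e.symm.trans hc)
  have hLi : ∀ i, i ≠ l → ((C.add v).UsedL i ↔ C.UsedL i) := by
    intro i hi
    constructor
    · rintro ⟨w, hw, e⟩; exact ⟨w, (Conf.out_add.1 hw).1, e⟩
    · rintro ⟨w, hw, e⟩
      refine ⟨w, Conf.out_add.2 ⟨hw, ?_⟩, e⟩
      rintro rfl; exact hi (e.symm.trans (by rw [hc, hl]))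
  refine Run.st1' (s.reg .xc) v rfl (by simp [Expr.eval, hfv]) (by omega) ?_
  refine Run.asg' (s.reg .xc + 1) rfl (by omega) ?_
  refine Run.st1' v 0 (by simp [Expr.eval, HS.set, HS.st1, hfv]) rfl (by omega) ?_
  set s1 := ((s.st1 .xarr (s.reg .xc) v).set .xc (s.reg .xc + 1)).st1 .ty v 0 with hs1
  have hB1 : Bd B s1 := by
    refine ⟨fun r => ?_, fun f j => ?_, hB.m2⟩
    · simp only [hs1, HS.set, HS.st1]; split_ifs; exacts [by omega, hB.reg r]
    · simp only [hs1, HS.set, HS.st1]; split_ifs; exacts [by omega, by omega, hB.m1 _ _]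
  refine (Run.bind (T1 := 0) (T2 := 0) hB1 (Q1 := fun s' => s'.m1 .freeL = s.m1 .freeL ∧
    Stack (s'.m1 .freeP) (s'.reg .nfp) (2 * C.n) C.n (C.add v).UsedP)
    (Run.ite (fun h => ?_) fun h => ?_) ?_)
  · have h0 : ¬ (C.add v).UsedP c := by
      rw [← hcc]; simpa [Cond.holds, Expr.eval, hs1, HS.set, HS.st1, hap] using h
    refine Run.st1' (s.reg .nfp) c rfl (by simp [hs1, HS.set, HS.st1, Expr.eval, hap])
      (by omega) ?_
    refine Run.asg (s.reg .nfp + 1) rfl (by omega) ?_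
    refine ⟨by simp [hs1, HS.set, HS.st1], ?_⟩
    simp only [HS.set, HS.st1, hs1, true_and, reduceCtorEq, false_and, if_false, if_true]
    refine hb.freeP.push (by omega) (by omega) hP fun i => ?_
    by_cases hi : i = c
    · simp [hi, h0]
    · simp [hi, hPi i hi]
  · have h0 : (C.add v).UsedP c := by
      rw [← not_not (a := (C.add v).UsedP c), ← hcc]
      simpa [Cond.holds, Expr.eval, hs1, HS.set, HS.st1, hap] using h
    refine Run.skip ⟨by simp [hs1, HS.st1, HS.set], ?_⟩
    have := hb.freeP.congr (used' := (C.add v).UsedP) fun i => by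
      by_cases hi : i = c
      · rw [hi]; exact iff_of_true h0 hP
      · exact hPi i hi
    simpa [hs1, HS.st1, HS.set] using this
  rintro s2 hB2 hF2 ⟨hfe, hSP⟩
  refine (Run.full (Q := fun s' => Stack (s'.m1 .freeL) (s'.reg .nfl) C.n C.n (C.add v).UsedL)
    (T := 0) (Run.ite (fun h => ?_) fun h => ?_) hB2).mono le_rfl ?_
  · have g1 : s2.m1 (.cnt .sub) = s.m1 (.cnt .sub) := (hF2.m1 (.cnt .sub) rfl).trans (by simp [hs1, HS.set, HS.st1])
    have g2 : s2.reg .fl = l := (hF2.reg .fl rfl).trans (by simp [hs1, HS.set, HS.st1, hfl])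
    have g3 : s2.reg .nfl = s.reg .nfl := (hF2.reg .nfl rfl).trans (by simp [hs1, HS.set, HS.st1])
    have h0 : ¬ (C.add v).UsedL l := by
      rw [← hcl]; simpa [Cond.holds, Expr.eval, g1, g2] using h
    refine Run.st1' (s.reg .nfl) l (by simp [Expr.eval, g3]) (by simp [Expr.eval, g2])
      (by omega) ?_
    refine Run.asg (s.reg .nfl + 1) (by simp [Expr.eval, HS.st1, g3, Arith.eval]) (by omega) ?_
    simp only [HS.set, HS.st1, true_and, if_true, hfe]
    refine hb.freeL.push (by omega) (by omega) hLu fun i => ?_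
    by_cases hi : i = l
    · simp [hi, h0]
    · simp [hi, hLi i hi]
  · have g1 : s2.m1 (.cnt .sub) = s.m1 (.cnt .sub) := (hF2.m1 (.cnt .sub) rfl).trans (by simp [hs1, HS.set, HS.st1])
    have g2 : s2.reg .fl = l := (hF2.reg .fl rfl).trans (by simp [hs1, HS.set, HS.st1, hfl])
    have g3 : s2.reg .nfl = s.reg .nfl := (hF2.reg .nfl rfl).trans (by simp [hs1, HS.set, HS.st1])
    have h0 : (C.add v).UsedL l := by
      rw [← not_not (a := (C.add v).UsedL l), ← hcl]
      simpa [Cond.holds, Expr.eval, g1, g2] using h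
    refine Run.skip ?_
    rw [hfe, g3]
    refine hb.freeL.congr fun i => ?_
    by_cases hi : i = l
    · rw [hi]; exact iff_of_true h0 hLu
    · exact hLi i hi
  · rintro s3 ⟨hB3, hF3, hSL⟩
    have k1 : ∀ r, r ≠ .nfl → r ≠ .nfp → s3.reg r = s1.reg r := fun r h1 h2 =>
      (hF3.reg r (by simp [Stmt.writes, h1])).trans (hF2.reg r (by simp [Stmt.writes, h2]))
    have k2 : ∀ f, f ≠ .freeL → f ≠ .freeP → s3.m1 f = s1.m1 f := fun f h1 h2 =>
      (hF3.m1 f (by simp [Stmt.stores1, h1])).trans (hF2.m1 f (by simp [Stmt.stores1, h2]))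
    have k3 : s3.m2 .gm = s.m2 .gm := (hF3.m2 .gm rfl).trans (hF2.m2 .gm rfl)
    have k4 : s3.m1 .freeP = s2.m1 .freeP := hF3.m1 .freeP rfl
    have k5 : s3.reg .nfp = s2.reg .nfp := hF3.reg .nfp rfl
    obtain ⟨a1, a2, a3, a4, a5, a6, a7, a8, ⟨a9, a10, a11⟩, a12, a13, a14, a15⟩ := hb
    have kxa : s3.m1 .xarr = fun j => if j = s.reg .xc then v else s.m1 .xarr j := by
      rw [k2 _ (by simp) (by simp)]; simp [hs1, HS.set, HS.st1]
    have kty : s3.m1 .ty = fun j => if j = v then 0 else s.m1 .ty j := by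
      rw [k2 _ (by simp) (by simp)]; simp [hs1, HS.set, HS.st1]
    have kxc : s3.reg .xc = s.reg .xc + 1 := by
      rw [k1 _ (by simp) (by simp)]; simp [hs1, HS.set, HS.st1]
    refine ⟨a1.add hv, ?_, ?_, ?_, ?_, ?_, ?_, ?_, ⟨?_, ?_, ?_⟩, ?_, ?_, hSL, ?_⟩
    · rw [k1 _ (by simp) (by simp)]; exact a2
    · intro w hw
      rw [kty]
      simp only [Conf.add, Finset.mem_insert]
      by_cases hwv : w = v
      · simp [hwv]
      · simpa [hwv] using a3 w hw
    · intro w h1 h2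
      change C.n ≤ w at h1
      rw [kty]; simp [show w ≠ v by omega, a4 w h1 h2]
    · intro w h1 h2
      change 2 * C.n ≤ w at h1
      rw [kty]; simp [show w ≠ v by omega, a5 w h1 h2]
    · rw [k3]; exact a6
    · rw [k2 _ (by simp) (by simp)]; exact Eq.trans (by simp [hs1, HS.set, HS.st1]) a7
    · rw [k2 _ (by simp) (by simp)]; exact Eq.trans (by simp [hs1, HS.set, HS.st1]) a8
    · rw [kxc, Finset.card_insert_of_notMem hvA, a9]
    · intro i hi
      rw [kxa]
      by_cases e : i = s.reg .xc
      · simp [e]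
      · simp [e, a10 i (by omega)]
    · intro x hx
      rw [kxc, kxa]
      rcases Finset.mem_insert.1 hx with rfl | hx
      · exact ⟨s.reg .xc, by omega, by simp⟩
      · obtain ⟨i, hi, e⟩ := a11 x hx
        exact ⟨i, by omega, by simp [hi.ne, e]⟩
    · exact Finset.insert_subset_insert _ a12
    · intro x hx
      rcases Finset.mem_insert.1 hx with rfl | hx
      exacts [hvn, a13 x hx]
    · rw [k4, k5]; exact hSP

/-- Put the vertex `fv` into the solution. -/
def addX : Stmt :=
  .asg .ap (.ld1 .cls Reg.fv) ;; .asg .fl (.ld1 .clu Reg.ap) ;; unlink ;; enlist ;; refresh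

/-- After `unlink` the lists are right except for touched relations, which `refresh` recomputes. If
the cluster of `v` has become empty, `refresh` finds no class in it and thereby removes its links to
solution vertices. -/
theorem addX_spec {v : ℕ} (hB : Bd B s)
    (hN : 64 * (4 * (3 * C.n) * (3 * C.n) + 3 * C.n + 1) ≤ B)
    (h : Inv C A s) (hv : v < C.n) (hvA : v ∉ A) (hfv : s.reg .fv = v) :
    Run B addX s (Inv (C.add v) (insert v A)) (A.card + (A.card + 1) * (2 ^ (C.X.card + 1) + 1)) := by
  have hO : C.Out v := ⟨hv, fun h' => hvA (h.base.sub h')⟩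
  have hcr := h.base.ok.cls_rng v hO
  have hlr := h.base.ok.clu_rng v hO
  have hok' := h.base.ok.add hO
  refine Run.asg' (C.cls v) (by simp [Expr.eval, hfv, h.base.cls]) (by nlinarith) ?_
  refine Run.asg' (C.clu (C.cls v)) (by simp [Expr.eval, HS.set, h.base.clu]) (by nlinarith) ?_
  set s1 := (s.set .ap (C.cls v)).set .fl (C.clu (C.cls v)) with hs1
  have hF1 : Frame (.asg .ap 0 ;; .asg .fl 0) s s1 := by
    refine ⟨fun r hr => ?_, fun _ _ => rfl, fun _ _ => rfl⟩
    simp [Stmt.writes] at hr; simp [hs1, HS.set, hr]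
  have hB1 : Bd B s1 := by
    refine ⟨fun r => ?_, hB.m1, hB.m2⟩
    simp only [hs1, HS.set]; split_ifs; exacts [by nlinarith, by nlinarith, hB.reg r]
  have h1 : Inv C A s1 := ⟨h.base.frame hF1 (by decide),
    fun κ a => (h.lw κ a).congr rfl rfl rfl rfl rfl rfl, h.rel⟩
  have r1 : s1.reg .fl = C.clu (C.cls v) ∧ s1.reg .fv = v ∧ s1.reg .ap = C.cls v := by
    simp [hs1, HS.set, hfv]
  refine Run.bind hB1 (unlink_spec hB1 hN h1 hO rfl rfl r1.1 r1.2.1 r1.2.2) ?_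
  rintro s2 hB2 hF2 ⟨hL2, hR2⟩
  have r2 : s2.reg .fl = C.clu (C.cls v) ∧ s2.reg .fv = v ∧ s2.reg .ap = C.cls v :=
    ⟨(hF2.reg _ rfl).trans r1.1, (hF2.reg _ rfl).trans r1.2.1, (hF2.reg _ rfl).trans r1.2.2⟩
  have hb2 := h1.base.frame hF2 (by decide)
  have hR2' : ∀ κ a b, (¬ ∃ x ∈ insert v A, (C.add v).Touched (C.clu (C.cls v)) v x κ a b) →
      (s2.Lst κ a b ↔ (C.add v).Spec κ a b) := by
    intro κ a b ht
    rw [hR2, h.base.ok.spec_add hO (Finset.insert_subset_insert _ h.base.sub) ht]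
  have hsub : ∀ a, C.n ≤ a → ∀ b, s2.Lst .sub a b ↔ (C.add v).Ch a b := by
    intro a ha b
    refine hR2' .sub a b ?_
    rintro ⟨x, hx, h1, -⟩
    rcases Finset.mem_insert.1 hx with rfl | hx
    · omega
    · have := h.base.lt x hx; omega
  have := Run.bind hB2 (enlist_spec hB2 hN hb2 hO hvA rfl rfl r2.1 r2.2.1 r2.2.2 ?_ ?_)
    (q := refresh) (Q := Inv (C.add v) (insert v A))
    (T2 := (A.card + 1) * (2 ^ (C.X.card + 1) + 1)) ?_
  · exact this.mono (by omega) fun _ h => h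
  · rw [(hL2 _ _).cnt_eq_zero, Conf.UsedP, not_exists]
    refine forall_congr' fun w => not_congr ?_
    rw [hsub _ (by omega), hok'.ch_class hcr.1]
  · rw [(hL2 _ _).cnt_eq_zero, Conf.UsedL]
    rw [← not_exists]
    refine not_congr ⟨?_, ?_⟩
    · rintro ⟨w, hw⟩
      rw [hsub _ hlr.1, hok'.ch_cluster hlr.1 hlr.2] at hw
      obtain ⟨u, hu, rfl, e⟩ := hw
      exact ⟨u, hu, e⟩
    · rintro ⟨w, hw, e⟩
      exact ⟨_, (hsub _ hlr.1 _).2 ((hok'.ch_cluster hlr.1 hlr.2).2 ⟨w, hw, rfl, e⟩)⟩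
  · rintro s3 hB3 hF3 hb3
    have r3 : s3.reg .fl = C.clu (C.cls v) ∧ s3.reg .fv = v :=
      ⟨(hF3.reg _ rfl).trans r2.1, (hF3.reg _ rfl).trans r2.2.1⟩
    have e : ∀ κ a, s3.m2 (.pos κ) a = s2.m2 (.pos κ) a := fun κ a => by rw [hF3.m2 (.pos κ) rfl]
    refine (refresh_spec (C := C.add v) hB3 hN hb3 (fun κ a => (hL2 κ a).congr ?_ ?_ ?_ ?_ ?_ ?_) r3.1 r3.2 hv
      hlr.1 hlr.2 fun κ a b ht => ?_).mono ?_ fun _ h => h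
    · rw [hF3.m1 (.cnt κ) rfl]
    · rw [hF3.m1 (.rhead κ) rfl]
    · rw [hF3.m2 (.val κ) rfl]
    · rw [hF3.m2 (.rnext κ) rfl]
    · rw [hF3.m2 (.arr κ) rfl]
    · rw [hF3.m2 (.pos κ) rfl]
    · rw [← hR2' κ a b ht, HS.Lst, HS.Lst, e]
    · rw [Finset.card_insert_of_notMem hvA]
      refine Nat.mul_le_mul_left _ (Nat.add_le_add_right (Nat.pow_le_pow_right (by omega) ?_) _)
      exact Finset.card_insert_le _ _

end AddVertex

end DynCVD

namespace DynCVD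

/-! ### The program that takes a vertex out of the solution -/

section RemoveVertex

variable {B : ℕ} {p q : Stmt} {s : HS} {Q Q1 : HS → Prop} {T T1 T2 : ℕ} {C : Conf} {A : Finset ℕ}

theorem Bd.set (hB : Bd B s) (r : Reg) {a : ℕ} (ha : a < B) : Bd B (s.set r a) := by
  refine ⟨fun r' => ?_, hB.m1, hB.m2⟩
  simp only [HS.set]; split_ifs; exacts [ha, hB.reg r']

theorem Frame.set (s : HS) (r : Reg) (a : ℕ) : Frame (.asg r 0) s (s.set r a) := by
  refine ⟨fun r' hr => ?_, fun _ _ => rfl, fun _ _ => rfl⟩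
  simp [Stmt.writes] at hr; simp [HS.set, hr]

theorem Inv.frame_set {r : Reg} {a : ℕ} (h : Inv C A s) (hr : Stmt.keeps (.asg r 0) = true) :
    Inv C A (s.set r a) :=
  ⟨h.base.frame (Frame.set s r a) hr, fun κ b => (h.lw κ b).congr rfl rfl rfl rfl rfl rfl, h.rel⟩

/-- `p` modifies none of the lists. -/
def Stmt.keepsLists (p : Stmt) : Bool :=
  [Kd.adj, .nbr, .sub].all fun κ => !p.stores1 (.cnt κ) && !p.stores1 (.rhead κ) &&
    !p.stores2 (.val κ) && !p.stores2 (.rnext κ) && !p.stores2 (.arr κ) && !p.stores2 (.pos κ)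

theorem Stmt.keepsLists_iff (hp : p.keepsLists = true) (κ : Kd) :
    p.stores1 (.cnt κ) = false ∧ p.stores1 (.rhead κ) = false ∧ p.stores2 (.val κ) = false ∧
      p.stores2 (.rnext κ) = false ∧ p.stores2 (.arr κ) = false ∧ p.stores2 (.pos κ) = false := by
  simp only [Stmt.keepsLists, List.all_cons, List.all_nil, Bool.and_eq_true, Bool.not_eq_true',
    Bool.and_true] at hp
  cases κ <;> tauto

theorem LW.frame {N : ℕ} {s' : HS} (h : LW N s) (hF : Frame p s s') (hp : p.keepsLists = true) :
    LW N s' := by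
  intro κ a
  obtain ⟨h1, h2, h3, h4, h5, h6⟩ := Stmt.keepsLists_iff hp κ
  exact (h κ a).congr (by rw [hF.m1 _ h1]) (by rw [hF.m1 _ h2]) (by rw [hF.m2 _ h3])
    (by rw [hF.m2 _ h4]) (by rw [hF.m2 _ h5]) (by rw [hF.m2 _ h6])

theorem Lst.frame {s' : HS} (hF : Frame p s s') (hp : p.keepsLists = true) (κ : Kd) (a b : ℕ) :
    s'.Lst κ a b ↔ s.Lst κ a b := by
  unfold HS.Lst; rw [hF.m2 _ (Stmt.keepsLists_iff hp κ).2.2.2.2.2]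

theorem Inv.frame {s' : HS} (h : Inv C A s) (hF : Frame p s s') (hp : p.keeps = true)
    (hp' : p.keepsLists = true) : Inv C A s' :=
  ⟨h.base.frame hF hp, h.lw.frame hF hp', fun κ a b => (Lst.frame hF hp' κ a b).trans (h.rel κ a b)⟩

/-- Find the cluster for the vertex `fv`. -/
def pickCluster : Stmt :=
  .ite (.eq (.ld1 (.cnt .sub) Reg.fv) 0) (.asg .fl (.ld1 .freeL (Reg.nfl - 1 : Expr)))
    (.asg .fl (.ld2 (.arr .sub) Reg.fv 0))

/-- Compare the neighbourhoods of `fv` and `ar` in the solution. -/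
def compareNbr : Stmt :=
  .asg .ab 1 ;;
  forLt .aj Reg.xc (.asg .ay (.ld1 .xarr Reg.aj) ;;
    .ite (.and (.eq (.ld1 .ty Reg.ay) 0) (.and (.not (.eq Reg.ay Reg.fv))
      (.not (.eq (.ld2 .gm Reg.ay Reg.ar) (.ld2 .gm Reg.ay Reg.fv))))) (.asg .ab 0) .skip)

/-- Find the class for the vertex `fv` in the cluster `fl`. -/
def pickClass : Stmt :=
  .asg .ap 0 ;;
  forLt .ai (.ld1 (.cnt .sub) Reg.fl)
    (.asg .aq (.ld2 (.arr .sub) Reg.fl Reg.ai) ;; .asg .ar (.ld2 (.arr .sub) Reg.aq 0) ;;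
      compareNbr ;; .ite (.eq Reg.ab 1) (.asg .ap Reg.aq) .skip) ;;
  .ite (.eq Reg.ap 0) (.asg .ap (.ld1 .freeP (Reg.nfp - 1 : Expr))) .skip

/-- Any cluster in the list of `x` can serve: when `x` is allowed to leave, there is at most one. If
there is none, a fresh label is taken; one exists since `x` lies in the solution, so fewer than `n`
vertices lie outside and use labels. -/
theorem pickCluster_spec {x : ℕ} (hB : Bd B s) (h : Inv C A s) (hx : x ∈ C.X)
    (hfv : s.reg .fv = x) :
    Run B pickCluster s (fun s' =>
      (C.Ch x (s'.reg .fl) ∨ (C.n ≤ s'.reg .fl ∧ s'.reg .fl < 2 * C.n ∧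
        (∀ w, C.Out w → C.clu (C.cls w) ≠ s'.reg .fl) ∧ ∀ w, C.Out w → ¬ C.G.Adj x w)) ∧
      (C.UsedL (s'.reg .fl) ∨ 0 < s.reg .nfl ∧ s'.reg .fl = s.m1 .freeL (s.reg .nfl - 1))) 0 := by
  have hxn := h.base.ok.X_lt x hx
  refine Run.ite (fun hc => ?_) fun hc => ?_ <;>
    simp only [Cond.holds, Expr.eval, hfv] at hc
  · have h0 := (h.lw .sub x).cnt_eq_zero.1 hc
    have hpos : 0 < s.reg .nfl := by
      refine h.base.freeL.pos (fun w => C.clu (C.cls w)) ((Finset.range C.n).erase x) ?_ ?_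
      · rw [Finset.card_erase_of_mem (by simpa using hxn), Finset.card_range]; omega
      · rintro a ⟨w, hw, e⟩
        refine ⟨w, Finset.mem_erase.2 ⟨?_, Finset.mem_range.2 hw.1⟩, e⟩
        rintro rfl; exact hw.2 hx
    have hr := h.base.freeL.rng (s.reg .nfl - 1) (by omega)
    have hu := h.base.freeL.free (s.reg .nfl - 1) (by omega)
    refine Run.asg (s.m1 .freeL (s.reg .nfl - 1)) rfl (hB.m1 _ _) ?_
    simp only [HS.set, if_true]
    refine ⟨Or.inr ⟨hr.1, by omega, fun w hw e => hu ⟨w, hw, e⟩, fun w hw ha => ?_⟩,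
      Or.inr ⟨hpos, by simp⟩⟩
    exact h0 _ ((h.rel .sub _ _).2 ((h.base.ok.ch_vertex hxn).2 ⟨hx, w, hw, rfl, ha⟩))
  · refine Run.asg (s.m2 (.arr .sub) x 0) (by simp [Expr.eval, hfv]) (hB.m2 _ _ _) ?_
    simp only [HS.set, if_true]
    have hch : C.Ch x (s.m2 (.arr .sub) x 0) :=
      (h.rel .sub _ _).1 ((h.lw .sub x).arr_mem (Nat.pos_of_ne_zero hc))
    refine ⟨Or.inl hch, Or.inl ?_⟩
    obtain ⟨-, w, hw, e, -⟩ := (h.base.ok.ch_vertex hxn).1 hch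
    exact ⟨w, hw, e⟩

open Classical in
theorem compareNbr_spec {x r : ℕ} (hB : Bd B s) (hB0 : C.n + 1 < B) (h : Inv C A s)
    (hfv : s.reg .fv = x) (har : s.reg .ar = r) :
    Run B compareNbr s (fun s' => s'.reg .ab =
      if ∀ y ∈ C.X.erase x, C.G.Adj y x ↔ C.G.Adj y r then 1 else 0) A.card := by
  refine Run.asg' 1 rfl (by omega) ?_
  have hB1 := hB.set .ab (a := 1) (by omega)
  have h1 : Inv C A (s.set .ab 1) := h.frame_set (by decide)
  obtain ⟨P, hP⟩ : ∃ P : ℕ → Prop, ∀ j, P j ↔ ∀ i < j, s.m1 .xarr i ∈ C.X.erase x →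
    (C.G.Adj (s.m1 .xarr i) x ↔ C.G.Adj (s.m1 .xarr i) r) := ⟨_, fun _ => Iff.rfl⟩
  rw [← h.base.listing.card]
  refine (Run.forLt (N := s.reg .xc) (T := 0)
    (I := fun j s' => s'.reg .ab = if P j then 1 else 0) hB1 (hB.reg _) rfl ?_ ?_ ?_).mono
      (by omega) ?_
  · simp [HS.set, hP]
  · intro j s' hF _; exact hF.reg .xc rfl
  · rintro j s' hj hB' haj hF hab
    have hb' := h1.base.frame hF (by decide)
    have e1 : s'.m1 .xarr = s.m1 .xarr := hF.m1 .xarr rfl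
    have hjn := h.base.xarr_lt hj
    have hPs : P (j + 1) ↔ P j ∧ (s.m1 .xarr j ∈ C.X.erase x →
        (C.G.Adj (s.m1 .xarr j) x ↔ C.G.Adj (s.m1 .xarr j) r)) := by
      rw [hP, hP]
      constructor
      · exact fun h => ⟨fun i hi => h i (by omega), h j (by omega)⟩
      · rintro ⟨h1, h2⟩ i hi
        rcases Nat.lt_succ_iff_lt_or_eq.1 hi with h' | rfl
        exacts [h1 i h', h2]
    refine Run.asg' (s.m1 .xarr j) (by simp [Expr.eval, haj, e1]) (hB.m1 _ _) ?_
    have ex : s'.reg .fv = x := (hF.reg .fv rfl).trans (by simp [HS.set, hfv])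
    have er : s'.reg .ar = r := (hF.reg .ar rfl).trans (by simp [HS.set, har])
    have hg : s'.m2 .gm (s.m1 .xarr j) r = s'.m2 .gm (s.m1 .xarr j) x ↔
        (C.G.Adj (s.m1 .xarr j) x ↔ C.G.Adj (s.m1 .xarr j) r) := by
      rw [hb'.gm, hb'.gm]; split_ifs <;> simp_all
    have hty := hb'.ty_eq_zero hjn
    have hcond : Cond.holds (s'.set .ay (s.m1 .xarr j)) (.and (.eq (.ld1 .ty Reg.ay) 0)
        (.and (.not (.eq Reg.ay Reg.fv))
        (.not (.eq (.ld2 .gm Reg.ay Reg.ar) (.ld2 .gm Reg.ay Reg.fv))))) ↔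
        ¬ (s.m1 .xarr j ∈ C.X.erase x →
        (C.G.Adj (s.m1 .xarr j) x ↔ C.G.Adj (s.m1 .xarr j) r)) := by
      simp only [Cond.holds, Expr.eval, HS.set, reduceCtorEq, if_false, if_true, ex, er, hg]
      rw [Finset.mem_erase, ← hty]
      tauto
    refine Run.ite (fun hc => ?_) fun hc => ?_ <;> rw [hcond] at hc
    · refine Run.asg 0 rfl (by omega) ?_
      simp only [HS.set, reduceCtorEq, if_false, if_true]
      rw [if_neg]; rw [hPs]; exact fun h => hc h.2
    · refine Run.skip ?_
      simp only [HS.set, reduceCtorEq, if_false, hab]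
      rw [not_not] at hc
      have : P (j + 1) ↔ P j := by rw [hPs]; exact and_iff_left hc
      simp only [this]
  · intro s' hs'
    rw [hs']
    have : P (s.reg .xc) ↔ ∀ y ∈ C.X.erase x, C.G.Adj y x ↔ C.G.Adj y r := by
      rw [hP]
      constructor
      · intro hh y hy
        obtain ⟨i, hi, rfl⟩ := h.base.listing.all y (h.base.sub (Finset.mem_of_mem_erase hy))
        exact hh i hi hy
      · exact fun hh i _ hy => hh _ hy
    simp only [this]

-- The neighbourhood of `x` in `X ∖ {x}` is compared with that of the first member of each class of
-- `l`. The value `0` of `ap` means that no class fits; it is not a class label, because class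
-- labels are at least `2 * n` and `n` is positive.
open Classical in
theorem pickClass_spec {x l : ℕ} (hB : Bd B s)
    (hN : 64 * (4 * (3 * C.n) * (3 * C.n) + 3 * C.n + 1) ≤ B) (h : Inv C A s) (hx : x ∈ C.X)
    (hfv : s.reg .fv = x) (hfl : s.reg .fl = l) (hl : C.n ≤ l) (hl' : l < 2 * C.n) :
    Run B pickClass s (fun s' =>
      ((C.Ch l (s'.reg .ap) ∧ ∀ w, C.Out w → C.cls w = s'.reg .ap →
          ∀ y ∈ C.X.erase x, C.G.Adj y x ↔ C.G.Adj y w) ∨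
        (2 * C.n ≤ s'.reg .ap ∧ s'.reg .ap < 3 * C.n ∧ (∀ w, C.Out w → C.cls w ≠ s'.reg .ap) ∧
        ∀ w, C.Out w → C.clu (C.cls w) = l → ¬ ∀ y ∈ C.X.erase x, C.G.Adj y x ↔ C.G.Adj y w)) ∧
      (C.UsedP (s'.reg .ap) ∨ 0 < s.reg .nfp ∧ s'.reg .ap = s.m1 .freeP (s.reg .nfp - 1)))
      (2 ^ C.X.card * (A.card + 1)) := by
  have hxn := h.base.ok.X_lt x hx
  have hnB : 3 * C.n + 1 < B := by nlinarith
  have hcnt := cnt_sub_le h.base.ok h.lw hl hl' fun b => (h.rel .sub l b).1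
  have hll := h.lw .sub l
  set R := fun p => s.m2 (.arr .sub) p 0 with hRdef
  have hrep : ∀ p, C.Ch l p → C.Out (R p) ∧ C.cls (R p) = p := fun p hp =>
    Inv.rep_aux h.base.ok h.lw hl hl' hp fun b => h.rel .sub p b
  obtain ⟨M, hM⟩ : ∃ M : ℕ → Prop, ∀ p, M p ↔ ∀ y ∈ C.X.erase x, C.G.Adj y x ↔ C.G.Adj y (R p) :=
    ⟨_, fun _ => Iff.rfl⟩
  have hMw : ∀ w, C.Out w → C.clu (C.cls w) = l →
      (M (C.cls w) ↔ ∀ y ∈ C.X.erase x, C.G.Adj y x ↔ C.G.Adj y w) := by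
    intro w hw e
    have hr := hrep _ ((h.base.ok.ch_cluster hl hl').2 ⟨w, hw, rfl, e⟩)
    have := ((h.base.ok.cls_iff _ w hr.1 hw).1 hr.2).2
    rw [hM]
    refine forall₂_congr fun y hy => ?_
    rw [this y (Finset.mem_of_mem_erase hy)]
  refine Run.asg' 0 rfl (by omega) ?_
  have hB1 := hB.set .ap (a := 0) (by omega)
  have h1 : Inv C A (s.set .ap 0) := h.frame_set (by decide)
  refine (Run.bind (T1 := s.m1 (.cnt .sub) l * (A.card + 1)) (T2 := 0) hB1
    (Run.forLt (N := s.m1 (.cnt .sub) l) (I := fun j s' =>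
      (s'.reg .ap = 0 ∧ ∀ i < j, ¬ M (s.m2 (.arr .sub) l i)) ∨
      (∃ i < j, s'.reg .ap = s.m2 (.arr .sub) l i ∧ M (s.m2 (.arr .sub) l i)))
      hB1 (hB.m1 _ _) rfl ?_ ?_ ?_) ?_).mono (by nlinarith) (fun _ h => h)
  · left; simp [HS.set]
  · rintro j s' hF -
    have e1 : s'.reg .fl = l := (hF.reg .fl rfl).trans (by simp [HS.set, hfl])
    simp only [Expr.eval, e1, hF.m1 (.cnt .sub) rfl]; rfl
  · rintro j s' hj hB' hai hF hI
    have e1 : s'.reg .fl = l := (hF.reg .fl rfl).trans (by simp [HS.set, hfl])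
    have e2 : s'.reg .fv = x := (hF.reg .fv rfl).trans (by simp [HS.set, hfv])
    have e3 : s'.m2 (.arr .sub) = s.m2 (.arr .sub) := hF.m2 (.arr .sub) rfl
    have hch : C.Ch l (s.m2 (.arr .sub) l j) := (h.rel .sub _ _).1 (hll.arr_mem hj)
    set c := s.m2 (.arr .sub) l j with hc
    refine Run.asg' c (by simp [Expr.eval, hai, e1, e3, hc]) (hB.m2 _ _ _) ?_
    refine Run.asg' (R c) (by simp [Expr.eval, HS.set, e3, hRdef]) (hB.m2 _ _ _) ?_
    have hB2 : Bd B ((s'.set .aq c).set .ar (R c)) :=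
      (hB'.set .aq (hB.m2 _ _ _)).set .ar (hB.m2 _ _ _)
    have hinv : Inv C A ((s'.set .aq c).set .ar (R c)) :=
      ((h1.frame hF (by decide) (by decide)).frame_set (by decide)).frame_set (by decide)
    refine (Run.bind hB2 (T2 := 0) (compareNbr_spec (x := x) (r := R c) hB2 (by omega) hinv
      (by simp [HS.set, e2]) (by simp [HS.set])) ?_).mono le_rfl (fun _ h => h)
    intro s2 hB2' hF2 hab
    have hab := hab.trans (if_congr (Q := M c) (hM c).symm rfl rfl)
    have e4 : s2.reg .aq = c := (hF2.reg .aq rfl).trans (by simp [HS.set])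
    have e5 : s2.reg .ap = s'.reg .ap := (hF2.reg .ap rfl).trans (by simp [HS.set])
    refine Run.ite (fun hcond => ?_) fun hcond => ?_ <;>
      simp only [Cond.holds, Expr.eval, hab] at hcond
    · have hMc : M c := by by_contra hn; rw [if_neg hn] at hcond; cases hcond
      refine Run.asg c (by simp [Expr.eval, e4]) (hB.m2 _ _ _) (Or.inr ⟨j, by omega, ?_, hMc⟩)
      simp [HS.set, hc]
    · have hMc : ¬ M c := by intro hn; rw [if_pos hn] at hcond; exact hcond rfl
      refine Run.skip ?_
      change (s2.reg .ap = 0 ∧ _) ∨ (∃ i < j + 1, s2.reg .ap = _ ∧ _)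
      rw [e5]
      rcases hI with ⟨h0, hI⟩ | ⟨i, hi, h2, h3⟩
      · refine Or.inl ⟨h0, fun i hi => ?_⟩
        rcases Nat.lt_succ_iff_lt_or_eq.1 hi with h' | rfl
        exacts [hI i h', hMc]
      · exact Or.inr ⟨i, by omega, h2, h3⟩
  · rintro s1 hB1' hF1 hI
    have e1 : s1.reg .nfp = s.reg .nfp := (hF1.reg .nfp rfl).trans (by simp [HS.set])
    have e2 : s1.m1 .freeP = s.m1 .freeP := hF1.m1 .freeP rfl
    refine Run.ite (fun hc => ?_) fun hc => ?_ <;>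
      simp only [Cond.holds, Expr.eval] at hc
    · change s1.reg .ap = 0 at hc
      have hpos : 0 < s.reg .nfp := by
        refine h.base.freeP.pos C.cls ((Finset.range C.n).erase x) ?_ ?_
        · rw [Finset.card_erase_of_mem (by simpa using hxn), Finset.card_range]; omega
        · rintro a ⟨w, hw, e⟩
          refine ⟨w, Finset.mem_erase.2 ⟨?_, Finset.mem_range.2 hw.1⟩, e⟩
          rintro rfl; exact hw.2 hx
      have hr := h.base.freeP.rng (s.reg .nfp - 1) (by omega)
      have hu := h.base.freeP.free (s.reg .nfp - 1) (by omega)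
      refine Run.asg (s.m1 .freeP (s.reg .nfp - 1))
        (by rw [← e1, ← e2]; rfl) (hB.m1 _ _) ?_
      simp only [HS.set, if_true]
      refine ⟨Or.inr ⟨hr.1, by omega, fun w hw e => hu ⟨w, hw, e⟩, fun w hw e => ?_⟩,
        Or.inr ⟨hpos, by simp⟩⟩
      rw [← hMw w hw e]
      rcases hI with ⟨-, hI⟩ | ⟨i, hi, h2, -⟩
      · obtain ⟨i, hi, e'⟩ := hll.exists_arr ((h.rel .sub l (C.cls w)).2
          ((h.base.ok.ch_cluster hl hl').2 ⟨w, hw, rfl, e⟩))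
        rw [← e']; exact hI i hi
      · have := h.base.ok.ch_rng ((h.rel .sub _ _).1 (hll.arr_mem hi)); omega
    · change ¬ s1.reg .ap = 0 at hc
      refine Run.skip ?_
      rcases hI with ⟨h0, -⟩ | ⟨i, hi, h2, h3⟩
      · exact absurd h0 hc
      · rw [h2]
        have hch := (h.rel .sub _ _).1 (hll.arr_mem hi)
        obtain ⟨w, hw, e, -⟩ := (h.base.ok.ch_cluster hl hl').1 hch
        refine ⟨Or.inl ⟨hch, fun w hw e => ?_⟩, Or.inl ⟨w, hw, e⟩⟩
        have hl2 : C.clu (C.cls w) = l := by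
          obtain ⟨-, -, -, e'⟩ := (h.base.ok.ch_cluster hl hl').1 hch
          rw [e, e']
        rw [← hMw w hw hl2, e]; exact h3

/-- The vertex `fv` gets the class `ap` and the cluster `fl`. -/
def assign : Stmt :=
  .st1 .ty Reg.fv 3 ;; .st1 .cls Reg.fv Reg.ap ;; .st1 .clu Reg.ap Reg.fl ;;
  .ite (.eq (.ld1 (.cnt .sub) Reg.ap) 0) (.asg .nfp (Reg.nfp - 1 : Expr)) .skip ;;
  .ite (.eq (.ld1 (.cnt .sub) Reg.fl) 0) (.asg .nfl (Reg.nfl - 1 : Expr)) .skip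

/-- The lists of children still describe the old state. An empty one shows that the chosen label was
not in use, so it was taken from the top of its stack and has to be popped. -/
theorem assign_spec {x c l : ℕ} (hB : Bd B s) (hN : 3 * C.n + 4 ≤ B) (h : Inv C A s)
    (hf : C.Fit x c l) (hfv : s.reg .fv = x) (hap : s.reg .ap = c) (hfl : s.reg .fl = l)
    (hc : C.UsedP c ∨ 0 < s.reg .nfp ∧ c = s.m1 .freeP (s.reg .nfp - 1))
    (hl : C.UsedL l ∨ 0 < s.reg .nfl ∧ l = s.m1 .freeL (s.reg .nfl - 1)) :
    Run B assign s (Base (C.remove x c l) A) 0 := by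
  have hok := h.base.ok
  have hxn := hok.X_lt x hf.mem
  have hlr := hf.l_rng hok
  have hcr := hf.p_rng hok
  have hcc : s.m1 (.cnt .sub) c = 0 ↔ ¬ C.UsedP c := by
    rw [(h.lw _ _).cnt_eq_zero, Conf.UsedP, not_exists]
    refine forall_congr' fun w => not_congr ?_
    rw [h.rel]; exact hok.ch_class hcr.1
  have hcl : s.m1 (.cnt .sub) l = 0 ↔ ¬ C.UsedL l := by
    rw [(h.lw _ _).cnt_eq_zero, Conf.UsedL, ← not_exists]
    refine not_congr ⟨?_, ?_⟩
    · rintro ⟨w, hw⟩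
      rw [h.rel] at hw
      obtain ⟨u, hu, rfl, e⟩ := (hok.ch_cluster hlr.1 hlr.2).1 hw
      exact ⟨u, hu, e⟩
    · rintro ⟨w, hw, e⟩
      exact ⟨_, (h.rel .sub _ _).2 ((hok.ch_cluster hlr.1 hlr.2).2 ⟨w, hw, rfl, e⟩)⟩
  refine Run.st1' x 3 (by simp [Expr.eval, hfv]) rfl (by omega) ?_
  refine Run.st1' x c (by simp [Expr.eval, HS.st1, hfv]) (by simp [Expr.eval, HS.st1, hap]) (by omega) ?_
  refine Run.st1' c l (by simp [Expr.eval, HS.st1, hap]) (by simp [Expr.eval, HS.st1, hfl]) (by omega) ?_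
  set s1 := ((s.st1 .ty x 3).st1 .cls x c).st1 .clu c l with hs1
  have hB1 : Bd B s1 := by
    refine ⟨hB.reg, fun f j => ?_, hB.m2⟩
    simp only [hs1, HS.st1]; split_ifs; exacts [by omega, by omega, by omega, hB.m1 _ _]
  have hk : s1.reg = s.reg := rfl
  have hk1 : ∀ f, f ≠ .ty → f ≠ .cls → f ≠ .clu → s1.m1 f = s.m1 f := by
    intro f h1 h2 h3; simp [hs1, HS.st1, h1, h2, h3]
  refine (Run.bind (T1 := 0) (T2 := 0) hB1 (Q1 := fun s' =>
    Stack (s.m1 .freeP) (s'.reg .nfp) (2 * C.n) C.n (C.remove x c l).UsedP)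
    (Run.ite (fun hh => ?_) fun hh => ?_) ?_)
  · have h0 : ¬ C.UsedP c := by
      rw [← hcc, ← hk1 (.cnt .sub) (by simp) (by simp) (by simp), ← hap]; exact hh
    obtain ⟨h1, h2⟩ := hc.resolve_left h0
    refine Run.asg (s.reg .nfp - 1) rfl (by have := hB.reg .nfp; omega) ?_
    simp only [HS.set, if_true]
    refine Stack.pop (used := C.UsedP) ?_ fun i => ?_
    · rw [Nat.sub_add_cancel h1]; exact h.base.freeP
    · rw [hok.usedP_remove hf, h2]
  · have h0 : C.UsedP c := by
      rw [← not_not (a := C.UsedP c), ← hcc, ← hk1 (.cnt .sub) (by simp) (by simp) (by simp), ← hap]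
      exact hh
    refine Run.skip (h.base.freeP.congr fun i => ?_)
    rw [hok.usedP_remove hf]
    exact ⟨fun h' => h'.elim id fun e => e ▸ h0, Or.inl⟩
  rintro s2 hB2 hF2 hSP
  have g1 : s2.m1 (.cnt .sub) = s.m1 (.cnt .sub) :=
    (hF2.m1 (.cnt .sub) rfl).trans (hk1 _ (by simp) (by simp) (by simp))
  have g2 : s2.reg .fl = l := (hF2.reg .fl rfl).trans hfl
  have g3 : s2.reg .nfl = s.reg .nfl := hF2.reg .nfl rfl
  refine (Run.full (Q := fun s' =>
    Stack (s.m1 .freeL) (s'.reg .nfl) C.n C.n (C.remove x c l).UsedL)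
    (T := 0) (Run.ite (fun hh => ?_) fun hh => ?_) hB2).mono le_rfl ?_
  · have h0 : ¬ C.UsedL l := by rw [← hcl, ← g1, ← g2]; exact hh
    obtain ⟨h1, h2⟩ := hl.resolve_left h0
    refine Run.asg (s.reg .nfl - 1) (by rw [← g3]; rfl) (by have := hB.reg .nfl; omega) ?_
    simp only [HS.set, if_true]
    refine Stack.pop (used := C.UsedL) ?_ fun i => ?_
    · rw [Nat.sub_add_cancel h1]; exact h.base.freeL
    · rw [hok.usedL_remove hf, h2]
  · have h0 : C.UsedL l := by
      rw [← not_not (a := C.UsedL l), ← hcl, ← g1, ← g2]; exact hh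
    refine Run.skip ?_
    rw [g3]
    refine h.base.freeL.congr fun i => ?_
    rw [hok.usedL_remove hf]
    exact ⟨fun h' => h'.elim id fun e => e ▸ h0, Or.inl⟩
  · rintro s3 ⟨hB3, hF3, hSL⟩
    have k1 : ∀ r, r ≠ .nfl → r ≠ .nfp → s3.reg r = s.reg r := fun r h1 h2 =>
      (hF3.reg r (by simp [Stmt.writes, h1])).trans (hF2.reg r (by simp [Stmt.writes, h2]))
    have k2 : ∀ f, s3.m1 f = s1.m1 f := fun f => (hF3.m1 f rfl).trans (hF2.m1 f rfl)
    have k3 : s3.m2 .gm = s.m2 .gm := (hF3.m2 .gm rfl).trans (hF2.m2 .gm rfl)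
    have k5 : s3.reg .nfp = s2.reg .nfp := hF3.reg .nfp rfl
    have kty : s3.m1 .ty = fun j => if j = x then 3 else s.m1 .ty j := by
      rw [k2]; simp [hs1, HS.st1]
    obtain ⟨a1, a2, a3, a4, a5, a6, a7, a8, ⟨a9, a10, a11⟩, a12, a13, a14, a15⟩ := h.base
    have kxc := k1 .xc (by simp) (by simp)
    have kxa := (k2 .xarr).trans (hk1 _ (by simp) (by simp) (by simp))
    refine ⟨a1.remove hf, ?_, ?_, ?_, ?_, ?_, ?_, ?_, ⟨?_, ?_, ?_⟩, ?_, ?_, ?_, ?_⟩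
    · rw [k1 _ (by simp) (by simp)]; exact a2
    · intro w hw
      rw [kty]
      simp only [Conf.remove, Finset.mem_erase]
      by_cases hwx : w = x
      · simp [hwx]
      · simpa [hwx] using a3 w hw
    · intro w h1 h2
      change C.n ≤ w at h1
      rw [kty]; simp [show w ≠ x by omega, a4 w h1 h2]
    · intro w h1 h2
      change 2 * C.n ≤ w at h1
      rw [kty]; simp [show w ≠ x by omega, a5 w h1 h2]
    · rw [k3]; exact a6
    · rw [k2]
      funext j
      by_cases hj : j = x
      · simp [hs1, HS.st1, Conf.remove, hj]
      · simp [hs1, HS.st1, Conf.remove, hj, a7]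
    · rw [k2]
      funext j
      by_cases hj : j = c
      · simp [hs1, HS.st1, Conf.remove, hj]
      · simp [hs1, HS.st1, Conf.remove, hj, a8]
    · rw [kxc, a9]
    · rw [kxc, kxa]; exact a10
    · rw [kxc, kxa]; exact a11
    · exact (Finset.erase_subset _ _).trans a12
    · exact a13
    · rw [(k2 .freeL).trans (hk1 _ (by simp) (by simp) (by simp))]; exact hSL
    · rw [(k2 .freeP).trans (hk1 _ (by simp) (by simp) (by simp)), k5]; exact hSP

/-- Enter the relations of the class `ap` with the cluster `fl` and the vertex `fv`. -/
def link : Stmt :=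
  ins .adj Reg.ap Reg.fl ;; ins .adj Reg.fl Reg.ap ;; ins .sub Reg.fl Reg.ap ;;
  ins .adj Reg.fv Reg.ap ;; ins .adj Reg.ap Reg.fv ;; ins .sub Reg.ap Reg.fv

theorem link_spec {N x c l : ℕ} (hB : Bd B s) (hN : 64 * (4 * N * N + N + 1) ≤ B) (hL : LW N s)
    (hfv : s.reg .fv = x) (hap : s.reg .ap = c) (hfl : s.reg .fl = l) (hx : x < N) (hc : c < N)
    (hl : l < N) :
    Run B link s (fun s' => LW N s' ∧ ∀ κ a b, s'.Lst κ a b ↔ s.Lst κ a b ∨ Conf.New l c x κ a b)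
      0 := by
  have hF : ∀ {κ e e' s1 s2}, Frame (ins κ e e') s1 s2 → s1.reg .fl = l ∧ s1.reg .fv = x ∧
      s1.reg .ap = c → s2.reg .fl = l ∧ s2.reg .fv = x ∧ s2.reg .ap = c :=
    fun h ⟨h1, h2, h3⟩ => ⟨(h.reg _ rfl).trans h1, (h.reg _ rfl).trans h2, (h.reg _ rfl).trans h3⟩
  have r0 : s.reg .fl = l ∧ s.reg .fv = x ∧ s.reg .ap = c := ⟨hfl, hfv, hap⟩
  refine Run.bind (T1 := 0) (T2 := 0) hB (ins_spec (a := c) (b := l) hB hN hL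
    (by simp [Expr.eval, r0]) (by simp [Expr.eval, HS.set, r0]) hc hl) ?_
  rintro s1 hB1 hF1 ⟨hL1, hR1, -⟩
  have r1 := hF hF1 r0
  refine Run.bind (T1 := 0) (T2 := 0) hB1 (ins_spec (a := l) (b := c) hB1 hN hL1
    (by simp [Expr.eval, r1]) (by simp [Expr.eval, HS.set, r1]) hl hc) ?_
  rintro s2 hB2 hF2 ⟨hL2, hR2, -⟩
  have r2 := hF hF2 r1
  refine Run.bind (T1 := 0) (T2 := 0) hB2 (ins_spec (a := l) (b := c) hB2 hN hL2
    (by simp [Expr.eval, r2]) (by simp [Expr.eval, HS.set, r2]) hl hc) ?_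
  rintro s3 hB3 hF3 ⟨hL3, hR3, -⟩
  have r3 := hF hF3 r2
  refine Run.bind (T1 := 0) (T2 := 0) hB3 (ins_spec (a := x) (b := c) hB3 hN hL3
    (by simp [Expr.eval, r3]) (by simp [Expr.eval, HS.set, r3]) hx hc) ?_
  rintro s4 hB4 hF4 ⟨hL4, hR4, -⟩
  have r4 := hF hF4 r3
  refine Run.bind (T1 := 0) (T2 := 0) hB4 (ins_spec (a := c) (b := x) hB4 hN hL4
    (by simp [Expr.eval, r4]) (by simp [Expr.eval, HS.set, r4]) hc hx) ?_
  rintro s5 hB5 hF5 ⟨hL5, hR5, -⟩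
  have r5 := hF hF5 r4
  refine (ins_spec (a := c) (b := x) hB5 hN hL5
    (by simp [Expr.eval, r5]) (by simp [Expr.eval, HS.set, r5]) hc hx).mono le_rfl ?_
  rintro s6 ⟨hL6, hR6, -⟩
  refine ⟨hL6, fun κ a b => ?_⟩
  rw [hR6, hR5, hR4, hR3, hR2, hR1]
  cases κ <;> simp [Conf.New] <;> tauto

/-- Take the vertex `fv` out of the solution. -/
def removeX : Stmt := pickCluster ;; pickClass ;; assign ;; link ;; refresh

/-- The first summand of the time is the search for the class, the second the recomputation. The
array of listed vertices is left alone, so `A` does not shrink with the solution. -/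
theorem removeX_spec {x : ℕ} (hB : Bd B s)
    (hN : 64 * (4 * (3 * C.n) * (3 * C.n) + 3 * C.n + 1) ≤ B)
    (h : Inv C A s) (hx : x ∈ C.X) (hfree : P3Free C.G (C.X.erase x)) (hfv : s.reg .fv = x) :
    Run B removeX s (fun s' => ∃ c l, Inv (C.remove x c l) A s')
      (2 ^ C.X.card * (A.card + 1) + A.card * (2 ^ C.X.card + 1)) := by
  have hok := h.base.ok
  have hxn := hok.X_lt x hx
  have hnB : 3 * C.n + 4 ≤ B := by nlinarith
  refine (Run.bind (T1 := 0) hB (pickCluster_spec hB h hx hfv)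
    (T2 := 2 ^ C.X.card * (A.card + 1) + A.card * (2 ^ C.X.card + 1)) ?_).mono (by omega)
      fun _ h => h
  rintro s1 hB1 hF1 ⟨hl1, hl2⟩
  obtain ⟨l, hl⟩ : ∃ l, s1.reg .fl = l := ⟨_, rfl⟩
  rw [hl] at hl1 hl2
  have h1 := h.frame hF1 (by decide) (by decide)
  have hlr : C.n ≤ l ∧ l < 2 * C.n := by
    rcases hl1 with h' | h'
    · have := hok.ch_rng h'; omega
    · exact ⟨h'.1, h'.2.1⟩
  have e1 : s1.reg .fv = x := (hF1.reg .fv rfl).trans hfv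
  refine Run.bind hB1 (pickClass_spec hB1 hN h1 hx e1 hl hlr.1 hlr.2) ?_
  rintro s2 hB2 hF2 ⟨hc1, hc2⟩
  obtain ⟨c, hc⟩ : ∃ c, s2.reg .ap = c := ⟨_, rfl⟩
  rw [hc] at hc1 hc2
  have h2 := h1.frame hF2 (by decide) (by decide)
  have e2 : s2.reg .fv = x := (hF2.reg .fv rfl).trans e1
  have e3 : s2.reg .fl = l := (hF2.reg .fl rfl).trans hl
  have hf : C.Fit x c l := ⟨hx, hfree, hl1, hc1⟩
  have hcr := hf.p_rng hok
  refine (Run.bind (T1 := 0) hB2 (assign_spec hB2 hnB h2 hf e2 hc e3 ?_ ?_)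
    (T2 := A.card * (2 ^ C.X.card + 1)) ?_).mono (by omega) fun _ h => h
  · rw [hF2.reg .nfp rfl, hF2.m1 .freeP rfl]; exact hc2
  · rw [hF2.reg .nfl rfl, hF2.m1 .freeL rfl, hF1.reg .nfl rfl, hF1.m1 .freeL rfl]; exact hl2
  rintro s3 hB3 hF3 hb3
  have f1 : s3.reg .fv = x := (hF3.reg .fv rfl).trans e2
  have f2 : s3.reg .fl = l := (hF3.reg .fl rfl).trans e3
  have f3 : s3.reg .ap = c := (hF3.reg .ap rfl).trans hc
  have hL3 := h2.lw.frame hF3 (by decide)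
  have hR3 := Lst.frame hF3 (by decide)
  refine (Run.bind (T1 := 0) hB3 (link_spec hB3 hN hL3 f1 f3 f2 (by omega) (by omega) (by omega))
    (T2 := A.card * (2 ^ C.X.card + 1)) ?_).mono (by omega) fun _ h => h
  rintro s4 hB4 hF4 ⟨hL4, hR4⟩
  refine (refresh_spec (C := C.remove x c l) hB4 hN (hb3.frame hF4 (by decide)) hL4
    ((hF4.reg .fl rfl).trans f2) ((hF4.reg .fv rfl).trans f1) hxn hlr.1 hlr.2 ?_).mono ?_
      fun s' hs' => ⟨c, l, hs'⟩
  · intro κ a b ht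
    rw [hR4, hR3, h2.rel, hok.spec_remove hf h2.base.sub ht]
  · refine Nat.mul_le_mul_left _ (Nat.add_le_add_right (Nat.pow_le_pow_right (by omega) ?_) _)
    exact Finset.card_le_card (Finset.erase_subset _ _)

end RemoveVertex

end DynCVD

namespace DynCVD

namespace Conf

section Kernel

variable {C : Conf} {d : ℕ} {K : Set ℕ} {D : Finset ℕ}

/-! ### A small set of vertices that shows every obstruction -/

/-- The set `K` contains the solution, and enough members of every class of enough clusters. -/
structure Kernel (C : Conf) (d : ℕ) (K : Set ℕ) : Prop where
  lt : ∀ w ∈ K, w < C.n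
  sol : ∀ x ∈ C.X, x ∈ K
  ex : ∃ L : Set ℕ,
    (∀ x ∈ C.X, (∀ l, C.Ch x l → l ∈ L) ∨
      ∃ P : Finset ℕ, P.card = d + 2 ∧ ∀ l ∈ P, C.Ch x l ∧ l ∈ L) ∧
    ∀ l ∈ L, ∀ c, C.Ch l c → (∀ w, C.Ch c w → w ∈ K) ∨
      ∃ P : Finset ℕ, P.card = d + 1 ∧ ∀ w ∈ P, C.Ch c w ∧ w ∈ K

theorem OK.adj_iff (h : C.OK) {v w : ℕ} (hv : C.Out v) (hw : C.Out w) (hvw : v ≠ w) :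
    C.G.Adj v w ↔ C.clu (C.cls v) = C.clu (C.cls w) := by
  rw [h.clu_iff v w hv hw]; simp [hvw]

theorem OK.adj_congr (h : C.OK) {v w x : ℕ} (hv : C.Out v) (hw : C.Out w)
    (hvw : C.cls v = C.cls w) (hx : x ∈ C.X) : C.G.Adj x v ↔ C.G.Adj x w :=
  ((h.cls_iff v w hv hw).1 hvw).2 x hx

/-- Two pigeonhole arguments. A solution vertex `x ∉ D` with `d + 2` collected clusters would have
neighbours in two clusters that `D` avoids, and these form with `x` an induced path in `K ∖ D`.
Hence all clusters adjacent to solution vertices outside `D` are collected. Among `d + 1` collected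
members of a class one avoids `D`. So every induced path outside `D` can be moved into `K ∖ D` by
replacing its outside vertices with members of the same classes. -/
theorem Kernel.p3Free (hK : Kernel C d K) (h : C.OK) (hD : D.card ≤ d)
    (hf : ∀ a ∈ K, ∀ b ∈ K, ∀ c ∈ K, a ∉ D → b ∉ D → c ∉ D → C.G.Adj a b → C.G.Adj b c → a ≠ c →
      C.G.Adj a c) : P3Free C.G D := by
  classical
  obtain ⟨L, hL1, hL2⟩ := hK.ex
  -- every vertex of a collected cluster has a twin in `K`
  have twin : ∀ w, C.Out w → w ∉ D → C.clu (C.cls w) ∈ L →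
      ∃ w' ∈ K, w' ∉ D ∧ C.Out w' ∧ C.cls w' = C.cls w := by
    intro w hw hwD hwL
    have hcr := (h.cls_rng w hw).1
    have hlr := h.clu_rng w hw
    have hch : C.Ch (C.clu (C.cls w)) (C.cls w) :=
      (h.ch_cluster hlr.1 hlr.2).2 ⟨w, hw, rfl, rfl⟩
    rcases hL2 _ hwL _ hch with h' | ⟨P, hP, h'⟩
    · exact ⟨w, h' w ((h.ch_class hcr).2 ⟨hw, rfl⟩), hwD, hw, rfl⟩
    · obtain ⟨w', hw', hw'D⟩ := Finset.exists_mem_notMem_of_card_lt_card (s := D) (t := P) (by omega)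
      obtain ⟨h1, h2⟩ := h' w' hw'
      obtain ⟨h3, h4⟩ := (h.ch_class hcr).1 h1
      exact ⟨w', h2, hw'D, h3, h4⟩
  -- a neighbour in every collected cluster adjacent to a solution vertex
  have nbr : ∀ x ∈ C.X, ∀ l, C.Ch x l → l ∈ L → (∀ w ∈ D, C.Out w → C.clu (C.cls w) ≠ l) →
      ∃ w' ∈ K, w' ∉ D ∧ C.Out w' ∧ C.clu (C.cls w') = l ∧ C.G.Adj x w' := by
    intro x hx l hl hlL hlD
    obtain ⟨-, w, hw, rfl, hxw⟩ := (h.ch_vertex (h.X_lt x hx)).1 hl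
    have hwD : w ∉ D := fun hwD => hlD w hwD hw rfl
    obtain ⟨w', h1, h2, h3, h4⟩ := twin w hw hwD hlL
    exact ⟨w', h1, h2, h3, by rw [h4], (h.adj_congr h3 hw h4 hx).2 hxw⟩
  -- all clusters adjacent to a solution vertex outside `D` are collected
  have coll : ∀ x ∈ C.X, x ∉ D → ∀ w, C.Out w → C.G.Adj x w → C.clu (C.cls w) ∈ L := by
    intro x hx hxD w hw hxw
    rcases hL1 x hx with h' | ⟨P, hP, h'⟩
    · exact h' _ ((h.ch_vertex (h.X_lt x hx)).2 ⟨hx, w, hw, rfl, hxw⟩)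
    · exfalso
      -- `E` contains the clusters that `D` meets, at most `d` of them, so two of the `d + 2`
      -- collected clusters remain.
      set E := D.image fun w => C.clu (C.cls w) with hE
      have hEc : E.card ≤ d := Finset.card_image_le.trans hD
      have h2 : 1 < (P \ E).card := by
        have := Finset.le_card_sdiff E P; omega
      obtain ⟨l1, h1, l2, h2, hne⟩ := Finset.one_lt_card.1 h2
      rw [Finset.mem_sdiff] at h1 h2
      have hE' : ∀ l, l ∉ E → ∀ w ∈ D, C.Out w → C.clu (C.cls w) ≠ l := by
        rintro l hl w hw - rfl
        exact hl (Finset.mem_image_of_mem _ hw)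
      obtain ⟨w1, a1, a2, a3, a4, a5⟩ := nbr x hx l1 (h' l1 h1.1).1 (h' l1 h1.1).2 (hE' l1 h1.2)
      obtain ⟨w2, b1, b2, b3, b4, b5⟩ := nbr x hx l2 (h' l2 h2.1).1 (h' l2 h2.1).2 (hE' l2 h2.2)
      have hw12 : w1 ≠ w2 := by rintro rfl; exact hne (a4.symm.trans b4)
      have := hf w1 a1 x (hK.sol x hx) w2 b1 a2 hxD b2 a5.symm b5 hw12
      rw [h.adj_iff a3 b3 hw12, a4, b4] at this
      exact hne this
  intro a b c ha hb hc hab hbc hac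
  by_contra hnac
  have hout : ∀ {w}, w < C.n → w ∉ C.X → C.Out w := fun h1 h2 => ⟨h1, h2⟩
  have han := h.adj_lt _ _ hab
  have hbn := h.adj_lt _ _ hbc
  have hcn := h.adj_lt _ _ hbc.symm
  -- representatives
  have rep : ∀ w, w < C.n → w ∉ D → (C.Out w → C.clu (C.cls w) ∈ L) →
      ∃ w' ∈ K, w' ∉ D ∧ ((w ∈ C.X ∧ w' = w) ∨ (C.Out w ∧ C.Out w' ∧ C.cls w' = C.cls w)) := by
    intro w hwn hwD hwL
    by_cases hwX : w ∈ C.X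
    · exact ⟨w, hK.sol w hwX, hwD, Or.inl ⟨hwX, rfl⟩⟩
    · obtain ⟨w', h1, h2, h3, h4⟩ := twin w ⟨hwn, hwX⟩ hwD (hwL ⟨hwn, hwX⟩)
      exact ⟨w', h1, h2, Or.inr ⟨⟨hwn, hwX⟩, h3, h4⟩⟩
  -- Every induced path contains a solution vertex; if the middle vertex is outside, it is an end,
  -- and `coll` applies to that end.
  have hbL : C.Out b → C.clu (C.cls b) ∈ L := by
    intro hbO
    by_cases haX : a ∈ C.X
    · exact coll a haX ha b hbO hab
    · by_cases hcX : c ∈ C.X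
      · exact coll c hcX hc b hbO hbc.symm
      · exact absurd (h.p3Free a b c haX hbO.2 hcX hab hbc hac) hnac
  have hside : ∀ w, w ∉ D → C.G.Adj b w → C.Out w → C.clu (C.cls w) ∈ L := by
    intro w hwD hbw hwO
    by_cases hbX : b ∈ C.X
    · exact coll b hbX hb w hwO hbw
    · have hbO : C.Out b := ⟨hbn, hbX⟩
      rw [← (h.adj_iff hbO hwO hbw.ne).1 hbw]; exact hbL hbO
  obtain ⟨a', a1, a2, a3⟩ := rep a han ha (hside a ha hab.symm)
  obtain ⟨b', b1, b2, b3⟩ := rep b hbn hb hbL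
  obtain ⟨c', c1, c2, c3⟩ := rep c hcn hc (hside c hc hbc)
  -- Passing to representatives preserves distinctness and adjacency for pairs that do not lie in
  -- one class.
  have tr : ∀ {v v' w w'}, ((v ∈ C.X ∧ v' = v) ∨ (C.Out v ∧ C.Out v' ∧ C.cls v' = C.cls v)) →
      ((w ∈ C.X ∧ w' = w) ∨ (C.Out w ∧ C.Out w' ∧ C.cls w' = C.cls w)) → v ≠ w →
      (C.Out v → C.Out w → C.cls v ≠ C.cls w) → (v' ≠ w' ∧ (C.G.Adj v' w' ↔ C.G.Adj v w)) := by
    rintro v v' w w' (⟨hv, rfl⟩ | ⟨hv, hv', ev⟩) (⟨hw, rfl⟩ | ⟨hw, hw', ew⟩) hne hcl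
    · exact ⟨hne, Iff.rfl⟩
    · exact ⟨fun e => hw'.2 (e ▸ hv), h.adj_congr hw' hw ew hv⟩
    · refine ⟨fun e => hv'.2 (e ▸ hw), ?_⟩
      rw [C.G.adj_comm v', C.G.adj_comm v]; exact h.adj_congr hv' hv ev hw
    · have hne' : v' ≠ w' := by
        rintro rfl; exact hcl hv hw (ev.symm.trans ew)
      refine ⟨hne', ?_⟩
      rw [h.adj_iff hv' hw' hne', h.adj_iff hv hw hne, ev, ew]
  -- No two vertices of an induced path lie in one class: two adjacent ones would agree about the
  -- third vertex, and the two ends would be adjacent.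
  have e1 := tr a3 b3 hab.ne fun hao hbo e => by
    by_cases hcX : c ∈ C.X
    · exact hnac ((h.adj_congr hao hbo e hcX).2 hbc.symm).symm
    · exact hnac (h.p3Free a b c hao.2 hbo.2 hcX hab hbc hac)
  have e2 := tr b3 c3 hbc.ne fun hbo hco e => by
    by_cases haX : a ∈ C.X
    · exact hnac ((h.adj_congr hbo hco e haX).1 hab)
    · exact hnac (h.p3Free a b c haX hbo.2 hco.2 hab hbc hac)
  have e3 := tr a3 c3 hac fun hao hco e => by
    exact hnac ((h.adj_iff hao hco hac).2 (by rw [e]))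
  exact hnac (e3.2.1 (hf a' a1 b' b1 c' c1 a2 b2 c2 (e1.2.2 hab) (e2.2.2 hbc) e3.1))

/-- The vertices of `K ∖ D` do not distinguish `y` and `v`. -/
def PairOK (C : Conf) (K : Set ℕ) (D : Finset ℕ) (y v : ℕ) : Prop :=
  ∀ w ∈ K, w ∉ D → w ≠ y → w ≠ v → (C.G.Adj y w ↔ C.G.Adj v w)

/-- The outcome of an unsuccessful search for obstructions at `y`. -/
def Checked (C : Conf) (K : Set ℕ) (D : Finset ℕ) (y : ℕ) : Prop :=
  ((∀ w ∈ K, w ∉ D → w ∉ C.X → ¬ C.G.Adj y w) ∨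
    ∃ g ∈ K, g ∉ D ∧ g ∉ C.X ∧ C.G.Adj y g ∧ PairOK C K D y g) ∧
  ∀ v ∈ C.X, v ∉ D → C.G.Adj y v → PairOK C K D y v

/-- One outside neighbour `g` of `y` stands for all of them. If nothing in `K ∖ D` distinguishes `y`
and `g`, then the outside neighbours of `y` in `K ∖ D` are exactly the vertices of the cluster of
`g` there. Every conceivable path then has two adjacent vertices, a solution vertex and a solution
neighbour or its partner, that the third vertex would distinguish, or it contradicts this
description of outside neighbourhoods. -/
theorem OK.free_of_checked (h : C.OK) (hc : ∀ y ∈ C.X, y ∉ D → Checked C K D y) :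
    ∀ a ∈ K, ∀ b ∈ K, ∀ c ∈ K, a ∉ D → b ∉ D → c ∉ D → C.G.Adj a b → C.G.Adj b c → a ≠ c →
      C.G.Adj a c := by
  intro a ha b hb c hcK haD hbD hcD hab hbc hac
  by_contra hnac
  have out : ∀ {w}, w < C.n → w ∉ C.X → C.Out w := fun h1 h2 => ⟨h1, h2⟩
  have han := h.adj_lt _ _ hab
  have hbn := h.adj_lt _ _ hbc
  have hcn := h.adj_lt _ _ hbc.symm
  have sym : ∀ {u v}, ¬ C.G.Adj u v → ¬ C.G.Adj v u := fun h h' => h h'.symm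
  by_cases hbX : b ∈ C.X
  · by_cases haX : a ∈ C.X
    · exact hnac (((hc a haX haD).2 b hbX hbD hab c hcK hcD hac.symm hbc.ne').2 hbc)
    · by_cases hcX : c ∈ C.X
      · exact hnac (((hc c hcX hcD).2 b hbX hbD hbc.symm a ha haD hac hab.ne).2 hab.symm).symm
      · rcases (hc b hbX hbD).1 with h' | ⟨g, hgK, hgD, hgX, hbg, hp⟩
        · exact h' a ha haD haX hab.symm
        · have hgn := h.adj_lt _ _ hbg.symm
          have hgo : C.Out g := ⟨hgn, hgX⟩
          -- Both ends are outside neighbours of `b`, so they lie in the cluster of its partner and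
          -- are adjacent.
          have key : ∀ w ∈ K, w ∉ D → w ∉ C.X → C.G.Adj b w → C.clu (C.cls w) = C.clu (C.cls g) := by
            intro w hwK hwD hwX hbw
            have hwo : C.Out w := ⟨h.adj_lt _ _ hbw.symm, hwX⟩
            by_cases e : w = g
            · rw [e]
            · exact ((h.adj_iff hgo hwo (Ne.symm e)).1
                ((hp w hwK hwD hbw.ne' e).1 hbw)).symm
          have e1 := key a ha haD haX hab.symm
          have e2 := key c hcK hcD hcX hbc
          exact hnac ((h.adj_iff ⟨han, haX⟩ ⟨hcn, hcX⟩ hac).2 (e1.trans e2.symm))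
  · have hbo : C.Out b := ⟨hbn, hbX⟩
    -- a solution vertex adjacent to `b` has a partner in the cluster of `b`
    have key : ∀ x ∈ C.X, x ∉ D → C.G.Adj x b → ∃ g ∈ K, g ∉ D ∧ g ∉ C.X ∧ C.G.Adj x g ∧
        PairOK C K D x g ∧ C.clu (C.cls g) = C.clu (C.cls b) := by
      intro x hx hxD hxb
      rcases (hc x hx hxD).1 with h' | ⟨g, hgK, hgD, hgX, hxg, hp⟩
      · exact absurd hxb (h' b hb hbD hbX)
      · refine ⟨g, hgK, hgD, hgX, hxg, hp, ?_⟩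
        have hgo : C.Out g := ⟨h.adj_lt _ _ hxg.symm, hgX⟩
        by_cases e : b = g
        · rw [e]
        · exact (h.adj_iff hgo hbo (Ne.symm e)).1 ((hp b hb hbD hxb.ne' e).1 hxb)
    -- and a vertex outside the solution that is adjacent to `b` is adjacent to it
    have key2 : ∀ x ∈ C.X, x ∉ D → C.G.Adj x b → ∀ w ∈ K, w ∉ D → w ∉ C.X → C.G.Adj b w →
        C.G.Adj x w := by
      intro x hx hxD hxb w hwK hwD hwX hbw
      obtain ⟨g, hgK, hgD, hgX, hxg, hp, e⟩ := key x hx hxD hxb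
      have hwo : C.Out w := ⟨h.adj_lt _ _ hbw.symm, hwX⟩
      have hgo : C.Out g := ⟨h.adj_lt _ _ hxg.symm, hgX⟩
      by_cases e' : w = g
      · rw [e']; exact hxg
      · refine (hp w hwK hwD (fun e => hwX (e ▸ hx)) e').2 ?_
        rw [h.adj_iff hgo hwo (Ne.symm e'), e]
        exact (h.adj_iff hbo hwo hbw.ne).1 hbw
    by_cases haX : a ∈ C.X
    · by_cases hcX : c ∈ C.X
      · obtain ⟨g, hgK, hgD, hgX, hcg, hp, e⟩ := key c hcX hcD hbc.symm
        have hgo : C.Out g := ⟨h.adj_lt _ _ hcg.symm, hgX⟩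
        have hag : C.G.Adj a g := by
          by_cases e' : g = b
          · rw [e']; exact hab
          · exact key2 a haX haD hab g hgK hgD hgX ((h.adj_iff hbo hgo (Ne.symm e')).2 e.symm)
        exact hnac ((hp a ha haD hac hag.ne).2 hag.symm).symm
      · exact hnac (key2 a haX haD hab c hcK hcD hcX hbc)
    · by_cases hcX : c ∈ C.X
      · exact hnac (key2 c hcX hcD hbc.symm a ha haD haX hab.symm).symm
      · exact hnac (h.p3Free a b c haX hbX hcX hab hbc hac)

end Kernel

end Conf

end DynCVD

namespace DynCVD

section Collect

variable {B : ℕ} {p q : Stmt} {s : HS} {Q Q1 : HS → Prop} {T T1 T2 : ℕ} {C : Conf} {A : Finset ℕ}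

/-! ### Collecting the kernel -/

/-- For each `x` in the array `src`, append the first `lim` children of `x` to the array `dst`. -/
def expand (src dst : F1) (sc dc : Reg) (lim : Expr) : Stmt :=
  .asg dc 0 ;;
  forLt .xi sc
    (.asg .xa (.ld1 src Reg.xi) ;;
      .ite (.lt lim (.ld1 (.cnt .sub) Reg.xa)) (.asg .xb lim) (.asg .xb (.ld1 (.cnt .sub) Reg.xa)) ;;
      forLt .xj Reg.xb
        (.st1 dst dc (.ld2 (.arr .sub) Reg.xa Reg.xj) ;; .asg dc (dc + 1 : Expr)))

/-- The first `m` children of `a`. -/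
def HS.Kids (s : HS) (m : ℕ) (a b : ℕ) : Prop :=
  ∃ j < min m (s.m1 (.cnt .sub) a), s.m2 (.arr .sub) a j = b

/-- Two bounds for the number of children are carried along: `M` measures the running time, while
the cruder `N` keeps counters below `B`. Repeated entries are harmless, since only the set listed by
the target array matters. -/
theorem expand_spec {src dst : F1} {sc dc : Reg} {lim : Expr} {m : ℕ → ℕ} {N M : ℕ} (hB : Bd B s)
    (hcnt : ∀ i < s.reg sc, s.m1 (.cnt .sub) (s.m1 src i) ≤ N)
    (hNB : s.reg sc * N + N + 1 < B)
    (hM : ∀ i < s.reg sc, min (m (s.m1 src i)) (s.m1 (.cnt .sub) (s.m1 src i)) ≤ M)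
    (hlim : ∀ s', s'.reg .d = s.reg .d → s'.m1 (.cnt .sub) = s.m1 (.cnt .sub) →
      lim.eval s' = m (s'.reg .xa))
    (h1 : dst ≠ src) (h2 : dst ≠ .cnt .sub)
    (h4 : sc ≠ dc) (h5 : dc ≠ .d) (h6 : sc ≠ .xi) (h7 : sc ≠ .xj) (h8 : sc ≠ .xa) (h9 : sc ≠ .xb)
    (h10 : dc ≠ .xi) (h11 : dc ≠ .xj) (h12 : dc ≠ .xa) (h13 : dc ≠ .xb) :
    Run B (expand src dst sc dc lim) s (fun s' =>
      s'.reg dc ≤ s.reg sc * M ∧ s'.reg dc ≤ s.reg sc * N ∧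
      ∀ b, (∃ t < s'.reg dc, s'.m1 dst t = b) ↔
        ∃ i < s.reg sc, s.Kids (m (s.m1 src i)) (s.m1 src i) b) (s.reg sc * (M + 1)) := by
  refine Run.asg' 0 rfl (by omega) ?_
  have hB1 := hB.set dc (a := 0) (by omega)
  have hw : ∀ r, r ≠ dc → r ≠ .xi → r ≠ .xa → r ≠ .xb → r ≠ .xj → ∀ {s1 s2 : HS},
    Frame (forLt .xi sc
    (.asg .xa (.ld1 src Reg.xi) ;;
      .ite (.lt lim (.ld1 (.cnt .sub) Reg.xa)) (.asg .xb lim) (.asg .xb (.ld1 (.cnt .sub) Reg.xa)) ;;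
      forLt .xj Reg.xb
        (.st1 dst dc (.ld2 (.arr .sub) Reg.xa Reg.xj) ;; .asg dc (dc + 1 : Expr)))) s1 s2 →
        s2.reg r = s1.reg r := by
    intro r a1 a2 a3 a4 a5 s1 s2 hF
    exact hF.reg r (by simp [forLt, Stmt.writes, a1, a2, a3, a4, a5])
  have hwm : ∀ f, f ≠ dst → ∀ {s1 s2 : HS},
    Frame (forLt .xi sc
    (.asg .xa (.ld1 src Reg.xi) ;;
      .ite (.lt lim (.ld1 (.cnt .sub) Reg.xa)) (.asg .xb lim) (.asg .xb (.ld1 (.cnt .sub) Reg.xa)) ;;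
      forLt .xj Reg.xb
        (.st1 dst dc (.ld2 (.arr .sub) Reg.xa Reg.xj) ;; .asg dc (dc + 1 : Expr)))) s1 s2 →
        s2.m1 f = s1.m1 f ∧ s2.m2 = s1.m2 := by
    intro f a1 s1 s2 hF
    exact ⟨hF.m1 f (by simp [forLt, Stmt.stores1, a1]),
      funext fun g => hF.m2 g (by simp [forLt, Stmt.stores2])⟩
  have e0 : ∀ r, r ≠ dc → (s.set dc 0).reg r = s.reg r := fun r hr => by simp [HS.set, hr]
  have hsc : (s.set dc 0).reg sc = s.reg sc := e0 sc h4
  refine (Run.forLt (N := s.reg sc) (T := M) (I := fun j s' =>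
    s'.reg dc ≤ j * M ∧ s'.reg dc ≤ j * N ∧
      ∀ b, (∃ t < s'.reg dc, s'.m1 dst t = b) ↔
        ∃ i < j, s.Kids (m (s.m1 src i)) (s.m1 src i) b) hB1 (hB.reg _) ?_ ?_ ?_ ?_)
  · simp [Stmt.writes, forLt, h10.symm]
  · simp [HS.set, h10]
  · intro j s' hF _
    exact (hw sc h4 h6 h8 h9 h7 hF).trans hsc
  · rintro j s' hj hB' hxi hF ⟨hd1, hd2, hI⟩
    have em1 : s'.m1 src = s.m1 src := (hwm src h1.symm hF).1
    have em2 : s'.m1 (.cnt .sub) = s.m1 (.cnt .sub) := (hwm _ h2.symm hF).1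
    have em3 : s'.m2 = s.m2 := (hwm src h1.symm hF).2
    have ed : s'.reg .d = s.reg .d :=
      (hw .d h5.symm (by simp) (by simp) (by simp) (by simp) hF).trans (e0 _ h5.symm)
    obtain ⟨x, hx⟩ : ∃ x, s.m1 src j = x := ⟨_, rfl⟩
    have hcx : s.m1 (.cnt .sub) x ≤ N := hx ▸ hcnt j hj
    have hMx : min (m x) (s.m1 (.cnt .sub) x) ≤ M := hx ▸ hM j hj
    refine Run.asg' x (by simp [Expr.eval, hxi, em1, hx]) (hx ▸ hB.m1 _ _) ?_
    have hB2 := hB'.set .xa (hx ▸ hB.m1 src j : x < B)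
    refine (Run.bind (T1 := 0) hB2 (Q1 := fun s1 => s1 = (s'.set .xa x).set .xb
      (min (m x) (s.m1 (.cnt .sub) x))) (Run.ite (fun hc => ?_) fun hc => ?_) (T2 := M) ?_).mono
        (by omega) fun _ h => h
    · have hl := hlim (s'.set .xa x) (by simp [HS.set, ed]) (by simp [HS.set, em2])
      simp only [Cond.holds, hl] at hc
      simp [HS.set, Expr.eval, em2] at hc
      refine Run.asg (m x) (by rw [hl]; simp [HS.set]) (by omega) ?_
      rw [min_eq_left hc.le]
    · have hl := hlim (s'.set .xa x) (by simp [HS.set, ed]) (by simp [HS.set, em2])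
      simp only [Cond.holds, hl] at hc
      simp [HS.set, Expr.eval, em2] at hc
      refine Run.asg (s.m1 (.cnt .sub) x) (by simp [Expr.eval, HS.set, em2]) (by omega) ?_
      rw [min_eq_right hc]
    · rintro s1 hB1 - rfl
      set k := min (m x) (s.m1 (.cnt .sub) x) with hk
      have hkN : k ≤ N := (min_le_right _ _).trans hcx
      have hdj : s'.reg dc + k + 1 < B := by
        have : (j + 1) * N ≤ s.reg sc * N := Nat.mul_le_mul_right _ hj
        nlinarith
      refine (Run.forLt (N := k) (T := 0) (I := fun i s2 =>
        s2.reg dc = s'.reg dc + i ∧ (∀ t < s'.reg dc, s2.m1 dst t = s'.m1 dst t) ∧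
        ∀ t < i, s2.m1 dst (s'.reg dc + t) = s.m2 (.arr .sub) x t) hB1 (by omega) ?_ ?_ ?_ ?_).mono
          (by omega) ?_
      · simp [Stmt.writes, h11.symm]
      · simp [HS.set, h11, h12, h13]
      · intro i s2 hF2 _
        have : s2.reg .xb = _ := hF2.reg .xb (by simp [forLt, Stmt.writes, h13.symm])
        simp [Expr.eval, this, HS.set]
      · rintro i s2 hi hB2 hxj hF2 ⟨a1, a2, a3⟩
        have f1 : s2.reg .xa = _ := hF2.reg .xa (by simp [forLt, Stmt.writes, h12.symm])
        simp only [HS.set, reduceCtorEq, if_false, if_true] at f1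
        have f2 : s2.m2 (.arr .sub) = s'.m2 (.arr .sub) := hF2.m2 (.arr .sub) rfl
        refine Run.st1' (s'.reg dc + i) (s.m2 (.arr .sub) x i) (by simp [Expr.eval, a1])
          (by simp [Expr.eval, f1, f2, hxj, em3]) (hB.m2 _ _ _) ?_
        refine Run.asg (s'.reg dc + (i + 1)) (by simp only [HS.st1, Expr.eval, a1]; rfl)
          (by omega) ⟨by simp [HS.set, h11], fun t ht => ?_, fun t ht => ?_⟩
        · simp [HS.set, HS.st1, show t ≠ s'.reg dc + i by omega, a2 t ht]
        · by_cases e : t = i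
          · simp [HS.set, HS.st1, e]
          · simp [HS.set, HS.st1, e, a3 t (by omega)]
      · rintro s2 ⟨a1, a2, a3⟩
        refine ⟨?_, ?_, fun b => ?_⟩
        · simp only [HS.set, h10, if_false, a1]; nlinarith
        · simp only [HS.set, h10, if_false, a1]; nlinarith
        · simp only [HS.set, h10, if_false, a1]
          have : (∃ i < j + 1, s.Kids (m (s.m1 src i)) (s.m1 src i) b) ↔
              (∃ i < j, s.Kids (m (s.m1 src i)) (s.m1 src i) b) ∨ s.Kids (m x) x b := by
            simp only [Nat.lt_succ_iff_lt_or_eq, or_and_right, exists_or, exists_eq_left, hx]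
          rw [this, ← hI b]
          constructor
          · rintro ⟨t, ht, rfl⟩
            by_cases e : t < s'.reg dc
            · exact Or.inl ⟨t, e, (a2 t e).symm⟩
            · refine Or.inr ⟨t - s'.reg dc, by omega, ?_⟩
              rw [← a3 _ (by omega)]; congr 1; omega
          · rintro (⟨t, ht, rfl⟩ | ⟨t, ht, rfl⟩)
            · exact ⟨t, by omega, a2 t ht⟩
            · exact ⟨s'.reg dc + t, by omega, a3 t ht⟩

/-- Collect the kernel for the search depth `d` in the array `karr`. -/
def collect : Stmt :=
  expand .xarr .larr .xc .lc (Reg.d + 2 : Expr) ;;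
  expand .larr .parr .lc .pc (.ld1 (.cnt .sub) Reg.xa) ;;
  expand .parr .karr .pc .kc (Reg.d + 1 : Expr) ;;
  forLt .xi Reg.xc (.st1 .karr Reg.kc (.ld1 .xarr Reg.xi) ;; .asg .kc (Reg.kc + 1 : Expr))

/-- The set listed in the array `karr`. -/
def HS.kset (s : HS) : Set ℕ := {w | ∃ t < s.reg .kc, s.m1 .karr t = w}

/-- An upper bound for the size of the kernel. -/
def kerBound (z d : ℕ) : ℕ := z * (d + 2) * 2 ^ z * (d + 1) + z

/-- The bound `kerBound` is exponential in the size of the solution and useless for keeping numbers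
below `B`. For that purpose each list is bounded by `3 * n`, which gives at most `27 * n ^ 4`
collected members; this explains the assumption on `(C.n + 1) ^ 4`. -/
theorem collect_spec {d : ℕ} (hB : Bd B s) (hN : 100 * (C.n + 1) ^ 4 < B) (h : Inv C A s)
    (hA : A = C.X) (hd : s.reg .d = d) (hdn : d ≤ C.n) :
    Run B collect s (fun s' => C.Kernel d s'.kset ∧ s'.reg .kc ≤ kerBound A.card d)
      (4 * kerBound A.card d + 4 * A.card) := by
  have hok := h.base.ok
  obtain ⟨n, hn⟩ : ∃ n, C.n = n := ⟨_, rfl⟩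
  obtain ⟨z, hz⟩ : ∃ z, A.card = z := ⟨_, rfl⟩
  have hxc : s.reg .xc = z := h.base.listing.card.trans hz
  have hzn : z ≤ n := by rw [← hxc, ← hn]; exact h.base.xc_le
  rw [hn] at hN hdn
  have hcn : ∀ a, s.m1 (.cnt .sub) a ≤ 3 * n := fun a => hn ▸ (h.lw .sub a).cnt_le
  have hp2 : n ^ 2 ≤ (n + 1) ^ 4 :=
    (Nat.pow_le_pow_left (by omega) 2).trans (Nat.pow_le_pow_right (by omega) (by omega))
  have hp1 : n + 1 ≤ (n + 1) ^ 4 := by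
    simpa using Nat.pow_le_pow_right (n := n + 1) (i := 1) (j := 4) (by omega) (by omega)
  have hp3 : n ^ 3 ≤ (n + 1) ^ 4 :=
    (Nat.pow_le_pow_left (by omega) 3).trans (Nat.pow_le_pow_right (by omega) (by omega))
  have hp4 : n ^ 4 ≤ (n + 1) ^ 4 := Nat.pow_le_pow_left (by omega) 4
  rw [hz]
  -- clusters
  refine (Run.bind hB (T1 := z * (d + 2 + 1)) (T2 := z * (d + 2) * (2 ^ z + 1) +
    (z * (d + 2) * 2 ^ z * (d + 1 + 1) + z)) ((expand_spec (m := fun _ => d + 2) (N := 3 * n)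
      (M := d + 2) hB (fun i _ => hcn _) (by rw [hxc]; nlinarith) (fun _ _ => min_le_left _ _)
      (fun s' e _ => ?_) (by simp) (by simp) (by simp) (by simp) (by simp) (by simp) (by simp)
      (by simp) (by simp) (by simp) (by simp) (by simp)).mono (by rw [hxc]) fun _ h => h) ?_).mono
        ?_ fun _ h => h
  · simp only [Expr.eval, e, hd]; rfl
  rotate_left
  · unfold kerBound
    have e1 : 1 ≤ 2 ^ z := Nat.one_le_two_pow
    have e2 : z * (d + 2) ≤ z * (d + 2) * 2 ^ z := Nat.le_mul_of_pos_right _ e1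
    have e3 : z * (d + 2) * 2 ^ z ≤ z * (d + 2) * 2 ^ z * (d + 1) :=
      Nat.le_mul_of_pos_right _ (by omega)
    nlinarith
  rintro s1 hB1 hF1 ⟨hl1, hl2, hl3⟩
  rw [hxc] at hl1 hl2 hl3
  have h1 := h.frame hF1 (by decide) (by decide)
  have c1 : s1.m1 (.cnt .sub) = s.m1 (.cnt .sub) := hF1.m1 (.cnt .sub) rfl
  have a1 : s1.m2 (.arr .sub) = s.m2 (.arr .sub) := hF1.m2 (.arr .sub) rfl
  have x1 : s1.m1 .xarr = s.m1 .xarr := hF1.m1 .xarr rfl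
  have kids1 : ∀ m a b, s1.Kids m a b ↔ s.Kids m a b := fun m a b => by
    unfold HS.Kids; rw [c1, a1]
  have hcluster : ∀ i < s1.reg .lc, C.n ≤ s1.m1 .larr i ∧ s1.m1 .larr i < 2 * C.n := by
    intro i hi
    obtain ⟨j, hj, k, hk, e⟩ := (hl3 _).1 ⟨i, hi, rfl⟩
    have := (h.rel .sub _ _).1 ((h.lw .sub _).arr_mem (lt_of_lt_of_le hk (min_le_right _ _)))
    rw [e] at this
    have h3 := h.base.xarr_lt (hxc ▸ hj)
    have := hok.ch_rng this
    omega
  have hlc3 : s1.reg .lc ≤ 3 * n ^ 2 := hl2.trans (by nlinarith)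
  -- classes
  refine Run.bind hB1 (T1 := z * (d + 2) * (2 ^ z + 1)) ((expand_spec (m := s.m1 (.cnt .sub))
      (N := 3 * n) (M := 2 ^ z) hB1 (fun i _ => by rw [c1]; exact hcn _) (by nlinarith)
      (fun i hi => (min_le_right _ _).trans ?_)
      (fun s' _ e => ?_) (by simp) (by simp) (by simp) (by simp) (by simp) (by simp) (by simp)
      (by simp) (by simp) (by simp) (by simp) (by simp)).mono (Nat.mul_le_mul_right _ hl1)
        fun _ h => h) ?_
  · have := hcluster i hi
    rw [← hz, hA]
    exact cnt_sub_le hok h1.lw this.1 this.2 fun b => (h1.rel .sub _ b).1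
  · simp [Expr.eval, e, c1]
  rintro s2 hB2 hF2 ⟨hp1', hp2', hp3'⟩
  have h2 := h1.frame hF2 (by decide) (by decide)
  have c2 : s2.m1 (.cnt .sub) = s.m1 (.cnt .sub) := (hF2.m1 (.cnt .sub) rfl).trans c1
  have a2 : s2.m2 (.arr .sub) = s.m2 (.arr .sub) := (hF2.m2 (.arr .sub) rfl).trans a1
  have x2 : s2.m1 .xarr = s.m1 .xarr := (hF2.m1 .xarr rfl).trans x1
  have kids2 : ∀ m a b, s2.Kids m a b ↔ s.Kids m a b := fun m a b => by
    unfold HS.Kids; rw [c2, a2]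
  have hpc3 : s2.reg .pc ≤ 9 * n ^ 3 := hp2'.trans (by nlinarith)
  have hd2 : s2.reg .d = d := (hF2.reg .d rfl).trans ((hF1.reg .d rfl).trans hd)
  -- members
  refine Run.bind hB2 (T1 := z * (d + 2) * 2 ^ z * (d + 1 + 1)) ((expand_spec
      (m := fun _ => d + 1) (N := 3 * n) (M := d + 1) hB2 (fun i _ => by rw [c2]; exact hcn _)
      (by nlinarith) (fun _ _ => min_le_left _ _)
      (fun s' e _ => ?_) (by simp) (by simp) (by simp) (by simp) (by simp) (by simp) (by simp)
      (by simp) (by simp) (by simp) (by simp) (by simp)).mono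
        (Nat.mul_le_mul_right _ (hp1'.trans (Nat.mul_le_mul_right _ hl1))) fun _ h => h) ?_
  · simp only [Expr.eval, e, hd2]; rfl
  rintro s3 hB3 hF3 ⟨hk1, hk2, hk3⟩
  have x3 : s3.m1 .xarr = s.m1 .xarr := (hF3.m1 .xarr rfl).trans x2
  have xc3 : s3.reg .xc = z := (hF3.reg .xc rfl).trans
    ((hF2.reg .xc rfl).trans ((hF1.reg .xc rfl).trans hxc))
  have hkc3 : s3.reg .kc ≤ 27 * n ^ 4 := hk2.trans (by nlinarith)
  have hkc4 : s3.reg .kc ≤ z * (d + 2) * 2 ^ z * (d + 1) :=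
    hk1.trans (Nat.mul_le_mul_right _ (hp1'.trans (Nat.mul_le_mul_right _ hl1)))
  -- solution vertices
  refine (Run.forLt (N := z) (T := 0) (I := fun i s4 => s4.reg .kc = s3.reg .kc + i ∧
    (∀ t < s3.reg .kc, s4.m1 .karr t = s3.m1 .karr t) ∧
    ∀ t < i, s4.m1 .karr (s3.reg .kc + t) = s.m1 .xarr t) hB3 (by omega) rfl ?_ ?_ ?_).mono
      (by omega) ?_
  · simp [HS.set]
  · intro i s4 hF _; exact (hF.reg .xc rfl).trans xc3
  · rintro i s4 hi hB4 hxi hF ⟨b1, b2, b3⟩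
    refine Run.st1' (s3.reg .kc + i) (s.m1 .xarr i) (by simp [Expr.eval, b1])
      (by simp [Expr.eval, hF.m1 .xarr rfl, x3, hxi]) (hB.m1 _ _) ?_
    refine Run.asg (s3.reg .kc + (i + 1)) (by simp only [HS.st1, Expr.eval, b1]; rfl)
      (by omega) ⟨by simp [HS.set], fun t ht => ?_, fun t ht => ?_⟩
    · simp [HS.set, HS.st1, show t ≠ s3.reg .kc + i by omega, b2 t ht]
    · by_cases e : t = i
      · simp [HS.set, HS.st1, e]
      · simp [HS.set, HS.st1, e, b3 t (by omega)]
  rintro s4 ⟨b1, b2, b3⟩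
  have hmem : ∀ w, w ∈ s4.kset ↔ (∃ i < s2.reg .pc, s.Kids (d + 1) (s2.m1 .parr i) w) ∨ w ∈ A := by
    intro w
    have : (∃ i < s2.reg .pc, s.Kids (d + 1) (s2.m1 .parr i) w) ↔
        ∃ t < s3.reg .kc, s3.m1 .karr t = w := by
      rw [hk3]; simp only [kids2]
    rw [this]
    constructor
    · rintro ⟨t, ht, rfl⟩
      by_cases e : t < s3.reg .kc
      · exact Or.inl ⟨t, e, (b2 t e).symm⟩
      · right
        have : s4.m1 .karr t = s.m1 .xarr (t - s3.reg .kc) := by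
          rw [← b3 _ (by omega)]; congr 1; omega
        rw [this]
        exact h.base.listing.mem _ (by omega)
    · rintro (⟨t, ht, rfl⟩ | hw)
      · exact ⟨t, by omega, b2 t ht⟩
      · obtain ⟨i, hi, rfl⟩ := h.base.listing.all w hw
        exact ⟨s3.reg .kc + i, by omega, b3 i (by omega)⟩
  have hKid : ∀ {m a b}, s.Kids m a b → C.Ch a b := by
    rintro m a b ⟨j, hj, rfl⟩
    exact (h.rel .sub _ _).1 ((h.lw .sub _).arr_mem (lt_of_lt_of_le hj (min_le_right _ _)))
  have hclass : ∀ i < s2.reg .pc, 2 * C.n ≤ s2.m1 .parr i := by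
    intro i hi
    obtain ⟨j, hj, hk⟩ := (hp3' _).1 ⟨i, hi, rfl⟩
    have h3 := hcluster j hj
    have := hok.ch_rng (hKid ((kids1 _ _ _).1 hk))
    omega
  -- Either the list ends before the limit and is copied completely, or its first `m` entries are
  -- `m` different children.
  have hfew : ∀ m a, (∀ b, C.Ch a b → s.Kids m a b) ∨
      ∃ P : Finset ℕ, P.card = m ∧ ∀ b ∈ P, C.Ch a b ∧ s.Kids m a b := by
    intro m a
    by_cases hm : s.m1 (.cnt .sub) a ≤ m
    · left
      intro b hb
      obtain ⟨i, hi, rfl⟩ := (h.lw .sub a).exists_arr ((h.rel .sub a b).2 hb)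
      exact ⟨i, by omega, rfl⟩
    · right
      classical
      refine ⟨(Finset.range m).image (s.m2 (.arr .sub) a), ?_, fun b hb => ?_⟩
      · rw [Finset.card_image_of_injOn, Finset.card_range]
        intro i hi j hj e
        simp only [Finset.coe_range, Set.mem_Iio] at hi hj
        exact (h.lw .sub a).arr_inj (by omega) (by omega) e
      · obtain ⟨i, hi, rfl⟩ := Finset.mem_image.1 hb
        have hk : s.Kids m a (s.m2 (.arr .sub) a i) :=
          ⟨i, by have := Finset.mem_range.1 hi; omega, rfl⟩
        exact ⟨hKid hk, hk⟩
  refine ⟨⟨fun w hw => ?_, fun x hx => (hmem x).2 (Or.inr (hA ▸ hx)),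
    {l | ∃ i < s1.reg .lc, s1.m1 .larr i = l}, fun x hx => ?_, ?_⟩, ?_⟩
  · rcases (hmem w).1 hw with ⟨i, hi, hk⟩ | hw
    · exact ((hok.ch_class (hclass i hi)).1 (hKid hk)).1.1
    · exact h.base.lt w hw
  · obtain ⟨i, hi, rfl⟩ := h.base.listing.all x (hA ▸ hx)
    have hin : ∀ l, s.Kids (d + 2) (s.m1 .xarr i) l → ∃ i < s1.reg .lc, s1.m1 .larr i = l :=
      fun l hl => (hl3 l).2 ⟨i, by omega, hl⟩
    rcases hfew (d + 2) (s.m1 .xarr i) with h' | ⟨P, hP, h'⟩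
    · exact Or.inl fun l hl => hin l (h' l hl)
    · exact Or.inr ⟨P, hP, fun l hl => ⟨(h' l hl).1, hin l (h' l hl).2⟩⟩
  · rintro l ⟨i, hi, rfl⟩ c hc
    have hcin : ∃ t < s2.reg .pc, s2.m1 .parr t = c := by
      refine (hp3' c).2 ⟨i, hi, (kids1 _ _ _).2 ?_⟩
      obtain ⟨j, hj, e⟩ := (h.lw .sub _).exists_arr ((h.rel .sub _ _).2 hc)
      exact ⟨j, by omega, e⟩
    obtain ⟨t, ht, rfl⟩ := hcin
    have hin : ∀ w, s.Kids (d + 1) (s2.m1 .parr t) w → w ∈ s4.kset :=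
      fun w hw => (hmem w).2 (Or.inl ⟨t, ht, hw⟩)
    rcases hfew (d + 1) (s2.m1 .parr t) with h' | ⟨P, hP, h'⟩
    · exact Or.inl fun w hw => hin w (h' w hw)
    · exact Or.inr ⟨P, hP, fun w hw => ⟨(h' w hw).1, hin w (h' w hw).2⟩⟩
  · rw [b1, kerBound]; omega

end Collect

end DynCVD

namespace DynCVD

section Find

variable {B : ℕ} {p q : Stmt} {s : HS} {Q Q1 : HS → Prop} {T T1 T2 : ℕ} {C : Conf}
  {D : Finset ℕ} {K : Set ℕ}

/-! ### Searching the kernel for an obstruction -/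

/-- Look for a vertex that distinguishes the adjacent vertices `y` and `vv`. -/
def scan : Stmt :=
  .ite (.and (.eq (.ld1 .mark Reg.vv) 0) (.eq (.ld2 .gm Reg.y Reg.vv) 1))
    (forLt .t Reg.kc
      (.asg .w (.ld1 .karr Reg.t) ;;
        .ite (.and (.eq (.ld1 .mark Reg.w) 0) (.and (.not (.eq Reg.w Reg.y))
            (.and (.not (.eq Reg.w Reg.vv)) (.not (.eq (.ld2 .gm Reg.y Reg.w)
              (.ld2 .gm Reg.vv Reg.w))))))
          (.asg .hit 1 ;; .asg .pa Reg.y ;; .asg .pb Reg.vv ;; .asg .pd Reg.w) .skip))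
    .skip

/-- Look for an unmarked neighbour of `y` outside the solution. -/
def partner : Stmt :=
  .asg .g Reg.y ;;
  forLt .t Reg.kc
    (.asg .w (.ld1 .karr Reg.t) ;;
      .ite (.and (.eq (.ld1 .mark Reg.w) 0) (.and (.eq (.ld1 .ty Reg.w) 3)
        (.eq (.ld2 .gm Reg.y Reg.w) 1))) (.asg .g Reg.w) .skip)

def findP3 : Stmt :=
  .asg .hit 0 ;;
  forLt .yi Reg.xc
    (.asg .y (.ld1 .xarr Reg.yi) ;;
      .ite (.eq (.ld1 .mark Reg.y) 0)
        (partner ;; forLt .jv Reg.xc (.asg .vv (.ld1 .xarr Reg.jv) ;; scan) ;;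
          .asg .vv Reg.g ;; scan) .skip)

/-- The vertices of `D` are marked and `K` is listed in `karr`. -/
structure Scene (C : Conf) (K : Set ℕ) (D : Finset ℕ) (s : HS) : Prop where
  base : Base C C.X s
  mark : ∀ v < C.n, s.m1 .mark v = 0 ↔ v ∉ D
  kset : s.kset = K
  lt : ∀ w ∈ K, w < C.n

/-- `a`, `b` and `c` induce a path. -/
structure Obs (C : Conf) (D : Finset ℕ) (a b c : ℕ) : Prop where
  a_lt : a < C.n
  b_lt : b < C.n
  c_lt : c < C.n
  a_mem : a ∉ D
  b_mem : b ∉ D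
  c_mem : c ∉ D
  ac : c ≠ a
  bc : c ≠ b
  adj : C.G.Adj a b
  dist : ¬ (C.G.Adj a c ↔ C.G.Adj b c)

def HS.HitOK (C : Conf) (D : Finset ℕ) (s : HS) : Prop :=
  s.reg .hit ≠ 0 → Obs C D (s.reg .pa) (s.reg .pb) (s.reg .pd)

def Stmt.keepsScene (p : Stmt) : Bool :=
  p.keeps && !p.stores1 .mark && !p.stores1 .karr && !p.writes .kc

theorem Scene.frame {s' : HS} (h : Scene C K D s) (hF : Frame p s s') (hp : p.keepsScene = true) :
    Scene C K D s' := by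
  simp only [Stmt.keepsScene, Bool.and_eq_true, Bool.not_eq_true'] at hp
  obtain ⟨⟨⟨h1, h2⟩, h3⟩, h4⟩ := hp
  refine ⟨h.base.frame hF h1, ?_, ?_, h.lt⟩
  · rw [hF.m1 _ h2]; exact h.mark
  · rw [← h.kset]; unfold HS.kset; rw [hF.m1 _ h3, hF.reg _ h4]

theorem Scene.karr_mem (h : Scene C K D s) {t : ℕ} (ht : t < s.reg .kc) : s.m1 .karr t ∈ K := by
  rw [← h.kset]; exact ⟨t, ht, rfl⟩

/-- There is no early exit. A recorded hit may be overwritten by a later one but is never cleared,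
so `hit = 0` at the end means that no vertex of the kernel distinguished the pair. -/
theorem scan_spec {y v : ℕ} (hB : Bd B s) (hn : C.n + 1 < B) (h : Scene C K D s) (hy : y < C.n)
    (hyD : y ∉ D) (hv : v < C.n) (hry : s.reg .y = y) (hrv : s.reg .vv = v) (hh : s.HitOK C D) :
    Run B scan s (fun s' => s'.HitOK C D ∧ (s'.reg .hit = 0 → s.reg .hit = 0 ∧
      (v ∉ D → C.G.Adj y v → C.PairOK K D y v))) (s.reg .kc) := by
  have hcond : Cond.holds s (.and (.eq (.ld1 .mark Reg.vv) 0) (.eq (.ld2 .gm Reg.y Reg.vv) 1)) ↔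
      v ∉ D ∧ C.G.Adj y v := by
    simp only [Cond.holds, Expr.eval, hry, hrv]
    exact and_congr (h.mark v hv) h.base.gm_eq_one
  refine Run.ite (fun hc => ?_) fun hc => ?_ <;> rw [hcond] at hc
  · refine (Run.forLt (N := s.reg .kc) (T := 0) (I := fun j s' => s'.HitOK C D ∧
      (s'.reg .hit = 0 → s.reg .hit = 0 ∧ ∀ t < j, s.m1 .karr t ∉ D → s.m1 .karr t ≠ y →
        s.m1 .karr t ≠ v → (C.G.Adj y (s.m1 .karr t) ↔ C.G.Adj v (s.m1 .karr t))))
      hB (hB.reg _) rfl ?_ ?_ ?_).mono (by omega) ?_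
    · exact ⟨hh, fun e => ⟨e, by simp⟩⟩
    · intro j s' hF _; exact hF.reg .kc rfl
    · rintro j s' hj hB' ht hF ⟨a1, a2⟩
      have h' := h.frame hF (by decide)
      have ek : s'.m1 .karr = s.m1 .karr := hF.m1 .karr rfl
      have ey : s'.reg .y = y := (hF.reg .y rfl).trans hry
      have ev : s'.reg .vv = v := (hF.reg .vv rfl).trans hrv
      obtain ⟨w, hw⟩ : ∃ w, s.m1 .karr j = w := ⟨_, rfl⟩
      have hwK : w ∈ K := hw ▸ h.karr_mem hj
      have hwn := h.lt w hwK
      refine Run.asg' w (by simp [Expr.eval, ht, ek, hw]) (by omega) ?_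
      have hg : s'.m2 .gm y w = s'.m2 .gm v w ↔ (C.G.Adj y w ↔ C.G.Adj v w) := by
        rw [h'.base.gm, h'.base.gm]; split_ifs <;> simp_all
      have hcond2 : Cond.holds (s'.set .w w) (.and (.eq (.ld1 .mark Reg.w) 0)
          (.and (.not (.eq Reg.w Reg.y)) (.and (.not (.eq Reg.w Reg.vv))
          (.not (.eq (.ld2 .gm Reg.y Reg.w) (.ld2 .gm Reg.vv Reg.w)))))) ↔
          w ∉ D ∧ w ≠ y ∧ w ≠ v ∧ ¬ (C.G.Adj y w ↔ C.G.Adj v w) := by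
        simp only [Cond.holds, Expr.eval, HS.set, reduceCtorEq, if_false, if_true, ey, ev, hg]
        exact and_congr (h'.mark w hwn) Iff.rfl
      refine Run.ite (fun hc2 => ?_) fun hc2 => ?_ <;> rw [hcond2] at hc2
      · refine Run.asg' 1 rfl (by omega) ?_
        refine Run.asg' y (by simp [Expr.eval, HS.set, ey]) (by omega) ?_
        refine Run.asg' v (by simp [Expr.eval, HS.set, ev]) (by omega) ?_
        refine Run.asg w (by simp [Expr.eval, HS.set]) (by omega) ⟨fun _ => ?_, fun e => ?_⟩
        · simp only [HS.set, reduceCtorEq, if_false, if_true]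
          exact ⟨hy, hv, hwn, hyD, hc.1, hc2.1, hc2.2.1, hc2.2.2.1, hc.2, hc2.2.2.2⟩
        · simp [HS.set] at e
      · refine Run.skip ⟨fun e => a1 e, fun e => ?_⟩
        obtain ⟨e1, e2⟩ := a2 e
        refine ⟨e1, fun t ht => ?_⟩
        rcases Nat.lt_succ_iff_lt_or_eq.1 ht with h' | rfl
        · exact e2 t h'
        · rw [hw]; tauto
    · rintro s' ⟨a1, a2⟩
      refine ⟨a1, fun e => ⟨(a2 e).1, fun _ _ w hwK => ?_⟩⟩
      rw [← h.kset] at hwK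
      obtain ⟨t, ht, rfl⟩ := hwK
      exact (a2 e).2 t ht
  · exact Run.skip ⟨hh, fun e => ⟨e, fun h1 h2 => absurd ⟨h1, h2⟩ hc⟩⟩

/-- The value `y` of `g` means that there is no partner. As `y` is not adjacent to itself, the scan
of this pair that follows then does nothing. -/
theorem partner_spec {y : ℕ} (hB : Bd B s) (hn : C.n + 1 < B) (h : Scene C K D s) (hy : y < C.n)
    (hry : s.reg .y = y) :
    Run B partner s (fun s' => (s'.reg .g = y ∧ ∀ w ∈ K, w ∉ D → w ∉ C.X → ¬ C.G.Adj y w) ∨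
      (s'.reg .g ∈ K ∧ s'.reg .g ∉ D ∧ s'.reg .g ∉ C.X ∧ C.G.Adj y (s'.reg .g))) (s.reg .kc) := by
  refine Run.asg' y (by simp [Expr.eval, hry]) (by omega) ?_
  have hB1 := hB.set .g (a := y) (by omega)
  have hF1 := Frame.set s .g y
  have h1 := h.frame hF1 (by decide)
  refine (Run.forLt (N := s.reg .kc) (T := 0) (I := fun j s' =>
    (s'.reg .g = y ∧ ∀ t < j, s.m1 .karr t ∉ D → s.m1 .karr t ∉ C.X → ¬ C.G.Adj y (s.m1 .karr t)) ∨
    (s'.reg .g ∈ K ∧ s'.reg .g ∉ D ∧ s'.reg .g ∉ C.X ∧ C.G.Adj y (s'.reg .g)))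
    hB1 (hB.reg _) rfl ?_ ?_ ?_).mono (by omega) ?_
  · left; simp [HS.set]
  · intro j s' hF _; exact hF.reg .kc rfl
  · rintro j s' hj hB' ht hF hI
    have h' := h1.frame hF (by decide)
    have ek : s'.m1 .karr = s.m1 .karr := hF.m1 .karr rfl
    have ey : s'.reg .y = y := (hF.reg .y rfl).trans (by simp [HS.set, hry])
    obtain ⟨w, hw⟩ : ∃ w, s.m1 .karr j = w := ⟨_, rfl⟩
    have hwK : w ∈ K := hw ▸ h.karr_mem hj
    have hwn := h.lt w hwK
    refine Run.asg' w (by simp [Expr.eval, ht, ek, hw]) (by omega) ?_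
    have hty : s'.m1 .ty w = 3 ↔ w ∉ C.X := by
      rw [h'.base.ty w hwn]; split_ifs with e <;> simp [e]
    have hcond2 : Cond.holds (s'.set .w w) (.and (.eq (.ld1 .mark Reg.w) 0)
        (.and (.eq (.ld1 .ty Reg.w) 3) (.eq (.ld2 .gm Reg.y Reg.w) 1))) ↔
        w ∉ D ∧ w ∉ C.X ∧ C.G.Adj y w := by
      simp only [Cond.holds, Expr.eval, HS.set, reduceCtorEq, if_false, if_true, ey]
      exact and_congr (h'.mark w hwn) (and_congr hty h'.base.gm_eq_one)
    refine Run.ite (fun hc2 => ?_) fun hc2 => ?_ <;> rw [hcond2] at hc2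
    · refine Run.asg w (by simp [Expr.eval, HS.set]) (by omega) (Or.inr ?_)
      simp only [HS.set, reduceCtorEq, if_false, if_true]
      exact ⟨hwK, hc2⟩
    · refine Run.skip ?_
      rcases hI with ⟨e, hI⟩ | hI
      · refine Or.inl ⟨e, fun t ht => ?_⟩
        rcases Nat.lt_succ_iff_lt_or_eq.1 ht with h' | rfl
        · exact hI t h'
        · rw [hw]; tauto
      · exact Or.inr hI
  · rintro s' (⟨e, hI⟩ | hI)
    · refine Or.inl ⟨e, fun w hwK => ?_⟩
      rw [← h.kset] at hwK
      obtain ⟨t, ht, rfl⟩ := hwK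
      exact hI t ht
    · exact Or.inr hI

/-- The time for one search. -/
def findBound (z c : ℕ) : ℕ := z * ((z + 2) * (c + 1) + 1)

/-- Each solution vertex costs at most `z + 2` passes through the kernel: one to find the partner,
one per solution vertex, and one for the partner. -/
theorem findP3_spec (hB : Bd B s) (hn : C.n + 1 < B) (h : Scene C K D s) :
    Run B findP3 s (fun s' => s'.HitOK C D ∧
      (s'.reg .hit = 0 → ∀ y ∈ C.X, y ∉ D → C.Checked K D y))
      (findBound C.X.card (s.reg .kc)) := by
  have hz : s.reg .xc = C.X.card := h.base.listing.card
  rw [← hz]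
  obtain ⟨k, hk⟩ : ∃ k, s.reg .kc = k := ⟨_, rfl⟩
  rw [hk]
  refine Run.asg' 0 rfl (by omega) ?_
  have hB1 := hB.set .hit (a := 0) (by omega)
  have h1 := h.frame (Frame.set s .hit 0) (by decide)
  refine (Run.forLt (N := s.reg .xc) (T := (s.reg .xc + 2) * (k + 1)) (I := fun j s' =>
    s'.HitOK C D ∧ (s'.reg .hit = 0 → ∀ i < j, s.m1 .xarr i ∉ D → C.Checked K D (s.m1 .xarr i)))
    hB1 (hB.reg _) rfl ?_ ?_ ?_).mono le_rfl ?_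
  · exact ⟨fun e => absurd (by simp [HS.set]) e, by simp⟩
  · intro j s' hF _; exact hF.reg .xc rfl
  · rintro j s' hj hB' hyi hF ⟨a1, a2⟩
    have h' := h1.frame hF (by decide)
    have ex : s'.m1 .xarr = s.m1 .xarr := hF.m1 .xarr rfl
    have exc : s'.reg .xc = s.reg .xc := (hF.reg .xc rfl).trans (by simp [HS.set])
    have ekc : s'.reg .kc = k := (hF.reg .kc rfl).trans (by simp [HS.set, hk])
    obtain ⟨y, hy⟩ : ∃ y, s.m1 .xarr j = y := ⟨_, rfl⟩
    have hyX : y ∈ C.X := hy ▸ h.base.listing.mem j hj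
    have hyn := h.base.lt y hyX
    refine Run.asg' y (by simp [Expr.eval, hyi, ex, hy]) (by omega) ?_
    have hB2 := hB'.set .y (a := y) (by omega)
    have h2 := h'.frame (Frame.set s' .y y) (by decide)
    have hcond : Cond.holds (s'.set .y y) (.eq (.ld1 .mark Reg.y) 0) ↔ y ∉ D := by
      simp only [Cond.holds, Expr.eval, HS.set, if_true]
      exact h'.mark y hyn
    refine Run.ite (fun hc => ?_) fun hc => ?_ <;> rw [hcond] at hc
    · refine (Run.bind (T1 := k) (T2 := (s.reg .xc + 1) * (k + 1)) hB2
        ((partner_spec hB2 hn h2 hyn (by simp [HS.set])).mono (by simp [HS.set, ekc]) fun _ h => h)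
        ?_).mono (by nlinarith) fun _ h => h
      rintro s3 hB3 hF3 hp
      have h3 := h2.frame hF3 (by decide)
      have k3 : s3.reg .kc = k := (hF3.reg .kc rfl).trans (by simp [HS.set, ekc])
      have y3 : s3.reg .y = y := (hF3.reg .y rfl).trans (by simp [HS.set])
      have x3 : s3.reg .xc = s.reg .xc := (hF3.reg .xc rfl).trans (by simp [HS.set, exc])
      have xa3 : s3.m1 .xarr = s.m1 .xarr := (hF3.m1 .xarr rfl).trans (by simp [HS.set, ex])
      have hit3 : s3.reg .hit = s'.reg .hit := (hF3.reg .hit rfl).trans (by simp [HS.set])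
      have ok3 : s3.HitOK C D := by
        unfold HS.HitOK
        rw [hit3, hF3.reg .pa rfl, hF3.reg .pb rfl, hF3.reg .pd rfl]; exact a1
      refine (Run.bind (T1 := s.reg .xc * (k + 1)) (T2 := k) hB3 (Run.forLt (N := s.reg .xc)
        (T := k) (I := fun i s4 => s4.HitOK C D ∧ (s4.reg .hit = 0 → s'.reg .hit = 0 ∧
          ∀ t < i, s.m1 .xarr t ∉ D → C.G.Adj y (s.m1 .xarr t) →
            C.PairOK K D y (s.m1 .xarr t))) hB3 (hB.reg _) rfl ?_ ?_ ?_) ?_).mono (by nlinarith)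
              fun _ h => h
      · exact ⟨ok3, fun e => ⟨hit3.symm.trans e, by simp⟩⟩
      · intro i s4 hF4 _; exact (hF4.reg .xc rfl).trans x3
      · rintro i s4 hi hB4 hjv hF4 ⟨b1, b2⟩
        have h4 := h3.frame hF4 (by decide)
        have hvn := h.base.xarr_lt hi
        obtain ⟨v, hv⟩ : ∃ v, s.m1 .xarr i = v := ⟨_, rfl⟩
        rw [hv] at hvn
        refine Run.asg' v (by simp [Expr.eval, hjv, hF4.m1 .xarr rfl, xa3, hv]) (by omega) ?_
        refine (scan_spec (y := y) (v := v) (hB4.set .vv (by omega)) hn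
          (h4.frame (Frame.set s4 .vv v) (by decide)) hyn hc hvn ?_ (by simp [HS.set]) b1).mono ?_ ?_
        · simp [HS.set, (hF4.reg .y rfl).trans y3]
        · simp [HS.set, (hF4.reg .kc rfl).trans k3]
        · rintro s5 ⟨c1, c2⟩
          refine ⟨c1, fun e => ?_⟩
          obtain ⟨c3, c4⟩ := c2 e
          obtain ⟨c5, c6⟩ := b2 c3
          refine ⟨c5, fun t ht => ?_⟩
          rcases Nat.lt_succ_iff_lt_or_eq.1 ht with h' | rfl
          · exact c6 t h'
          · rw [hv]; exact c4
      · rintro s4 hB4 hF4 ⟨b1, b2⟩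
        have h4 := h3.frame hF4 (by decide)
        have g4 : s4.reg .g = s3.reg .g := hF4.reg .g rfl
        obtain ⟨g, hg⟩ : ∃ g, s3.reg .g = g := ⟨_, rfl⟩
        rw [hg] at hp g4
        have hgn : g < C.n := by
          rcases hp with ⟨rfl, -⟩ | ⟨h', -⟩
          exacts [hyn, h.lt g h']
        refine Run.asg' g (by simp [Expr.eval, g4]) (by omega) ?_
        refine (scan_spec (y := y) (v := g) (hB4.set .vv (by omega)) hn
          (h4.frame (Frame.set s4 .vv g) (by decide)) hyn hc hgn ?_ (by simp [HS.set]) b1).mono ?_ ?_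
        · simp [HS.set, (hF4.reg .y rfl).trans y3]
        · simp [HS.set, (hF4.reg .kc rfl).trans k3]
        · rintro s5 ⟨c1, c2⟩
          refine ⟨c1, fun e => ?_⟩
          obtain ⟨c3, c4⟩ := c2 e
          obtain ⟨c5, c6⟩ := b2 c3
          intro t ht
          rcases Nat.lt_succ_iff_lt_or_eq.1 ht with h' | rfl
          · exact a2 c5 t h'
          · rw [hy]
            refine fun _ => ⟨?_, fun v hv => ?_⟩
            · rcases hp with ⟨-, hp⟩ | ⟨p1, p2, p3, p4⟩
              · exact Or.inl hp
              · exact Or.inr ⟨g, p1, p2, p3, p4, c4 p2 p4⟩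
            · obtain ⟨i, hi, rfl⟩ := h.base.listing.all v hv
              exact c6 i hi
    · refine Run.skip ⟨a1, fun e t ht => ?_⟩
      rcases Nat.lt_succ_iff_lt_or_eq.1 ht with h' | rfl
      · exact a2 e t h'
      · rw [hy]; exact fun h' => absurd h' hc
  · rintro s' ⟨a1, a2⟩
    refine ⟨a1, fun e y hy => ?_⟩
    obtain ⟨i, hi, rfl⟩ := h.base.listing.all y hy
    exact a2 e i hi

end Find

end DynCVD

namespace DynCVD

section Search

variable {B : ℕ} {p q : Stmt} {s : HS} {Q Q1 : HS → Prop} {T T1 T2 : ℕ} {C : Conf}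
  {D : Finset ℕ} {K : Set ℕ}

/-! ### Branching -/

/-- Store `c` in the field `mark` of all entries of a list. -/
def setMarks (k e : Expr) (c : ℕ) : Stmt := forLt .j k (.st1 .mark e (.num c))

open Classical in
theorem setMarks_spec {k e : Expr} {c N : ℕ} {f : ℕ → ℕ} (hB : Bd B s) (hc : c < B) (hN : N < B)
    (hk : ∀ s', Frame (setMarks k e c) s s' → k.eval s' = N)
    (he : ∀ i s', i < N → s'.reg .j = i → Frame (setMarks k e c) s s' → e.eval s' = f i) :
    Run B (setMarks k e c) s (fun s' => ∀ v, s'.m1 .mark v =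
      if ∃ i < N, f i = v then c else s.m1 .mark v) N := by
  refine (Run.forLt (N := N) (T := 0) (I := fun j s' => ∀ v, s'.m1 .mark v =
      if ∃ i < j, f i = v then c else s.m1 .mark v) hB hN rfl ?_ ?_ ?_).mono (by omega) fun _ h => h
  · intro v; simp [HS.set]
  · intro j s' hF _; exact hk s' hF
  · intro j s' hj hB' hr hF hI
    refine Run.st1 (f j) c (he j s' hj hr hF) rfl hc fun v => ?_
    simp only [HS.set, HS.st1, true_and]
    have : (∃ i < j + 1, f i = v) ↔ (∃ i < j, f i = v) ∨ f j = v := by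
      simp only [Nat.lt_succ_iff_lt_or_eq, or_and_right, exists_or, exists_eq_left]
    simp only [this, eq_comm (a := v), hI v]
    by_cases h1 : f j = v <;> simp [h1]

/-- Copy the deletion set on top of the stack three times and add one vertex to each copy. -/
def branch : Stmt :=
  forLt .j Reg.ln
    (.st2 .slot (Reg.sp + 1 : Expr) Reg.j (.ld2 .slot Reg.sp Reg.j) ;;
      .st2 .slot (Reg.sp + 2 : Expr) Reg.j (.ld2 .slot Reg.sp Reg.j)) ;;
  .st2 .slot Reg.sp Reg.ln Reg.pa ;; .st2 .slot (Reg.sp + 1 : Expr) Reg.ln Reg.pb ;;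
  .st2 .slot (Reg.sp + 2 : Expr) Reg.ln Reg.pd ;;
  .st1 .len Reg.sp (Reg.ln + 1 : Expr) ;; .st1 .len (Reg.sp + 1 : Expr) (Reg.ln + 1 : Expr) ;;
  .st1 .len (Reg.sp + 2 : Expr) (Reg.ln + 1 : Expr) ;;
  .asg .sp (Reg.sp + 3 : Expr)

/-- Process the deletion set on top of the stack. -/
def expandTop : Stmt :=
  .asg .sp (Reg.sp - 1 : Expr) ;; .asg .ln (.ld1 .len Reg.sp) ;;
  setMarks Reg.ln (.ld2 .slot Reg.sp Reg.j) 1 ;; findP3 ;;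
  setMarks Reg.ln (.ld2 .slot Reg.sp Reg.j) 0 ;;
  .ite (.eq Reg.hit 0)
    (.asg .found 1 ;; .asg .dlen Reg.ln ;;
      forLt .j Reg.ln (.st1 .dl Reg.j (.ld2 .slot Reg.sp Reg.j)) ;; .asg .sp 0)
    (.ite (.lt Reg.ln Reg.d) branch .skip)

def search : Stmt := .asg .sp 1 ;; .st1 .len 0 0 ;; .loop (.lt 0 Reg.sp) expandTop

/-- The deletion set in position `i` of the stack. -/
def HS.stk (s : HS) (i : ℕ) : Finset ℕ := (Finset.range (s.m1 .len i)).image (s.m2 .slot i)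

/-- The array `dl` lists the deletion set `D`. -/
structure Found (C : Conf) (D : Finset ℕ) (s : HS) : Prop where
  free : P3Free C.G D
  lt : ∀ v ∈ D, v < C.n
  card : s.reg .dlen = D.card
  mem : ∀ i < s.reg .dlen, s.m1 .dl i ∈ D
  all : ∀ v ∈ D, ∃ i < s.reg .dlen, s.m1 .dl i = v

/-- The condition `i ≤ 2 * len i` bounds the height of the stack: a set of size `k` in position `i`
is replaced by sets of size `k + 1` in the positions `i`, `i + 1` and `i + 2`. The field `none`
expresses completeness: as long as nothing is found, each deletion set of size at most `d` extends a
set on the stack. -/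
structure Work (C : Conf) (K : Set ℕ) (d : ℕ) (s : HS) : Prop where
  scene : Scene C K ∅ s
  depth : s.reg .d = d
  len : ∀ i < s.reg .sp, s.m1 .len i ≤ d ∧ i ≤ 2 * s.m1 .len i
  lt : ∀ i < s.reg .sp, ∀ j < s.m1 .len i, s.m2 .slot i j < C.n
  card : ∀ i < s.reg .sp, (s.stk i).card = s.m1 .len i
  none : s.reg .found = 0 → ∀ Y, P3Free C.G Y → Y.card ≤ d → ∃ i < s.reg .sp, s.stk i ⊆ Y
  some : s.reg .found ≠ 0 → s.reg .sp = 0 ∧ ∃ D, D.card ≤ d ∧ Found C D s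

/-- The number of deletion sets in a search of depth `r`. -/
def wt : ℕ → ℕ
  | 0 => 1
  | r + 1 => 3 * wt r + 1

theorem wt_le (r : ℕ) : wt r ≤ 2 * 3 ^ r := by
  -- Strengthened by 1, so that the recursion `3 * wt r + 1` goes through.
  have : ∀ r, wt r + 1 ≤ 2 * 3 ^ r := by
    intro r
    induction r with
    | zero => simp [wt]
    | succ r ih => simp only [wt, pow_succ]; omega
  have := this r; omega

theorem wt_pos (r : ℕ) : 0 < wt r := by cases r <;> simp [wt]

theorem Obs.mem_of_free {a b c : ℕ} (h : Obs C D a b c) {Y : Finset ℕ} (hY : P3Free C.G Y) :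
    a ∈ Y ∨ b ∈ Y ∨ c ∈ Y := by
  by_contra hn
  simp only [not_or] at hn
  obtain ⟨h1, h2, h3⟩ := hn
  refine h.dist ⟨fun hac => ?_, fun hbc => ?_⟩
  · exact hY b a c h2 h1 h3 h.adj.symm hac h.bc.symm
  · exact hY a b c h1 h2 h3 h.adj hbc h.ac.symm

theorem branch_spec {n i k a b c : ℕ} (hB : Bd B s) (hsp : s.reg .sp = i) (hln : s.reg .ln = k)
    (ha : s.reg .pa = a) (hb : s.reg .pb = b) (hc : s.reg .pd = c) (hk : k + 1 < B)
    (hi : i + 3 < B) (hlt : ∀ j < k, s.m2 .slot i j < n) (han : a < n) (hbn : b < n) (hcn : c < n) :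
    Run B branch s (fun s' => s'.reg .sp = i + 3 ∧
      (∀ r < i, s'.m1 .len r = s.m1 .len r ∧ s'.m2 .slot r = s.m2 .slot r) ∧
      (∀ r, i ≤ r → r < i + 3 → s'.m1 .len r = k + 1 ∧ ∀ j < k + 1, s'.m2 .slot r j < n) ∧
      s'.stk i = insert a ((Finset.range k).image (s.m2 .slot i)) ∧
      s'.stk (i + 1) = insert b ((Finset.range k).image (s.m2 .slot i)) ∧
      s'.stk (i + 2) = insert c ((Finset.range k).image (s.m2 .slot i))) k := by
  refine (Run.bind (T1 := k) (T2 := 0) hB ((Run.forLt (N := k) (T := 0) (I := fun j s' =>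
    (∀ r ≤ i, s'.m2 .slot r = s.m2 .slot r) ∧
    ∀ t < j, s'.m2 .slot (i + 1) t = s.m2 .slot i t ∧ s'.m2 .slot (i + 2) t = s.m2 .slot i t)
    hB (by omega) rfl ?_ ?_ ?_).mono (by omega) fun _ h => h) ?_).mono (by omega) fun _ h => h
  · exact ⟨fun r _ => by simp [HS.set], by simp⟩
  · intro j s' hF _; exact (hF.reg .ln rfl).trans hln
  · rintro j s' hj hB' hr hF ⟨a1, a2⟩
    have e1 : s'.reg .sp = i := (hF.reg .sp rfl).trans hsp
    have hv : s'.m2 .slot i j = s.m2 .slot i j := by rw [a1 i le_rfl]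
    refine Run.st2' (i + 1) j (s.m2 .slot i j) (by rw [Expr.eval_add]; simp only [Expr.eval, e1])
      (by simp [Expr.eval, hr]) (by simp [Expr.eval, e1, hr, hv]) (hB.m2 _ _ _) ?_
    refine Run.st2 (i + 2) j (s.m2 .slot i j) (by rw [Expr.eval_add]; simp only [Expr.eval, HS.st2, e1])
      (by simp [Expr.eval, HS.st2, hr]) (by simp [Expr.eval, HS.st2, e1, hr, hv]) (hB.m2 _ _ _)
      ⟨fun r hr => ?_, fun t ht => ?_⟩
    · funext t
      simp [HS.set, HS.st2, show r ≠ i + 1 by omega, show r ≠ i + 2 by omega, a1 r hr]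
    · by_cases e : t = j
      · simp [HS.set, HS.st2, e]
      · simp [HS.set, HS.st2, e, a2 t (by omega)]
  · rintro s1 hB1 hF1 ⟨a1, a2⟩
    have e1 : s1.reg .sp = i := (hF1.reg .sp rfl).trans hsp
    have e2 : s1.reg .ln = k := (hF1.reg .ln rfl).trans hln
    have e3 : s1.reg .pa = a := (hF1.reg .pa rfl).trans ha
    have e4 : s1.reg .pb = b := (hF1.reg .pb rfl).trans hb
    have e5 : s1.reg .pd = c := (hF1.reg .pd rfl).trans hc
    have e6 : s1.m1 .len = s.m1 .len := hF1.m1 .len rfl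
    refine Run.st2' i k a (by simp [Expr.eval, e1]) (by simp [Expr.eval, e2])
      (by simp [Expr.eval, e3]) (ha ▸ hB.reg _) ?_
    refine Run.st2' (i + 1) k b (by rw [Expr.eval_add]; simp only [Expr.eval, HS.st2, e1])
      (by simp [Expr.eval, HS.st2, e2]) (by simp [Expr.eval, HS.st2, e4]) (hb ▸ hB.reg _) ?_
    refine Run.st2' (i + 2) k c (by rw [Expr.eval_add]; simp only [Expr.eval, HS.st2, e1])
      (by simp [Expr.eval, HS.st2, e2]) (by simp [Expr.eval, HS.st2, e5]) (hc ▸ hB.reg _) ?_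
    refine Run.st1' i (k + 1) (by simp [Expr.eval, HS.st2, e1])
      (by rw [Expr.eval_add]; simp only [Expr.eval, HS.st2, e2]) (by omega) ?_
    refine Run.st1' (i + 1) (k + 1) (by rw [Expr.eval_add]; simp only [Expr.eval, HS.st1, HS.st2, e1])
      (by rw [Expr.eval_add]; simp only [Expr.eval, HS.st1, HS.st2, e2]) (by omega) ?_
    refine Run.st1' (i + 2) (k + 1) (by rw [Expr.eval_add]; simp only [Expr.eval, HS.st1, HS.st2, e1])
      (by rw [Expr.eval_add]; simp only [Expr.eval, HS.st1, HS.st2, e2]) (by omega) ?_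
    refine Run.asg (i + 3) (by rw [Expr.eval_add]; simp only [Expr.eval, HS.st1, HS.st2, e1])
      (by omega) ⟨by simp [HS.set], fun r hr => ⟨?_, ?_⟩, fun r hr hr' => ?_, ?_, ?_, ?_⟩
    · simp [HS.set, HS.st1, HS.st2, show r ≠ i by omega, show r ≠ i + 1 by omega,
        show r ≠ i + 2 by omega, e6]
    · funext t
      simp [HS.set, HS.st1, HS.st2, show r ≠ i by omega, show r ≠ i + 1 by omega,
        show r ≠ i + 2 by omega, a1 r hr.le]
    · obtain rfl | rfl | rfl : r = i ∨ r = i + 1 ∨ r = i + 2 := by omega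
      · refine ⟨by simp [HS.set, HS.st1, HS.st2], fun j hj => ?_⟩
        by_cases e : j = k
        · simp [HS.set, HS.st1, HS.st2, e, han]
        · simp [HS.set, HS.st1, HS.st2, e, a1 r le_rfl, hlt j (by omega)]
      · refine ⟨by simp [HS.set, HS.st1, HS.st2], fun j hj => ?_⟩
        by_cases e : j = k
        · simp [HS.set, HS.st1, HS.st2, e, hbn]
        · simp [HS.set, HS.st1, HS.st2, e, a2 j (by omega), hlt j (by omega)]
      · refine ⟨by simp [HS.set, HS.st1, HS.st2], fun j hj => ?_⟩
        by_cases e : j = k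
        · simp [HS.set, HS.st1, HS.st2, e, hcn]
        · simp [HS.set, HS.st1, HS.st2, e, a2 j (by omega), hlt j (by omega)]
    · unfold HS.stk
      simp only [HS.set, HS.st1, HS.st2, true_and, if_true,
        show ¬ i = i + 1 by omega, show ¬ i = i + 2 by omega, false_and, and_false, if_false]
      rw [Finset.range_add_one, Finset.image_insert]
      simp only [if_true]
      congr 1
      refine Finset.image_congr fun j hj => ?_
      have hj : j < k := by simpa using hj
      simp [show j ≠ k by omega, a1 i le_rfl]
    · unfold HS.stk
      simp only [HS.set, HS.st1, HS.st2, true_and, if_true,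
        show ¬ i + 1 = i + 2 by omega, show ¬ i + 1 = i by omega, false_and, and_false, if_false]
      rw [Finset.range_add_one, Finset.image_insert]
      simp only [if_true]
      congr 1
      refine Finset.image_congr fun j hj => ?_
      have hj : j < k := by simpa using hj
      simp [show j ≠ k by omega, a2 j hj]
    · unfold HS.stk
      simp only [HS.set, HS.st1, HS.st2, true_and, if_true,
        show ¬ i + 2 = i + 1 by omega, show ¬ i + 2 = i by omega, false_and, and_false, if_false]
      rw [Finset.range_add_one, Finset.image_insert]
      simp only [if_true]
      congr 1
      refine Finset.image_congr fun j hj => ?_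
      have hj : j < k := by simpa using hj
      simp [show j ≠ k by omega, a2 j hj]

/-- The measure of the work that is left. -/
def HS.work (d : ℕ) (s : HS) : ℕ := ∑ i ∈ Finset.range (s.reg .sp), wt (d - s.m1 .len i)

/-- The top of the stack may be dropped when it extends to no deletion set of size at most `d`. -/
theorem Work.pop {d : ℕ} (h : Work C K d s) (hsp : 0 < s.reg .sp) {s' : HS}
    (h' : Scene C K ∅ s') (hd : s'.reg .d = d) (hsp' : s'.reg .sp = s.reg .sp - 1)
    (hl : s'.m1 .len = s.m1 .len) (hs : s'.m2 .slot = s.m2 .slot) (hf : s'.reg .found = s.reg .found)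
    (hY : ∀ Y, P3Free C.G Y → Y.card ≤ d → ¬ s.stk (s.reg .sp - 1) ⊆ Y) :
    Work C K d s' ∧ s'.work d < s.work d := by
  have hst : ∀ i, s'.stk i = s.stk i := fun i => by unfold HS.stk; rw [hl, hs]
  refine ⟨⟨h', hd, ?_, ?_, ?_, ?_, ?_⟩, ?_⟩
  · rw [hl, hsp']; exact fun i hi => h.len i (by omega)
  · rw [hl, hsp', hs]; exact fun i hi => h.lt i (by omega)
  · rw [hl, hsp']; intro i hi; rw [hst]; exact h.card i (by omega)
  · rw [hf, hsp']
    intro h0 Y h1 h2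
    obtain ⟨i, hi, hY'⟩ := h.none h0 Y h1 h2
    refine ⟨i, ?_, (hst i).symm ▸ hY'⟩
    have : i ≠ s.reg .sp - 1 := by rintro rfl; exact hY Y h1 h2 hY'
    omega
  · rw [hf]; intro h0; have := (h.some h0).1; omega
  · unfold HS.work
    rw [hsp', hl]
    obtain ⟨m, hm⟩ : ∃ m, s.reg .sp = m + 1 := ⟨_, (Nat.succ_pred_eq_of_pos hsp).symm⟩
    rw [hm, Finset.sum_range_succ, Nat.add_sub_cancel]
    have := wt_pos (d - s.m1 .len m)
    omega

/-- The top set either meets all induced paths, by the two kernel theorems, or misses one. In the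
latter case every deletion set above it contains one of the three vertices of that path, and it is
replaced by three larger sets if its size permits. Marks are set and cleared along the set itself,
so marking costs at most `2 * d`, and copying at most `d`. -/
theorem expandTop_spec {d : ℕ} (hB : Bd B s) (hn : 3 * C.n + 4 ≤ B) (hok : C.OK)
    (hK : C.Kernel d K) (hd : d ≤ C.n) (h : Work C K d s) (hsp : 0 < s.reg .sp) :
    Run B expandTop s (fun s' => Work C K d s' ∧ s'.work d < s.work d)
      (findBound C.X.card (s.reg .kc) + 3 * d) := by
  obtain ⟨i, hi⟩ : ∃ i, s.reg .sp = i + 1 := ⟨_, (Nat.succ_pred_eq_of_pos hsp).symm⟩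
  obtain ⟨k, hk⟩ : ∃ k, s.m1 .len i = k := ⟨_, rfl⟩
  have hlen := h.len i (by omega)
  have hlt := h.lt i (by omega)
  have hcard := h.card i (by omega)
  rw [hk] at hlen hlt hcard
  have hf0 : s.reg .found = 0 := by
    by_contra h0; have := (h.some h0).1; omega
  obtain ⟨D, hD⟩ : ∃ D, s.stk i = D := ⟨_, rfl⟩
  rw [hD] at hcard
  have hDi : D = (Finset.range k).image (s.m2 .slot i) := by rw [← hD, HS.stk, hk]
  have hDmem : ∀ v, v ∈ D ↔ ∃ j < k, s.m2 .slot i j = v := by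
    intro v; rw [hDi]; simp
  have hDlt : ∀ v ∈ D, v < C.n := by
    intro v hv; obtain ⟨j, hj, rfl⟩ := (hDmem v).1 hv; exact hlt j hj
  refine Run.asg' i (by rw [Expr.eval_sub]; simp only [Expr.eval, hi]; exact Nat.add_sub_cancel _ _) (by omega) ?_
  refine Run.asg' k (by simp [Expr.eval, HS.set, hk]) (by omega) ?_
  set s1 := (s.set .sp i).set .ln k with hs1
  have hB1 : Bd B s1 := (hB.set .sp (by omega)).set .ln (by omega)
  have sc1 : Scene C K ∅ s1 :=
    (h.scene.frame (Frame.set s .sp i) (by decide)).frame (Frame.set _ .ln k) (by decide)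
  refine (Run.bind (T1 := k) (T2 := findBound C.X.card (s.reg .kc) + 2 * d) hB1
    (setMarks_spec (k := Reg.ln) (e := .ld2 .slot Reg.sp Reg.j) (N := k) (f := s.m2 .slot i) hB1 (by omega) (by omega)
      (fun s' hF => (hF.reg .ln rfl).trans (by simp [hs1, HS.set]))
      (fun j s' hj hr hF => ?_)) ?_).mono (by omega) fun _ h => h
  · simp [Expr.eval, hF.reg .sp rfl, hr, hF.m2 .slot rfl, hs1, HS.set]
  rintro s2 hB2 hF2 hm2
  have b2 := sc1.base.frame hF2 (by decide)
  have sc2 : Scene C K D s2 := by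
    refine ⟨b2, fun v hv => ?_, ?_, sc1.lt⟩
    · rw [hm2, hDmem]
      split_ifs with he
      · simp [he]
      · simp only [he, not_false_iff, iff_true]
        exact (sc1.mark v hv).2 (by simp)
    · rw [← sc1.kset]; unfold HS.kset; rw [hF2.m1 .karr rfl, hF2.reg .kc rfl]
  refine (Run.bind (T1 := findBound C.X.card (s.reg .kc)) (T2 := 2 * d) hB2
    ((findP3_spec hB2 (by omega) sc2).mono (by rw [hF2.reg .kc rfl]; simp [hs1, HS.set])
      fun _ h => h) ?_).mono (by omega) fun _ h => h
  rintro s3 hB3 hF3 ⟨hhit, hmiss⟩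
  have sc3 := sc2.frame hF3 (by decide)
  have sp3 : s3.reg .sp = i := (hF3.reg .sp rfl).trans ((hF2.reg .sp rfl).trans (by simp [hs1, HS.set]))
  have ln3 : s3.reg .ln = k := (hF3.reg .ln rfl).trans ((hF2.reg .ln rfl).trans (by simp [hs1, HS.set]))
  have sl3 : s3.m2 .slot = s.m2 .slot := (hF3.m2 .slot rfl).trans ((hF2.m2 .slot rfl).trans (by simp [hs1, HS.set]))
  refine (Run.bind (T1 := k) (T2 := d) hB3
    (setMarks_spec (k := Reg.ln) (e := .ld2 .slot Reg.sp Reg.j) (N := k) (f := s.m2 .slot i) hB3 (by omega) (by omega)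
      (fun s' hF => (hF.reg .ln rfl).trans ln3)
      (fun j s' hj hr hF => ?_)) ?_).mono (by omega) fun _ h => h
  · simp [Expr.eval, hF.reg .sp rfl, hr, hF.m2 .slot rfl, sp3, sl3]
  rintro s4 hB4 hF4 hm4
  have sc4 : Scene C K ∅ s4 := by
    refine ⟨sc3.base.frame hF4 (by decide), fun v hv => ?_, ?_, sc3.lt⟩
    · rw [hm4]
      split_ifs with he
      · simp
      · rw [sc3.mark v hv, hDmem]; simp [he]
    · rw [← sc3.kset]; unfold HS.kset; rw [hF4.m1 .karr rfl, hF4.reg .kc rfl]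
  have sp4 : s4.reg .sp = i := (hF4.reg .sp rfl).trans sp3
  have ln4 : s4.reg .ln = k := (hF4.reg .ln rfl).trans ln3
  have sl4 : s4.m2 .slot = s.m2 .slot := (hF4.m2 .slot rfl).trans sl3
  have le4 : s4.m1 .len = s.m1 .len := (hF4.m1 .len rfl).trans ((hF3.m1 .len rfl).trans (hF2.m1 .len rfl))
  have d4 : s4.reg .d = d := (hF4.reg .d rfl).trans ((hF3.reg .d rfl).trans
    ((hF2.reg .d rfl).trans (by simp [hs1, HS.set, h.depth])))
  have f4 : s4.reg .found = s.reg .found := (hF4.reg .found rfl).trans ((hF3.reg .found rfl).trans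
    ((hF2.reg .found rfl).trans (by simp [hs1, HS.set])))
  have hit4 : s4.reg .hit = s3.reg .hit := hF4.reg .hit rfl
  refine Run.ite (fun hc => ?_) fun hc => ?_ <;> simp only [Cond.holds, Expr.eval, hit4] at hc
  · change s3.reg .hit = 0 at hc
    have hfree : P3Free C.G D := hK.p3Free hok (hcard.trans_le hlen.1)
      (hok.free_of_checked (hmiss hc))
    refine Run.asg' 1 rfl (by omega) ?_
    refine Run.asg' k (by simp [Expr.eval, HS.set, ln4]) (by omega) ?_
    set s5 := (s4.set .found 1).set .dlen k with hs5
    have hB5 : Bd B s5 := (hB4.set .found (by omega)).set .dlen (by omega)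
    refine (Run.bind (T1 := k) (T2 := 0) hB5 ((Run.forLt (N := k) (T := 0) (I := fun j s' =>
      ∀ t < j, s'.m1 .dl t = s.m2 .slot i t) hB5 (by omega) rfl (by simp) ?_ ?_).mono (by omega)
        fun _ h => h) ?_).mono (by omega) fun _ h => h
    · intro j s' hF _; exact (hF.reg .ln rfl).trans (by simp [hs5, HS.set, ln4])
    · intro j s' hj hB' hr hF hI
      refine Run.st1 j (s.m2 .slot i j) (by simp [Expr.eval, hr])
        (by simp [Expr.eval, hF.reg .sp rfl, hr, hF.m2 .slot rfl, hs5, HS.set, sp4, sl4])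
        (hB.m2 _ _ _) fun t ht => ?_
      by_cases e : t = j
      · simp [HS.set, HS.st1, e]
      · simp [HS.set, HS.st1, e, hI t (by omega)]
    · intro s6 hB6 hF6 hI
      refine Run.asg 0 rfl (by omega) ?_
      have sc6 := ((sc4.frame (Frame.set s4 .found 1) (by decide)).frame
        (Frame.set _ .dlen k) (by decide)).frame hF6 (by decide)
      have sc7 := sc6.frame (Frame.set s6 .sp 0) (by decide)
      have dl6 : s6.reg .dlen = k := (hF6.reg .dlen rfl).trans (by simp [hs5, HS.set])
      have d6 : s6.reg .d = d := (hF6.reg .d rfl).trans (by simp [hs5, HS.set, d4])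
      have fo6 : s6.reg .found = 1 := (hF6.reg .found rfl).trans (by simp [hs5, HS.set])
      refine ⟨⟨sc7, ?_, ?_, ?_, ?_, ?_, ?_⟩, ?_⟩
      · simp [HS.set, d6]
      · simp [HS.set]
      · simp [HS.set]
      · simp [HS.set]
      · intro h0; simp [HS.set, fo6] at h0
      · intro _
        refine ⟨by simp [HS.set], D, hcard.trans_le hlen.1, hfree, hDlt, ?_, ?_, ?_⟩
        · simp [HS.set, dl6, hcard]
        · intro t ht
          simp [HS.set, dl6] at ht ⊢
          rw [hI t ht, hDmem]; exact ⟨t, ht, rfl⟩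
        · intro v hv
          obtain ⟨t, ht, e⟩ := (hDmem v).1 hv
          refine ⟨t, by simpa [HS.set, dl6] using ht, ?_⟩
          simp [HS.set, hI t ht, e]
      · unfold HS.work
        rw [hi, Finset.sum_range_succ]
        have := wt_pos (d - s.m1 .len i)
        simp [HS.set]; omega
  · change ¬ s3.reg .hit = 0 at hc
    have hobs := hhit hc
    obtain ⟨a, ha⟩ : ∃ a, s3.reg .pa = a := ⟨_, rfl⟩
    obtain ⟨b, hb⟩ : ∃ b, s3.reg .pb = b := ⟨_, rfl⟩
    obtain ⟨c, hc'⟩ : ∃ c, s3.reg .pd = c := ⟨_, rfl⟩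
    rw [ha, hb, hc'] at hobs
    refine Run.ite (fun hl => ?_) fun hl => ?_ <;> simp only [Cond.holds, Expr.eval, ln4, d4] at hl
    · refine (Run.full (branch_spec (n := C.n) (i := i) (k := k) (a := a) (b := b) (c := c) hB4 sp4 ln4
        ((hF4.reg .pa rfl).trans ha) ((hF4.reg .pb rfl).trans hb) ((hF4.reg .pd rfl).trans hc')
        (by omega) (by omega) (by rw [sl4]; exact hlt) hobs.a_lt hobs.b_lt hobs.c_lt) hB4).mono
          hlen.1 ?_
      rw [sl4, le4, ← hDi]
      rintro s5 ⟨hB5, hF5, q1, q2, q3, q4, q5, q6⟩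
      have hst : ∀ r < i, s5.stk r = s.stk r := fun r hr => by
        unfold HS.stk; rw [(q2 r hr).1, (q2 r hr).2]
      have f5 : s5.reg .found = 0 := (hF5.reg .found rfl).trans (f4.trans hf0)
      have hcases : ∀ r < i + 3, r < i ∨ (i ≤ r ∧ (r = i ∨ r = i + 1 ∨ r = i + 2)) := by
        intro r hr; omega
      refine ⟨⟨sc4.frame hF5 (by decide), (hF5.reg .d rfl).trans d4, ?_, ?_, ?_, ?_, ?_⟩, ?_⟩
      · rw [q1]
        intro r hr
        rcases hcases r hr with h1 | ⟨h1, -⟩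
        · rw [(q2 r h1).1]; exact h.len r (by omega)
        · rw [(q3 r h1 hr).1]; omega
      · rw [q1]
        intro r hr
        rcases hcases r hr with h1 | ⟨h1, -⟩
        · rw [(q2 r h1).1, (q2 r h1).2]; exact h.lt r (by omega)
        · rw [(q3 r h1 hr).1]; exact (q3 r h1 hr).2
      · rw [q1]
        intro r hr
        rcases hcases r hr with h1 | ⟨h1, h2⟩
        · rw [(q2 r h1).1, hst r h1]; exact h.card r (by omega)
        · rw [(q3 r h1 hr).1]
          rcases h2 with rfl | rfl | rfl
          · rw [q4, Finset.card_insert_of_notMem hobs.a_mem, hcard]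
          · rw [q5, Finset.card_insert_of_notMem hobs.b_mem, hcard]
          · rw [q6, Finset.card_insert_of_notMem hobs.c_mem, hcard]
      · intro _ Y hY1 hY2
        rw [q1]
        obtain ⟨r, hr, hrY⟩ := h.none hf0 Y hY1 hY2
        by_cases e : r = i
        · rw [e, hD] at hrY
          rcases hobs.mem_of_free hY1 with h' | h' | h'
          · exact ⟨i, by omega, q4 ▸ Finset.insert_subset h' hrY⟩
          · exact ⟨i + 1, by omega, q5 ▸ Finset.insert_subset h' hrY⟩
          · exact ⟨i + 2, by omega, q6 ▸ Finset.insert_subset h' hrY⟩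
        · exact ⟨r, by omega, (hst r (by omega)).symm ▸ hrY⟩
      · intro h0; exact absurd f5 h0
      · unfold HS.work
        rw [q1, hi, Finset.sum_range_succ, Finset.sum_range_succ, Finset.sum_range_succ,
          Finset.sum_range_succ, (q3 i (by omega) (by omega)).1, (q3 (i + 1) (by omega) (by omega)).1,
          (q3 (i + 2) (by omega) (by omega)).1, hk]
        have e1 : ∑ r ∈ Finset.range i, wt (d - s5.m1 .len r) =
            ∑ r ∈ Finset.range i, wt (d - s.m1 .len r) :=
          Finset.sum_congr rfl fun r hr => by rw [(q2 r (Finset.mem_range.1 hr)).1]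
        -- The weight is made so that one set of size `k < d` outweighs its three successors by
        -- exactly 1.
        have e2 : wt (d - k) = 3 * wt (d - (k + 1)) + 1 := by
          rw [show d - k = d - (k + 1) + 1 by omega]; rfl
        rw [e1, e2]; omega
    · refine Run.skip (h.pop hsp sc4 d4 (by omega) le4 sl4 f4 fun Y hY1 hY2 hY => ?_)
      rw [hi, Nat.add_sub_cancel, hD] at hY
      -- Here `D` has the full size `d`, so the only candidate that extends it is `D` itself, and
      -- `D` misses the path just found.
      have e : D = Y := Finset.eq_of_subset_of_card_le hY (by omega)
      subst e
      rcases hobs.mem_of_free hY1 with h' | h' | h'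
      exacts [hobs.a_mem h', hobs.b_mem h', hobs.c_mem h']

/-- The time for a search of depth `d`. -/
def searchBound (z k d : ℕ) : ℕ := wt d * (findBound z k + 3 * d + 1)

theorem search_spec {d : ℕ} (hB : Bd B s) (hn : 3 * C.n + 4 ≤ B) (hok : C.OK)
    (hK : C.Kernel d K) (hd : d ≤ C.n) (h : Scene C K ∅ s) (hrd : s.reg .d = d)
    (hf : s.reg .found = 0) :
    Run B search s (fun s' => Scene C K ∅ s' ∧
      (s'.reg .found = 0 → ∀ Y, P3Free C.G Y → ¬ Y.card ≤ d) ∧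
      (s'.reg .found ≠ 0 → ∃ D, D.card ≤ d ∧ Found C D s'))
      (searchBound C.X.card (s.reg .kc) d) := by
  refine Run.asg' 1 rfl (by omega) (Run.st1' 0 0 rfl rfl (by omega) ?_)
  set s1 := (s.set .sp 1).st1 .len 0 0 with hs1
  have hB1 : Bd B s1 := by
    have := hB.set .sp (a := 1) (by omega)
    refine ⟨this.reg, fun f j => ?_, this.m2⟩
    simp only [hs1, HS.st1]; split_ifs; exacts [by omega, this.m1 f j]
  have hF1 : Frame (.asg .sp 1 ;; .st1 .len 0 0) s s1 := by
    refine ⟨fun r hr => ?_, fun f hf => ?_, fun _ _ => rfl⟩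
    · simp [Stmt.writes] at hr; simp [hs1, HS.set, HS.st1, hr]
    · simp [Stmt.stores1] at hf; simp [hs1, HS.set, HS.st1, hf]
  have hlen0 : s1.m1 .len 0 = 0 := by simp [hs1, HS.st1]
  have hsp1 : s1.reg .sp = 1 := by simp [hs1, HS.st1, HS.set]
  have hw : Work C K d s1 := by
    refine ⟨h.frame hF1 (by decide), (hF1.reg .d rfl).trans hrd, ?_, ?_, ?_, ?_, ?_⟩
    · intro i hi
      obtain rfl : i = 0 := by omega
      rw [hlen0]; omega
    · intro i hi
      obtain rfl : i = 0 := by omega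
      rw [hlen0]; intro j hj; omega
    · intro i hi
      obtain rfl : i = 0 := by omega
      simp [HS.stk, hlen0]
    · intro _ Y _ _
      exact ⟨0, by omega, by simp [HS.stk, hlen0]⟩
    · intro h0; exact absurd ((hF1.reg .found rfl).trans hf) h0
  refine (Run.loop (I := Work C K d) (μ := HS.work d) (T := findBound C.X.card (s.reg .kc) + 3 * d)
    hB1 hw ?_).mono ?_ ?_
  · intro s' hB' hF hI hc
    refine (expandTop_spec hB' hn hok hK hd hI hc).mono ?_ fun _ h => h
    rw [hF.reg .kc rfl]; simp [hs1, HS.st1, HS.set]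
  · simp [searchBound, HS.work, hsp1, hlen0]
  · rintro s' ⟨hI, hc⟩
    have h0 : s'.reg .sp = 0 := by
      simp only [Cond.holds, Expr.eval] at hc
      exact Nat.eq_zero_of_not_pos hc
    refine ⟨hI.scene, fun hf Y h1 h2 => ?_, fun hf => (hI.some hf).2⟩
    obtain ⟨i, hi, -⟩ := hI.none hf Y h1 h2
    omega

end Search

end DynCVD

namespace DynCVD

section Solve

variable {B : ℕ} {p q : Stmt} {s : HS} {Q Q1 : HS → Prop} {T T1 T2 : ℕ} {C : Conf}
  {D : Finset ℕ} {K : Set ℕ}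

/-! ### A minimum deletion set -/

/-- Compute a minimum deletion set, by searches of increasing depth. -/
def solve : Stmt :=
  .asg .found 0 ;; .asg .d 0 ;;
  .loop (.eq Reg.found 0) (collect ;; search ;; .asg .d (Reg.d + 1 : Expr))

/-- The time for a solution of size `k` when there is one of size `z`. -/
def solveBound (z k : ℕ) : ℕ :=
  (k + 1) * (4 * kerBound z k + 4 * z + searchBound z (kerBound z k) k + 1)

theorem kerBound_mono {z d d' : ℕ} (h : d ≤ d') : kerBound z d ≤ kerBound z d' := by
  unfold kerBound; gcongr

theorem findBound_mono {z k k' : ℕ} (h : k ≤ k') : findBound z k ≤ findBound z k' := by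
  unfold findBound; gcongr

theorem wt_mono {d d' : ℕ} (h : d ≤ d') : wt d ≤ wt d' := by
  induction h with
  | refl => exact le_rfl
  | step _ ih => exact ih.trans (by simp only [wt]; omega)

theorem searchBound_mono {z k k' d d' : ℕ} (h : k ≤ k') (h' : d ≤ d') :
    searchBound z k d ≤ searchBound z k' d' := by
  unfold searchBound
  exact Nat.mul_le_mul (wt_mono h') (by have := findBound_mono (z := z) h; omega)

/-- A depth is tried only after all smaller ones have failed, so the first set found is a minimum
one. The kernel depends on the depth and is collected anew each time. -/
theorem solve_spec {Y : Finset ℕ} (hB : Bd B s) (hn : 100 * (C.n + 1) ^ 4 < B)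
    (h : Inv C C.X s) (hm : ∀ v < C.n, s.m1 .mark v = 0) (hY : P3Free C.G Y)
    (hmin : ∀ Y', P3Free C.G Y' → Y.card ≤ Y'.card) :
    Run B solve s (fun s' => (∀ v < C.n, s'.m1 .mark v = 0) ∧ ∃ D, D.card = Y.card ∧ Found C D s')
      (solveBound C.X.card Y.card) := by
  have hok := h.base.ok
  have hp1 : C.n + 1 ≤ (C.n + 1) ^ 4 := by
    simpa using Nat.pow_le_pow_right (n := C.n + 1) (i := 1) (j := 4) (by omega) (by omega)
  obtain ⟨k, hk⟩ : ∃ k, Y.card = k := ⟨_, rfl⟩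
  have hkn : k ≤ C.n := by
    rw [← hk, ← Finset.card_range C.n]
    -- The set of all vertices is a deletion set, so the minimum is at most `n`.
    exact hmin _ fun a b c ha _ _ hab => absurd (hok.adj_lt _ _ hab) (by simpa using ha)
  rw [hk]
  refine Run.asg' 0 rfl (by omega) (Run.asg' 0 rfl (by omega) ?_)
  set s1 := (s.set .found 0).set .d 0 with hs1
  have hB1 : Bd B s1 := (hB.set .found (by omega)).set .d (by omega)
  have h1 : Inv C C.X s1 := (h.frame_set (by decide)).frame_set (by decide)
  -- While nothing is found the depth stays at most `k`, the minimum, which gives at most `k + 1`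
  -- rounds; a success sends the measure to `0`.
  refine (Run.loop (T := 4 * kerBound C.X.card k + 4 * C.X.card +
      searchBound C.X.card (kerBound C.X.card k) k) (I := fun s' => (∀ v < C.n, s'.m1 .mark v = 0) ∧
      (s'.reg .found = 0 → s'.reg .d ≤ k ∧ ∀ Y, P3Free C.G Y → s'.reg .d ≤ Y.card) ∧
      (s'.reg .found ≠ 0 → ∃ D, D.card ≤ k ∧ Found C D s'))
    (μ := fun s' => if s'.reg .found = 0 then k + 1 - s'.reg .d else 0) hB1 ?_ ?_).mono ?_ ?_
  · refine ⟨hm, fun _ => ⟨by simp [hs1, HS.set], fun Y _ => by simp [hs1, HS.set]⟩, fun h0 => ?_⟩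
    simp [hs1, HS.set] at h0
  · rintro s2 hB2 hF2 ⟨m2, i2, -⟩ hc
    have hf2 : s2.reg .found = 0 := hc
    obtain ⟨hd2, hlow⟩ := i2 hf2
    obtain ⟨d, hd⟩ : ∃ d, s2.reg .d = d := ⟨_, rfl⟩
    rw [hd] at hd2 hlow
    have h2 := h1.frame hF2 (by decide) (by decide)
    refine (Run.bind (T1 := 4 * kerBound C.X.card d + 4 * C.X.card)
      (T2 := searchBound C.X.card (kerBound C.X.card k) k) hB2
      (collect_spec hB2 hn h2 rfl hd (by omega)) ?_).mono ?_ fun _ h => h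
    · rintro s3 hB3 hF3 ⟨hK, hkc⟩
      have h3 := h2.frame hF3 (by decide) (by decide)
      have hf3 : s3.reg .found = 0 := (hF3.reg .found rfl).trans hf2
      have hd3 : s3.reg .d = d := (hF3.reg .d rfl).trans hd
      have sc3 : Scene C s3.kset ∅ s3 := by
        refine ⟨h3.base, fun v hv => ?_, rfl, hK.lt⟩
        simp [hF3.m1 .mark rfl, m2 v hv]
      refine (Run.bind (T1 := searchBound C.X.card (kerBound C.X.card k) k) (T2 := 0) hB3
        ((search_spec hB3 (by omega) hok hK (by omega) sc3 hd3 hf3).mono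
          (searchBound_mono (hkc.trans (kerBound_mono hd2)) hd2) fun _ h => h) ?_).mono
          (by omega) fun _ h => h
      rintro s4 hB4 hF4 ⟨sc4, hno, hyes⟩
      have hd4 : s4.reg .d = d := (hF4.reg .d rfl).trans hd3
      refine Run.asg (d + 1) (by rw [Expr.eval_add]; simp only [Expr.eval, hd4]) (by omega)
        ⟨⟨fun v hv => ?_, fun hf => ?_, fun hf => ?_⟩, ?_⟩
      · exact (sc4.mark v hv).2 (by simp)
      · have hf : s4.reg .found = 0 := hf
        simp only [HS.set, if_true]
        have : ∀ Y, P3Free C.G Y → d + 1 ≤ Y.card := fun Y hY => by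
          have := hno hf Y hY; omega
        exact ⟨hk ▸ this Y hY, this⟩
      · have hf : s4.reg .found ≠ 0 := hf
        obtain ⟨D, hD, hD'⟩ := hyes hf
        exact ⟨D, by omega, ⟨hD'.free, hD'.lt, hD'.card, hD'.mem, hD'.all⟩⟩
      · simp only [HS.set, reduceCtorEq, if_false, if_true, hf2, hd]
        split_ifs <;> omega
    · have := kerBound_mono (z := C.X.card) hd2
      omega
  · simp [hs1, HS.set, solveBound]
  · rintro s' ⟨⟨m, -, i⟩, hc⟩
    obtain ⟨D, hD, hF⟩ := i hc
    exact ⟨m, D, le_antisymm hD (hk ▸ hmin D hF.free), hF⟩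

end Solve

/-! ### The change of an edge inside the solution -/

theorem P3Free.mono {V : Type*} {G : SimpleGraph V} {X Y : Finset V} (h : P3Free G X) (hXY : X ⊆ Y) :
    P3Free G Y := fun a b c ha hb hc =>
  h a b c (fun h => ha (hXY h)) (fun h => hb (hXY h)) (fun h => hc (hXY h))

namespace Conf

variable {C : Conf} {G' : SimpleGraph ℕ} {u v : ℕ}

/-- Clusters and classes only depend on adjacencies with at least one end outside the solution, and
the changed pair has none. -/
theorem OK.setG (h : C.OK) (hu : u ∈ C.X) (hv : v ∈ C.X)
    (hG : ∀ a b, ¬ (a = u ∧ b = v ∨ a = v ∧ b = u) → (G'.Adj a b ↔ C.G.Adj a b)) :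
    ({C with G := G'} : Conf).OK := by
  have hne : ∀ a b, C.Out b → (G'.Adj a b ↔ C.G.Adj a b) := by
    intro a b hb
    refine hG a b ?_
    rintro (⟨-, rfl⟩ | ⟨-, rfl⟩)
    exacts [hb.2 hv, hb.2 hu]
  refine ⟨h.X_lt, fun a b hab => ?_, h.cls_rng, h.clu_rng, fun a b ha hb => ?_, fun a b ha hb => ?_⟩
  · by_cases e : a = u ∧ b = v ∨ a = v ∧ b = u
    · rcases e with ⟨rfl, -⟩ | ⟨rfl, -⟩
      exacts [h.X_lt _ hu, h.X_lt _ hv]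
    · exact h.adj_lt a b ((hG a b e).1 hab)
  · rw [show ({C with G := G'} : Conf).G.Adj a b ↔ C.G.Adj a b from hne a b hb]
    exact h.clu_iff a b ha hb
  · refine (h.cls_iff a b ha hb).trans (and_congr_right' (forall₂_congr fun x _ => ?_))
    rw [← hne x a ha, ← hne x b hb]

theorem spec_setG (hu : u ∈ C.X) (hv : v ∈ C.X)
    (hG : ∀ a b, ¬ (a = u ∧ b = v ∨ a = v ∧ b = u) → (G'.Adj a b ↔ C.G.Adj a b)) {κ : Kd} {a b : ℕ}
    (hab : ¬ (κ = .adj ∧ (a = u ∧ b = v ∨ a = v ∧ b = u))) :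
    ({C with G := G'} : Conf).Spec κ a b ↔ C.Spec κ a b := by
  have hne : ∀ a b, C.Out b → (G'.Adj a b ↔ C.G.Adj a b) := by
    intro a b hb
    refine hG a b ?_
    rintro (⟨-, rfl⟩ | ⟨-, rfl⟩)
    exacts [hb.2 hv, hb.2 hu]
  have hch : ∀ a b, ({C with G := G'} : Conf).Ch a b ↔ C.Ch a b := by
    intro a b
    refine or_congr (and_congr_right' (exists_congr fun w => and_congr_right fun hw => ?_)) Iff.rfl
    rw [show ({C with G := G'} : Conf).G.Adj a w ↔ C.G.Adj a w from hne a w hw]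
  cases κ with
  | adj =>
    refine or_congr (and_congr_right' (and_congr_right' ?_)) (or_congr (hch a b) (hch b a))
    exact hG a b fun h' => hab ⟨rfl, h'⟩
  | nbr =>
    exact and_congr_right' (exists_congr fun w => and_congr_right fun hw =>
      and_congr_right' (hne b w hw))
  | sub => exact hch a b

end Conf

end DynCVD

namespace DynCVD

section Update

variable {B : ℕ} {p q : Stmt} {s : HS} {Q Q1 : HS → Prop} {T T1 T2 : ℕ} {C : Conf}
  {A D : Finset ℕ}

/-! ### Updates -/

/-- Put the vertex `fv` into the solution if it is not there. -/
def addIfOut : Stmt := .ite (.not (.eq (.ld1 .ty Reg.fv) 0)) addX .skip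

/-- A bound for the time of a move of a vertex when the solutions have size at most `m`. -/
def moveBound (m : ℕ) : ℕ := m + (m + 1) * (2 ^ (m + 1) + 1)

theorem moveBound_mono {m m' : ℕ} (h : m ≤ m') : moveBound m ≤ moveBound m' := by
  unfold moveBound; gcongr; omega

theorem addIfOut_spec {v : ℕ} (hB : Bd B s)
    (hN : 64 * (4 * (3 * C.n) * (3 * C.n) + 3 * C.n + 1) ≤ B)
    (h : Inv C C.X s) (hv : v < C.n) (hfv : s.reg .fv = v) :
    Run B addIfOut s (Inv (C.add v) (C.add v).X) (moveBound C.X.card) := by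
  have hty : (Cond.not (.eq (.ld1 .ty Reg.fv) 0)).holds s ↔ v ∉ C.X := by
    rw [← h.base.ty_eq_zero hv]; simp [Cond.holds, Expr.eval, hfv]
  refine Run.ite (fun hc => ?_) fun hc => ?_
  · exact addX_spec hB hN h hv (hty.1 hc) hfv
  · refine Run.skip ?_
    have : C.add v = C := by
      rw [hty, not_not] at hc
      simp [Conf.add, Finset.insert_eq_of_mem hc]
    rwa [this]

/-- Put all entries of the array `dl` into the solution. -/
def addAll : Stmt := forLt .ui Reg.dlen (.asg .fv (.ld1 .dl Reg.ui) ;; addIfOut)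

/-- The set `Y` enters the solution. -/
def Conf.addSet (C : Conf) (Y : Finset ℕ) : Conf := { C with X := C.X ∪ Y }

theorem addAll_spec (hB : Bd B s) (hN : 64 * (4 * (3 * C.n) * (3 * C.n) + 3 * C.n + 1) ≤ B)
    (h : Inv C C.X s) (hD : Found C D s) :
    Run B addAll s (fun s' => Inv (C.addSet D) (C.X ∪ D) s')
      (D.card * (moveBound (C.X.card + D.card) + 1)) := by
  have hDn : D.card ≤ C.n := by
    simpa using Finset.card_le_card (t := Finset.range C.n) fun x hx => Finset.mem_range.2 (hD.lt x hx)
  have hn4 : C.n < B := by nlinarith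
  have himg : (Finset.range D.card).image (s.m1 .dl) = D := by
    ext v
    simp only [Finset.mem_image, Finset.mem_range, ← hD.card]
    exact ⟨fun ⟨i, hi, e⟩ => e ▸ hD.mem i hi, hD.all v⟩
  refine (Run.forLt (N := D.card) (I := fun j s' =>
    Inv (C.addSet ((Finset.range j).image (s.m1 .dl))) (C.X ∪ (Finset.range j).image (s.m1 .dl)) s')
    (T := moveBound (C.X.card + D.card)) hB (by omega) (by decide) ?_ ?_ ?_).mono le_rfl ?_
  · have e : C.addSet ((Finset.range 0).image (s.m1 .dl)) = C := by simp [Conf.addSet]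
    rw [e]
    simpa using h.frame_set (by decide)
  · intro j s' hF _
    simp only [Expr.eval]; rw [hF.reg _ (by decide), hD.card]
  · intro j s' hj hB' hr hF hI
    have hdl : s'.m1 .dl = s.m1 .dl := hF.m1 _ (by decide)
    have hjD : s.m1 .dl j ∈ D := hD.mem j (by rw [hD.card]; exact hj)
    have hjn := hD.lt _ hjD
    refine Run.asg' (s.m1 .dl j) (by simp [Expr.eval, hr, hdl]) (by omega) ?_
    refine (addIfOut_spec (C := C.addSet ((Finset.range j).image (s.m1 .dl)))
      (hB'.set _ (by omega)) hN (hI.frame_set (by decide)) hjn (by simp [HS.set])).mono ?_ ?_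
    · refine moveBound_mono ((Finset.card_union_le _ _).trans (Nat.add_le_add_left ?_ _))
      exact Finset.card_le_card
        ((Finset.image_subset_image (Finset.range_subset_range.2 hj.le)).trans himg.subset)
    · intro s'' h''
      have e : (C.addSet ((Finset.range j).image (s.m1 .dl))).add (s.m1 .dl j) =
          C.addSet ((Finset.range (j + 1)).image (s.m1 .dl)) := by
        simp [Conf.addSet, Conf.add, Finset.range_add_one, Finset.image_insert, Finset.union_insert]
      rw [e] at h''
      exact h''.frame_set (by decide)
  · intro s' h'
    rwa [himg] at h'

/-- Take all vertices without a mark out of the solution. -/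
def removeAll : Stmt :=
  forLt .ui Reg.xc (.asg .fv (.ld1 .xarr Reg.ui) ;;
    .ite (.and (.eq (.ld1 .mark Reg.fv) 0) (.eq (.ld1 .ty Reg.fv) 0)) removeX .skip)

/-- Every set between `D` and `C.X` is a deletion set, so the vertices outside `D` may leave in any
order. The loop runs over the array of the old solution, which keeps its entries meanwhile. -/
theorem removeAll_spec (hB : Bd B s) (hN : 64 * (4 * (3 * C.n) * (3 * C.n) + 3 * C.n + 1) ≤ B)
    (h : Inv C C.X s) (hD : P3Free C.G D) (hDX : D ⊆ C.X)
    (hm : ∀ v < C.n, s.m1 .mark v = 0 ↔ v ∉ D) :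
    Run B removeAll s (fun s' => ∃ C', C'.n = C.n ∧ C'.G = C.G ∧ C'.X = D ∧ Inv C' C.X s')
      (C.X.card * (moveBound C.X.card + 1)) := by
  have hxc := h.base.listing.card
  have hxn := h.base.xc_le
  have hn4 : C.n < B := by nlinarith
  rw [← hxc]
  refine (Run.forLt (N := s.reg .xc) (I := fun j s' => ∃ C', C'.n = C.n ∧ C'.G = C.G ∧ D ⊆ C'.X ∧
    C'.X ⊆ C.X ∧ (∀ i < j, s.m1 .xarr i ∉ D → s.m1 .xarr i ∉ C'.X) ∧ Inv C' C.X s')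
    (T := moveBound C.X.card) hB (by omega) (by decide) ?_ ?_ ?_).mono (by rw [hxc]) ?_
  · exact ⟨C, rfl, rfl, hDX, subset_rfl, fun i hi => absurd hi (by omega), h.frame_set (by decide)⟩
  · rintro j s' - ⟨C', -, -, -, -, -, hI⟩
    simp only [Expr.eval]; rw [hI.base.listing.card, hxc]
  · rintro j s' hj hB' hr hF ⟨C', hCn, hCG, hDC, hCX, hdone, hI⟩
    obtain ⟨x, hx⟩ : ∃ x, s.m1 .xarr j = x := ⟨_, rfl⟩
    have hxX : x ∈ C.X := hx ▸ h.base.listing.mem j hj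
    have hxn' := h.base.lt x hxX
    have hxa : s'.m1 .xarr = s.m1 .xarr := hF.m1 _ (by decide)
    have hmk : s'.m1 .mark = s.m1 .mark := hF.m1 _ (by decide)
    refine Run.asg' x (by simp [Expr.eval, hr, hxa, hx]) (by omega) ?_
    have hI' : Inv C' C.X (s'.set .fv x) := hI.frame_set (by decide)
    have hc : (Cond.and (.eq (.ld1 .mark Reg.fv) 0) (.eq (.ld1 .ty Reg.fv) 0)).holds
        (s'.set .fv x) ↔ x ∉ D ∧ x ∈ C'.X := by
      rw [← hI'.base.ty_eq_zero (hCn ▸ hxn'), ← hm x hxn', ← hmk]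
      simp [Cond.holds, Expr.eval, HS.set]
    refine Run.ite (fun h' => ?_) fun h' => ?_
    · obtain ⟨h1, h2⟩ := hc.1 h'
      have hle := Finset.card_le_card hCX
      refine (removeX_spec (C := C') (x := x) (hB'.set _ (by omega)) (by rwa [hCn]) hI' h2
        (hCG ▸ hD.mono fun y hy => Finset.mem_erase.2 ⟨fun e => h1 (e ▸ hy), hDC hy⟩)
        (by simp [HS.set])).mono ?_ ?_
      · have := Nat.pow_le_pow_right (n := 2) (by omega) hle
        unfold moveBound
        rw [pow_succ]
        have h3 := Nat.mul_le_mul_right (C.X.card + 1) this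
        have h4 := Nat.mul_le_mul_left C.X.card (Nat.add_le_add_right this 1)
        generalize 2 ^ C.X.card = b at *
        generalize 2 ^ C'.X.card = b' at *
        nlinarith
      · rintro s'' ⟨c, l, h''⟩
        refine ⟨C'.remove x c l, hCn, hCG, fun y hy => Finset.mem_erase.2
          ⟨fun e => h1 (e ▸ hy), hDC hy⟩, (Finset.erase_subset _ _).trans hCX, fun i hi hiD hiX => ?_,
          h''.frame_set (by decide)⟩
        obtain ⟨h3, h4⟩ := Finset.mem_erase.1 hiX
        rcases Nat.lt_succ_iff_lt_or_eq.1 hi with h5 | rfl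
        · exact hdone i h5 hiD h4
        · exact h3 hx
    · rw [hc, not_and] at h'
      refine Run.skip ⟨C', hCn, hCG, hDC, hCX, fun i hi hiD => ?_, hI'.frame_set (by decide)⟩
      rcases Nat.lt_succ_iff_lt_or_eq.1 hi with h5 | rfl
      · exact hdone i h5 hiD
      · rw [hx] at hiD ⊢; exact h' hiD
  · rintro s' ⟨C', h1, h2, h3, h4, h5, h6⟩
    refine ⟨C', h1, h2, (Finset.Subset.antisymm h3 fun x hx => ?_).symm, h6⟩
    by_contra hxD
    obtain ⟨i, hi, rfl⟩ := h.base.listing.all x (h4 hx)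
    exact h5 i hi hxD hx

/-- Copy the array `dl` to the array of the solution. -/
def publish : Stmt :=
  forLt .ui Reg.dlen (.st1 .xarr Reg.ui (.ld1 .dl Reg.ui)) ;; .asg .xc Reg.dlen

/-- The array is rewritten only now, when the solution is the set in `dl`; afterwards it lists
exactly the solution again. -/
theorem publish_spec (hB : Bd B s) (h : Inv C A s) (hn : C.n < B) (hD : Found C C.X s) :
    Run B publish s (Inv C C.X) C.X.card := by
  have hXn : C.X.card ≤ C.n := by
    simpa using Finset.card_le_card (t := Finset.range C.n) fun x hx => Finset.mem_range.2 (hD.lt x hx)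
  refine (Run.bind hB (Run.forLt (N := C.X.card) (T := 0)
    (I := fun j s' => ∀ i < j, s'.m1 .xarr i = s.m1 .dl i)
    hB (by omega) rfl (by simp) ?_ ?_) (T1 := C.X.card * 1) (T2 := 0) ?_).mono (by omega)
      fun _ h => h
  · intro j s' hF _
    simp only [Expr.eval]; rw [hF.reg _ (by decide), hD.card]
  · intro j s' hj hB' hr hF hI
    have hdl : s'.m1 .dl = s.m1 .dl := hF.m1 _ (by decide)
    have hjn := hD.lt _ (hD.mem j (by rw [hD.card]; exact hj))
    refine Run.st1 j (s.m1 .dl j) hr (by simp [Expr.eval, hr, hdl]) (by omega) fun i hi => ?_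
    simp only [HS.set, HS.st1, true_and]
    split_ifs with e
    · rw [e]
    · exact hI i (by omega)
  · intro s1 hB1 hF1 hI
    have hdl : s1.reg .dlen = C.X.card := (hF1.reg _ (by decide)).trans hD.card
    refine Run.asg C.X.card hdl (by omega) ?_
    have hn' : s1.reg .n = s.reg .n := hF1.reg _ (by decide)
    have hnl : s1.reg .nfl = s.reg .nfl := hF1.reg _ (by decide)
    have hnp : s1.reg .nfp = s.reg .nfp := hF1.reg _ (by decide)
    have hm1 : ∀ f, f ≠ .xarr → s1.m1 f = s.m1 f := fun f hf => hF1.m1 f (by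
      simp [forLt, Stmt.stores1, hf])
    have hgm : s1.m2 .gm = s.m2 .gm := hF1.m2 _ (by decide)
    have hLW : LW (3 * C.n) s1 := h.lw.frame hF1 (by decide)
    refine ⟨?_, fun κ a => (hLW κ a).congr rfl rfl rfl rfl rfl rfl,
      fun κ a b => (Lst.frame hF1 (by decide) κ a b).trans (h.rel κ a b)⟩
    obtain ⟨a1, a2, a3, a4, a5, a6, a7, a8, -, a12, a13, a14, a15⟩ := h.base
    refine ⟨a1, ?_, ?_, ?_, ?_, ?_, ?_, ?_, ⟨?_, ?_, ?_⟩, subset_rfl, hD.lt, ?_, ?_⟩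
    all_goals simp only [HS.set, reduceCtorEq, if_true, if_false]
    · rw [hn', a2]
    · rw [hm1 _ (by simp)]; exact a3
    · rw [hm1 _ (by simp)]; exact a4
    · rw [hm1 _ (by simp)]; exact a5
    · rw [hgm]; exact a6
    · rw [hm1 _ (by simp)]; exact a7
    · rw [hm1 _ (by simp)]; exact a8
    · intro i hi
      rw [hI i hi]; exact hD.mem i (by rw [hD.card]; exact hi)
    · intro x hx
      obtain ⟨i, hi, e⟩ := hD.all x hx
      rw [hD.card] at hi
      exact ⟨i, hi, (hI i hi).trans e⟩
    · rw [hm1 _ (by simp), hnl]; exact a14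
    · rw [hm1 _ (by simp), hnp]; exact a15

/-- The data structure holds a minimum deletion set. -/
structure Ready (C : Conf) (s : HS) : Prop where
  inv : Inv C C.X s
  mark : ∀ v < C.n, s.m1 .mark v = 0
  min : ∀ Y, P3Free C.G Y → C.X.card ≤ Y.card

theorem Ready.frame {s' : HS} (h : Ready C s) (hF : Frame p s s') (hp : p.keeps = true)
    (hp' : p.keepsLists = true) (hp'' : p.stores1 .mark = false) : Ready C s' :=
  ⟨h.inv.frame hF hp hp', fun v hv => by rw [hF.m1 _ hp'', h.mark v hv], h.min⟩

/-- Replace the solution by the one in the array `dl`. -/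
def exchange : Stmt :=
  addAll ;; setMarks Reg.dlen (.ld1 .dl Reg.j) 1 ;; removeAll ;;
    setMarks Reg.dlen (.ld1 .dl Reg.j) 0 ;; publish

/-- The time to replace a solution of size `z` by one of size `k`. -/
def exchangeBound (z k : ℕ) : ℕ := (z + 2 * k) * (moveBound (z + k) + 1) + 3 * k

/-- All of `D` enters before anything leaves. Hence the solution has at most `z + k` vertices at any
time, a cluster has at most `2 ^ (z + k)` classes, and each of the at most `z + 2 * k` moves is
bounded accordingly. -/
theorem exchange_spec (hB : Bd B s) (hN : 64 * (4 * (3 * C.n) * (3 * C.n) + 3 * C.n + 1) ≤ B)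
    (h : Inv C C.X s) (hm : ∀ v < C.n, s.m1 .mark v = 0) (hD : Found C D s)
    (hmin : ∀ Y, P3Free C.G Y → D.card ≤ Y.card) :
    Run B exchange s (fun s' => ∃ C', C'.n = C.n ∧ C'.G = C.G ∧ C'.X = D ∧ Ready C' s')
      (exchangeBound C.X.card D.card) := by
  have hDn : D.card ≤ C.n := by
    simpa using Finset.card_le_card (t := Finset.range C.n) fun x hx => Finset.mem_range.2 (hD.lt x hx)
  have hn4 : C.n + 1 < B := by nlinarith
  have hlist : ∀ v, (∃ i < D.card, s.m1 .dl i = v) ↔ v ∈ D := fun v => by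
    rw [← hD.card]
    exact ⟨fun ⟨i, hi, e⟩ => e ▸ hD.mem i hi, hD.all v⟩
  have hmarks : ∀ {c s'}, c < B → Bd B s' → s'.reg .dlen = s.reg .dlen → s'.m1 .dl = s.m1 .dl →
      Run B (setMarks Reg.dlen (.ld1 .dl Reg.j) c) s'
        (fun s'' => ∀ v, (v ∈ D → s''.m1 .mark v = c) ∧ (v ∉ D → s''.m1 .mark v = s'.m1 .mark v))
        D.card := by
    intro c s' hc hB' e1 e2
    refine (setMarks_spec (f := s.m1 .dl) hB' hc (by omega) ?_ ?_).mono le_rfl ?_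
    · intro s'' hF
      simp only [Expr.eval]; rw [hF.reg .dlen rfl, e1, hD.card]
    · intro i s'' _ hj hF
      simp only [Expr.eval]; rw [hF.m1 .dl rfl, e2, hj]
    · intro s'' h'' v
      rw [h'' v]
      split_ifs with h'
      · exact ⟨fun _ => rfl, fun hv => absurd ((hlist v).1 h') hv⟩
      · exact ⟨fun hv => absurd ((hlist v).2 hv) h', fun _ => rfl⟩
  have hcard := Finset.card_union_le C.X D
  have hmv := moveBound_mono hcard
  refine (Run.bind hB (addAll_spec hB hN h hD) (T2 := D.card + ((C.X ∪ D).card *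
    (moveBound (C.X ∪ D).card + 1) + (D.card + D.card))) ?_).mono ?_ fun _ h => h
  · intro s1 hB1 hF1 h1
    have hl1 : s1.reg .dlen = s.reg .dlen := hF1.reg _ (by decide)
    have hd1 : s1.m1 .dl = s.m1 .dl := hF1.m1 _ (by decide)
    have hk1 : s1.m1 .mark = s.m1 .mark := hF1.m1 _ (by decide)
    refine Run.bind hB1 (hmarks (by omega) hB1 hl1 hd1) ?_
    intro s2 hB2 hF2 hm2
    have hl2 : s2.reg .dlen = s.reg .dlen := (hF2.reg _ (by decide)).trans hl1
    have hd2 : s2.m1 .dl = s.m1 .dl := (hF2.m1 _ (by decide)).trans hd1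
    refine Run.bind hB2 (removeAll_spec (C := C.addSet D) (D := D) hB2 hN
      (h1.frame hF2 (by decide) (by decide)) hD.free Finset.subset_union_right ?_) ?_
    · intro v hv
      by_cases hvD : v ∈ D
      · simp [(hm2 v).1 hvD, hvD]
      · simp [(hm2 v).2 hvD, hvD, hk1, hm v hv]
    · rintro s3 hB3 hF3 ⟨C', hCn, hCG, hCX, h3⟩
      have hl3 : s3.reg .dlen = s.reg .dlen := (hF3.reg _ (by decide)).trans hl2
      have hd3 : s3.m1 .dl = s.m1 .dl := (hF3.m1 _ (by decide)).trans hd2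
      have hk3 : s3.m1 .mark = s2.m1 .mark := hF3.m1 _ (by decide)
      refine Run.bind hB3 (hmarks (by omega) hB3 hl3 hd3) ?_
      intro s4 hB4 hF4 hm4
      have hl4 : s4.reg .dlen = s.reg .dlen := (hF4.reg _ (by decide)).trans hl3
      have hd4 : s4.m1 .dl = s.m1 .dl := (hF4.m1 _ (by decide)).trans hd3
      have hF : Found C' C'.X s4 := by
        rw [hCX]
        refine ⟨hCG ▸ hD.free, fun v hv => hCn ▸ hD.lt v hv, ?_, ?_, ?_⟩
        · rw [hl4, hD.card]
        · rw [hl4, hd4]; exact hD.mem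
        · rw [hl4, hd4]; exact hD.all
      have h4 : Inv C' (C.X ∪ D) s4 := h3.frame hF4 (by decide) (by decide)
      obtain ⟨s5, t, e1, e2, e3⟩ := publish_spec hB4 h4
        (by rw [hCn]; exact (by omega : C.n < B)) hF
      refine ⟨s5, t, e1, hCX ▸ e2, C', hCn, hCG, hCX, e3, fun v hv => ?_, fun Y hY => ?_⟩
      · have hv' : v < C.n := hCn ▸ hv
        rw [e1.frame.m1 .mark (by decide)]
        by_cases hvD : v ∈ D
        · exact (hm4 v).1 hvD
        · rw [(hm4 v).2 hvD, hk3, (hm2 v).2 hvD, hk1, hm v hv']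
      · rw [hCX]; exact hmin Y (hCG ▸ hY)
  · have : (C.X ∪ D).card * (moveBound (C.X ∪ D).card + 1) ≤
        (C.X.card + D.card) * (moveBound (C.X.card + D.card) + 1) := by gcongr
    unfold exchangeBound
    nlinarith

/-- Change the adjacency of `eu` and `ev`, which are in the solution, to `val`. -/
def setEdge (val : ℕ) : Stmt :=
  .st2 .gm Reg.eu Reg.ev (.num val) ;; .st2 .gm Reg.ev Reg.eu (.num val) ;;
    .asg .fx Reg.eu ;; .asg .fv Reg.ev ;; fixX

/-- With both ends in the solution, the only entries of the lists that may change are `v` in the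
adjacency list of `u` and `u` in that of `v`, which `fixX` recomputes. -/
theorem setEdge_spec {u v val : ℕ} {G' : SimpleGraph ℕ} (hB : Bd B s)
    (hN : 64 * (4 * (3 * C.n) * (3 * C.n) + 3 * C.n + 1) ≤ B) (h : Inv C C.X s)
    (heu : s.reg .eu = u) (hev : s.reg .ev = v) (hu : u ∈ C.X) (hv : v ∈ C.X)
    (hG : ∀ a b, ¬ (a = u ∧ b = v ∨ a = v ∧ b = u) → (G'.Adj a b ↔ C.G.Adj a b))
    (hval : val ≤ 1) (hGuv : G'.Adj u v ↔ val = 1) :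
    Run B (setEdge val) s (Inv { C with G := G' } C.X) 0 := by
  have hok := h.base.ok
  have hun := hok.X_lt u hu
  have hvn := hok.X_lt v hv
  have hn4 : C.n + 1 < B := by nlinarith
  refine Run.st2' u v val heu hev rfl (by omega) ?_
  refine Run.st2' v u val (by simp [Expr.eval, HS.st2, hev]) (by simp [Expr.eval, HS.st2, heu]) rfl
    (by omega) ?_
  refine Run.asg' u (by simp [Expr.eval, HS.st2, heu]) (by omega) ?_
  refine Run.asg' v (by simp [Expr.eval, HS.set, HS.st2, hev]) (by omega) ?_
  set s1 := ((((s.st2 .gm u v val).st2 .gm v u val).set .fx u).set .fv v) with hs1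
  have hB1 : Bd B s1 := by
    have hB0 : Bd B ((s.st2 .gm u v val).st2 .gm v u val) := by
      refine ⟨hB.reg, hB.m1, fun f a b => ?_⟩
      have := hB.m2 f a b
      simp only [HS.st2]; split_ifs <;> omega
    exact (hB0.set .fx (by omega)).set .fv (by omega)
  have hL1 : LW (3 * C.n) s1 := fun κ a => (h.lw κ a).congr rfl rfl rfl
    (by simp [hs1, HS.set, HS.st2]) (by simp [hs1, HS.set, HS.st2]) (by simp [hs1, HS.set, HS.st2])
  have hgm : ∀ a b, s1.m2 .gm a b = if a = u ∧ b = v ∨ a = v ∧ b = u then val else s.m2 .gm a b := by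
    intro a b
    simp only [hs1, HS.set, HS.st2, true_and]
    by_cases e1 : a = v ∧ b = u <;> by_cases e2 : a = u ∧ b = v <;> simp [e1, e2]
  have r1 : s1.reg .fx = u := by simp [hs1, HS.set]
  have r2 : s1.reg .fv = v := by simp [hs1, HS.set]
  have hty : s1.m1 .ty = s.m1 .ty := rfl
  refine ((fixX_spec hB1 hN hL1 (by omega) (by omega)).full hB1).mono le_rfl ?_
  rintro s2 ⟨hB2, hF2, hL2, -, hR2⟩
  rw [r1, r2, hty, (h.base.ty_eq_zero hun), (h.base.ty_eq_zero hvn), hgm u v,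
    if_pos (Or.inl ⟨rfl, rfl⟩)] at hR2
  have hm1 : ∀ f, fixX.stores1 f = false → s2.m1 f = s.m1 f := fun f hf => hF2.m1 f hf
  have hreg : ∀ r, fixX.writes r = false → r ≠ .fx → r ≠ .fv → s2.reg r = s.reg r := by
    intro r hr h1 h2
    rw [hF2.reg r hr]; simp [hs1, HS.set, HS.st2, h1, h2]
  have hgm2 : s2.m2 .gm = s1.m2 .gm := hF2.m2 _ (by decide)
  refine ⟨?_, hL2, fun κ a b => ?_⟩
  · obtain ⟨a1, a2, a3, a4, a5, a6, a7, a8, ⟨a9, a10, a11⟩, a12, a13, a14, a15⟩ := h.base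
    have e1 := hreg .n (by decide) (by simp) (by simp)
    have e2 := hreg .xc (by decide) (by simp) (by simp)
    have e3 := hreg .nfl (by decide) (by simp) (by simp)
    have e4 := hreg .nfp (by decide) (by simp) (by simp)
    have f1 := hm1 .ty (by decide)
    have f2 := hm1 .cls (by decide)
    have f3 := hm1 .clu (by decide)
    have f4 := hm1 .xarr (by decide)
    have f5 := hm1 .freeL (by decide)
    have f6 := hm1 .freeP (by decide)
    refine ⟨a1.setG hu hv hG, e1.trans a2, by rw [f1]; exact a3, by rw [f1]; exact a4,
      by rw [f1]; exact a5, fun a b => ?_, f2.trans a7, f3.trans a8, ⟨e2.trans a9, ?_, ?_⟩, a12, a13,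
      ?_, ?_⟩
    · rw [hgm2, hgm]
      split_ifs with e1 e2 e2
      · change G'.Adj a b at e2
        rcases e1 with ⟨rfl, rfl⟩ | ⟨rfl, rfl⟩
        exacts [hGuv.1 e2, hGuv.1 e2.symm]
      · change ¬ G'.Adj a b at e2
        have : val ≠ 1 := fun h1 => e2 (by
          rcases e1 with ⟨rfl, rfl⟩ | ⟨rfl, rfl⟩
          exacts [hGuv.2 h1, (hGuv.2 h1).symm])
        omega
      · rw [a6, if_pos ((hG a b e1).1 e2)]
      · rw [a6, if_neg fun h' => e2 ((hG a b e1).2 h')]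
    · rw [e2, f4]; exact a10
    · rw [e2, f4]; exact a11
    · rw [e3, f5]; exact a14
    · rw [e4, f6]; exact a15
  · rw [hR2]
    split_ifs with e
    · obtain ⟨rfl, e⟩ := e
      have hab : a ∈ C.X ∧ b ∈ C.X ∧ (G'.Adj a b ↔ val = 1) := by
        rcases e with ⟨rfl, rfl⟩ | ⟨rfl, rfl⟩
        exacts [⟨hu, hv, hGuv⟩, ⟨hv, hu, (G'.adj_comm _ _).trans hGuv⟩]
      have hok' : ({ C with G := G' } : Conf).OK := hok.setG hu hv hG
      constructor
      · exact fun h' => Or.inl ⟨hab.1, hab.2.1, hab.2.2.2 h'.2.2⟩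
      · rintro (h' | h' | h')
        · exact ⟨hu, hv, hab.2.2.1 h'.2.2⟩
        · have := hok'.ch_rng h'
          have := hok.X_lt _ hab.1; have := hok.X_lt _ hab.2.1
          simp only at *; omega
        · have := hok'.ch_rng h'
          have := hok.X_lt _ hab.1; have := hok.X_lt _ hab.2.1
          simp only at *; omega
    · rw [Conf.spec_setG hu hv hG e, ← h.rel]
      rfl

/-- Change the adjacency of `eu` and `ev` to `val`. -/
def update (val : ℕ) : Stmt :=
  .asg .fv Reg.eu ;; addIfOut ;; .asg .fv Reg.ev ;; addIfOut ;; setEdge val ;; solve ;; exchange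

/-- The time of an update that leads from a solution of size `z` to one of size `k`. -/
def changeBound (z k : ℕ) : ℕ :=
  2 * moveBound (z + 2) + solveBound (z + 2) k + exchangeBound (z + 2) k

theorem kerBound_mono_left {z z' d : ℕ} (h : z ≤ z') : kerBound z d ≤ kerBound z' d := by
  unfold kerBound; gcongr; omega

theorem solveBound_mono {z z' k : ℕ} (h : z ≤ z') : solveBound z k ≤ solveBound z' k := by
  have := kerBound_mono_left (d := k) h
  unfold solveBound searchBound findBound; gcongr

theorem exchangeBound_mono {z z' k : ℕ} (h : z ≤ z') : exchangeBound z k ≤ exchangeBound z' k := by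
  have := moveBound_mono (Nat.add_le_add_right h k)
  unfold exchangeBound; gcongr

/-- Insertion and deletion are the same program with `val = 1` and `val = 0`. Both ends enter first,
so the solution has at most `z + 2` vertices when the search begins. -/
theorem update_spec {u v val : ℕ} {G' : SimpleGraph ℕ} {Y : Finset ℕ} (hB : Bd B s)
    (hN : 64 * (4 * (3 * C.n) * (3 * C.n) + 3 * C.n + 1) ≤ B) (hn : 100 * (C.n + 1) ^ 4 < B)
    (h : Ready C s) (heu : s.reg .eu = u) (hev : s.reg .ev = v) (hu : u < C.n) (hv : v < C.n)
    (hG : ∀ a b, ¬ (a = u ∧ b = v ∨ a = v ∧ b = u) → (G'.Adj a b ↔ C.G.Adj a b))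
    (hval : val ≤ 1) (hGuv : G'.Adj u v ↔ val = 1) (hY : P3Free G' Y)
    (hmin : ∀ Y', P3Free G' Y' → Y.card ≤ Y'.card) :
    Run B (update val) s (fun s' => ∃ C', C'.n = C.n ∧ C'.G = G' ∧ Ready C' s')
      (changeBound C.X.card Y.card) := by
  have hn4 : C.n + 1 < B := by nlinarith
  set C1 := C.add u with hC1
  set C2 := C1.add v with hC2
  have c1 : C1.X.card ≤ C.X.card + 1 := Finset.card_insert_le _ _
  have c2 : C2.X.card ≤ C1.X.card + 1 := Finset.card_insert_le _ _
  have k1 := moveBound_mono (show C.X.card ≤ C.X.card + 2 by omega)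
  have k2 := moveBound_mono (show C1.X.card ≤ C.X.card + 2 by omega)
  have k3 := solveBound_mono (k := Y.card) (show C2.X.card ≤ C.X.card + 2 by omega)
  have k4 := exchangeBound_mono (k := Y.card) (show C2.X.card ≤ C.X.card + 2 by omega)
  refine Run.asg' u heu (by omega) ?_
  refine (Run.bind (T2 := moveBound C1.X.card + (0 + (solveBound C2.X.card Y.card +
      exchangeBound C2.X.card Y.card))) (hB.set _ (by omega))
    (addIfOut_spec (v := u) (hB.set _ (by omega)) hN (h.inv.frame_set (by decide)) hu
      (by simp [HS.set])) ?_).mono (by unfold changeBound; omega) fun _ h => h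
  intro s1 hB1 hF1 h1
  have heu1 : s1.reg .eu = u := by rw [hF1.reg _ (by decide)]; simp [HS.set, heu]
  have hev1 : s1.reg .ev = v := by rw [hF1.reg _ (by decide)]; simp [HS.set, hev]
  have hm1 : s1.m1 .mark = s.m1 .mark := hF1.m1 _ (by decide)
  refine Run.asg' v hev1 (by omega) ?_
  refine Run.bind (hB1.set _ (by omega)) (addIfOut_spec (C := C1) (v := v) (hB1.set _ (by omega)) hN
    (h1.frame_set (by decide)) hv (by simp [HS.set])) ?_
  intro s2 hB2 hF2 h2
  have heu2 : s2.reg .eu = u := by rw [hF2.reg _ (by decide)]; simp [HS.set, heu1]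
  have hev2 : s2.reg .ev = v := by rw [hF2.reg _ (by decide)]; simp [HS.set, hev1]
  have hm2 : s2.m1 .mark = s.m1 .mark := (hF2.m1 _ (by decide)).trans hm1
  refine Run.bind hB2 (setEdge_spec (C := C2) hB2 hN h2 heu2 hev2
    (by simp [hC2, hC1, Conf.add]) (by simp [hC2, hC1, Conf.add]) hG hval hGuv) ?_
  intro s3 hB3 hF3 h3
  have hm3 : s3.m1 .mark = s.m1 .mark := by
    rw [← hm2]; exact hF3.m1 _ rfl
  refine Run.bind hB3 (solve_spec (C := { C2 with G := G' }) hB3 hn h3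
    (fun w hw => by rw [hm3]; exact h.mark w hw) hY hmin) ?_
  rintro s4 hB4 hF4 ⟨hm4, D, hDY, hD⟩
  rw [← hDY]
  refine (exchange_spec (C := { C2 with G := G' }) hB4 hN (h3.frame hF4 (by decide) (by decide)) hm4
    hD (hDY ▸ hmin)).mono le_rfl ?_
  rintro s5 ⟨C', e1, e2, -, e3⟩
  exact ⟨C', e1, e2, e3⟩

end Update

end DynCVD

namespace DynCVD

section Init

variable {B : ℕ} {s : HS}

/-! ### Initialization -/

/-- Enter the labels of the cluster of the vertex `ui`. -/
def initVertex : Stmt :=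
  .st1 .ty Reg.ui 3 ;; .st1 .ty (Reg.n + Reg.ui : Expr) 1 ;;
    .st1 .ty (Reg.n + Reg.n + Reg.ui : Expr) 2 ;; .st1 .cls Reg.ui (Reg.n + Reg.n + Reg.ui : Expr) ;;
    .st1 .clu (Reg.n + Reg.n + Reg.ui : Expr) (Reg.n + Reg.ui : Expr) ;; .asg .fv Reg.ui ;;
    .asg .fl (Reg.n + Reg.ui : Expr) ;; .asg .ap (Reg.n + Reg.n + Reg.ui : Expr) ;; link

/-- Build the data structure for the edgeless graph. -/
def init : Stmt := forLt .ui Reg.n initVertex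

/-- The memory before the initialization. -/
def HS.start (n : ℕ) : HS := ⟨fun r => if r = .n then n else 0, fun _ _ => 0, fun _ _ _ => 0⟩

/-- The state of the initialization when the vertices below `j` have been entered. -/
structure Entered (n j : ℕ) (s : HS) : Prop where
  ty : ∀ v < j, s.m1 .ty v = 3 ∧ s.m1 .ty (n + v) = 1 ∧ s.m1 .ty (n + n + v) = 2
  cls : ∀ v < j, s.m1 .cls v = n + n + v ∧ s.m1 .clu (n + n + v) = n + v
  lw : LW (3 * n) s
  rel : ∀ κ a b, s.Lst κ a b ↔ ∃ i < j, Conf.New (n + i) (n + n + i) i κ a b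

theorem initVertex_spec {n j : ℕ} (hB : Bd B s) (hN : 64 * (4 * (3 * n) * (3 * n) + 3 * n + 1) ≤ B)
    (h : Entered n j s) (hn : s.reg .n = n) (hj : j < n) (hu : s.reg .ui = j) :
    Run B initVertex s (Entered n (j + 1)) 0 := by
  have hn4 : 3 * n + 4 < B := by nlinarith
  refine Run.st1' j 3 hu rfl (by omega) ?_
  refine Run.st1' (n + j) 1 (by simp only [Arith.eval, Expr.eval, HS.st1, hn, hu]) rfl
    (by omega) ?_
  refine Run.st1' (n + n + j) 2 (by simp only [Arith.eval, Expr.eval, HS.st1, hn, hu]) rfl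
    (by omega) ?_
  refine Run.st1' j (n + n + j) (by simp only [Expr.eval, HS.st1, hu])
    (by simp only [Arith.eval, Expr.eval, HS.st1, hn, hu]) (by omega) ?_
  refine Run.st1' (n + n + j) (n + j) (by simp only [Arith.eval, Expr.eval, HS.st1, hn, hu])
    (by simp only [Arith.eval, Expr.eval, HS.st1, hn, hu]) (by omega) ?_
  refine Run.asg' j (by simp only [Expr.eval, HS.st1, hu]) (by omega) ?_
  refine Run.asg' (n + j) (by simp [Arith.eval, Expr.eval, HS.st1, HS.set, hn, hu]) (by omega) ?_
  refine Run.asg' (n + n + j) (by simp [Arith.eval, Expr.eval, HS.st1, HS.set, hn, hu])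
    (by omega) ?_
  set s1 := ((((((((s.st1 .ty j 3).st1 .ty (n + j) 1).st1 .ty (n + n + j) 2).st1 .cls j
    (n + n + j)).st1 .clu (n + n + j) (n + j)).set .fv j).set .fl (n + j)).set .ap (n + n + j))
    with hs1
  have hB1 : Bd B s1 := by
    have hst : ∀ {s : HS} (f : F1) (i : ℕ) {a : ℕ}, Bd B s → a < B → Bd B (s.st1 f i a) := by
      intro s f i a hB ha
      refine ⟨hB.reg, fun f' i' => ?_, hB.m2⟩
      simp only [HS.st1]; split_ifs; exacts [ha, hB.m1 f' i']
    exact (((hst _ _ (hst _ _ (hst _ _ (hst _ _ (hst _ _ hB (by omega)) (by omega)) (by omega))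
      (by omega)) (by omega)).set _ (by omega)).set _ (by omega)).set _ (by omega)
  have hL1 : LW (3 * n) s1 := fun κ a => (h.lw κ a).congr (by simp [hs1, HS.set, HS.st1])
    (by simp [hs1, HS.set, HS.st1]) rfl rfl rfl rfl
  refine ((link_spec (x := j) (c := n + n + j) (l := n + j) hB1 hN hL1 (by simp [hs1, HS.set])
    (by simp [hs1, HS.set]) (by simp [hs1, HS.set]) (by omega) (by omega) (by omega)).full
    hB1).mono le_rfl ?_
  rintro s2 ⟨-, hF, hL2, hR2⟩
  have hty : s2.m1 .ty = fun i => if i = n + n + j then 2 else if i = n + j then 1 else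
      if i = j then 3 else s.m1 .ty i := by
    rw [hF.m1 .ty rfl]; simp [hs1, HS.set, HS.st1]
  have hcls : s2.m1 .cls = fun i => if i = j then n + n + j else s.m1 .cls i := by
    rw [hF.m1 .cls rfl]; simp [hs1, HS.set, HS.st1]
  have hclu : s2.m1 .clu = fun i => if i = n + n + j then n + j else s.m1 .clu i := by
    rw [hF.m1 .clu rfl]; simp [hs1, HS.set, HS.st1]
  refine ⟨fun v hv => ?_, fun v hv => ?_, hL2, fun κ a b => ?_⟩
  · rw [hty]
    simp only
    rcases Nat.lt_succ_iff_lt_or_eq.1 hv with hv | rfl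
    · obtain ⟨h1, h2, h3⟩ := h.ty v hv
      rw [if_neg (by omega), if_neg (by omega), if_neg (by omega), if_neg (by omega),
        if_neg (by omega), if_neg (by omega), if_neg (by omega), if_neg (by omega),
        if_neg (by omega)]
      exact ⟨h1, h2, h3⟩
    · rw [if_neg (by omega), if_neg (by omega), if_pos rfl, if_neg (by omega), if_pos rfl,
        if_pos rfl]
      exact ⟨rfl, rfl, rfl⟩
  · rw [hcls, hclu]
    simp only
    rcases Nat.lt_succ_iff_lt_or_eq.1 hv with hv | rfl
    · rw [if_neg (by omega), if_neg (by omega)]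
      exact h.cls v hv
    · simp
  · rw [hR2, show s1.Lst κ a b ↔ s.Lst κ a b from Iff.rfl, h.rel]
    constructor
    · rintro (⟨i, hi, h'⟩ | h')
      exacts [⟨i, by omega, h'⟩, ⟨j, by omega, h'⟩]
    · rintro ⟨i, hi, h'⟩
      rcases Nat.lt_succ_iff_lt_or_eq.1 hi with hi | rfl
      exacts [Or.inl ⟨i, hi, h'⟩, Or.inr h']

/-- Without edges, each vertex `v` is a cluster and a class of its own, with the labels `n + v` and
`2 * n + v`. The solution is empty and all labels are in use, so the cleared counters and stacks are
right as they are. -/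
theorem init_spec {n : ℕ} (hB : Bd B (HS.start n))
    (hN : 64 * (4 * (3 * n) * (3 * n) + 3 * n + 1) ≤ B) :
    Run B init (HS.start n) (fun s' => ∃ C, C.n = n ∧ C.G = ⊥ ∧ Ready C s') n := by
  have hn4 : n < B := by nlinarith
  refine ((Run.forLt (N := n) (T := 0) (I := Entered n) hB hn4 rfl ?_ ?_ ?_).full hB).mono
    (by omega) ?_
  · refine ⟨by simp, by simp, fun κ a => ?_, fun κ a b => ?_⟩
    · constructor <;> simp [HS.start, HS.set]
    · simp [HS.Lst, HS.start, HS.set]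
  · intro j s' hF _
    simp only [Expr.eval]; rw [hF.reg .n rfl]; rfl
  · intro j s' hj hB' hu hF h
    refine (initVertex_spec hB' hN h ((hF.reg .n rfl).trans rfl) hj hu).mono le_rfl ?_
    exact fun s'' h'' => ⟨h''.ty, h''.cls, fun κ a => (h''.lw κ a).congr rfl rfl rfl rfl rfl rfl,
      h''.rel⟩
  · rintro s' ⟨-, hF, h⟩
    have hout : ∀ v, (⟨n, ⊥, ∅, s'.m1 .cls, s'.m1 .clu⟩ : Conf).Out v ↔ v < n := by simp [Conf.Out]
    refine ⟨⟨n, ⊥, ∅, s'.m1 .cls, s'.m1 .clu⟩, rfl, rfl, ⟨⟨⟨?_, ?_, ?_, ?_, ?_, ?_⟩, ?_, ?_, ?_, ?_,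
      ?_, rfl, rfl, ⟨?_, ?_, ?_⟩, ?_, ?_, ⟨?_, ?_, ?_, ?_⟩, ⟨?_, ?_, ?_, ?_⟩⟩, h.lw, ?_⟩, ?_, ?_⟩
    · simp
    · simp
    · intro v hv
      simp only [hout] at hv
      simp only [(h.cls v hv).1]; omega
    · intro v hv
      simp only [hout] at hv
      simp only [(h.cls v hv).1, (h.cls v hv).2]; omega
    · intro v w hv hw
      simp only [hout] at hv hw
      simp only [(h.cls v hv).1, (h.cls v hv).2, (h.cls w hw).1, (h.cls w hw).2]
      simp
    · intro v w hv hw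
      simp only [hout] at hv hw
      simp only [(h.cls v hv).1, (h.cls v hv).2, (h.cls w hw).1, (h.cls w hw).2]
      simp
    · exact (hF.reg .n rfl).trans rfl
    · intro v hv; simpa using (h.ty v hv).1
    · intro l h1 h2
      simp only at h1 h2
      have := (h.ty (l - n) (by omega)).2.1
      rwa [show n + (l - n) = l by omega] at this
    · intro l h1 h2
      simp only at h1 h2
      have := (h.ty (l - n - n) (by omega)).2.2
      rwa [show n + n + (l - n - n) = l by omega] at this
    · intro u v
      rw [hF.m2 .gm rfl]; simp [HS.start]
    · exact (hF.reg .xc rfl).trans rfl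
    · rw [hF.reg .xc rfl]; simp [HS.start]
    · simp
    · simp
    · simp
    · rw [hF.reg .nfl rfl]; simp [HS.start]
    · rw [hF.reg .nfl rfl]; simp [HS.start]
    · rw [hF.reg .nfl rfl]; simp [HS.start]
    · intro a h1 h2 h3
      simp only at h1 h2
      refine absurd ⟨a - n, (hout _).2 (by omega), ?_⟩ h3
      simp only [(h.cls (a - n) (by omega)).1, (h.cls (a - n) (by omega)).2]; omega
    · rw [hF.reg .nfp rfl]; simp [HS.start]
    · rw [hF.reg .nfp rfl]; simp [HS.start]
    · rw [hF.reg .nfp rfl]; simp [HS.start]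
    · intro a h1 h2 h3
      simp only at h1 h2
      refine absurd ⟨a - n - n, (hout _).2 (by omega), ?_⟩ h3
      simp only [(h.cls (a - n - n) (by omega)).1]; omega
    · intro κ a b
      rw [h.rel]
      have hch : ∀ a b, (⟨n, ⊥, ∅, s'.m1 .cls, s'.m1 .clu⟩ : Conf).Ch a b ↔
          ∃ i < n, (a = n + i ∧ b = n + n + i) ∨ (a = n + n + i ∧ b = i) := by
        intro a b
        simp only [Conf.Ch, hout]
        constructor
        · rintro (⟨h1, -⟩ | ⟨v, hv, e1, e2⟩ | ⟨hb, e⟩)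
          · simp at h1
          · rw [(h.cls v hv).1] at e1
            rw [← e1, (h.cls v hv).2] at e2
            exact ⟨v, hv, Or.inl ⟨e2.symm, e1.symm⟩⟩
          · rw [(h.cls b hb).1] at e
            exact ⟨b, hb, Or.inr ⟨e.symm, rfl⟩⟩
        · rintro ⟨i, hi, ⟨rfl, rfl⟩ | ⟨rfl, rfl⟩⟩
          · exact Or.inr (Or.inl ⟨i, hi, (h.cls i hi).1, (h.cls i hi).2⟩)
          · exact Or.inr (Or.inr ⟨hi, (h.cls b hi).1⟩)
      cases κ with
      | adj =>
        simp only [Conf.Spec, Conf.New, hch]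
        constructor
        · rintro ⟨i, hi, h'⟩
          rcases h' with h' | h' | h' | h'
          all_goals first
            | exact Or.inr (Or.inl ⟨i, hi, by omega⟩)
            | exact Or.inr (Or.inr ⟨i, hi, by omega⟩)
        · rintro (h' | ⟨i, hi, h'⟩ | ⟨i, hi, h'⟩)
          · simp at h'
          · exact ⟨i, hi, by omega⟩
          · exact ⟨i, hi, by omega⟩
      | nbr => simp [Conf.Spec, Conf.New]
      | sub =>
        simp only [Conf.Spec, Conf.New, hch]
        exact exists_congr fun i => and_congr_right' or_comm
    · intro v _
      rw [hF.m1 .mark rfl]; rfl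
    · simp

end Init

end DynCVD

namespace DynCVD

/-! ### Graphs on `Fin n` and on the numbers below `n` -/

section Lift

variable {n : ℕ} {G : SimpleGraph (Fin n)}

/-- Without induced paths, adjacency spreads along a walk from its end backwards: each step composes
the next edge with an adjacency already obtained. -/
theorem isCVD_iff_p3Free {V : Type*} {G : SimpleGraph V} {X : Finset V} :
    IsCVD G X ↔ P3Free G X := by
  constructor
  · intro h a b c ha hb hc hab hbc hac
    have h1 : (G.induce {v | v ∉ X}).Adj ⟨a, ha⟩ ⟨b, hb⟩ := hab
    have h2 : (G.induce {v | v ∉ X}).Adj ⟨b, hb⟩ ⟨c, hc⟩ := hbc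
    exact h ⟨a, ha⟩ ⟨c, hc⟩ (h1.reachable.trans h2.reachable) (by simpa using hac)
  · rintro h a b ⟨w⟩
    induction w with
    | nil => exact fun h => absurd rfl h
    | @cons u v w hadj p ih =>
      intro hne
      by_cases hvw : v = w
      · exact hvw ▸ hadj
      · exact h u v w u.2 v.2 w.2 hadj (ih hvw) fun e => hne (Subtype.ext e)

/-- The graph on the natural numbers. -/
def lift (G : SimpleGraph (Fin n)) : SimpleGraph ℕ := G.map Fin.valEmbedding

theorem lift_adj {a b : Fin n} : (lift G).Adj a b ↔ G.Adj a b :=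
  SimpleGraph.map_adj_apply (f := Fin.valEmbedding)

theorem lift_adj_iff {a b : ℕ} :
    (lift G).Adj a b ↔ ∃ (ha : a < n) (hb : b < n), G.Adj ⟨a, ha⟩ ⟨b, hb⟩ := by
  constructor
  · rintro ⟨-, u, v, h, rfl, rfl⟩; exact ⟨u.2, v.2, h⟩
  · rintro ⟨ha, hb, h⟩; exact lift_adj.2 h

theorem p3Free_lift {Y : Finset ℕ} {X : Finset (Fin n)} (h : ∀ v : Fin n, v ∈ X ↔ (v : ℕ) ∈ Y) :
    P3Free (lift G) Y ↔ IsCVD G X := by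
  rw [isCVD_iff_p3Free]
  constructor
  · intro h' a b c ha hb hc hab hbc hac
    rw [h] at ha hb hc
    exact lift_adj.1 (h' a b c ha hb hc (lift_adj.2 hab) (lift_adj.2 hbc)
      fun e => hac (Fin.ext e))
  · intro h' a b c ha hb hc hab hbc hac
    obtain ⟨ha', hb', hab⟩ := lift_adj_iff.1 hab
    obtain ⟨_, hc', hbc⟩ := lift_adj_iff.1 hbc
    refine lift_adj_iff.2 ⟨ha', hc', h' _ _ _ ?_ ?_ ?_ hab hbc fun e => hac (Fin.mk.inj e)⟩
    all_goals rw [h]; assumption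

/-- The elements of `Y` below `n`. -/
def lower (n : ℕ) (Y : Finset ℕ) : Finset (Fin n) := Finset.univ.filter fun v => (v : ℕ) ∈ Y

theorem mem_lower {Y : Finset ℕ} {v : Fin n} : v ∈ lower n Y ↔ (v : ℕ) ∈ Y := by simp [lower]

theorem card_lower_le (Y : Finset ℕ) : (lower n Y).card ≤ Y.card :=
  Finset.card_le_card_of_injOn Fin.val (fun _ hv => mem_lower.1 hv) fun _ _ _ _ e => Fin.ext e

theorem cvdNumber_le {X : Finset (Fin n)} (h : IsCVD G X) : cvdNumber G ≤ X.card :=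
  Nat.sInf_le ⟨X, h, rfl⟩

/-- Numbers from `n` on are isolated in the lifted graph and useless in a deletion set, so
discarding them carries minimality over from `Fin n` to sets of natural numbers. -/
theorem exists_minimum (G : SimpleGraph (Fin n)) : ∃ Y : Finset ℕ, P3Free (lift G) Y ∧
    Y.card = cvdNumber G ∧ ∀ Y', P3Free (lift G) Y' → Y.card ≤ Y'.card := by
  obtain ⟨X, hX, hc⟩ : ∃ X : Finset (Fin n), IsCVD G X ∧ X.card = cvdNumber G :=
    Nat.sInf_mem (s := {m | ∃ X : Finset (Fin n), IsCVD G X ∧ X.card = m})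
      ⟨_, Finset.univ, fun a => absurd (Finset.mem_univ _) a.2, rfl⟩
  refine ⟨X.map Fin.valEmbedding, (p3Free_lift fun v => ?_).2 hX, by simpa using hc, fun Y' hY' => ?_⟩
  · rw [Finset.mem_map]
    exact ⟨fun h => ⟨v, h, rfl⟩, fun ⟨a, h, e⟩ => Fin.ext e ▸ h⟩
  · rw [Finset.card_map, hc]
    exact (cvdNumber_le ((p3Free_lift fun v => mem_lower).1 hY')).trans (card_lower_le Y')

theorem lift_sup_edge {u v : Fin n} (huv : u ≠ v) :
    (lift (G ⊔ SimpleGraph.edge u v)).Adj u v ∧ ∀ a b : ℕ,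
      ¬ (a = u ∧ b = v ∨ a = v ∧ b = u) →
        ((lift (G ⊔ SimpleGraph.edge u v)).Adj a b ↔ (lift G).Adj a b) := by
  refine ⟨lift_adj.2 (Or.inr ?_), fun a b hab => ?_⟩
  · rw [SimpleGraph.edge_adj]; exact ⟨Or.inl ⟨rfl, rfl⟩, huv⟩
  · rw [lift_adj_iff, lift_adj_iff]
    refine exists_congr fun ha => exists_congr fun hb => ?_
    rw [SimpleGraph.sup_adj, SimpleGraph.edge_adj]
    refine or_iff_left fun h => hab ?_
    simpa [Fin.ext_iff, eq_comm] using h.1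

theorem lift_deleteEdges {u v : Fin n} :
    ¬ (lift (G.deleteEdges {s(u, v)})).Adj u v ∧ ∀ a b : ℕ,
      ¬ (a = u ∧ b = v ∨ a = v ∧ b = u) →
        ((lift (G.deleteEdges {s(u, v)})).Adj a b ↔ (lift G).Adj a b) := by
  refine ⟨fun h => ?_, fun a b hab => ?_⟩
  · rw [lift_adj, SimpleGraph.deleteEdges_adj] at h
    exact h.2 rfl
  · rw [lift_adj_iff, lift_adj_iff]
    refine exists_congr fun ha => exists_congr fun hb => ?_
    rw [SimpleGraph.deleteEdges_adj]
    refine and_iff_left fun h => hab ?_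
    simpa [Fin.ext_iff] using h

theorem lift_bot : lift (⊥ : SimpleGraph (Fin n)) = ⊥ := by
  ext a b; simp [lift_adj_iff]

end Lift

/-! ### The time of an update -/

theorem moveBound_le (m : ℕ) : moveBound m ≤ 4 * (m + 1) * 2 ^ m := by
  unfold moveBound
  have := Nat.one_le_two_pow (n := m)
  rw [pow_succ]
  nlinarith

/-- With `m` the larger solution size and `q = max 1 m`, the moves cost `O(q * 8 ^ m)`, the exchange
`O(q ^ 2 * 8 ^ m)` and the searches `O(q ^ 6 * 8 ^ m)`. The constant 6000 exceeds `2 * 80 + 5214 +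
408 + 1`. Replacing `m` by `q` in polynomial factors absorbs the additive constants and covers `m =
0`. -/
theorem exists_changeBound_le : ∃ K, ∀ z k, changeBound z k + 1 ≤ K * updateBound (max z k) := by
  refine ⟨6000, fun z k => ?_⟩
  obtain ⟨m, hm⟩ : ∃ m, max z k = m := ⟨_, rfl⟩
  have hz : z ≤ m := hm ▸ le_max_left _ _
  have hk : k ≤ m := hm ▸ le_max_right _ _
  obtain ⟨q, hq⟩ : ∃ q, max 1 m = q := ⟨_, rfl⟩
  have hq1 : 1 ≤ q := hq ▸ le_max_left _ _
  have hmq : m ≤ q := hq ▸ le_max_right _ _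
  have h2 : 1 ≤ 2 ^ m := Nat.one_le_two_pow
  have h4 : 4 ^ m ≤ 8 ^ m := Nat.pow_le_pow_left (by omega) _
  have h6 : 6 ^ m ≤ 8 ^ m := Nat.pow_le_pow_left (by omega) _
  have h32 : 3 ^ m * 2 ^ m = 6 ^ m := (mul_pow 3 2 m).symm
  have h8 : 1 ≤ 8 ^ m := Nat.one_le_pow _ _ (by omega)
  have hp : ∀ {i j a : ℕ}, i ≤ j → 1 ≤ a → q ^ i ≤ q ^ j * a := fun hij ha =>
    (Nat.pow_le_pow_right hq1 hij).trans (Nat.le_mul_of_pos_right _ ha)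
  -- The union of the old solution, the two end points and the new solution has at most `2 * m + 2`
  -- vertices, so `2 ^ (2 * m + 2) = 4 * 4 ^ m` bounds the classes of a cluster.
  have hmove : moveBound (2 * m + 2) ≤ 80 * (q * 8 ^ m) := by
    refine (moveBound_le _).trans ?_
    have e : 2 ^ (2 * m + 2) = 4 * 4 ^ m := by rw [pow_add, pow_mul]; ring
    rw [e]
    calc 4 * (2 * m + 2 + 1) * (4 * 4 ^ m) ≤ 4 * (5 * q) * (4 * 8 ^ m) := by gcongr; omega
      _ = _ := by ring
  have hmove' : moveBound (z + 2) ≤ 80 * (q * 8 ^ m) := (moveBound_mono (by omega)).trans hmove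
  have hex : exchangeBound (z + 2) k ≤ 408 * (q ^ 2 * 8 ^ m) := by
    have h1 : moveBound (z + 2 + k) ≤ 80 * (q * 8 ^ m) := (moveBound_mono (by omega)).trans hmove
    have h3 := hp (i := 0) (j := 1) (Nat.zero_le _) h8
    have h5 := hp (i := 1) (j := 2) (by omega) h8
    simp only [pow_zero, pow_one] at h3 h5
    calc exchangeBound (z + 2) k = (z + 2 + 2 * k) * (moveBound (z + 2 + k) + 1) + 3 * k := rfl
      _ ≤ (5 * q) * (81 * (q * 8 ^ m)) + 3 * (q ^ 2 * 8 ^ m) := by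
        gcongr
        · omega
        · omega
        · omega
      _ = _ := by ring
  have hker : kerBound (z + 2) k ≤ 75 * (q ^ 3 * 2 ^ m) := by
    have h5 := hp (i := 1) (j := 3) (by omega) h2
    rw [pow_one] at h5
    calc kerBound (z + 2) k = (z + 2) * (k + 2) * 2 ^ (z + 2) * (k + 1) + (z + 2) := rfl
      _ ≤ (3 * q) * (3 * q) * 2 ^ (m + 2) * (2 * q) + 3 * (q ^ 3 * 2 ^ m) := by
        gcongr
        all_goals omega
      _ = _ := by rw [pow_add]; ring
  have hfind : findBound (z + 2) (kerBound (z + 2) k) ≤ 1143 * (q ^ 5 * 2 ^ m) := by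
    have h3 := hp (i := 0) (j := 3) (Nat.zero_le _) h2
    have h5 := hp (i := 0) (j := 4) (Nat.zero_le _) h2
    rw [pow_zero] at h3 h5
    calc findBound (z + 2) (kerBound (z + 2) k) =
          (z + 2) * ((z + 2 + 2) * (kerBound (z + 2) k + 1) + 1) := rfl
      _ ≤ (3 * q) * ((5 * q) * (76 * (q ^ 3 * 2 ^ m)) + q ^ 4 * 2 ^ m) := by
        gcongr
        all_goals omega
      _ = _ := by ring
  have hsearch : searchBound (z + 2) (kerBound (z + 2) k) k ≤ 2294 * (q ^ 5 * 6 ^ m) := by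
    have h3 := hp (i := 0) (j := 5) (Nat.zero_le _) h2
    have h5 := hp (i := 1) (j := 5) (by omega) h2
    rw [pow_zero] at h3
    rw [pow_one] at h5
    calc searchBound (z + 2) (kerBound (z + 2) k) k =
          wt k * (findBound (z + 2) (kerBound (z + 2) k) + 3 * k + 1) := rfl
      _ ≤ (2 * 3 ^ m) * (1147 * (q ^ 5 * 2 ^ m)) := by
        refine Nat.mul_le_mul ((wt_le k).trans ?_) (by omega)
        exact Nat.mul_le_mul_left _ (Nat.pow_le_pow_right (by omega) hk)
      _ = 2294 * (q ^ 5 * (3 ^ m * 2 ^ m)) := by ring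
      _ = _ := by rw [h32]
  have hsolve : solveBound (z + 2) k ≤ 5214 * (q ^ 6 * 8 ^ m) := by
    have h3 := hp (i := 0) (j := 5) (Nat.zero_le _) h8
    have h5 := hp (i := 1) (j := 5) (by omega) h8
    rw [pow_zero] at h3
    rw [pow_one] at h5
    have h7 : q ^ 3 * 2 ^ m ≤ q ^ 5 * 8 ^ m := by gcongr <;> omega
    have h9 : q ^ 5 * 6 ^ m ≤ q ^ 5 * 8 ^ m := by gcongr
    calc solveBound (z + 2) k = (k + 1) * (4 * kerBound (z + 2) k + 4 * (z + 2) +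
          searchBound (z + 2) (kerBound (z + 2) k) k + 1) := rfl
      _ ≤ (2 * q) * (2607 * (q ^ 5 * 8 ^ m)) := Nat.mul_le_mul (by omega) (by omega)
      _ = _ := by ring
  have e1 : q * 8 ^ m ≤ q ^ 6 * 8 ^ m := by
    have := Nat.mul_le_mul_right (8 ^ m) (Nat.pow_le_pow_right hq1 (show 1 ≤ 6 by omega))
    rwa [pow_one] at this
  have e2 : q ^ 2 * 8 ^ m ≤ q ^ 6 * 8 ^ m := by gcongr; omega
  have e3 : 1 ≤ q ^ 6 * 8 ^ m := Nat.mul_pos (Nat.pow_pos hq1) h8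
  rw [hm, updateBound, hq, mul_comm (8 ^ m)]
  unfold changeBound
  omega

end DynCVD

namespace DynCVD

section Machine

variable {n : ℕ} {G G' : SimpleGraph (Fin n)} {s : State}

/-! ### The programs of the machine -/

/-- Put a power of register `0` into register `2`. -/
def powCmd : ℕ → Cmd
  | 0 => .const 2 1
  | k + 1 => .seq (powCmd k) (.arith .mul 2 2 0)

theorem powCmd_spec {W a : ℕ} (k : ℕ) (ha : 1 ≤ a) (hs : s.reg 0 = a) (hW : a ^ k < W) :
    Ex W (powCmd k) s (fun s' => s' = s.setReg 2 (a ^ k)) (k + 1) := by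
  induction k with
  | zero => exact Ex.const hW
  | succ k ih =>
    have hk : a ^ k < W := (Nat.pow_le_pow_right ha (Nat.le_succ k)).trans_lt hW
    refine Ex.seq (ih hk) ?_
    rintro _ rfl
    refine (Ex.arith ?_).mono le_rfl ?_
    · simpa [Arith.eval, State.setReg, hs, ← pow_succ] using hW
    · rintro _ rfl
      simp [Arith.eval, State.setReg, hs, ← pow_succ]

/-- The exponent is `320 = 20 * 16`: register `2` receives `(n + 2) ^ 320`, which is `valueBound n ^
16`, the start of `xarr`. -/
def initCmd : Cmd :=
  .seq (.move (Reg.n.code + 3) 0) (.seq (.const 1 2) (.seq (.arith .add 0 0 1)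
    (.seq (powCmd 320) (compile init))))

def updateCmd (val : ℕ) : Cmd :=
  .seq (.move (Reg.eu.code + 3) 0) (.seq (.move (Reg.ev.code + 3) 1) (compile (update val)))

def queryCmd : Cmd := .seq (.move 0 (Reg.xc.code + 3)) (.move 1 2)

/-- The bound for the stored numbers. -/
def valueBound (n : ℕ) : ℕ := (n + 2) ^ 20

/-- Stored numbers are below `B = (n + 2) ^ 20`, and the compiler needs words up to `B ^ 20`; this
is the origin of the exponent 400. -/
theorem wordBound_eq (n : ℕ) : wordBound 400 n = valueBound n ^ 20 := by
  rw [wordBound, valueBound, ← pow_mul]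

theorem valueBound_ge (n : ℕ) : 65536 * (n + 2) ^ 4 ≤ valueBound n := by
  have h : 2 ^ 16 ≤ (n + 2) ^ 16 := Nat.pow_le_pow_left (by omega) _
  calc 65536 * (n + 2) ^ 4 ≤ (n + 2) ^ 16 * (n + 2) ^ 4 := Nat.mul_le_mul_right _ h
    _ = valueBound n := by rw [valueBound, ← pow_add]

theorem valueBound_bounds (n : ℕ) : 1024 ≤ valueBound n ∧ n < valueBound n ∧
    64 * (4 * (3 * n) * (3 * n) + 3 * n + 1) ≤ valueBound n ∧
    100 * (n + 1) ^ 4 < valueBound n := by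
  have h := valueBound_ge n
  have h1 : n + 2 ≤ (n + 2) ^ 4 := Nat.le_self_pow (by omega) _
  have h2 : (n + 2) ^ 2 ≤ (n + 2) ^ 4 := Nat.pow_le_pow_right (by omega) (by omega)
  have h3 : (n + 1) ^ 4 ≤ (n + 2) ^ 4 := Nat.pow_le_pow_left (by omega) _
  refine ⟨by omega, by omega, ?_, by omega⟩
  nlinarith

/-- The machine holds the data structure for `G`. -/
def Holds (n : ℕ) (G : SimpleGraph (Fin n)) (s : State) : Prop :=
  ∃ C σ, C.n = n ∧ C.G = lift G ∧ Ready C σ ∧ Bd (valueBound n) σ ∧ Sim (valueBound n) σ s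

theorem reg_lt_wordBound {σ : HS} (hB : Bd (valueBound n) σ) (x : Reg) :
    σ.reg x < wordBound 400 n := by
  rw [wordBound_eq]
  exact (hB.reg x).trans_le (Nat.le_self_pow (by omega) _)

theorem initCmd_spec : ∃ T, ∀ n, Ex (wordBound 400 n) initCmd (startState n) (Holds n ⊥)
    (T * (n + 1)) := by
  obtain ⟨K, hK⟩ := compile_spec init (by decide)
  refine ⟨K + 400, fun n => ?_⟩
  obtain ⟨h1, h2, h3, h4⟩ := valueBound_bounds n
  have hW : valueBound n ≤ wordBound 400 n := by
    rw [wordBound_eq]; exact Nat.le_self_pow (by omega) _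
  have hn : (startState n).reg 0 = n := by simp [startState, State.setReg]
  refine (Ex.seq (T2 := 1 + (1 + (320 + 1 + K * (n + 1)))) (Ex.move (by omega)) ?_).mono
    (by nlinarith) fun _ h => h
  rintro _ rfl
  refine Ex.seq (Ex.const (by omega)) ?_
  rintro _ rfl
  refine Ex.seq (Ex.arith ?_) ?_
  · simp [State.setReg, Arith.eval, hn]
    have := valueBound_ge n
    have h1 : n + 2 ≤ (n + 2) ^ 4 := Nat.le_self_pow (by omega) _
    omega
  rintro _ rfl
  refine Ex.seq (powCmd_spec (a := n + 2) 320 (by omega) ?_ ?_) ?_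
  · simp [State.setReg, Arith.eval, hn]
  · rw [wordBound]; exact Nat.pow_lt_pow_right (by omega) (by omega)
  rintro _ rfl
  have hB : Bd (valueBound n) (HS.start n) := by
    refine ⟨fun x => ?_, fun _ _ => by simp only [HS.start]; omega,
      fun _ _ _ => by simp only [HS.start]; omega⟩
    simp only [HS.start]; split_ifs <;> omega
  obtain ⟨σ, t, e1, e2, C, c1, c2, c3⟩ := init_spec hB h3
  rw [wordBound_eq]
  refine (hK _ _ σ t _ h1 e1 hB ⟨?_, fun x => ?_, fun f j _ => ?_, fun f i j _ _ => ?_⟩).mono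
    (Nat.mul_le_mul_left _ (by omega)) fun s' h => ⟨C, σ, c1, ?_, c3, e1.bd hB, h⟩
  · simp [State.setReg, valueBound, ← pow_mul]
  · by_cases hx : x = .n
    · subst hx
      simp [State.setReg, HS.start, hn]
    · have : x.code ≠ Reg.n.code := fun e => hx (Reg.code_inj e)
      simp [State.setReg, HS.start, hx, this, startState]
  · rfl
  · rfl
  · rw [c2, lift_bot]

theorem Ready.cvdNumber_eq {C : Conf} {σ : HS} (h : Ready C σ) (hG : C.G = lift G) :
    C.X.card = cvdNumber G := by
  obtain ⟨Y, h1, h2, h3⟩ := exists_minimum G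
  have h4 := h.inv.base.ok.p3Free
  rw [hG] at h4
  exact le_antisymm (h2 ▸ h.min Y (hG ▸ h1)) (h2 ▸ h3 _ h4)

theorem updateCmd_spec {val : ℕ} (hok : (update val).ok = true) (hval : val ≤ 1) : ∃ T, ∀ n
    (G G' : SimpleGraph (Fin n)) (u v : Fin n) (s : State), Holds n G s →
    ((lift G').Adj u v ↔ val = 1) →
    (∀ a b : ℕ, ¬ (a = u ∧ b = v ∨ a = v ∧ b = u) → ((lift G').Adj a b ↔ (lift G).Adj a b)) →
    Ex (wordBound 400 n) (updateCmd val) (s.withEdge u v) (Holds n G')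
      (T * updateBound (max (cvdNumber G) (cvdNumber G'))) := by
  obtain ⟨K, hK⟩ := compile_spec (update val) hok
  obtain ⟨K', hK'⟩ := exists_changeBound_le
  refine ⟨K * K' + 2, ?_⟩
  rintro n G G' u v s ⟨C, σ, hn, hG, hR, hB, hS⟩ huv hab
  obtain ⟨h1, h2, h3, h4⟩ := valueBound_bounds n
  have hW : valueBound n ≤ wordBound 400 n := by
    rw [wordBound_eq]; exact Nat.le_self_pow (by omega) _
  obtain ⟨Y, hY, hYc, hmin⟩ := exists_minimum G'
  have hu : (u : ℕ) < valueBound n := u.2.trans h2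
  have hv : (v : ℕ) < valueBound n := v.2.trans h2
  refine (Ex.seq (T2 := 1 + K * (changeBound (cvdNumber G) (cvdNumber G') + 1))
    (Ex.move ?_) ?_).mono ?_ fun _ h => h
  · simp [State.withEdge, State.setReg]; omega
  · rintro _ rfl
    refine Ex.seq (Ex.move ?_) ?_
    · simp [State.withEdge, State.setReg]; omega
    rintro _ rfl
    have hB' : Bd (valueBound n) ((σ.set .eu u).set .ev v) := (hB.set _ hu).set _ hv
    have hR' : Ready C ((σ.set .eu u).set .ev v) :=
      (hR.frame (Frame.set _ _ _) (by decide) (by decide) (by decide)).frame (Frame.set _ _ _)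
        (by decide) (by decide) (by decide)
    obtain ⟨σ', t, e1, e2, C', c1, c2, c3⟩ := update_spec (C := C) (u := u) (v := v) (val := val)
      (G' := lift G') (Y := Y) hB' (hn ▸ h3) (hn ▸ h4) hR' (by simp [HS.set]) (by simp [HS.set])
      (hn ▸ u.2) (hn ▸ v.2) (hG ▸ hab) hval huv hY hmin
    rw [hR.cvdNumber_eq hG, hYc] at e2
    rw [wordBound_eq]
    refine (hK _ _ σ' t _ h1 e1 hB' ⟨?_, fun x => ?_, fun f j hj => ?_,
      fun f i j hi hj => ?_⟩).mono (Nat.mul_le_mul_left _ (by omega))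
      fun s' h => ⟨C', σ', c1.trans hn, c2, c3, e1.bd hB', h⟩
    · simpa [State.withEdge, State.setReg] using hS.off
    · by_cases hx : x = .ev
      · subst hx
        simp [State.withEdge, State.setReg, HS.set]
      · have hx' : x.code ≠ Reg.ev.code := fun e => hx (Reg.code_inj e)
        by_cases hy : x = .eu
        · subst hy
          simp [State.withEdge, State.setReg, HS.set, hx']
        · have hy' : x.code ≠ Reg.eu.code := fun e => hy (Reg.code_inj e)
          simpa [State.withEdge, State.setReg, HS.set, hx, hx', hy, hy'] using hS.reg x
    · exact hS.m1 f j hj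
    · exact hS.m2 f i j hi hj
  · have h5 := Nat.mul_le_mul_left K (hK' (cvdNumber G) (cvdNumber G'))
    have h6 : 1 ≤ updateBound (max (cvdNumber G) (cvdNumber G')) :=
      Nat.mul_pos (Nat.pow_pos (by omega)) (Nat.pow_pos (by omega))
    rw [add_mul, mul_assoc]
    omega

/-- Only the registers `0` and `1` change, and these represent nothing of the structured state, so
the simulation persists. -/
theorem queryCmd_spec {σ : HS} (hB : Bd (valueBound n) σ) (hS : Sim (valueBound n) σ s) :
    Ex (wordBound 400 n) queryCmd s (fun s' => Sim (valueBound n) σ s' ∧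
      s'.reg 0 = σ.reg .xc ∧ s'.reg 1 = valueBound n ^ 16) 2 := by
  refine Ex.seq (Ex.move ?_) ?_ (T1 := 1) (T2 := 1)
  · rw [hS.reg]; exact reg_lt_wordBound hB _
  rintro _ rfl
  refine (Ex.move ?_).mono le_rfl ?_
  · simp only [State.setReg]
    rw [Function.update_of_ne (by omega), hS.off, wordBound_eq]
    exact Nat.pow_lt_pow_right (by have := (valueBound_bounds n).1; omega) (by omega)
  · rintro _ rfl
    refine ⟨⟨?_, fun x => ?_, hS.m1, hS.m2⟩, ?_, ?_⟩
    · simpa [State.setReg] using hS.off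
    · simpa [State.setReg] using hS.reg x
    · simpa [State.setReg] using hS.reg .xc
    · simpa [State.setReg] using hS.off

end Machine

end DynCVD

namespace DynCVD

/-! ### Linked lists -/

section Lists

variable {n B N : ℕ} {σ : HS} {s : State} {κ : Kd}

/-- The first `j` cells form a linked list that runs from cell `j - 1` down to cell `0`, which
allows induction on `j`. No cell has address `0`, because the codes of `val` are positive. -/
theorem listAt_of_lok {a j : ℕ} (hS : Sim B σ s) (hL : LOK N σ κ a) (ha : a < B ^ 3)
    (hc : σ.m1 (.cnt κ) a ≤ B ^ 3) (hj : j ≤ σ.m1 (.cnt κ) a) :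
    ListAt s.mem (if j = 0 then 0 else addr2 (.val κ) a (j - 1))
      ((List.range j).reverse.map fun i => σ.m2 (.arr κ) a i * 64) := by
  induction j with
  | zero => rfl
  | succ j ih =>
    have hjB : j < B ^ 3 := by omega
    simp only [List.range_succ, List.reverse_append, List.reverse_cons, List.reverse_nil,
      List.nil_append, List.map_cons, List.singleton_append,
      Nat.add_one_ne_zero, if_false, Nat.add_sub_cancel]
    have e1 := hS.m2 (.val κ) a j ha hjB
    have e2 := hS.m2 (.rnext κ) a j ha hjB
    have e3 : addr2 (.rnext κ) a j = addr2 (.val κ) a j + 1 := by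
      cases κ <;> simp [addr2, F2.code, Kd.code]
    rw [e3, hL.rnext j (by omega)] at e2
    refine ⟨?_, ?_, ?_⟩
    · cases κ <;> simp [addr2, F2.code, Kd.code]
    · rw [e1, hL.val j (by omega)]
    · rw [e2]; exact ih (by omega)

/-- Lists in memory hold identifiers; if these are injective names of objects in `α`, the list can
be pulled back to the objects. -/
theorem exists_list {α : Type*} {a : ℕ} (hS : Sim B σ s) (hL : LOK N σ κ a) (ha : a < B ^ 3)
    (hN : N ≤ B ^ 3) (f : α → ℕ) (hf : Function.Injective f) {P : α → Prop}
    (hP : ∀ b, σ.Lst κ a b ↔ ∃ x, f x = b ∧ P x) :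
    ∃ l : List α, l.Nodup ∧ (∀ x, x ∈ l ↔ P x) ∧
      ListAt s.mem (σ.m1 (.rhead κ) a) (l.map fun x => f x * 64) := by
  have hmem : ∀ b, b ∈ ((List.range (σ.m1 (.cnt κ) a)).reverse.map (σ.m2 (.arr κ) a)) ↔
      σ.Lst κ a b := by
    intro b
    simp only [List.mem_map, List.mem_reverse, List.mem_range]
    exact ⟨fun ⟨i, hi, e⟩ => e ▸ hL.arr_mem hi, hL.exists_arr⟩
  obtain ⟨l, hl⟩ : (List.range (σ.m1 (.cnt κ) a)).reverse.map (σ.m2 (.arr κ) a) ∈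
      Set.range (List.map f) := by
    rw [Set.range_list_map]
    intro b hb
    obtain ⟨x, hx, -⟩ := (hP b).1 ((hmem b).1 hb)
    exact ⟨x, hx⟩
  refine ⟨l, List.Nodup.of_map f ?_, fun x => ?_, ?_⟩
  · rw [hl]
    refine List.Nodup.map_on ?_ (List.nodup_reverse.2 List.nodup_range)
    intro i hi j hj e
    simp only [List.mem_reverse, List.mem_range] at hi hj
    exact hL.arr_inj hi hj e
  · rw [← List.mem_map_of_injective hf, hl, hmem, hP]
    exact ⟨fun ⟨y, e, hy⟩ => hf e ▸ hy, fun h => ⟨x, rfl, h⟩⟩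
  · have h := listAt_of_lok hS hL ha (hL.cnt_le.trans hN) le_rfl
    rw [← hL.rhead] at h
    have e : l.map (fun x => f x * 64) = (l.map f).map (· * 64) := by simp [Function.comp_def]
    rw [e, hl, List.map_map]
    exact h

end Lists

/-! ### The nodes of the auxiliary graph and their identifiers -/

namespace Conf

variable {n : ℕ} {G : SimpleGraph (Fin n)} {X : Finset (Fin n)} {C : Conf}

/-- `C` is a configuration for `G` and `X`. -/
structure Rep (C : Conf) (G : SimpleGraph (Fin n)) (X : Finset (Fin n)) : Prop where
  ok : C.OK
  n_eq : C.n = n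
  G_eq : C.G = lift G
  mem : ∀ v : Fin n, v ∈ X ↔ (v : ℕ) ∈ C.X

open Classical in
/-- The identifier of a node. -/
noncomputable def nid (C : Conf) (G : SimpleGraph (Fin n)) (X : Finset (Fin n)) :
    Node (Fin n) → ℕ
  | .vertex v => v
  | .clusterLabel S => if h : S.Nonempty then C.clu (C.cls h.some) else 0
  | .classLabel S R => if h : (equivClass G X S R).Nonempty then C.cls h.some else 0

namespace Rep

theorem adj (h : C.Rep G X) {v w : Fin n} : C.G.Adj v w ↔ G.Adj v w := by rw [h.G_eq, lift_adj]

theorem out (h : C.Rep G X) {v : Fin n} : C.Out v ↔ v ∉ X := by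
  rw [Conf.Out, h.n_eq, h.mem]; exact and_iff_right v.2

theorem exists_fin (h : C.Rep G X) {a : ℕ} (ha : a < C.n) : ∃ v : Fin n, (v : ℕ) = a :=
  ⟨⟨a, h.n_eq ▸ ha⟩, rfl⟩

theorem clu_iff (h : C.Rep G X) {v w : Fin n} (hv : v ∉ X) (hw : w ∉ X) :
    C.clu (C.cls v) = C.clu (C.cls w) ↔ v = w ∨ G.Adj v w := by
  rw [h.ok.clu_iff v w (h.out.2 hv) (h.out.2 hw), h.adj, Fin.ext_iff]

theorem cls_iff (h : C.Rep G X) {v w : Fin n} (hv : v ∉ X) (hw : w ∉ X) :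
    C.cls v = C.cls w ↔ C.clu (C.cls v) = C.clu (C.cls w) ∧
      G.neighborSet v ∩ X = G.neighborSet w ∩ X := by
  rw [h.ok.cls_iff v w (h.out.2 hv) (h.out.2 hw)]
  refine and_congr_right' ⟨fun h' => ?_, fun h' x hx => ?_⟩
  · ext x
    simp only [Set.mem_inter_iff, SimpleGraph.mem_neighborSet, Finset.mem_coe]
    refine and_congr_left fun hx => ?_
    have := h' x ((h.mem x).1 hx)
    rwa [h.adj, h.adj, G.adj_comm, G.adj_comm x w] at this
  · obtain ⟨x, rfl⟩ := h.exists_fin (h.ok.X_lt x hx)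
    have := congrArg (fun S => x ∈ S) h'
    simp only [Set.mem_inter_iff, SimpleGraph.mem_neighborSet, Finset.mem_coe, (h.mem x).2 hx,
      and_true, eq_iff_iff] at this
    rw [h.adj, h.adj, G.adj_comm, G.adj_comm x w, this]

/-- The cluster of a vertex. -/
def clusterOf (C : Conf) (X : Finset (Fin n)) (v : Fin n) : Set (Fin n) :=
  {w | w ∉ X ∧ C.clu (C.cls w) = C.clu (C.cls v)}

theorem isCluster_clusterOf (h : C.Rep G X) {v : Fin n} (hv : v ∉ X) :
    IsCluster G X (clusterOf C X v) := by
  refine ⟨⟨v, hv, rfl⟩, ⟨fun w hw => hw.1, fun a ha b hb hab => ?_⟩, fun D hD hle w hw => ?_⟩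
  · exact ((h.clu_iff ha.1 hb.1).1 (ha.2.trans hb.2.symm)).resolve_left hab
  · refine ⟨hD.1 w hw, (h.clu_iff (hD.1 w hw) hv).2 ?_⟩
    by_cases e : w = v
    · exact Or.inl e
    · exact Or.inr (hD.2 hw (hle ⟨hv, rfl⟩) e)

/-- All members of a clique through `v` outside `X` carry the cluster label of `v`. The vertices
with this label form a clique, so by maximality they are the whole cluster. -/
theorem cluster_eq (h : C.Rep G X) {S : Set (Fin n)} (hS : IsCluster G X S) {v : Fin n}
    (hv : v ∈ S) : v ∉ X ∧ S = clusterOf C X v := by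
  have hvX := hS.2.prop.1 v hv
  refine ⟨hvX, hS.2.eq_of_le (h.isCluster_clusterOf hvX).2.prop fun w hw => ?_⟩
  refine ⟨hS.2.prop.1 w hw, (h.clu_iff (hS.2.prop.1 w hw) hvX).2 ?_⟩
  by_cases e : w = v
  · exact Or.inl e
  · exact Or.inr (hS.2.prop.2 hw hv e)

theorem nid_cluster (h : C.Rep G X) {S : Set (Fin n)} (hS : IsCluster G X S) {v : Fin n}
    (hv : v ∈ S) : C.nid G X (.clusterLabel S) = C.clu (C.cls v) := by
  have hne : S.Nonempty := ⟨v, hv⟩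
  have h1 := hne.some_mem
  simp only [nid, hne, dif_pos]
  exact ((Set.ext_iff.1 (h.cluster_eq hS hv).2 _).1 h1).2

theorem nid_class (h : C.Rep G X) {S R : Set (Fin n)} (hS : IsCluster G X S) {v : Fin n}
    (hv : v ∈ equivClass G X S R) : C.nid G X (.classLabel S R) = C.cls v := by
  have hne : (equivClass G X S R).Nonempty := ⟨v, hv⟩
  have h1 := hne.some_mem
  simp only [nid, hne, dif_pos]
  obtain ⟨h2, h3⟩ := h.cluster_eq hS hv.1
  have h4 := (Set.ext_iff.1 h3 _).1 h1.1
  exact (h.cls_iff h4.1 h2).2 ⟨h4.2, h1.2.trans hv.2.symm⟩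

/-- The members of a class. -/
theorem mem_class (h : C.Rep G X) {S R : Set (Fin n)} (hS : IsCluster G X S) {v w : Fin n}
    (hv : v ∈ equivClass G X S R) (hw : w ∉ X) (e : C.cls w = C.cls v) :
    w ∈ equivClass G X S R := by
  obtain ⟨h2, h3⟩ := h.cluster_eq hS hv.1
  obtain ⟨h4, h5⟩ := (h.cls_iff hw h2).1 e
  refine ⟨?_, h5.trans hv.2⟩
  rw [h3]; exact ⟨hw, h4⟩

theorem nid_cluster_rng (h : C.Rep G X) {S : Set (Fin n)} (hS : IsCluster G X S) :
    C.n ≤ C.nid G X (.clusterLabel S) ∧ C.nid G X (.clusterLabel S) < 2 * C.n := by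
  obtain ⟨v, hv⟩ := hS.1
  rw [h.nid_cluster hS hv]
  exact h.ok.clu_rng v (h.out.2 (h.cluster_eq hS hv).1)

theorem nid_class_rng (h : C.Rep G X) {S R : Set (Fin n)} (hS : IsNode G X (.classLabel S R)) :
    2 * C.n ≤ C.nid G X (.classLabel S R) ∧ C.nid G X (.classLabel S R) < 3 * C.n := by
  obtain ⟨hS, v, hv⟩ := hS
  rw [h.nid_class hS hv]
  exact h.ok.cls_rng v (h.out.2 (h.cluster_eq hS hv.1).1)

theorem nid_vertex_lt (h : C.Rep G X) (v : Fin n) : C.nid G X (.vertex v) < C.n := by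
  rw [h.n_eq]; exact v.2

theorem nid_lt (h : C.Rep G X) (a : {a : Node (Fin n) // IsNode G X a}) :
    C.nid G X a.1 < 3 * C.n := by
  obtain ⟨v | S | ⟨S, R⟩, ha⟩ := a <;> simp only
  · have := h.nid_vertex_lt v; omega
  · have := h.nid_cluster_rng ha; omega
  · exact (h.nid_class_rng ha).2

/-- The three kinds of nodes have disjoint ranges of identifiers. Within one kind, a cluster or
class is nonempty and can be recovered from any of its members, whose labels decide it. -/
theorem nid_injective (h : C.Rep G X) :
    Function.Injective fun a : {a : Node (Fin n) // IsNode G X a} => C.nid G X a.1 := by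
  rintro ⟨v | S | ⟨S, R⟩, ha⟩ ⟨w | S' | ⟨S', R'⟩, hb⟩ e <;> simp only at e
  · have e : (v : ℕ) = w := e
    obtain rfl := Fin.ext e
    rfl
  · have := h.nid_vertex_lt v; have := h.nid_cluster_rng hb; omega
  · have := h.nid_vertex_lt v; have := h.nid_class_rng hb; omega
  · have := h.nid_vertex_lt w; have := h.nid_cluster_rng ha; omega
  · obtain ⟨v, hv⟩ := ha.1
    obtain ⟨w, hw⟩ := hb.1
    rw [h.nid_cluster ha hv, h.nid_cluster hb hw] at e
    have : S = S' := by
      rw [(h.cluster_eq ha hv).2, (h.cluster_eq hb hw).2]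
      simp only [clusterOf, e]
    subst this; rfl
  · have := h.nid_cluster_rng ha; have := h.nid_class_rng hb; omega
  · have := h.nid_vertex_lt w; have := h.nid_class_rng ha; omega
  · have := h.nid_cluster_rng hb; have := h.nid_class_rng ha; omega
  · obtain ⟨hS, v, hv⟩ := ha
    obtain ⟨hS', w, hw⟩ := hb
    rw [h.nid_class hS hv, h.nid_class hS' hw] at e
    obtain ⟨k1, k2⟩ := h.cluster_eq hS hv.1
    obtain ⟨k3, k4⟩ := h.cluster_eq hS' hw.1
    obtain ⟨h1, h2⟩ := (h.cls_iff k1 k3).1 e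
    have e1 : S = S' := by rw [k2, k4]; simp only [clusterOf, h1]
    have e2 : R = R' := by rw [← hv.2, ← hw.2, h2]
    subst e1 e2; rfl

/-- The node with the label of the cluster of a vertex. -/
theorem exists_cluster (h : C.Rep G X) {v : Fin n} (hv : v ∉ X) :
    ∃ a : {a : Node (Fin n) // IsNode G X a}, C.nid G X a.1 = C.clu (C.cls v) :=
  ⟨⟨.clusterLabel (clusterOf C X v), h.isCluster_clusterOf hv⟩,
    h.nid_cluster (h.isCluster_clusterOf hv) ⟨hv, rfl⟩⟩

/-- The node with the label of the class of a vertex. -/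
theorem exists_class (h : C.Rep G X) {v : Fin n} (hv : v ∉ X) :
    ∃ a : {a : Node (Fin n) // IsNode G X a}, C.nid G X a.1 = C.cls v :=
  ⟨⟨.classLabel (clusterOf C X v) (G.neighborSet v ∩ X), h.isCluster_clusterOf hv,
    v, ⟨hv, rfl⟩, rfl⟩, h.nid_class (h.isCluster_clusterOf hv) ⟨⟨hv, rfl⟩, rfl⟩⟩

theorem exists_vertex (h : C.Rep G X) {v : ℕ} (hv : v < C.n) :
    ∃ a : {a : Node (Fin n) // IsNode G X a}, C.nid G X a.1 = v :=
  ⟨⟨.vertex ⟨v, h.n_eq ▸ hv⟩, trivial⟩, rfl⟩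

theorem exists_of_ch (h : C.Rep G X) {i j : ℕ} (hij : C.Ch i j) :
    (∃ a : {a : Node (Fin n) // IsNode G X a}, C.nid G X a.1 = i) ∧
      ∃ a : {a : Node (Fin n) // IsNode G X a}, C.nid G X a.1 = j := by
  rcases hij with ⟨h1, v, hv, rfl, -⟩ | ⟨v, hv, rfl, rfl⟩ | ⟨hv, rfl⟩
  · obtain ⟨v, rfl⟩ := h.exists_fin hv.1
    exact ⟨h.exists_vertex (h.ok.X_lt _ h1), h.exists_cluster (h.out.1 hv)⟩
  · obtain ⟨v, rfl⟩ := h.exists_fin hv.1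
    exact ⟨h.exists_cluster (h.out.1 hv), h.exists_class (h.out.1 hv)⟩
  · refine ⟨?_, h.exists_vertex hv.1⟩
    obtain ⟨v, rfl⟩ := h.exists_fin hv.1
    exact h.exists_class (h.out.1 hv)

/-- For the converse, the ranges of identifiers determine which of the three cases of `Ch` can occur
for given kinds of nodes; all other combinations are impossible. -/
theorem auxEdge_iff (h : C.Rep G X) (a b : {a : Node (Fin n) // IsNode G X a}) :
    AuxEdge G X a.1 b.1 ↔ (C.nid G X a.1 ∈ C.X ∧ C.nid G X b.1 ∈ C.X ∧
      C.G.Adj (C.nid G X a.1) (C.nid G X b.1)) ∨ C.Ch (C.nid G X a.1) (C.nid G X b.1) := by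
  constructor
  · obtain ⟨a, ha⟩ := a
    obtain ⟨b, hb⟩ := b
    simp only
    rintro (⟨x, y, hx, hy, hxy⟩ | ⟨x, S, hx, v, hv, hxv⟩ | ⟨S, R⟩ | ⟨S, R, v, hv⟩)
    · exact Or.inl ⟨(h.mem x).1 hx, (h.mem y).1 hy, h.adj.2 hxy⟩
    · rw [h.nid_cluster hb hv]
      exact Or.inr (Or.inl ⟨(h.mem x).1 hx, v, h.out.2 (h.cluster_eq hb hv).1, rfl, h.adj.2 hxv⟩)
    · obtain ⟨hS, v, hv⟩ := hb
      rw [h.nid_cluster hS hv.1, h.nid_class hS hv]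
      exact Or.inr (Or.inr (Or.inl ⟨v, h.out.2 (h.cluster_eq hS hv.1).1, rfl, rfl⟩))
    · rw [h.nid_class ha.1 hv]
      exact Or.inr (Or.inr (Or.inr ⟨h.out.2 (h.cluster_eq ha.1 hv.1).1, rfl⟩))
  · intro hE
    obtain ⟨v | S | ⟨S, R⟩, ha⟩ := a <;> obtain ⟨w | S' | ⟨S', R'⟩, hb⟩ := b <;> simp only at hE ⊢
    · rcases hE with ⟨h1, h2, h3⟩ | h'
      · exact .inSolution v w ((h.mem v).2 h1) ((h.mem w).2 h2) (h.adj.1 h3)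
      · have := h.ok.ch_rng h'; have := h.nid_vertex_lt v; have := h.nid_vertex_lt w; omega
    · have k1 := h.nid_vertex_lt v
      have k2 := h.nid_cluster_rng hb
      rcases hE with ⟨-, h2, -⟩ | h'
      · have := h.ok.X_lt _ h2; omega
      · obtain ⟨h1, u, hu, e, h2⟩ := (h.ok.ch_vertex k1).1 h'
        obtain ⟨u, rfl⟩ := h.exists_fin hu.1
        obtain ⟨w, hw⟩ := hb.1
        refine .incident v S' ((h.mem v).2 h1) ⟨u, ?_, h.adj.1 h2⟩
        rw [(h.cluster_eq hb hw).2]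
        exact ⟨h.out.1 hu, e.trans (h.nid_cluster hb hw)⟩
    · have k1 := h.nid_vertex_lt v
      have k2 := h.nid_class_rng hb
      rcases hE with ⟨-, h2, -⟩ | h'
      · have := h.ok.X_lt _ h2; omega
      · have := h.ok.ch_rng h'; omega
    · have k1 := h.nid_vertex_lt w
      have k2 := h.nid_cluster_rng ha
      rcases hE with ⟨h2, -⟩ | h'
      · have := h.ok.X_lt _ h2; omega
      · have := h.ok.ch_rng h'; omega
    · have k1 := h.nid_cluster_rng hb
      have k2 := h.nid_cluster_rng ha
      rcases hE with ⟨h2, -⟩ | h'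
      · have := h.ok.X_lt _ h2; omega
      · have := h.ok.ch_rng h'; omega
    · have k1 := h.nid_class_rng hb
      have k2 := h.nid_cluster_rng ha
      rcases hE with ⟨h2, -⟩ | h'
      · have := h.ok.X_lt _ h2; omega
      · obtain ⟨u, hu, e1, e2⟩ := (h.ok.ch_cluster k2.1 k2.2).1 h'
        obtain ⟨u, rfl⟩ := h.exists_fin hu.1
        obtain ⟨w, hw⟩ := ha.1
        obtain ⟨hS', w', hw'⟩ := hb
        rw [h.nid_class hS' hw'] at e1 e2
        rw [h.nid_cluster ha hw] at e2
        have : S' = S := by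
          rw [(h.cluster_eq ha hw).2, (h.cluster_eq hS' hw'.1).2]
          simp only [clusterOf, e2]
        subst this
        exact .hasClass S' R'
    · have k1 := h.nid_class_rng ha
      have k2 := h.nid_vertex_lt w
      rcases hE with ⟨h2, -⟩ | h'
      · have := h.ok.X_lt _ h2; omega
      · obtain ⟨h1, h2⟩ := (h.ok.ch_class k1.1).1 h'
        obtain ⟨hS, u, hu⟩ := ha
        rw [h.nid_class hS hu] at h2
        exact .member S R w (h.mem_class hS hu (h.out.1 h1) h2)
    · have k1 := h.nid_class_rng ha
      have k2 := h.nid_cluster_rng hb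
      rcases hE with ⟨h2, -⟩ | h'
      · have := h.ok.X_lt _ h2; omega
      · have := h.ok.ch_rng h'; omega
    · have k1 := h.nid_class_rng ha
      have k2 := h.nid_class_rng hb
      rcases hE with ⟨h2, -⟩ | h'
      · have := h.ok.X_lt _ h2; omega
      · have := h.ok.ch_rng h'; omega

theorem spec_adj_iff (h : C.Rep G X) (a : {a : Node (Fin n) // IsNode G X a}) (j : ℕ) :
    C.Spec .adj (C.nid G X a.1) j ↔ ∃ b : {a : Node (Fin n) // IsNode G X a},
      C.nid G X b.1 = j ∧ (auxGraph G X).Adj a b := by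
  have hadj : ∀ b : {a : Node (Fin n) // IsNode G X a}, (auxGraph G X).Adj a b ↔
      C.Spec .adj (C.nid G X a.1) (C.nid G X b.1) := by
    intro b
    rw [auxGraph, SimpleGraph.fromRel_adj, h.auxEdge_iff, h.auxEdge_iff]
    constructor
    · rintro ⟨-, (h' | h') | h' | h'⟩
      exacts [Or.inl h', Or.inr (Or.inl h'), Or.inl ⟨h'.2.1, h'.1, h'.2.2.symm⟩,
        Or.inr (Or.inr h')]
    · intro h'
      refine ⟨?_, ?_⟩
      · rintro rfl
        rcases h' with h' | h' | h'
        · exact C.G.loopless.irrefl _ h'.2.2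
        · have := h.ok.ch_rng h'; omega
        · have := h.ok.ch_rng h'; omega
      · rcases h' with h' | h' | h'
        exacts [Or.inl (Or.inl h'), Or.inl (Or.inr h'), Or.inr (Or.inr h')]
  constructor
  · intro h'
    obtain ⟨b, rfl⟩ : ∃ b : {a : Node (Fin n) // IsNode G X a}, C.nid G X b.1 = j := by
      rcases h' with h' | h' | h'
      exacts [h.exists_vertex (h.ok.X_lt _ h'.2.1), (h.exists_of_ch h').2, (h.exists_of_ch h').1]
    exact ⟨b, rfl, (hadj b).2 h'⟩
  · rintro ⟨b, rfl, h'⟩; exact (hadj b).1 h'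

theorem spec_nbr_iff (h : C.Rep G X) {S R : Set (Fin n)} (hS : IsNode G X (.classLabel S R))
    (j : ℕ) : C.Spec .nbr (C.nid G X (.classLabel S R)) j ↔ ∃ x : Fin n, (x : ℕ) = j ∧ x ∈ R := by
  obtain ⟨hS, v, hv⟩ := hS
  rw [h.nid_class hS hv]
  constructor
  · rintro ⟨hj, w, hw, e, hjw⟩
    obtain ⟨x, rfl⟩ := h.exists_fin (h.ok.X_lt j hj)
    obtain ⟨w, rfl⟩ := h.exists_fin hw.1
    refine ⟨x, rfl, ?_⟩
    rw [← (h.mem_class hS hv (h.out.1 hw) e).2]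
    exact ⟨h.adj.1 hjw.symm, (h.mem x).2 hj⟩
  · rintro ⟨x, rfl, hx⟩
    rw [← hv.2] at hx
    exact ⟨(h.mem x).1 hx.2, v, h.out.2 (h.cluster_eq hS hv.1).1, rfl, (h.adj.2 hx.1).symm⟩

end Rep

end Conf

/-! ### The memory of the machine -/

section Memory

variable {n : ℕ} {G : SimpleGraph (Fin n)} {C : Conf} {σ : HS} {s : State}

theorem Ready.rep (h : Ready C σ) (hn : C.n = n) (hG : C.G = lift G) : C.Rep G (lower n C.X) :=
  ⟨h.inv.base.ok, hn, hG, fun _ => mem_lower⟩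

/-- The record of a node is the block of 64 cells at 64 times its identifier. The fields `0`, `1`
and `2` of the block are the type, the head of the adjacency list, and the head of the list of the
elements of `S`. -/
theorem Ready.storesAuxGraph (h : Ready C σ) (hn : C.n = n) (hG : C.G = lift G)
    (hS : Sim (valueBound n) σ s) : StoresAuxGraph s.mem 0 64 G (lower n C.X) := by
  have hR := h.rep hn hG
  obtain ⟨h1, h2, h3, -⟩ := valueBound_bounds n
  have hB3 : valueBound n ≤ valueBound n ^ 3 := Nat.le_self_pow (by omega) _
  have hid : ∀ a : {a : Node (Fin n) // IsNode G (lower n C.X) a},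
      C.nid G (lower n C.X) a.1 < valueBound n ^ 3 := fun a => by
    have := hR.nid_lt a; rw [hn] at this; omega
  have hN : 3 * C.n ≤ valueBound n ^ 3 := by rw [hn]; omega
  have hrec : ∀ (f : F1) (a : {a : Node (Fin n) // IsNode G (lower n C.X) a}), f ≠ .xarr →
      s.mem (C.nid G (lower n C.X) a.1 * 64 + f.code) = σ.m1 f (C.nid G (lower n C.X) a.1) := by
    intro f a hf
    have := hS.m1 f _ (hid a)
    rwa [addr1, if_neg hf] at this
  refine ⟨fun a => C.nid G (lower n C.X) a.1 * 64, fun a b e => hR.nid_injective ?_, fun v => ?_,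
    fun a => ?_, fun a => ?_, fun S R hSR => ?_⟩
  · simp only at e ⊢; omega
  · simp only [Conf.nid]; ring
  · have := hrec .ty a (by simp)
    rw [show F1.ty.code = 0 from rfl, add_zero] at this
    rw [this]
    obtain ⟨v | S | ⟨S, R⟩, ha⟩ := a
    · have e := h.inv.base.ty v (hR.nid_vertex_lt v)
      simp only [Conf.nid, nodeKind, hR.mem]
      rw [e]
    · exact h.inv.base.ty_cluster _ (hR.nid_cluster_rng ha).1 (hR.nid_cluster_rng ha).2
    · exact h.inv.base.ty_class _ (hR.nid_class_rng ha).1 (hR.nid_class_rng ha).2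
  · have := hrec (.rhead .adj) a (by simp)
    rw [show (F1.rhead .adj).code = 1 from rfl] at this
    rw [this]
    exact exists_list hS (h.inv.lw .adj _) (hid a) hN _ hR.nid_injective fun j =>
      (h.inv.rel _ _ _).trans (hR.spec_adj_iff a j)
  · have := hrec (.rhead .nbr) ⟨.classLabel S R, hSR⟩ (by simp)
    rw [show (F1.rhead .nbr).code = 2 from rfl] at this
    rw [this]
    exact exists_list hS (h.inv.lw .nbr _) (hid ⟨.classLabel S R, hSR⟩) hN
      (fun x : Fin n => (x : ℕ)) Fin.val_injective fun j =>
      (h.inv.rel _ _ _).trans (hR.spec_nbr_iff hSR j)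

theorem Ready.isMinCVD (h : Ready C σ) (hG : C.G = lift G) :
    IsMinCVD G (lower n C.X) := by
  refine ⟨(p3Free_lift fun v => mem_lower).1 (hG ▸ h.inv.base.ok.p3Free), fun Y hY => ?_⟩
  exact (card_lower_le _).trans ((h.cvdNumber_eq hG).trans_le (cvdNumber_le hY))

theorem Ready.outputs (h : Ready C σ) (hn : C.n = n)
    (hS : Sim (valueBound n) σ s) (h0 : s.reg 0 = σ.reg .xc)
    (h1 : s.reg 1 = valueBound n ^ 16) : Outputs s (lower n C.X) := by
  have hL := h.inv.base.listing
  have hlt : ∀ i < σ.reg .xc, σ.m1 .xarr i < n := fun i hi => hn ▸ h.inv.base.xarr_lt hi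
  have hinj : ∀ i < σ.reg .xc, ∀ j < σ.reg .xc, σ.m1 .xarr i = σ.m1 .xarr j → i = j := by
    -- The entries exhaust the solution and their number is its size, so none is repeated.
    have himg : (Finset.range (σ.reg .xc)).image (σ.m1 .xarr) = C.X := by
      ext x
      simp only [Finset.mem_image, Finset.mem_range]
      exact ⟨fun ⟨i, hi, e⟩ => e ▸ hL.mem i hi, hL.all x⟩
    have := Finset.injOn_of_card_image_eq (s := Finset.range (σ.reg .xc)) (f := σ.m1 .xarr)
      (by rw [himg, Finset.card_range, hL.card])
    exact fun i hi j hj e => this (by simpa using hi) (by simpa using hj) e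
  refine ⟨List.ofFn fun i : Fin (σ.reg .xc) => ⟨σ.m1 .xarr i, hlt i i.2⟩, ?_, fun x => ?_, ?_,
    fun i hi => ?_⟩
  · rw [List.nodup_ofFn]
    intro i j e
    exact Fin.ext (hinj i i.2 j j.2 (Fin.mk.inj e))
  · rw [mem_lower, List.mem_ofFn]
    constructor
    · rintro ⟨i, rfl⟩; exact hL.mem i i.2
    · intro hx
      obtain ⟨i, hi, e⟩ := hL.all _ hx
      exact ⟨⟨i, hi⟩, Fin.ext e⟩
  · rw [h0, List.length_ofFn]
  · rw [List.length_ofFn] at hi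
    obtain ⟨k1, k2, -⟩ := valueBound_bounds n
    have hB3 : valueBound n ≤ valueBound n ^ 3 := Nat.le_self_pow (by omega) _
    have hxc := hn ▸ h.inv.base.xc_le
    have := hS.m1 .xarr i (by omega)
    rw [addr1, if_pos rfl] at this
    rw [h1, this]
    simp

/-- Each operation is known to have a run that preserves `Holds`; by determinism it is the run that
was given. -/
theorem Reaches.holds (h : Reaches ⟨initCmd, updateCmd 1, updateCmd 0, queryCmd⟩ 400 n G s) :
    Holds n G s := by
  induction h with
  | init h =>
    obtain ⟨T, hT⟩ := initCmd_spec
    obtain ⟨s', t, h1, -, h2⟩ := hT n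
    exact h.det h1 ▸ h2
  | insert u v hr huv hG h ih =>
    obtain ⟨T, hT⟩ := updateCmd_spec (val := 1) (by decide) le_rfl
    obtain ⟨s', t, h1, -, h2⟩ := hT n _ _ u v _ ih
      (iff_of_true (lift_sup_edge huv).1 rfl) (lift_sup_edge huv).2
    exact h.det h1 ▸ h2
  | delete u v hr hG h ih =>
    obtain ⟨T, hT⟩ := updateCmd_spec (val := 0) (by decide) (by omega)
    obtain ⟨s', t, h1, -, h2⟩ := hT n _ _ u v _ ih
      (iff_of_false lift_deleteEdges.1 (by omega)) lift_deleteEdges.2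
    exact h.det h1 ▸ h2
  | query hr h ih =>
    obtain ⟨C, σ, h1, h2, h3, h4, h5⟩ := ih
    obtain ⟨s', t, k1, -, k2, -⟩ := queryCmd_spec h4 h5
    exact ⟨C, σ, h1, h2, h3, h4, h.det k1 ▸ k2⟩

end Memory

end DynCVD

/-! ### The theorem -/

theorem mainTheorem5 :
    ∃ (D : DynCVD.Programs) (c T base stride : ℕ), ∀ n : ℕ,
      (∃ (s : DynCVD.State) (t : ℕ),
        DynCVD.Exec (DynCVD.wordBound c n) D.init (DynCVD.startState n) s t ∧ t ≤ T * (n + 1)) ∧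
      ∀ (G : SimpleGraph (Fin n)) (s : DynCVD.State), DynCVD.Reaches D c n G s →
        (∃ X : Finset (Fin n), DynCVD.IsMinCVD G X ∧
          DynCVD.StoresAuxGraph s.mem base stride G X ∧
          ∃ (s' : DynCVD.State) (t : ℕ),
            DynCVD.Exec (DynCVD.wordBound c n) D.query s s' t ∧ t ≤ T ∧ DynCVD.Outputs s' X) ∧
        (∀ u v : Fin n, u ≠ v → ¬ G.Adj u v →
          ∃ (s' : DynCVD.State) (t : ℕ),
            DynCVD.Exec (DynCVD.wordBound c n) D.insert (s.withEdge u v) s' t ∧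
            t ≤ T * DynCVD.updateBound
              (max (DynCVD.cvdNumber G) (DynCVD.cvdNumber (G ⊔ SimpleGraph.edge u v)))) ∧
        (∀ u v : Fin n, G.Adj u v →
          ∃ (s' : DynCVD.State) (t : ℕ),
            DynCVD.Exec (DynCVD.wordBound c n) D.delete (s.withEdge u v) s' t ∧
            t ≤ T * DynCVD.updateBound
              (max (DynCVD.cvdNumber G) (DynCVD.cvdNumber (G.deleteEdges {s(u, v)})))) := by
  obtain ⟨T1, h1⟩ := DynCVD.initCmd_spec
  obtain ⟨T2, h2⟩ := DynCVD.updateCmd_spec (val := 1) (by decide) le_rfl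
  obtain ⟨T3, h3⟩ := DynCVD.updateCmd_spec (val := 0) (by decide) (by omega)
  refine ⟨⟨DynCVD.initCmd, DynCVD.updateCmd 1, DynCVD.updateCmd 0, DynCVD.queryCmd⟩, 400,
    T1 + T2 + T3 + 2, 0, 64, fun n => ⟨?_, fun G s hs => ⟨?_, fun u v huv hG => ?_,
      fun u v hG => ?_⟩⟩⟩
  · obtain ⟨s, t, e1, e2, -⟩ := h1 n
    exact ⟨s, t, e1, e2.trans (Nat.mul_le_mul_right _ (by omega))⟩
  · obtain ⟨C, σ, hn, hC, hR, hB, hS⟩ := hs.holds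
    obtain ⟨s', t, e1, e2, hS', k0, k1⟩ := DynCVD.queryCmd_spec hB hS
    exact ⟨_, hR.isMinCVD hC, hR.storesAuxGraph hn hC hS, s', t, e1, by omega,
      hR.outputs hn hS' k0 k1⟩
  · obtain ⟨s', t, e1, e2, -⟩ := h2 n G (G ⊔ SimpleGraph.edge u v) u v s hs.holds
      (iff_of_true (DynCVD.lift_sup_edge huv).1 rfl) (DynCVD.lift_sup_edge huv).2
    exact ⟨s', t, e1, e2.trans (Nat.mul_le_mul_right _ (by omega))⟩
  · obtain ⟨s', t, e1, e2, -⟩ := h3 n G (G.deleteEdges {s(u, v)}) u v s hs.holds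
      (iff_of_false DynCVD.lift_deleteEdges.1 (by omega)) DynCVD.lift_deleteEdges.2
    exact ⟨s', t, e1, e2.trans (Nat.mul_le_mul_right _ (by omega))⟩
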